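/- Let $(J,+,0,\chi)$ be a small permutative category and let $\mathcal C\colon J\to\mathbf{Strict}$ be a functor to small permutative categories and strict symmetric monoidal functors. A *$J$-graded bipermutative category* structure on $\mathcal C$ consists of composition functors $\otimes\colon\mathcal C(x)\times\mathcal C(y)\to\mathcal C(x+y)$, natural in $x,y$, strictly associative, with a strict unit $1\in\mathcal C(0)$, such that zero objects annihilate strictly, right distributivity $(a\otimes b)\oplus(a'\otimes b)=(a\oplus a')\otimes b$ holds strictly (also on morphisms) and is compatible with the additive twist, together with natural isomorphisms $\gamma_\otimes^{a,b}\colon a\otimes b\to\mathcal C(\chi^{y,x})(b\otimes a)$, natural also in $x,y$, with $\mathcal C(\chi^{y,x})(\gamma_\otimes^{b,a})\circ\gamma_\otimes^{a,b}=\mathrm{id}$, $\gamma_\otimes^{a,1}=\gamma_\otimes^{1,a}=\mathrm{id}$ and the usual hexagon, and such that the induced left distributivity $d_\ell=\gamma_\otimes\circ(\gamma_\otimes\oplus\gamma_\otimes)\colon (a\otimes b)\oplus(a\otimes b')\to a\otimes(b\oplus b')$ is compatible with the additive twist, is associative ($d_\ell=(\mathrm{id}_a\otimes d_\ell)\circ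 d_\ell$ for $a\otimes b\otimes c\oplus a\otimes b\otimes c'\to a\otimes b\otimes(c\oplus c')$) and satisfies the pentagon relating $d_\ell$, $d_r=\mathrm{id}$ and the additive twist $\mathrm{id}\oplus\gamma_\oplus\oplus\mathrm{id}$. In a *$J$-graded strictly bimonoidal category* there is no $\gamma_\otimes$; instead $d_\ell$ is a given isomorphism, natural in all variables and in $x,y$, satisfying the same three conditions and in addition $d_\ell\otimes\mathrm{id}_c=d_\ell$ on $(a\otimes b\otimes c)\oplus(a\otimes b'\otimes c)$ and $d_\ell\circ(d_\ell\oplus\mathrm{id})=d_\ell\circ(\mathrm{id}\oplus d_\ell)$ on $a\otimes b\oplus a\otimes b'\oplus a\otimes b''$. *Zeroless* bipermutative (resp. strictly bimonoidal) categories are defined by the same axioms in the ungraded case, dropping everything that concerns zero objects. *The homotopy colimit.* $\operatorname{hocolim}_J\mathcal C$ has objects $n[(x_1,X_1),\dots,(x_n,X_n)]$ with $n\ge1$, $x_i\in J$, $X_i\in\mathcal C(x_i)$. A morphism to $m[(y_1,Y_1),\dots,(y_m,Y_m)]$ is a triple $(\psi,\ell_i,\varrho_j)$ of a surjection $\psi\colon\{1,\dots,n\}\to\{1,\dots,m\}$,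 morphisms $\ell_i\colon x_i\to y_{\psi(i)}$ and morphisms $\varrho_j\colon\bigoplus_{\psi(i)=j}\mathcal C(\ell_i)(X_i)\to Y_j$, the sum being taken in increasing order of $i$. The third coordinate of a composite $(\psi',\ell'_k,\varrho'_r)\circ(\psi,\ell_i,\varrho_k)$ is $$\bigoplus_{\psi'\psi(i)=r}\mathcal C(\ell'_{\psi(i)}\ell_i)(X_i)\xrightarrow{\ \sigma\ }\bigoplus_{\psi'(k)=r}\mathcal C(\ell'_k)\Bigl(\bigoplus_{\psi(i)=k}\mathcal C(\ell_i)(X_i)\Bigr)\xrightarrow{\bigoplus\mathcal C(\ell'_k)(\varrho_k)}\bigoplus_{\psi'(k)=r}\mathcal C(\ell'_k)(X'_k)\xrightarrow{\ \varrho'_r\ }X''_r ,$$ with $\sigma$ the canonical permutation of summands. Addition is concatenation, with additive twist $(\chi(n,m),\mathrm{id},\mathrm{id})$ the block permutation. The product of $n[(x_i,X_i)]$ and $m[(y_j,Y_j)]$ is $nm[(x_i+y_j,X_i\otimes Y_j)]$ in lexicographic order, with unit $1[(0,1)]$. The product $(\psi,\ell_i,\varrho_r)\otimes(\varphi,k_j,\pi_s)$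 is $(\psi\times\varphi,\ \ell_i+k_j,\ \ (\varrho_r\otimes\mathrm{id})\circ d_r\circ\bigoplus_{\psi(i)=r}(\mathrm{id}\otimes\pi_s)\circ\bigoplus_{\psi(i)=r}d_\ell)$, with iterated distributivities $d_r=\mathrm{id}$ and $d_\ell$ of $\mathcal C$. Its right distributivity is the identity, its left distributivity is $(\xi,\mathrm{id},\mathrm{id})$ with $\xi$ the permutation reordering $nm+nm'$ as $n(m+m')$, and, in the bipermutative case, its multiplicative twist is $(\sigma_{n,m},\chi,\gamma_\otimes)$ with $\sigma_{n,m}$ the matrix transposition. **Lemma.** If $\mathcal C$ is a $J$-graded bipermutative (resp. strictly bimonoidal) category, then: 1. $\operatorname{hocolim}_J\mathcal C$ with the structure above is a (well-defined) zeroless bipermutative (resp. strictly bimonoidal) category. 2. $\mathcal C^0=\mathcal C(0)$ is a zeroless bipermutative (resp. strictly bimonoidal) category, and the canonical functor $\mathcal C^0\to\operatorname{hocolim}_J\mathcal C$, $X\mapsto1[(0,X)]$, is a lax morphism of such: with the structure morphisms $1[(0,X)]\oplus1[(0,Y)]=2[(0,X),(0,Y)]\to1[(0,X\oplus Y)]$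 given by the surjection $\{1,2\}\to\{1\}$ and identities, and with identities $1[(0,X)]\otimes1[(0,Y)]=1[(0,X\otimes Y)]$ and $1=1[(0,1)]$, it is lax symmetric monoidal for $\oplus$, lax symmetric monoidal (resp. lax monoidal) for $\otimes$, and respects both distributivity laws. 3. For each $x\in J$, $\mathcal C^x=\mathcal C(x)$ is a zeroless left $\mathcal C^0$-module under $\otimes$, $\operatorname{hocolim}_J\mathcal C$ is a zeroless left $\mathcal C^0$-module through the functor in 2, and the canonical functor $\mathcal C^x\to\operatorname{hocolim}_J\mathcal C$, $X\mapsto1[(x,X)]$, with the analogous structure morphisms $1[(x,X)]\oplus1[(x,Y)]\to1[(x,X\oplus Y)]$, is a map of zeroless $\mathcal C^0$-modules: it is lax symmetric monoidal for $\oplus$, commutes strictly with the action, and respects the distributivity morphisms. Here a zeroless left module over a zeroless strictly bimonoidal (or bipermutative) category $\mathcal R$ is a zeroless permutative category $\mathcal M$ with a functor $\mathcal R\times\mathcal M\to\mathcal M$, strictly associative and unital, and natural distributivity morphisms $d_\ell\colon rm\oplus rm'\to r(m\oplus m')$ and $d_r\colon rm\oplus r'm\to(r\oplus r')m$ (not required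 to be invertible) that satisfy the associativity, additive twist, mixed and pentagon conditions of Elmendorf and Mandell. -/

import Mathlib

open CategoryTheory

universe w w' v u v₁ u₁ v₂ u₂

noncomputable section

/-! ## Permutative categories and strict symmetric monoidal functors -/

/-- A small permutative category: a symmetric monoidal category whose associativity and unit
isomorphisms are identities.  Equalities of morphisms whose sources and targets are equal only by
an earlier law are expressed by `HEq`. -/
structure PermCat where
  carrier : Type u
  [cat : Category.{v} carrier]
  add : carrier → carrier → carrier
  addHom : ∀ {a a' b b' : carrier}, (a ⟶ a') → (b ⟶ b') → (add a b ⟶ add a' b')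
  zero : carrier
  twist : ∀ a b : carrier, add a b ⟶ add b a
  addHom_id : ∀ a b : carrier, addHom (𝟙 a) (𝟙 b) = 𝟙 (add a b)
  addHom_comp : ∀ {a a' a'' b b' b'' : carrier} (f : a ⟶ a') (f' : a' ⟶ a'')
    (g : b ⟶ b') (g' : b' ⟶ b''), addHom (f ≫ f') (g ≫ g') = addHom f g ≫ addHom f' g'
  add_assoc : ∀ a b c : carrier, add (add a b) c = add a (add b c)
  addHom_assoc : ∀ {a a' b b' c c' : carrier} (f : a ⟶ a') (g : b ⟶ b') (h : c ⟶ c'),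
    HEq (addHom (addHom f g) h) (addHom f (addHom g h))
  zero_add : ∀ a : carrier, add zero a = a
  add_zero : ∀ a : carrier, add a zero = a
  zero_addHom : ∀ {a a' : carrier} (f : a ⟶ a'), HEq (addHom (𝟙 zero) f) f
  addHom_zero : ∀ {a a' : carrier} (f : a ⟶ a'), HEq (addHom f (𝟙 zero)) f
  twist_natural : ∀ {a a' b b' : carrier} (f : a ⟶ a') (g : b ⟶ b'),
    addHom f g ≫ twist a' b' = twist a b ≫ addHom g f
  twist_twist : ∀ a b : carrier, twist a b ≫ twist b a = 𝟙 (add a b)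
  twist_zero : ∀ a : carrier, HEq (twist a zero) (𝟙 a)
  twist_add : ∀ a b c : carrier, HEq (twist (add a b) c)
    (addHom (𝟙 a) (twist b c) ≫ eqToHom (add_assoc a c b).symm ≫ addHom (twist a c) (𝟙 b))

instance : CoeSort PermCat.{v, u} (Type u) := ⟨PermCat.carrier⟩

instance (P : PermCat.{v, u}) : Category.{v} P := P.cat

/-- A strict symmetric monoidal functor between permutative categories. -/
@[ext]
structure StrictHom (P Q : PermCat.{v, u}) where
  functor : P ⥤ Q
  obj_zero : functor.obj P.zero = Q.zero
  obj_add : ∀ a b : P, functor.obj (P.add a b) = Q.add (functor.obj a) (functor.obj b)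
  map_addHom : ∀ {a a' b b' : P} (f : a ⟶ a') (g : b ⟶ b'),
    HEq (functor.map (P.addHom f g)) (Q.addHom (functor.map f) (functor.map g))
  map_twist : ∀ a b : P,
    HEq (functor.map (P.twist a b)) (Q.twist (functor.obj a) (functor.obj b))

theorem heq_functor_map {A : Type u} [Category.{v} A] {B : Type u₁} [Category.{v₁} B] (F : A ⥤ B)
    {a b a' b' : A} (ha : a = a') (hb : b = b') {f : a ⟶ b} {g : a' ⟶ b'} (h : HEq f g) :
    HEq (F.map f) (F.map g) := by
  subst ha; subst hb; subst h; rfl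

/-- The category of small permutative categories and strict symmetric monoidal functors. -/
instance : Category.{max v u} PermCat.{v, u} where
  Hom P Q := StrictHom P Q
  id P := ⟨𝟭 P, rfl, fun _ _ => rfl, fun _ _ => HEq.rfl, fun _ _ => HEq.rfl⟩
  comp F G :=
    { functor := F.functor ⋙ G.functor
      obj_zero := by rw [Functor.comp_obj, F.obj_zero, G.obj_zero]
      obj_add := fun a b => by
        rw [Functor.comp_obj, F.obj_add, G.obj_add]; rfl
      map_addHom := fun f g =>
        (heq_functor_map G.functor (F.obj_add _ _) (F.obj_add _ _) (F.map_addHom f g)).trans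
          (G.map_addHom _ _)
      map_twist := fun a b =>
        (heq_functor_map G.functor (F.obj_add _ _) (F.obj_add _ _) (F.map_twist a b)).trans
          (G.map_twist _ _) }

namespace PermCat

/-! ### Finite sums in a permutative category -/

section Sums

variable (P : PermCat.{v, u}) {ι : Type w} {κ : Type w'}

/-- The iterated sum `A i₁ ⊕ ⋯ ⊕ A iₙ` over a list.  (The zero object is a strict unit, so for a
nonempty list this is the iterated sum without zero.) -/
def sum (A : ι → P) : List ι → P
  | [] => P.zero
  | i :: L => P.add (A i) (sum A L)

/-- The sum of a family of morphisms over a list. -/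
def sumHom {A B : ι → P} (f : ∀ i, A i ⟶ B i) : ∀ L : List ι, P.sum A L ⟶ P.sum B L
  | [] => 𝟙 P.zero
  | i :: L => P.addHom (f i) (sumHom f L)

theorem sum_map (f : κ → ι) (A : ι → P) (L : List κ) :
    P.sum A (L.map f) = P.sum (fun k => A (f k)) L := by
  induction L with
  | nil => rfl
  | cons k L ih => simp only [List.map_cons, sum, ih]

theorem sum_append (A : ι → P) (L M : List ι) :
    P.sum A (L ++ M) = P.add (P.sum A L) (P.sum A M) := by
  induction L with
  | nil => exact (P.zero_add _).symm
  | cons i L ih => simp only [List.cons_append, sum, ih, P.add_assoc]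

theorem sum_flatMap (A : ι → P) (L : List κ) (M : κ → List ι) :
    P.sum A (L.flatMap M) = P.sum (fun k => P.sum A (M k)) L := by
  induction L with
  | nil => rfl
  | cons k L ih => simp only [List.flatMap_cons, sum_append, sum, ih]

theorem _root_.StrictHom.obj_sum {P Q : PermCat.{v, u}} (F : StrictHom P Q) (A : ι → P)
    (L : List ι) : F.functor.obj (P.sum A L) = Q.sum (fun i => F.functor.obj (A i)) L := by
  induction L with
  | nil => exact F.obj_zero
  | cons i L ih => simp only [sum, F.obj_add, ih]

variable [DecidableEq ι]

/-- The symmetry isomorphism that moves the summand with index `i` to the front. -/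
def extract (A : ι → P) (i : ι) :
    ∀ L : List ι, i ∈ L → (P.sum A L ⟶ P.add (A i) (P.sum A (L.erase i)))
  | [], h => absurd h List.not_mem_nil
  | j :: L, h =>
    if e : j = i then
      eqToHom (by subst e; rw [List.erase_cons_head]; rfl)
    else
      P.addHom (𝟙 (A j)) (extract A i L ((List.mem_cons.1 h).resolve_left (Ne.symm e))) ≫
      eqToHom (P.add_assoc _ _ _).symm ≫
      P.addHom (P.twist (A j) (A i)) (𝟙 _) ≫
      eqToHom (by
        rw [P.add_assoc, List.erase_cons_tail (by simpa using e)]; rfl)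

/-- The symmetry isomorphism between two sums of the same summands in different orders. -/
def permHom (A : ι → P) : ∀ M L : List ι, L.Perm M → (P.sum A L ⟶ P.sum A M)
  | [], L, h => eqToHom (by rw [h.eq_nil])
  | i :: M, L, h =>
    P.extract A i L (h.mem_iff.2 List.mem_cons_self) ≫
      P.addHom (𝟙 (A i)) (permHom A M (L.erase i)
        (List.Perm.trans (h.erase i) (by rw [List.erase_cons_head])))

end Sums

section OrderedSums

variable (P : PermCat.{v, u}) {ι : Type w} [Fintype ι] [LinearOrder ι]
  {κ : Type w'} [Fintype κ] [LinearOrder κ]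

/-- The sum of a family indexed by a finite linearly ordered set, in increasing order. -/
def osum (A : ι → P) : P := P.sum A (Finset.univ.sort (α := ι))

def osumHom {A B : ι → P} (f : ∀ i, A i ⟶ B i) : P.osum A ⟶ P.osum B := P.sumHom f _

theorem _root_.StrictHom.obj_osum {P Q : PermCat.{v, u}} (F : StrictHom P Q) (A : ι → P) :
    F.functor.obj (P.osum A) = Q.osum (fun i => F.functor.obj (A i)) := F.obj_sum A _

/-- A sum with exactly one summand is that summand. -/
theorem osum_unique (A : ι → P) (i : ι) (h : ∀ j, j = i) : P.osum A = A i := by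
  have hu : (Finset.univ : Finset ι) = {i} := by
    ext j; simp [h j]
  rw [osum, hu, Finset.sort_singleton]
  exact P.add_zero _

/-- A sum with exactly two summands. -/
theorem osum_pair (A : ι → P) (i j : ι) (hij : i < j) (h : ∀ k, k = i ∨ k = j) :
    P.osum A = P.add (A i) (A j) := by
  have hs : (Finset.univ.sort (α := ι)) = [i, j] := by
    refine List.SortedLT.eq_of_mem_iff (Finset.sortedLT_sort _) ?_ ?_
    · simpa [List.sortedLT_iff_pairwise] using hij
    · intro k; simpa using h k
  rw [osum, hs]
  exact congrArg _ (P.add_zero _)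

theorem sort_perm_flatMap {ι' : κ → Type w'} [∀ k, Fintype (ι' k)] [∀ k, LinearOrder (ι' k)]
    (f : ∀ k, ι' k → ι) (hf : Function.Bijective fun s : Σ k, ι' k => f s.1 s.2) :
    (Finset.univ.sort (α := ι)).Perm ((Finset.univ.sort (α := κ)).flatMap
      fun k => (Finset.univ.sort (α := ι' k)).map (f k)) := by
  rw [List.perm_ext_iff_of_nodup (Finset.sort_nodup _ _)]
  · intro i
    obtain ⟨⟨k, j⟩, h⟩ := hf.2 i
    simp only [Finset.mem_sort, Finset.mem_univ, true_iff, List.mem_flatMap, List.mem_map,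
      true_and]
    exact ⟨k, j, h⟩
  · rw [List.nodup_flatMap]
    constructor
    · intro k _
      refine (Finset.sort_nodup _ _).map ?_
      intro a b hab
      have := @hf.1 ⟨k, a⟩ ⟨k, b⟩ hab
      simpa using this
    · refine (Finset.sort_nodup _ _).imp ?_
      intro k k' hk i hi hi'
      simp only [List.mem_map] at hi hi'
      obtain ⟨a, -, ha⟩ := hi
      obtain ⟨b, -, hb⟩ := hi'
      exact hk (congrArg Sigma.fst (@hf.1 ⟨k, a⟩ ⟨k', b⟩ (ha.trans hb.symm)))

/-- The symmetry isomorphism that sorts the summands of a finite sum into blocks: here `f`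
exhibits the index set as the disjoint union of the index sets `ι' k` of the blocks. -/
def regroup (A : ι → P) {ι' : κ → Type w'} [∀ k, Fintype (ι' k)] [∀ k, LinearOrder (ι' k)]
    (f : ∀ k, ι' k → ι) (hf : Function.Bijective fun s : Σ k, ι' k => f s.1 s.2) :
    P.osum A ⟶ P.osum fun k => P.osum fun i => A (f k i) :=
  P.permHom A _ _ (sort_perm_flatMap f hf) ≫ eqToHom (by
    simp only [sum_flatMap, sum_map, osum])

/-- The symmetry isomorphism given by a bijective change of the index set. -/
def reindex (A : ι → P) (f : κ → ι) (hf : Function.Bijective f) :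
    P.osum A ⟶ P.osum fun k => A (f k) :=
  P.permHom A ((Finset.univ.sort (α := κ)).map f) _ (by
    rw [List.perm_ext_iff_of_nodup (Finset.sort_nodup _ _) ((Finset.sort_nodup _ _).map hf.1)]
    intro i
    simpa using hf.2 i) ≫ eqToHom (P.sum_map f A _)

end OrderedSums

end PermCat

/-! ## Graded bipermutative and strictly bimonoidal categories -/

section Graded

/-- The identification of `C(x)` with `C(y)` for equal objects `x` and `y`. -/
abbrev gradeCast {J : Type u₁} [Category.{v₁} J] (C : J ⥤ PermCat.{v₂, u₂}) {x y : J}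
    (h : x = y) : C.obj x ⥤ C.obj y := (C.map (eqToHom h)).functor

/-- The data and laws that graded bipermutative and graded strictly bimonoidal categories have in
common: a functor `C` from `J` to permutative categories and strict functors with composition
functors `⊗ : C(x) × C(y) → C(x + y)`, natural in `x` and `y`, strictly associative and unital,
annihilated by the zero objects, strictly right distributive, and such that the right
distributivity identity is compatible with the additive twist. -/
structure GradedMul (J : PermCat.{v₁, u₁}) (C : J ⥤ PermCat.{v₂, u₂}) where
  mul : ∀ {x y : J}, C.obj x → C.obj y → C.obj (J.add x y)
  mulHom : ∀ {x y : J} {a a' : C.obj x} {b b' : C.obj y},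
    (a ⟶ a') → (b ⟶ b') → (mul a b ⟶ mul a' b')
  mulHom_id : ∀ {x y : J} (a : C.obj x) (b : C.obj y), mulHom (𝟙 a) (𝟙 b) = 𝟙 (mul a b)
  mulHom_comp : ∀ {x y : J} {a a' a'' : C.obj x} {b b' b'' : C.obj y} (f : a ⟶ a')
    (f' : a' ⟶ a'') (g : b ⟶ b') (g' : b' ⟶ b''),
    mulHom (f ≫ f') (g ≫ g') = mulHom f g ≫ mulHom f' g'
  map_mul : ∀ {x y z t : J} (k : x ⟶ z) (l : y ⟶ t) (a : C.obj x) (b : C.obj y),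
    (C.map (J.addHom k l)).functor.obj (mul a b) =
      mul ((C.map k).functor.obj a) ((C.map l).functor.obj b)
  map_mulHom : ∀ {x y z t : J} (k : x ⟶ z) (l : y ⟶ t) {a a' : C.obj x} {b b' : C.obj y}
    (f : a ⟶ a') (g : b ⟶ b'), HEq ((C.map (J.addHom k l)).functor.map (mulHom f g))
      (mulHom ((C.map k).functor.map f) ((C.map l).functor.map g))
  one : C.obj J.zero
  one_mul : ∀ {y : J} (b : C.obj y), (gradeCast C (J.zero_add y)).obj (mul one b) = b
  one_mulHom : ∀ {y : J} {b b' : C.obj y} (g : b ⟶ b'),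
    HEq ((gradeCast C (J.zero_add y)).map (mulHom (𝟙 one) g)) g
  mul_one : ∀ {x : J} (a : C.obj x), (gradeCast C (J.add_zero x)).obj (mul a one) = a
  mulHom_one : ∀ {x : J} {a a' : C.obj x} (f : a ⟶ a'),
    HEq ((gradeCast C (J.add_zero x)).map (mulHom f (𝟙 one))) f
  mul_assoc : ∀ {x y z : J} (a : C.obj x) (b : C.obj y) (c : C.obj z),
    (gradeCast C (J.add_assoc x y z)).obj (mul (mul a b) c) = mul a (mul b c)
  mulHom_assoc : ∀ {x y z : J} {a a' : C.obj x} {b b' : C.obj y} {c c' : C.obj z}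
    (f : a ⟶ a') (g : b ⟶ b') (h : c ⟶ c'),
    HEq ((gradeCast C (J.add_assoc x y z)).map (mulHom (mulHom f g) h))
      (mulHom f (mulHom g h))
  zero_mul : ∀ {x y : J} (b : C.obj y), mul (C.obj x).zero b = (C.obj (J.add x y)).zero
  zero_mulHom : ∀ {x y : J} {b b' : C.obj y} (g : b ⟶ b'),
    HEq (mulHom (𝟙 (C.obj x).zero) g) (𝟙 (C.obj (J.add x y)).zero)
  mul_zero : ∀ {x y : J} (a : C.obj x), mul a (C.obj y).zero = (C.obj (J.add x y)).zero
  mulHom_zero : ∀ {x y : J} {a a' : C.obj x} (f : a ⟶ a'),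
    HEq (mulHom f (𝟙 (C.obj y).zero)) (𝟙 (C.obj (J.add x y)).zero)
  add_mul : ∀ {x y : J} (a a' : C.obj x) (b : C.obj y),
    mul ((C.obj x).add a a') b = (C.obj (J.add x y)).add (mul a b) (mul a' b)
  add_mulHom : ∀ {x y : J} {a₁ a₁' a₂ a₂' : C.obj x} {b b' : C.obj y} (f₁ : a₁ ⟶ a₁')
    (f₂ : a₂ ⟶ a₂') (g : b ⟶ b'), HEq (mulHom ((C.obj x).addHom f₁ f₂) g)
      ((C.obj (J.add x y)).addHom (mulHom f₁ g) (mulHom f₂ g))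
  twist_mulHom : ∀ {x y : J} (a a' : C.obj x) (b : C.obj y),
    HEq (mulHom ((C.obj x).twist a a') (𝟙 b)) ((C.obj (J.add x y)).twist (mul a b) (mul a' b))

variable {J : PermCat.{v₁, u₁}} {C : J ⥤ PermCat.{v₂, u₂}}

namespace GradedMul

/-- Families of morphisms `(a ⊗ b) ⊕ (a ⊗ b') ⟶ a ⊗ (b ⊕ b')`. -/
abbrev LeftDist (M : GradedMul J C) :=
  ∀ ⦃x y : J⦄ (a : C.obj x) (b b' : C.obj y),
    (C.obj (J.add x y)).add (M.mul a b) (M.mul a b') ⟶ M.mul a ((C.obj y).add b b')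

/-- Families of morphisms `a ⊗ b ⟶ C(χ)(b ⊗ a)`. -/
abbrev MulTwist (M : GradedMul J C) :=
  ∀ ⦃x y : J⦄ (a : C.obj x) (b : C.obj y),
    M.mul a b ⟶ (C.map (J.twist y x)).functor.obj (M.mul b a)

/-- The laws on the left distributivity transformation that are common to the bipermutative and
the strictly bimonoidal case: compatibility with the additive twist, associativity, and the
pentagon. -/
structure LeftDistLaws (M : GradedMul J C) (dl : M.LeftDist) : Prop where
  twist : ∀ {x y : J} (a : C.obj x) (b b' : C.obj y),
    dl a b b' ≫ M.mulHom (𝟙 a) ((C.obj y).twist b b') =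
      (C.obj (J.add x y)).twist (M.mul a b) (M.mul a b') ≫ dl a b' b
  assoc : ∀ {x y z : J} (a : C.obj x) (b : C.obj y) (c c' : C.obj z),
    HEq ((gradeCast C (J.add_assoc x y z)).map (dl (M.mul a b) c c'))
      (dl a (M.mul b c) (M.mul b c') ≫ M.mulHom (𝟙 a) (dl b c c'))
  pentagon : ∀ {x y : J} (a a' : C.obj x) (b b' : C.obj y),
    HEq ((C.obj (J.add x y)).addHom (dl a b b') (dl a' b b'))
      ((C.obj (J.add x y)).addHom ((C.obj (J.add x y)).addHom (𝟙 (M.mul a b))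
          ((C.obj (J.add x y)).twist (M.mul a b') (M.mul a' b))) (𝟙 (M.mul a' b')) ≫
        eqToHom (by simp only [M.add_mul, (C.obj (J.add x y)).add_assoc]) ≫
        dl ((C.obj x).add a a') b b')

theorem map_twist_twist (x y : J) (a : C.obj (J.add x y)) :
    (C.map (J.twist y x)).functor.obj ((C.map (J.twist x y)).functor.obj a) = a := by
  have h : C.map (J.twist x y) ≫ C.map (J.twist y x) = 𝟙 _ := by
    rw [← C.map_comp, J.twist_twist, C.map_id]
  exact congrArg (fun F : StrictHom (C.obj (J.add x y)) (C.obj (J.add x y)) => F.functor.obj a) h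

/-- The left distributivity transformation determined by the multiplicative twist and the strict
right distributivity: `(a ⊗ b) ⊕ (a ⊗ b') ⟶ C(χ)(b ⊗ a) ⊕ C(χ)(b' ⊗ a) = C(χ)((b ⊕ b') ⊗ a)
⟶ C(χ) C(χ) (a ⊗ (b ⊕ b')) = a ⊗ (b ⊕ b')`. -/
def leftDistOfTwist (M : GradedMul J C) (γ : M.MulTwist) : M.LeftDist :=
  fun x y a b b' =>
    (C.obj (J.add x y)).addHom (γ a b) (γ a b') ≫
      eqToHom (by rw [M.add_mul, (C.map (J.twist y x)).obj_add]) ≫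
      (C.map (J.twist y x)).functor.map (γ ((C.obj y).add b b') a) ≫
      eqToHom (map_twist_twist x y _)

theorem map_assoc_twist (M : GradedMul J C) {x y z : J} (a : C.obj x) (b : C.obj y)
    (c : C.obj z) : (C.map (J.twist z (J.add x y))).functor.obj (M.mul c (M.mul a b)) =
      (C.map (eqToHom (J.add_assoc z x y) ≫ J.twist z (J.add x y))).functor.obj
        (M.mul (M.mul c a) b) := by
  rw [C.map_comp, ← M.mul_assoc c a b]; rfl

end GradedMul

/-- A `J`-graded bipermutative category (with underlying functor `C`). -/
structure GradedBipermutative (J : PermCat.{v₁, u₁}) (C : J ⥤ PermCat.{v₂, u₂}) extends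
    GradedMul J C where
  mulTwist : toGradedMul.MulTwist
  mulTwist_natural : ∀ {x y : J} {a a' : C.obj x} {b b' : C.obj y} (f : a ⟶ a') (g : b ⟶ b'),
    mulHom f g ≫ mulTwist a' b' =
      mulTwist a b ≫ (C.map (J.twist y x)).functor.map (mulHom g f)
  map_mulTwist : ∀ {x y z t : J} (k : x ⟶ z) (l : y ⟶ t) (a : C.obj x) (b : C.obj y),
    HEq ((C.map (J.addHom k l)).functor.map (mulTwist a b))
      (mulTwist ((C.map k).functor.obj a) ((C.map l).functor.obj b))
  mulTwist_mulTwist : ∀ {x y : J} (a : C.obj x) (b : C.obj y),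
    HEq (mulTwist a b ≫ (C.map (J.twist y x)).functor.map (mulTwist b a)) (𝟙 (mul a b))
  mulTwist_one : ∀ {x : J} (a : C.obj x), HEq (mulTwist a one) (𝟙 (mul a one))
  one_mulTwist : ∀ {x : J} (a : C.obj x), HEq (mulTwist one a) (𝟙 (mul one a))
  mulTwist_mul : ∀ {x y z : J} (a : C.obj x) (b : C.obj y) (c : C.obj z),
    HEq ((gradeCast C (J.add_assoc x y z)).map (mulTwist (mul a b) c ≫
        eqToHom (toGradedMul.map_assoc_twist a b c) ≫
        (C.map (eqToHom (J.add_assoc z x y) ≫ J.twist z (J.add x y))).functor.map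
          (mulHom (mulTwist c a) (𝟙 b))))
      (mulHom (𝟙 a) (mulTwist b c))
  leftDistLaws : toGradedMul.LeftDistLaws (toGradedMul.leftDistOfTwist mulTwist)

/-- The left distributivity transformation of a graded bipermutative category. -/
def GradedBipermutative.leftDist (B : GradedBipermutative J C) : B.LeftDist :=
  B.leftDistOfTwist B.mulTwist

/-- A `J`-graded strictly bimonoidal category (with underlying functor `C`).  The left
distributivity is a natural isomorphism, also natural in the grading. -/
structure GradedStrictlyBimonoidal (J : PermCat.{v₁, u₁}) (C : J ⥤ PermCat.{v₂, u₂}) extends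
    GradedMul J C where
  leftDist : toGradedMul.LeftDist
  isIso_leftDist : ∀ {x y : J} (a : C.obj x) (b b' : C.obj y), IsIso (leftDist a b b')
  leftDist_natural : ∀ {x y : J} {a a₁ : C.obj x} {b b₁ b' b₁' : C.obj y} (f : a ⟶ a₁)
    (g : b ⟶ b₁) (g' : b' ⟶ b₁'),
    (C.obj (J.add x y)).addHom (mulHom f g) (mulHom f g') ≫ leftDist a₁ b₁ b₁' =
      leftDist a b b' ≫ mulHom f ((C.obj y).addHom g g')
  map_leftDist : ∀ {x y z t : J} (k : x ⟶ z) (l : y ⟶ t) (a : C.obj x) (b b' : C.obj y),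
    HEq ((C.map (J.addHom k l)).functor.map (leftDist a b b'))
      (leftDist ((C.map k).functor.obj a) ((C.map l).functor.obj b) ((C.map l).functor.obj b'))
  leftDistLaws : toGradedMul.LeftDistLaws leftDist
  leftDist_mul : ∀ {x y z : J} (a : C.obj x) (b b' : C.obj y) (c : C.obj z),
    HEq ((gradeCast C (J.add_assoc x y z)).map (mulHom (leftDist a b b') (𝟙 c)))
      (leftDist a (mul b c) (mul b' c))
  leftDist_add : ∀ {x y : J} (a : C.obj x) (b b' b'' : C.obj y),
    HEq ((C.obj (J.add x y)).addHom (leftDist a b b') (𝟙 (mul a b'')) ≫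
        leftDist a ((C.obj y).add b b') b'')
      ((C.obj (J.add x y)).addHom (𝟙 (mul a b)) (leftDist a b' b'') ≫
        leftDist a b ((C.obj y).add b' b''))

end Graded

/-! ## Zeroless structures -/

section Zeroless

/-- The data of a zeroless permutative category: an addition and an additive twist. -/
structure AddData (H : Type u) [CategoryStruct.{v} H] where
  add : H → H → H
  addHom : ∀ {a a' b b' : H}, (a ⟶ a') → (b ⟶ b') → (add a b ⟶ add a' b')
  addTwist : ∀ a b : H, add a b ⟶ add b a

/-- The data of a zeroless strictly bimonoidal category; the right distributivity is an identity,
hence no datum. -/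
structure BimonData (H : Type u) [CategoryStruct.{v} H] extends AddData H where
  mul : H → H → H
  mulHom : ∀ {a a' b b' : H}, (a ⟶ a') → (b ⟶ b') → (mul a b ⟶ mul a' b')
  one : H
  leftDist : ∀ a b b' : H, add (mul a b) (mul a b') ⟶ mul a (add b b')

/-- The data of a zeroless left module over (the data of) a zeroless strictly bimonoidal
category. The distributivity morphisms need not be isomorphisms. -/
structure ModuleData {R : Type u} [CategoryStruct.{v} R] (D : BimonData R)
    (M : Type u₁) [CategoryStruct.{v₁} M] extends AddData M where
  act : R → M → M
  actHom : ∀ {r r' : R} {m m' : M}, (r ⟶ r') → (m ⟶ m') → (act r m ⟶ act r' m')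
  leftDist : ∀ (r : R) (m m' : M), add (act r m) (act r m') ⟶ act r (add m m')
  rightDist : ∀ (r r' : R) (m : M), add (act r m) (act r' m) ⟶ act (D.add r r') m

variable {H : Type u} [CategoryStruct.{v} H]

/-- The laws of a category. -/
structure IsCat (H : Type u) [CategoryStruct.{v} H] : Prop where
  id_comp : ∀ {a b : H} (f : a ⟶ b), 𝟙 a ≫ f = f
  comp_id : ∀ {a b : H} (f : a ⟶ b), f ≫ 𝟙 b = f
  assoc : ∀ {a b c d : H} (f : a ⟶ b) (g : b ⟶ c) (h : c ⟶ d), (f ≫ g) ≫ h = f ≫ g ≫ h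

/-- The laws of a zeroless permutative category. -/
structure IsZerolessPermutative (D : AddData H) : Prop where
  isCat : IsCat H
  addHom_id : ∀ a b : H, D.addHom (𝟙 a) (𝟙 b) = 𝟙 (D.add a b)
  addHom_comp : ∀ {a a' a'' b b' b'' : H} (f : a ⟶ a') (f' : a' ⟶ a'')
    (g : b ⟶ b') (g' : b' ⟶ b''), D.addHom (f ≫ f') (g ≫ g') = D.addHom f g ≫ D.addHom f' g'
  add_assoc : ∀ a b c : H, D.add (D.add a b) c = D.add a (D.add b c)
  addHom_assoc : ∀ {a a' b b' c c' : H} (f : a ⟶ a') (g : b ⟶ b') (h : c ⟶ c'),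
    HEq (D.addHom (D.addHom f g) h) (D.addHom f (D.addHom g h))
  twist_natural : ∀ {a a' b b' : H} (f : a ⟶ a') (g : b ⟶ b'),
    D.addHom f g ≫ D.addTwist a' b' = D.addTwist a b ≫ D.addHom g f
  twist_twist : ∀ a b : H, D.addTwist a b ≫ D.addTwist b a = 𝟙 (D.add a b)
  twist_add : ∀ a b c : H, HEq (D.addTwist (D.add a b) c)
    (D.addHom (𝟙 a) (D.addTwist b c) ≫ eqToHom (add_assoc a c b).symm ≫
      D.addHom (D.addTwist a c) (𝟙 b))

/-- The laws common to zeroless strictly bimonoidal and zeroless bipermutative categories. -/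
structure IsZerolessBimonoidalCore (D : BimonData H) : Prop where
  permutative : IsZerolessPermutative D.toAddData
  mulHom_id : ∀ a b : H, D.mulHom (𝟙 a) (𝟙 b) = 𝟙 (D.mul a b)
  mulHom_comp : ∀ {a a' a'' b b' b'' : H} (f : a ⟶ a') (f' : a' ⟶ a'')
    (g : b ⟶ b') (g' : b' ⟶ b''), D.mulHom (f ≫ f') (g ≫ g') = D.mulHom f g ≫ D.mulHom f' g'
  mul_assoc : ∀ a b c : H, D.mul (D.mul a b) c = D.mul a (D.mul b c)
  mulHom_assoc : ∀ {a a' b b' c c' : H} (f : a ⟶ a') (g : b ⟶ b') (h : c ⟶ c'),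
    HEq (D.mulHom (D.mulHom f g) h) (D.mulHom f (D.mulHom g h))
  one_mul : ∀ a : H, D.mul D.one a = a
  one_mulHom : ∀ {a a' : H} (f : a ⟶ a'), HEq (D.mulHom (𝟙 D.one) f) f
  mul_one : ∀ a : H, D.mul a D.one = a
  mulHom_one : ∀ {a a' : H} (f : a ⟶ a'), HEq (D.mulHom f (𝟙 D.one)) f
  add_mul : ∀ a a' b : H, D.mul (D.add a a') b = D.add (D.mul a b) (D.mul a' b)
  add_mulHom : ∀ {a₁ a₁' a₂ a₂' b b' : H} (f₁ : a₁ ⟶ a₁') (f₂ : a₂ ⟶ a₂') (g : b ⟶ b'),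
    HEq (D.mulHom (D.addHom f₁ f₂) g) (D.addHom (D.mulHom f₁ g) (D.mulHom f₂ g))
  twist_mulHom : ∀ a a' b : H,
    HEq (D.mulHom (D.addTwist a a') (𝟙 b)) (D.addTwist (D.mul a b) (D.mul a' b))
  leftDist_twist : ∀ a b b' : H, D.leftDist a b b' ≫ D.mulHom (𝟙 a) (D.addTwist b b') =
    D.addTwist (D.mul a b) (D.mul a b') ≫ D.leftDist a b' b
  leftDist_assoc : ∀ a b c c' : H, HEq (D.leftDist (D.mul a b) c c')
    (D.leftDist a (D.mul b c) (D.mul b c') ≫ D.mulHom (𝟙 a) (D.leftDist b c c'))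
  pentagon : ∀ a a' b b' : H, HEq (D.addHom (D.leftDist a b b') (D.leftDist a' b b'))
    (D.addHom (D.addHom (𝟙 (D.mul a b)) (D.addTwist (D.mul a b') (D.mul a' b)))
        (𝟙 (D.mul a' b')) ≫
      eqToHom (by simp only [add_mul, permutative.add_assoc]) ≫
      D.leftDist (D.add a a') b b')

/-- The laws of a zeroless strictly bimonoidal category. -/
structure IsZerolessStrictlyBimonoidal (D : BimonData H) : Prop extends
    IsZerolessBimonoidalCore D where
  leftDist_iso : ∀ a b b' : H, ∃ e : D.mul a (D.add b b') ⟶ D.add (D.mul a b) (D.mul a b'),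
    D.leftDist a b b' ≫ e = 𝟙 _ ∧ e ≫ D.leftDist a b b' = 𝟙 _
  leftDist_natural : ∀ {a a₁ b b₁ b' b₁' : H} (f : a ⟶ a₁) (g : b ⟶ b₁) (g' : b' ⟶ b₁'),
    D.addHom (D.mulHom f g) (D.mulHom f g') ≫ D.leftDist a₁ b₁ b₁' =
      D.leftDist a b b' ≫ D.mulHom f (D.addHom g g')
  leftDist_mul : ∀ a b b' c : H,
    HEq (D.mulHom (D.leftDist a b b') (𝟙 c)) (D.leftDist a (D.mul b c) (D.mul b' c))
  leftDist_add : ∀ a b b' b'' : H,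
    HEq (D.addHom (D.leftDist a b b') (𝟙 (D.mul a b'')) ≫ D.leftDist a (D.add b b') b'')
      (D.addHom (𝟙 (D.mul a b)) (D.leftDist a b' b'') ≫ D.leftDist a b (D.add b' b''))

/-- The laws of a zeroless bipermutative category with multiplicative twist `τ`. -/
structure IsZerolessBipermutative (D : BimonData H) (τ : ∀ a b : H, D.mul a b ⟶ D.mul b a) :
    Prop extends IsZerolessBimonoidalCore D where
  mulTwist_natural : ∀ {a a' b b' : H} (f : a ⟶ a') (g : b ⟶ b'),
    D.mulHom f g ≫ τ a' b' = τ a b ≫ D.mulHom g f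
  mulTwist_mulTwist : ∀ a b : H, τ a b ≫ τ b a = 𝟙 (D.mul a b)
  mulTwist_one : ∀ a : H, HEq (τ a D.one) (𝟙 a)
  one_mulTwist : ∀ a : H, HEq (τ D.one a) (𝟙 a)
  mulTwist_mul : ∀ a b c : H, HEq (τ (D.mul a b) c)
    (D.mulHom (𝟙 a) (τ b c) ≫ eqToHom (mul_assoc a c b).symm ≫ D.mulHom (τ a c) (𝟙 b))
  leftDist_eq : ∀ a b b' : H, D.leftDist a b b' =
    D.addHom (τ a b) (τ a b') ≫ eqToHom (add_mul b b' a).symm ≫ τ (D.add b b') a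

/-- The laws of a zeroless left module. -/
structure IsZerolessModule {R : Type u} [CategoryStruct.{v} R] {D : BimonData R}
    {M : Type u₁} [CategoryStruct.{v₁} M] (N : ModuleData D M) : Prop where
  permutative : IsZerolessPermutative N.toAddData
  actHom_id : ∀ (r : R) (m : M), N.actHom (𝟙 r) (𝟙 m) = 𝟙 (N.act r m)
  actHom_comp : ∀ {r r' r'' : R} {m m' m'' : M} (f : r ⟶ r') (f' : r' ⟶ r'')
    (g : m ⟶ m') (g' : m' ⟶ m''), N.actHom (f ≫ f') (g ≫ g') = N.actHom f g ≫ N.actHom f' g'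
  mul_act : ∀ (r s : R) (m : M), N.act (D.mul r s) m = N.act r (N.act s m)
  mul_actHom : ∀ {r r' s s' : R} {m m' : M} (f : r ⟶ r') (g : s ⟶ s') (h : m ⟶ m'),
    HEq (N.actHom (D.mulHom f g) h) (N.actHom f (N.actHom g h))
  one_act : ∀ m : M, N.act D.one m = m
  one_actHom : ∀ {m m' : M} (f : m ⟶ m'), HEq (N.actHom (𝟙 D.one) f) f
  leftDist_natural : ∀ {r r' : R} {m m₁ m' m₁' : M} (f : r ⟶ r') (g : m ⟶ m₁) (g' : m' ⟶ m₁'),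
    N.addHom (N.actHom f g) (N.actHom f g') ≫ N.leftDist r' m₁ m₁' =
      N.leftDist r m m' ≫ N.actHom f (N.addHom g g')
  rightDist_natural : ∀ {r r₁ r' r₁' : R} {m m' : M} (f : r ⟶ r₁) (f' : r' ⟶ r₁') (g : m ⟶ m'),
    N.addHom (N.actHom f g) (N.actHom f' g) ≫ N.rightDist r₁ r₁' m' =
      N.rightDist r r' m ≫ N.actHom (D.addHom f f') g
  leftDist_add : ∀ (r : R) (m m' m'' : M),
    HEq (N.addHom (N.leftDist r m m') (𝟙 (N.act r m'')) ≫ N.leftDist r (N.add m m') m'')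
      (N.addHom (𝟙 (N.act r m)) (N.leftDist r m' m'') ≫ N.leftDist r m (N.add m' m''))
  rightDist_add : ∀ (r r' r'' : R) (m : M),
    HEq (N.addHom (N.rightDist r r' m) (𝟙 (N.act r'' m)) ≫ N.rightDist (D.add r r') r'' m)
      (N.addHom (𝟙 (N.act r m)) (N.rightDist r' r'' m) ≫ N.rightDist r (D.add r' r'') m)
  leftDist_twist : ∀ (r : R) (m m' : M), N.leftDist r m m' ≫ N.actHom (𝟙 r) (N.addTwist m m') =
    N.addTwist (N.act r m) (N.act r m') ≫ N.leftDist r m' m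
  rightDist_twist : ∀ (r r' : R) (m : M),
    N.rightDist r r' m ≫ N.actHom (D.addTwist r r') (𝟙 m) =
      N.addTwist (N.act r m) (N.act r' m) ≫ N.rightDist r' r m
  leftDist_assoc : ∀ (r s : R) (m m' : M), HEq (N.leftDist (D.mul r s) m m')
    (N.leftDist r (N.act s m) (N.act s m') ≫ N.actHom (𝟙 r) (N.leftDist s m m'))
  rightDist_assoc : ∀ (r r' s : R) (m : M),
    HEq (N.rightDist (D.mul r s) (D.mul r' s) m) (N.rightDist r r' (N.act s m))
  leftDist_rightDist : ∀ (r s s' : R) (m : M),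
    HEq (N.leftDist r (N.act s m) (N.act s' m) ≫ N.actHom (𝟙 r) (N.rightDist s s' m))
      (N.rightDist (D.mul r s) (D.mul r s') m ≫ N.actHom (D.leftDist r s s') (𝟙 m))
  pentagon : ∀ (r r' : R) (m m' : M),
    HEq (N.addHom (N.leftDist r m m') (N.leftDist r' m m') ≫ N.rightDist r r' (N.add m m'))
      (N.addHom (N.addHom (𝟙 (N.act r m)) (N.addTwist (N.act r m') (N.act r' m)))
          (𝟙 (N.act r' m')) ≫
        eqToHom (by simp only [permutative.add_assoc]) ≫
        N.addHom (N.rightDist r r' m) (N.rightDist r r' m') ≫ N.leftDist (D.add r r') m m')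

/-- The data of a functor. -/
structure MapData (A : Type u) [CategoryStruct.{v} A] (B : Type u₁) [CategoryStruct.{v₁} B] where
  obj : A → B
  map : ∀ {a a' : A}, (a ⟶ a') → (obj a ⟶ obj a')

variable {A : Type u} [CategoryStruct.{v} A] {B : Type u₁} [CategoryStruct.{v₁} B]

/-- `F` is a functor and `η` makes it a (zeroless) lax symmetric monoidal functor with respect to
the additions. -/
structure IsLaxAdditive (D : AddData A) (E : AddData B) (F : MapData A B)
    (η : ∀ a b : A, E.add (F.obj a) (F.obj b) ⟶ F.obj (D.add a b)) : Prop where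
  map_id : ∀ a : A, F.map (𝟙 a) = 𝟙 (F.obj a)
  map_comp : ∀ {a b c : A} (f : a ⟶ b) (g : b ⟶ c), F.map (f ≫ g) = F.map f ≫ F.map g
  natural : ∀ {a a' b b' : A} (f : a ⟶ a') (g : b ⟶ b'),
    E.addHom (F.map f) (F.map g) ≫ η a' b' = η a b ≫ F.map (D.addHom f g)
  assoc : ∀ a b c : A, HEq (E.addHom (η a b) (𝟙 (F.obj c)) ≫ η (D.add a b) c)
    (E.addHom (𝟙 (F.obj a)) (η b c) ≫ η a (D.add b c))
  twist : ∀ a b : A, η a b ≫ F.map (D.addTwist a b) =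
    E.addTwist (F.obj a) (F.obj b) ≫ η b a

/-- A lax morphism of zeroless strictly bimonoidal categories. -/
structure IsLaxMorphism (D : BimonData A) (E : BimonData B) (F : MapData A B)
    (ηadd : ∀ a b : A, E.add (F.obj a) (F.obj b) ⟶ F.obj (D.add a b))
    (ηmul : ∀ a b : A, E.mul (F.obj a) (F.obj b) ⟶ F.obj (D.mul a b))
    (ηone : E.one ⟶ F.obj D.one) : Prop where
  additive : IsLaxAdditive D.toAddData E.toAddData F ηadd
  mul_natural : ∀ {a a' b b' : A} (f : a ⟶ a') (g : b ⟶ b'),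
    E.mulHom (F.map f) (F.map g) ≫ ηmul a' b' = ηmul a b ≫ F.map (D.mulHom f g)
  mul_assoc : ∀ a b c : A, HEq (E.mulHom (ηmul a b) (𝟙 (F.obj c)) ≫ ηmul (D.mul a b) c)
    (E.mulHom (𝟙 (F.obj a)) (ηmul b c) ≫ ηmul a (D.mul b c))
  one_mul : ∀ a : A, HEq (E.mulHom ηone (𝟙 (F.obj a)) ≫ ηmul D.one a) (𝟙 (F.obj a))
  mul_one : ∀ a : A, HEq (E.mulHom (𝟙 (F.obj a)) ηone ≫ ηmul a D.one) (𝟙 (F.obj a))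
  rightDist : ∀ a a' b : A,
    HEq (E.addHom (ηmul a b) (ηmul a' b) ≫ ηadd (D.mul a b) (D.mul a' b))
      (E.mulHom (ηadd a a') (𝟙 (F.obj b)) ≫ ηmul (D.add a a') b)
  leftDist : ∀ a b b' : A,
    (E.addHom (ηmul a b) (ηmul a b') ≫ ηadd (D.mul a b) (D.mul a b')) ≫
        F.map (D.leftDist a b b') =
      E.leftDist (F.obj a) (F.obj b) (F.obj b') ≫ E.mulHom (𝟙 (F.obj a)) (ηadd b b') ≫
        ηmul a (D.add b b')

/-- A lax morphism of zeroless bipermutative categories. -/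
structure IsLaxBipermutativeMorphism (D : BimonData A) (τ : ∀ a b : A, D.mul a b ⟶ D.mul b a)
    (E : BimonData B) (τ' : ∀ a b : B, E.mul a b ⟶ E.mul b a) (F : MapData A B)
    (ηadd : ∀ a b : A, E.add (F.obj a) (F.obj b) ⟶ F.obj (D.add a b))
    (ηmul : ∀ a b : A, E.mul (F.obj a) (F.obj b) ⟶ F.obj (D.mul a b))
    (ηone : E.one ⟶ F.obj D.one) : Prop extends IsLaxMorphism D E F ηadd ηmul ηone where
  mulTwist : ∀ a b : A, ηmul a b ≫ F.map (τ a b) = τ' (F.obj a) (F.obj b) ≫ ηmul b a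

/-- A map of zeroless modules: a lax symmetric monoidal functor that commutes strictly with the
action and respects the distributivity morphisms. -/
structure IsModuleMap {R : Type u₂} [CategoryStruct.{v₂} R] {D : BimonData R}
    (M : ModuleData D A) (N : ModuleData D B) (F : MapData A B)
    (η : ∀ a b : A, N.add (F.obj a) (F.obj b) ⟶ F.obj (M.add a b)) : Prop where
  additive : IsLaxAdditive M.toAddData N.toAddData F η
  obj_act : ∀ (r : R) (m : A), F.obj (M.act r m) = N.act r (F.obj m)
  map_actHom : ∀ {r r' : R} {m m' : A} (f : r ⟶ r') (g : m ⟶ m'),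
    HEq (F.map (M.actHom f g)) (N.actHom f (F.map g))
  leftDist : ∀ (r : R) (m m' : A),
    HEq (η (M.act r m) (M.act r m') ≫ F.map (M.leftDist r m m'))
      (N.leftDist r (F.obj m) (F.obj m') ≫ N.actHom (𝟙 r) (η m m'))
  rightDist : ∀ (r r' : R) (m : A),
    HEq (η (M.act r m) (M.act r' m) ≫ F.map (M.rightDist r r' m))
      (N.rightDist r r' (F.obj m))

end Zeroless

/-! ## The zeroless bipermutative category `C(0)` and its modules `C(x)` -/

section Degree

variable {J : PermCat.{v₁, u₁}} {C : J ⥤ PermCat.{v₂, u₂}}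

/-- The additive data of a permutative category, forgetting the zero object. -/
def PermCat.addData (P : PermCat.{v, u}) : AddData P where
  add := P.add
  addHom := P.addHom
  addTwist := P.twist

namespace GradedMul

variable (M : GradedMul J C)

/-- The action of `C(0)` on `C(x)`, where `0 + x = x`. -/
def act {x : J} (r : C.obj J.zero) (m : C.obj x) : C.obj x :=
  (gradeCast C (J.zero_add x)).obj (M.mul r m)

def actHom {x : J} {r r' : C.obj J.zero} {m m' : C.obj x} (f : r ⟶ r') (g : m ⟶ m') :
    M.act r m ⟶ M.act r' m' :=
  (gradeCast C (J.zero_add x)).map (M.mulHom f g)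

def actLeftDist (dl : M.LeftDist) {x : J} (r : C.obj J.zero) (m m' : C.obj x) :
    (C.obj x).add (M.act r m) (M.act r m') ⟶ M.act r ((C.obj x).add m m') :=
  eqToHom ((C.map (eqToHom (J.zero_add x))).obj_add _ _).symm ≫
    (gradeCast C (J.zero_add x)).map (dl r m m')

theorem add_act {x : J} (r r' : C.obj J.zero) (m : C.obj x) :
    (C.obj x).add (M.act r m) (M.act r' m) = M.act ((C.obj J.zero).add r r') m := by
  rw [act, act, act, M.add_mul]
  exact ((C.map (eqToHom (J.zero_add x))).obj_add _ _).symm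

/-- The zeroless data of the degree zero part `C(0)`. -/
def degreeZero (dl : M.LeftDist) : BimonData (C.obj J.zero) where
  toAddData := (C.obj J.zero).addData
  mul := M.act
  mulHom := M.actHom
  one := M.one
  leftDist := M.actLeftDist dl

/-- The zeroless `C(0)`-module `C(x)`. -/
def degreeModule (dl : M.LeftDist) (x : J) : ModuleData (M.degreeZero dl) (C.obj x) where
  toAddData := (C.obj x).addData
  act := M.act
  actHom := M.actHom
  leftDist := M.actLeftDist dl
  rightDist := fun r r' m => eqToHom (M.add_act r r' m)

theorem map_twist_zero (a : C.obj (J.add J.zero J.zero)) :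
    (C.map (J.twist J.zero J.zero)).functor.obj a = a := by
  have h : J.twist J.zero J.zero = 𝟙 (J.add J.zero J.zero) :=
    eq_of_heq ((J.twist_zero J.zero).trans (by rw [J.zero_add]))
  rw [h, C.map_id]; rfl

/-- The multiplicative twist of the degree zero part. -/
def degreeZeroTwist (γ : M.MulTwist) (a b : C.obj J.zero) : M.act a b ⟶ M.act b a :=
  (gradeCast C (J.zero_add J.zero)).map (γ a b ≫ eqToHom (map_twist_zero _))

end GradedMul

end Degree

/-! ## Thomason's homotopy colimit -/

/-- The objects `n[(x₁, X₁), …, (xₙ, Xₙ)]`, `n ≥ 1`, of the homotopy colimit of a diagram `C` of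
permutative categories and strict symmetric monoidal functors. -/
structure Hocolim {J : Type u₁} [Category.{v₁} J] (C : J ⥤ PermCat.{v₂, u₂}) where
  len : ℕ
  len_pos : 0 < len
  entry : Fin len → Σ x : J, C.obj x

namespace Hocolim

section Category

variable {J : Type u₁} [Category.{v₁} J] {C : J ⥤ PermCat.{v₂, u₂}}

/-- A morphism `(ψ, ℓ, ϱ)`: a surjection `ψ`, morphisms `ℓ i : x i ⟶ y (ψ i)` and morphisms
`ϱ j : ⨁_{ψ i = j} C(ℓ i)(X i) ⟶ Y j`, the summands being in increasing order of `i`. The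
morphism `x i ⟶ y (ψ i)` is written `ℓ i j h` with `j` and a proof `h` of `ψ i = j`. -/
@[ext]
structure Mor (S T : Hocolim C) where
  ψ : Fin S.len → Fin T.len
  surj : Function.Surjective ψ
  ℓ : ∀ i j, ψ i = j → ((S.entry i).1 ⟶ (T.entry j).1)
  ϱ : ∀ j, (C.obj (T.entry j).1).osum
    (fun i : {i // ψ i = j} => (C.map (ℓ i j i.2)).functor.obj (S.entry i).2) ⟶ (T.entry j).2

/-- The morphism whose first coordinate is a bijection `e` and whose third coordinate consists of
the morphisms `f i : C(ℓ i)(X i) ⟶ Y (e i)`. -/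
def Mor.ofEquiv {S T : Hocolim C} (e : Fin S.len ≃ Fin T.len)
    (ℓ : ∀ i j, e i = j → ((S.entry i).1 ⟶ (T.entry j).1))
    (f : ∀ i j (h : e i = j), (C.map (ℓ i j h)).functor.obj (S.entry i).2 ⟶ (T.entry j).2) :
    Mor S T where
  ψ := e
  surj := e.surjective
  ℓ := ℓ
  ϱ j := eqToHom (PermCat.osum_unique _ _ ⟨e.symm j, e.apply_symm_apply j⟩ (by
      rintro ⟨i, hi⟩; subst hi; simp)) ≫ f (e.symm j) j (e.apply_symm_apply j)

theorem entry_cast {p q : Σ x : J, C.obj x} (h : p = q) :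
    (C.map (eqToHom (congrArg Sigma.fst h))).functor.obj p.2 = q.2 := by
  subst h
  rw [eqToHom_refl, C.map_id]; rfl

/-- The morphism `(e, id, id)` given by a bijection `e` such that `(xᵢ, Xᵢ) = (y_{e i}, Y_{e i})`. -/
def Mor.perm {S T : Hocolim C} (e : Fin S.len ≃ Fin T.len)
    (h : ∀ i, S.entry i = T.entry (e i)) : Mor S T :=
  Mor.ofEquiv e (fun i j hj => eqToHom (congrArg Sigma.fst ((h i).trans (congrArg T.entry hj))))
    (fun i j hj => eqToHom (entry_cast ((h i).trans (congrArg T.entry hj))))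

section Comp

variable {S T U : Hocolim C} (f : Mor S T) (g : Mor T U)

def compℓ (i : Fin S.len) (r : Fin U.len) (h : g.ψ (f.ψ i) = r) :
    (S.entry i).1 ⟶ (U.entry r).1 :=
  f.ℓ i (f.ψ i) rfl ≫ g.ℓ (f.ψ i) r h

/-- The fibre of a composite over `r` is the disjoint union of the fibres of `f` over the points of
the fibre of `g` over `r`. -/
def compIncl (r : Fin U.len) (k : {k // g.ψ k = r}) (i : {i // f.ψ i = k.1}) :
    {i // g.ψ (f.ψ i) = r} :=
  ⟨i, by rw [i.2, k.2]⟩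

theorem compIncl_bijective (r : Fin U.len) : Function.Bijective
    fun s : Σ k : {k // g.ψ k = r}, {i // f.ψ i = k.1} => compIncl f g r s.1 s.2 := by
  constructor
  · rintro ⟨⟨k, hk⟩, ⟨i, hi⟩⟩ ⟨⟨k', hk'⟩, ⟨i', hi'⟩⟩ h
    have h' : i = i' := congrArg Subtype.val h
    subst h'
    dsimp only at hi hi'
    subst hi
    subst hi'
    rfl
  · rintro ⟨i, hi⟩
    exact ⟨⟨⟨f.ψ i, hi⟩, ⟨i, rfl⟩⟩, rfl⟩

theorem comp_summand (r : Fin U.len) (k : {k // g.ψ k = r}) (i : {i // f.ψ i = k.1}) :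
    (C.map (compℓ f g i r (compIncl f g r k i).2)).functor.obj (S.entry i).2 =
      (C.map (g.ℓ k r k.2)).functor.obj ((C.map (f.ℓ i k i.2)).functor.obj (S.entry i).2) := by
  obtain ⟨k, hk⟩ := k
  obtain ⟨i, hi⟩ := i
  dsimp only at hi
  subst hi
  dsimp only [compℓ]
  rw [C.map_comp]; rfl

/-- The composite of two morphisms. Its third coordinate is
`⨁_{ψ'ψ(i) = r} C(ℓ' ℓ)(X i) ⟶ ⨁_{ψ'(k) = r} ⨁_{ψ(i) = k} C(ℓ' ℓ)(X i)
= ⨁_{ψ'(k) = r} C(ℓ')(⨁_{ψ(i) = k} C(ℓ)(X i)) ⟶ ⨁_{ψ'(k) = r} C(ℓ')(X' k) ⟶ X'' r`. -/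
def comp : Mor S U where
  ψ := g.ψ ∘ f.ψ
  surj := g.surj.comp f.surj
  ℓ := compℓ f g
  ϱ r :=
    (C.obj (U.entry r).1).regroup _ (compIncl f g r) (compIncl_bijective f g r) ≫
    eqToHom (by
      refine congrArg _ (funext fun k => ?_)
      rw [StrictHom.obj_osum]
      exact congrArg _ (funext fun i => comp_summand f g r k i)) ≫
    (C.obj (U.entry r).1).osumHom (fun k : {k // g.ψ k = r} => (C.map (g.ℓ k r k.2)).functor.map (f.ϱ k)) ≫
    g.ϱ r

end Comp

instance : CategoryStruct (Hocolim C) where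
  Hom := Mor
  id S := Mor.perm (Equiv.refl _) fun _ => rfl
  comp := comp

/-- Addition of objects: concatenation. -/
abbrev add (S T : Hocolim C) : Hocolim C where
  len := S.len + T.len
  len_pos := Nat.add_pos_left S.len_pos _
  entry p := Sum.elim S.entry T.entry (finSumFinEquiv.symm p)

section AddHom

variable {S S' T T' : Hocolim C} (f : Mor S S') (g : Mor T T')

def sumℓ : ∀ (p : Fin S.len ⊕ Fin T.len) (q : Fin S'.len ⊕ Fin T'.len), Sum.map f.ψ g.ψ p = q →
    ((Sum.elim S.entry T.entry p).1 ⟶ (Sum.elim S'.entry T'.entry q).1)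
  | .inl i, .inl j, h => f.ℓ i j (Sum.inl_injective h)
  | .inr i, .inr j, h => g.ℓ i j (Sum.inr_injective h)
  | .inl _, .inr _, h => absurd h Sum.inl_ne_inr
  | .inr _, .inl _, h => absurd h Sum.inr_ne_inl

theorem sumℓ_left {p : Fin S.len ⊕ Fin T.len} {i : Fin S.len} {j : Fin S'.len}
    (hp : p = .inl i) (h : Sum.map f.ψ g.ψ p = .inl j) (h' : f.ψ i = j) :
    (C.map (sumℓ f g p (.inl j) h)).functor.obj (Sum.elim S.entry T.entry p).2 =
      (C.map (f.ℓ i j h')).functor.obj (S.entry i).2 := by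
  subst hp; rfl

theorem sumℓ_right {p : Fin S.len ⊕ Fin T.len} {i : Fin T.len} {j : Fin T'.len}
    (hp : p = .inr i) (h : Sum.map f.ψ g.ψ p = .inr j) (h' : g.ψ i = j) :
    (C.map (sumℓ f g p (.inr j) h)).functor.obj (Sum.elim S.entry T.entry p).2 =
      (C.map (g.ℓ i j h')).functor.obj (T.entry i).2 := by
  subst hp; rfl

/-- The inclusion of the fibre of `f` over `j` into the fibre of `f ⊕ g`. -/
def inclLeft (j : Fin S'.len) (i : {i // f.ψ i = j}) :
    {p : Fin (S.len + T.len) // Sum.map f.ψ g.ψ (finSumFinEquiv.symm p) = .inl j} :=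
  ⟨finSumFinEquiv (.inl i), by rw [Equiv.symm_apply_apply, Sum.map_inl, i.2]⟩

def inclRight (j : Fin T'.len) (i : {i // g.ψ i = j}) :
    {p : Fin (S.len + T.len) // Sum.map f.ψ g.ψ (finSumFinEquiv.symm p) = .inr j} :=
  ⟨finSumFinEquiv (.inr i), by rw [Equiv.symm_apply_apply, Sum.map_inr, i.2]⟩

theorem inclLeft_bijective (j : Fin S'.len) : Function.Bijective (inclLeft f g j) := by
  constructor
  · rintro ⟨i, hi⟩ ⟨i', hi'⟩ h
    simpa [inclLeft] using h
  · rintro ⟨p, hp⟩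
    obtain ⟨p, rfl⟩ := finSumFinEquiv.surjective p
    rw [Equiv.symm_apply_apply] at hp
    rcases p with i | i
    · exact ⟨⟨i, Sum.inl_injective hp⟩, rfl⟩
    · exact absurd hp Sum.inr_ne_inl

theorem inclRight_bijective (j : Fin T'.len) : Function.Bijective (inclRight f g j) := by
  constructor
  · rintro ⟨i, hi⟩ ⟨i', hi'⟩ h
    simpa [inclRight] using h
  · rintro ⟨p, hp⟩
    obtain ⟨p, rfl⟩ := finSumFinEquiv.surjective p
    rw [Equiv.symm_apply_apply] at hp
    rcases p with i | i
    · exact absurd hp Sum.inl_ne_inr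
    · exact ⟨⟨i, Sum.inr_injective hp⟩, rfl⟩

/-- The third coordinate of `f ⊕ g`, which is the one of `f` or the one of `g`. -/
def sumϱ : ∀ q : Fin S'.len ⊕ Fin T'.len,
    (C.obj (Sum.elim S'.entry T'.entry q).1).osum
      (fun p : {p : Fin (S.len + T.len) // Sum.map f.ψ g.ψ (finSumFinEquiv.symm p) = q} =>
        (C.map (sumℓ f g (finSumFinEquiv.symm p) q p.2)).functor.obj
          (Sum.elim S.entry T.entry (finSumFinEquiv.symm p)).2) ⟶
      (Sum.elim S'.entry T'.entry q).2
  | .inl j => PermCat.reindex _ _ (inclLeft f g j) (inclLeft_bijective f g j) ≫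
      eqToHom (congrArg (C.obj (S'.entry j).1).osum (funext fun i =>
        sumℓ_left f g (finSumFinEquiv.symm_apply_apply (.inl i.1)) (inclLeft f g j i).2 i.2)) ≫
      f.ϱ j
  | .inr j => PermCat.reindex _ _ (inclRight f g j) (inclRight_bijective f g j) ≫
      eqToHom (congrArg (C.obj (T'.entry j).1).osum (funext fun i =>
        sumℓ_right f g (finSumFinEquiv.symm_apply_apply (.inr i.1)) (inclRight f g j i).2 i.2)) ≫
      g.ϱ j

/-- Two descriptions of the fibre of `f ⊕ g` over `q`. -/
def sumFibre (q : Fin (S'.len + T'.len)) (p : {p : Fin (S.len + T.len) //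
    Sum.map f.ψ g.ψ (finSumFinEquiv.symm p) = finSumFinEquiv.symm q}) :
    {p : Fin (S.len + T.len) // finSumFinEquiv (Sum.map f.ψ g.ψ (finSumFinEquiv.symm p)) = q} :=
  ⟨p.1, (Equiv.eq_symm_apply _).1 p.2⟩

theorem sumFibre_bijective (q : Fin (S'.len + T'.len)) : Function.Bijective (sumFibre f g q) :=
  ⟨fun p p' h => by
      have h' : (sumFibre f g q p).1 = (sumFibre f g q p').1 := by rw [h]
      exact Subtype.ext h',
    fun p => ⟨⟨p.1, (Equiv.eq_symm_apply _).2 p.2⟩, rfl⟩⟩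

/-- Addition of morphisms. -/
def addHom : add S T ⟶ add S' T' where
  ψ p := finSumFinEquiv (Sum.map f.ψ g.ψ (finSumFinEquiv.symm p))
  surj := finSumFinEquiv.surjective.comp
    ((Function.Surjective.sumMap f.surj g.surj).comp finSumFinEquiv.symm.surjective)
  ℓ p q h := sumℓ f g (finSumFinEquiv.symm p) (finSumFinEquiv.symm q)
    ((Equiv.eq_symm_apply _).2 h)
  ϱ q := PermCat.reindex _ _ (sumFibre f g q) (sumFibre_bijective f g q) ≫
    sumϱ f g (finSumFinEquiv.symm q)

end AddHom

/-- The block permutation `χ(n, m)`. -/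
def blockSwap (n m : ℕ) : Fin (n + m) ≃ Fin (m + n) :=
  finSumFinEquiv.symm.trans ((Equiv.sumComm _ _).trans finSumFinEquiv)

/-- The additive twist `(χ(n, m), id, id)`. -/
def addTwist (S T : Hocolim C) : add S T ⟶ add T S :=
  Mor.perm (blockSwap S.len T.len) fun p => by
    obtain ⟨p, rfl⟩ := finSumFinEquiv.surjective p
    simp only [blockSwap, Equiv.trans_apply, Equiv.symm_apply_apply]
    cases p <;> rfl

def addData : AddData (Hocolim C) where
  add := add
  addHom := fun f g => addHom f g
  addTwist := addTwist

/-- The object `1[(x, X)]`. -/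
abbrev single (x : J) (X : C.obj x) : Hocolim C := ⟨1, Nat.one_pos, fun _ => ⟨x, X⟩⟩

theorem map_id_obj (x : J) (X : C.obj x) : (C.map (𝟙 x)).functor.obj X = X := by
  rw [C.map_id]; rfl

/-- The canonical functor `C(x) ⟶ hocolim C`, `X ↦ 1[(x, X)]`, `f ↦ (id, id, f)`. -/
def incl (x : J) : MapData (C.obj x) (Hocolim C) where
  obj X := single x X
  map {X Y} f := Mor.ofEquiv (S := single x X) (T := single x Y) (Equiv.refl _)
    (fun _ _ _ => 𝟙 x) fun _ _ _ => eqToHom (map_id_obj x X) ≫ f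

theorem add_single_entry {x : J} {X Y : C.obj x} (p : Fin (1 + 1)) :
    ((add (single x X) (single x Y)).entry p).1 = x := by
  change (Sum.elim (single x X).entry (single x Y).entry (finSumFinEquiv.symm p)).1 = x
  cases finSumFinEquiv.symm p <;> rfl

theorem osum_add_single {x : J} (X Y : C.obj x) (q : Fin 1) :
    (C.obj x).osum (fun p : {p : Fin (1 + 1) // (fun _ => (0 : Fin 1)) p = q} =>
      (C.map (eqToHom (add_single_entry (X := X) (Y := Y) p.1))).functor.obj
        ((add (single x X) (single x Y)).entry p.1).2) = (C.obj x).add X Y := by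
  rw [PermCat.osum_pair _ _ ⟨0, Subsingleton.elim _ _⟩ ⟨1, Subsingleton.elim _ _⟩
    (Subtype.mk_lt_mk.2 (by decide))]
  · exact congrArg₂ _ (map_id_obj x X) (map_id_obj x Y)
  · rintro ⟨p, hp⟩
    simp only [Subtype.mk.injEq]
    clear hp
    revert p
    decide

/-- The morphism `1[(x, X)] ⊕ 1[(x, Y)] = 2[(x, X), (x, Y)] ⟶ 1[(x, X ⊕ Y)]` given by the
surjection `2 ⟶ 1` and identities. -/
def inclAdd (x : J) (X Y : C.obj x) :
    add ((incl x).obj X) ((incl x).obj Y) ⟶ (incl x).obj ((C.obj x).add X Y) :=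
  show Mor (add (single x X) (single x Y)) (single x ((C.obj x).add X Y)) from
  { ψ := fun _ => (0 : Fin 1)
    surj := fun _ => ⟨(0 : Fin (1 + 1)), Subsingleton.elim (α := Fin 1) _ _⟩
    ℓ := fun p _ _ => eqToHom (add_single_entry p)
    ϱ := fun q => eqToHom (osum_add_single X Y q) }

end Category

section Mul

variable {J : PermCat.{v₁, u₁}} {C : J ⥤ PermCat.{v₂, u₂}} (M : GradedMul J C)

abbrev mulEntry (p q : Σ x : J, C.obj x) : Σ x : J, C.obj x :=
  ⟨J.add p.1 q.1, M.mul p.2 q.2⟩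

/-- Multiplication of objects: the terms `(xᵢ + yⱼ, Xᵢ ⊗ Yⱼ)` in the lexicographic order. -/
abbrev mul (S T : Hocolim C) : Hocolim C where
  len := S.len * T.len
  len_pos := Nat.mul_pos S.len_pos T.len_pos
  entry p := mulEntry M (S.entry (finProdFinEquiv.symm p).1) (T.entry (finProdFinEquiv.symm p).2)

/-- The unit `1[(0, 1)]`. -/
abbrev one : Hocolim C := single J.zero M.one

/-- The left distributivity for a sum over a list, by iteration. -/
def leftDistSum (dl : M.LeftDist) {x y : J} (a : C.obj x) {ι : Type} (b : ι → C.obj y) :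
    ∀ L : List ι, (C.obj (J.add x y)).sum (fun i => M.mul a (b i)) L ⟶
      M.mul a ((C.obj y).sum b L)
  | [] => eqToHom (M.mul_zero a).symm
  | i :: L => (C.obj (J.add x y)).addHom (𝟙 _) (leftDistSum dl a b L) ≫ dl a (b i) _

theorem rightDistSum {x y : J} {ι : Type} (a : ι → C.obj x) (b : C.obj y) (L : List ι) :
    (C.obj (J.add x y)).sum (fun i => M.mul (a i) b) L = M.mul ((C.obj x).sum a L) b := by
  induction L with
  | nil => exact (M.zero_mul b).symm
  | cons i L ih => simp only [PermCat.sum, M.add_mul, ih]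

section MulHom

variable (dl : M.LeftDist) {S S' T T' : Hocolim C} (f : Mor S S') (g : Mor T T')

/-- The second coordinate `ℓᵢ + kⱼ` of `f ⊗ g`, for pairs of indices. -/
def mulℓ (p : Fin S.len × Fin T.len) (q : Fin S'.len × Fin T'.len)
    (h : Prod.map f.ψ g.ψ p = q) :
    J.add (S.entry p.1).1 (T.entry p.2).1 ⟶ J.add (S'.entry q.1).1 (T'.entry q.2).1 :=
  J.addHom (f.ℓ p.1 q.1 (congrArg Prod.fst h)) (g.ℓ p.2 q.2 (congrArg Prod.snd h))

theorem mul_summand {p : Fin S.len × Fin T.len} {i : Fin S.len} {j : Fin T.len}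
    (hp : p = (i, j)) (q : Fin S'.len × Fin T'.len) (h : Prod.map f.ψ g.ψ p = q)
    (hi : f.ψ i = q.1) (hj : g.ψ j = q.2) :
    (C.map (mulℓ f g p q h)).functor.obj (M.mul (S.entry p.1).2 (T.entry p.2).2) =
      M.mul ((C.map (f.ℓ i q.1 hi)).functor.obj (S.entry i).2)
        ((C.map (g.ℓ j q.2 hj)).functor.obj (T.entry j).2) := by
  subst hp
  exact M.map_mul _ _ _ _

/-- The fibre of `f ⊗ g` over a pair is the product of the fibres of `f` and `g`. -/
def mulIncl (q : Fin (S'.len * T'.len)) (i : {i // f.ψ i = (finProdFinEquiv.symm q).1})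
    (j : {j // g.ψ j = (finProdFinEquiv.symm q).2}) :
    {p : Fin (S.len * T.len) //
      finProdFinEquiv (Prod.map f.ψ g.ψ (finProdFinEquiv.symm p)) = q} :=
  ⟨finProdFinEquiv (i.1, j.1), by
    rw [Equiv.symm_apply_apply, Prod.map_apply, i.2, j.2, Prod.mk.eta, Equiv.apply_symm_apply]⟩

theorem mulIncl_bijective (q : Fin (S'.len * T'.len)) : Function.Bijective
    fun s : Σ _ : {i // f.ψ i = (finProdFinEquiv.symm q).1},
      {j // g.ψ j = (finProdFinEquiv.symm q).2} => mulIncl f g q s.1 s.2 := by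
  constructor
  · rintro ⟨⟨i, hi⟩, ⟨j, hj⟩⟩ ⟨⟨i', hi'⟩, ⟨j', hj'⟩⟩ h
    have h' := finProdFinEquiv.injective (congrArg Subtype.val h)
    dsimp only at h'
    obtain ⟨rfl, rfl⟩ := Prod.mk.inj h'
    rfl
  · rintro ⟨p, hp⟩
    have hq := (Equiv.eq_symm_apply _).2 hp
    refine ⟨⟨⟨(finProdFinEquiv.symm p).1, congrArg Prod.fst hq⟩,
      ⟨(finProdFinEquiv.symm p).2, congrArg Prod.snd hq⟩⟩, Subtype.ext ?_⟩
    exact finProdFinEquiv.apply_symm_apply p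

/-- Multiplication of morphisms. The third coordinate is
`⨁_{(i,j)} C(ℓᵢ + kⱼ)(Xᵢ Yⱼ) = ⨁ᵢ ⨁ⱼ C(ℓᵢ)(Xᵢ) C(kⱼ)(Yⱼ) ⟶ ⨁ᵢ C(ℓᵢ)(Xᵢ) (⨁ⱼ C(kⱼ)(Yⱼ))
⟶ ⨁ᵢ C(ℓᵢ)(Xᵢ) Y'ₛ = (⨁ᵢ C(ℓᵢ)(Xᵢ)) Y'ₛ ⟶ X'ᵣ Y'ₛ`. -/
def mulHom : mul M S T ⟶ mul M S' T' :=
  show Mor (mul M S T) (mul M S' T') from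
  { ψ := fun p => finProdFinEquiv (Prod.map f.ψ g.ψ (finProdFinEquiv.symm p))
    surj := finProdFinEquiv.surjective.comp
      ((Function.Surjective.prodMap f.surj g.surj).comp finProdFinEquiv.symm.surjective)
    ℓ := fun p q h => mulℓ f g (finProdFinEquiv.symm p) (finProdFinEquiv.symm q)
      ((Equiv.eq_symm_apply _).2 h)
    ϱ := fun q =>
      PermCat.regroup _ _ (mulIncl f g q) (mulIncl_bijective f g q) ≫
      eqToHom (congrArg (PermCat.osum _) (funext fun i => congrArg (PermCat.osum _) (funext fun j =>
        mul_summand M f g (finProdFinEquiv.symm_apply_apply (i.1, j.1)) (finProdFinEquiv.symm q) _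
          i.2 j.2))) ≫
      PermCat.osumHom _ (fun i => leftDistSum M dl _ _ _ ≫
        M.mulHom (𝟙 _) (g.ϱ (finProdFinEquiv.symm q).2)) ≫
      eqToHom (rightDistSum M _ _ _) ≫
      M.mulHom (f.ϱ (finProdFinEquiv.symm q).1) (𝟙 _) }

end MulHom

/-- The permutation `ξ` that reorders `(n × m) + (n × m')` as `n × (m + m')`. -/
def leftDistPerm (n m m' : ℕ) : Fin (n * m + n * m') ≃ Fin (n * (m + m')) :=
  finSumFinEquiv.symm.trans <| (finProdFinEquiv.symm.sumCongr finProdFinEquiv.symm).trans <|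
    (Equiv.prodSumDistrib _ _ _).symm.trans <|
      ((Equiv.refl _).prodCongr finSumFinEquiv).trans finProdFinEquiv

/-- The left distributivity `(ξ, id, id)`. -/
def leftDist (S T T' : Hocolim C) : add (mul M S T) (mul M S T') ⟶ mul M S (add T T') :=
  Mor.perm (S := add (mul M S T) (mul M S T')) (T := mul M S (add T T'))
    (leftDistPerm S.len T.len T'.len) fun p => by
      obtain ⟨p, rfl⟩ := finSumFinEquiv.surjective p
      rcases p with p | p <;> obtain ⟨⟨i, j⟩, rfl⟩ := finProdFinEquiv.surjective p <;>
        simp only [leftDistPerm, Equiv.trans_apply, Equiv.symm_apply_apply] <;>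
        simp [Equiv.prodSumDistrib, -finProdFinEquiv_symm_apply]

/-- The bijection of `(n × m) + (n' × m)` with `(n + n') × m`. -/
def rightDistPerm (n n' m : ℕ) : Fin (n * m + n' * m) ≃ Fin ((n + n') * m) :=
  finSumFinEquiv.symm.trans <| (finProdFinEquiv.symm.sumCongr finProdFinEquiv.symm).trans <|
    (Equiv.sumProdDistrib _ _ _).symm.trans <|
      (finSumFinEquiv.prodCongr (Equiv.refl _)).trans finProdFinEquiv

/-- The identification of `(S ⊗ T) ⊕ (S' ⊗ T)` with `(S ⊕ S') ⊗ T`. -/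
def rightDist (S S' T : Hocolim C) : add (mul M S T) (mul M S' T) ⟶ mul M (add S S') T :=
  Mor.perm (S := add (mul M S T) (mul M S' T)) (T := mul M (add S S') T)
    (rightDistPerm S.len S'.len T.len) fun p => by
      obtain ⟨p, rfl⟩ := finSumFinEquiv.surjective p
      rcases p with p | p <;> obtain ⟨⟨i, j⟩, rfl⟩ := finProdFinEquiv.surjective p <;>
        simp only [rightDistPerm, Equiv.trans_apply, Equiv.symm_apply_apply] <;>
        simp [Equiv.sumProdDistrib, -finProdFinEquiv_symm_apply]

/-- The zeroless bimonoidal data of the homotopy colimit. -/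
def bimonData (dl : M.LeftDist) : BimonData (Hocolim C) where
  toAddData := addData
  mul := mul M
  mulHom := fun f g => mulHom M dl f g
  one := one M
  leftDist := leftDist M

/-- The matrix transposition `σ`. -/
def transpose (n m : ℕ) : Fin (n * m) ≃ Fin (m * n) :=
  finProdFinEquiv.symm.trans ((Equiv.prodComm _ _).trans finProdFinEquiv)

def twistℓ (S T : Hocolim C) : ∀ (p : Fin S.len × Fin T.len) (q : Fin T.len × Fin S.len),
    p.swap = q → ((mulEntry M (S.entry p.1) (T.entry p.2)).1 ⟶
      (mulEntry M (T.entry q.1) (S.entry q.2)).1)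
  | p, _, rfl => J.twist (S.entry p.1).1 (T.entry p.2).1

def twistϱ (γ : M.MulTwist) (S T : Hocolim C) :
    ∀ (p : Fin S.len × Fin T.len) (q : Fin T.len × Fin S.len) (h : p.swap = q),
    (C.map (twistℓ M S T p q h)).functor.obj (mulEntry M (S.entry p.1) (T.entry p.2)).2 ⟶
      (mulEntry M (T.entry q.1) (S.entry q.2)).2
  | p, _, rfl =>
    (C.map (J.twist (S.entry p.1).1 (T.entry p.2).1)).functor.map
        (γ (S.entry p.1).2 (T.entry p.2).2) ≫
      eqToHom (GradedMul.map_twist_twist _ _ _)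

theorem swap_eq {n m : ℕ} {p : Fin (n * m)} {q : Fin (m * n)} (h : transpose n m p = q) :
    (finProdFinEquiv.symm p).swap = finProdFinEquiv.symm q := by
  subst h
  simp [transpose, -finProdFinEquiv_symm_apply]

/-- The multiplicative twist `(σ, χ, C(χ)(γ))`: matrix transposition, the twist of `J`, and the
multiplicative twist of `C`. -/
def mulTwist (γ : M.MulTwist) (S T : Hocolim C) : mul M S T ⟶ mul M T S :=
  Mor.ofEquiv (S := mul M S T) (T := mul M T S) (transpose S.len T.len)
    (fun p q h => twistℓ M S T (finProdFinEquiv.symm p) (finProdFinEquiv.symm q) (swap_eq h))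
    (fun p q h => twistϱ M γ S T (finProdFinEquiv.symm p) (finProdFinEquiv.symm q) (swap_eq h))

theorem sigma_gradeCast {x y : J} (h : x = y) (a : C.obj x) :
    (⟨x, a⟩ : Σ x : J, C.obj x) = ⟨y, (gradeCast C h).obj a⟩ := by
  subst h
  exact congrArg (Sigma.mk x) (map_id_obj x a).symm

/-- The identification of `1[(0, X)] ⊗ 1[(0, Y)]` with `1[(0, X ⊗ Y)]`. -/
def inclMul (X Y : C.obj J.zero) :
    mul M ((incl J.zero).obj X) ((incl J.zero).obj Y) ⟶ (incl J.zero).obj (M.act X Y) :=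
  Mor.perm (S := mul M (single J.zero X) (single J.zero Y)) (T := single J.zero (M.act X Y))
    (finCongr (Nat.one_mul 1)) fun _ => sigma_gradeCast (J.zero_add J.zero) (M.mul X Y)

/-- The homotopy colimit as a zeroless `C(0)`-module, by restriction along the canonical functor
`C(0) ⟶ hocolim C`. The right distributivity is the composite
`r S ⊕ r' S = (1[(0, r)] ⊕ 1[(0, r')]) ⊗ S ⟶ 1[(0, r ⊕ r')] ⊗ S`. -/
def moduleData (dl : M.LeftDist) : ModuleData (M.degreeZero dl) (Hocolim C) where
  toAddData := addData
  act r S := mul M ((incl J.zero).obj r) S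
  actHom f g := mulHom M dl ((incl J.zero).map f) g
  leftDist r S T := leftDist M ((incl J.zero).obj r) S T
  rightDist r r' S := rightDist M ((incl J.zero).obj r) ((incl J.zero).obj r') S ≫
    mulHom M dl (inclAdd J.zero r r') (𝟙 S)

end Mul

end Hocolim

end

/-!
The homotopy colimit is a structure of families of *multimorphisms*: in the Grothendieck
construction of `C`, a multimorphism from a list of objects `(xᵢ, Xᵢ)` to `(y, Y)` consists of
morphisms `xᵢ ⟶ y` of `J` and a morphism `⨁ C(ℓᵢ)(Xᵢ) ⟶ Y` of `C(y)`, and a morphism of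
`hocolim C` is a family of these, one for each index of the target, whose sources partition the
indices of the source.  All laws of `hocolim C` are reduced to laws for multimorphisms, and the
reduction rests on two devices.

* Most laws hold only up to identifications of objects.  They are stated for *untyped arrows* `Arr`,
  morphisms bundled with source and target, for which an identification is an honest identity
  (`Arr.mk_eq`, `Arr.heq`).
* The definition of `hocolim C` sums over fibres in increasing order and hence contains permutations
  of summands.  The predicate `PermArr` holds of the composites of additive twists of adjacent
  summands, and coherence for permutative categories takes the form `PermArr.unique`: such an arrow
  is determined by the lists of indices of its source and target.  Consequently a morphism has a
  multimorphism for *every* enumeration of a fibre (`Mor.At`), any one of them determines it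
  (`Mor.At.ext`), and changing the enumeration is harmless (`Mor.At.reorder`).

With these, composites, sums and products of morphisms have as multimorphisms the composites, the
given ones and the products (`Mor.At.comp`, `Mor.At.inl`, `Mor.At.inr`, `Mor.At.mulHom`).
Associativity of composition is `Multi.comp_comp`.  The product of multimorphisms involves the
canonical morphism `prodSum : ⨁ᵢⱼ aᵢ ⊗ bⱼ ⟶ (⨁ᵢ aᵢ) ⊗ (⨁ⱼ bⱼ)`.  That the product is a functor is the
interchange `prodSum_sum_tensor_sum`, which is the pentagon iterated over lists (`sum_dlSum`); that
it does not depend on enumerations is `prodSum_perm`, which comes from the compatibility of `d_ℓ`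
with the additive twist; and it is associative by `prodSum_assoc`, which combines the associativity
of `d_ℓ` with the equation `d_ℓ ⊗ id = d_ℓ`.  The additive twist and the distributivity of
`hocolim C` are permutation morphisms (`Mor.IsPerm`), and these are determined by their maps of
indices (`Mor.IsPerm.heq`), so the laws in which only they occur are identities of permutations.

The two cases of the theorem are treated together, since a graded bipermutative category is strictly
bimonoidal (`GradedBipermutative.toGradedStrictlyBimonoidal`): its `d_ℓ` is conjugate to an identity
under `γ_⊗`, and the two additional laws follow from strict right distributivity and, for
`d_ℓ ⊗ id = d_ℓ`, from the hexagon.  In this case `γ_⊗` carries `prodSum` to `prodSum` with the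
factors exchanged (`prodSum_tm`), which makes the multiplicative twist of `hocolim C` natural
(`mulTwist_natural`); its hexagon is that of `C` (`twistMulti_mul`).

The laws of `C(0)` and of its action on `C(x)` are those of `C` after the identification of `0 + x`
with `x`.  Under the functor `X ↦ 1[(x, X)]` a morphism of `C(x)` whose source is a sum becomes a
multimorphism with identity legs (`Multi.fold`).  Composition and products of such multimorphisms
are composition and products in `C`, whence the laws of the lax morphisms and module maps.  Finally,
the laws of `hocolim C` as a module over `C(0)` follow formally from its laws as a bimonoidal category
and from those of the lax morphism `C(0) ⟶ hocolim C`.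
-/

noncomputable section


/-! ### Untyped arrows -/

/-- The type of all morphisms of a category. -/
structure Arr (X : Type u) [Category.{v} X] where
  {src tgt : X}
  hom : src ⟶ tgt

namespace Arr

section Basic

variable {X : Type u} [Category.{v} X] {Y : Type u₁} [Category.{v₁} Y]

/-- Heterogeneous equality of morphisms between equal objects is equality of arrows; with `heq` this
turns the laws that hold up to identification of objects into equations. -/
theorem mk_eq {a b a' b' : X} {f : a ⟶ b} {g : a' ⟶ b'} (ha : a = a') (hb : b = b')
    (h : HEq f g) : mk f = mk g := by
  subst ha; subst hb; subst h; rfl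

theorem heq {a b a' b' : X} {f : a ⟶ b} {g : a' ⟶ b'} (h : mk f = mk g) : HEq f g := by
  cases h; rfl

theorem mk_inj {a b : X} {f g : a ⟶ b} : mk f = mk g ↔ f = g :=
  ⟨fun h => eq_of_heq (heq h), fun h => by rw [h]⟩

/-- The identity of `a` as an arrow. -/
def ident (a : X) : Arr X := mk (𝟙 a)

@[simp] theorem id_src (a : X) : (ident a).src = a := rfl
@[simp] theorem id_tgt (a : X) : (ident a).tgt = a := rfl

open Classical in
/-- Composition of arrows in diagrammatic order.  If the target of `φ` is not the source of `θ`,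
the value is `φ`; with this convention the source of a composite is always that of `φ`. -/
def comp (φ θ : Arr X) : Arr X :=
  if h : φ.tgt = θ.src then mk (φ.hom ≫ eqToHom h ≫ θ.hom) else φ

infixr:60 " ⊚ " => Arr.comp

@[simp] theorem comp_src (φ θ : Arr X) : (φ ⊚ θ).src = φ.src := by
  rw [comp]; split <;> rfl

theorem comp_tgt {φ θ : Arr X} (h : φ.tgt = θ.src) : (φ ⊚ θ).tgt = θ.tgt := by
  rw [comp, dif_pos h]

theorem mk_comp {a b c : X} (f : a ⟶ b) (g : b ⟶ c) : mk (f ≫ g) = mk f ⊚ mk g := by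
  rw [comp, dif_pos rfl]; simp

theorem comp_assoc {φ θ ζ : Arr X} (h : φ.tgt = θ.src) : (φ ⊚ θ) ⊚ ζ = φ ⊚ θ ⊚ ζ := by
  obtain ⟨f⟩ := φ
  obtain ⟨g⟩ := θ
  obtain ⟨k⟩ := ζ
  dsimp only at h
  subst h
  rw [← mk_comp]
  by_cases h' : (mk g).tgt = (mk k).src
  · dsimp only at h'
    subst h'
    simp only [← mk_comp, Category.assoc]
  · rw [comp, dif_neg h', comp, comp, dif_neg h', dif_pos rfl]
    simp

@[simp] theorem id_comp (φ : Arr X) : ident φ.src ⊚ φ = φ := by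
  obtain ⟨f⟩ := φ
  rw [ident, ← mk_comp, Category.id_comp]

@[simp] theorem comp_id (φ : Arr X) (a : X) : φ ⊚ ident a = φ := by
  obtain ⟨f⟩ := φ
  rw [comp]
  split
  · next h => dsimp only [id_src] at h; subst h; simp [ident]
  · rfl

theorem id_comp' {φ : Arr X} {a : X} (h : a = φ.src) : ident a ⊚ φ = φ := by
  subst h; exact id_comp φ

@[simp] theorem mk_eqToHom {a b : X} (h : a = b) : mk (eqToHom h) = ident a := by
  subst h; rfl

@[simp] theorem mk_eqToHom_comp {a b c : X} (h : a = b) (f : b ⟶ c) :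
    mk (eqToHom h ≫ f) = mk f := by
  subst h; simp

@[simp] theorem mk_comp_eqToHom {a b c : X} (h : b = c) (f : a ⟶ b) :
    mk (f ≫ eqToHom h) = mk f := by
  subst h; simp

theorem mk_comp_eqToHom_comp_eqToHom {a b b' c d : X} (f : a ⟶ b) (h : b = b') (g : b' ⟶ c)
    (h' : c = d) : mk (f ≫ eqToHom h ≫ g ≫ eqToHom h') = mk f ⊚ mk g := by
  subst h; subst h'; simp [mk_comp]

/-- The image of an arrow under a functor. -/
def map (F : X ⥤ Y) (φ : Arr X) : Arr Y := mk (F.map φ.hom)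

@[simp] theorem map_src (F : X ⥤ Y) (φ : Arr X) : (φ.map F).src = F.obj φ.src := rfl
@[simp] theorem map_tgt (F : X ⥤ Y) (φ : Arr X) : (φ.map F).tgt = F.obj φ.tgt := rfl
@[simp] theorem map_mk (F : X ⥤ Y) {a b : X} (f : a ⟶ b) : (mk f).map F = mk (F.map f) := rfl

@[simp] theorem map_id (F : X ⥤ Y) (a : X) : (ident a).map F = ident (F.obj a) :=
  congrArg mk (F.map_id a)

theorem map_comp (F : X ⥤ Y) {φ θ : Arr X} (h : φ.tgt = θ.src) :
    (φ ⊚ θ).map F = φ.map F ⊚ θ.map F := by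
  obtain ⟨f⟩ := φ
  obtain ⟨g⟩ := θ
  dsimp only at h
  subst h
  simp only [← mk_comp, map_mk, F.map_comp]

end Basic

section Add

variable {P : PermCat.{v, u}} {Q : PermCat.{v, u}}

instance : Zero (Arr P) := ⟨ident P.zero⟩

instance : Add (Arr P) := ⟨fun φ θ => mk (P.addHom φ.hom θ.hom)⟩

theorem zero_def : (0 : Arr P) = ident P.zero := rfl

theorem mk_addHom {a a' b b' : P} (f : a ⟶ a') (g : b ⟶ b') :
    mk (P.addHom f g) = mk f + mk g := rfl

@[simp] theorem add_src (φ θ : Arr P) : (φ + θ).src = P.add φ.src θ.src := rfl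
@[simp] theorem add_tgt (φ θ : Arr P) : (φ + θ).tgt = P.add φ.tgt θ.tgt := rfl
@[simp] theorem zero_src : (0 : Arr P).src = P.zero := rfl
@[simp] theorem zero_tgt : (0 : Arr P).tgt = P.zero := rfl

instance : AddMonoid (Arr P) where
  add_assoc φ θ ζ := mk_eq (P.add_assoc _ _ _) (P.add_assoc _ _ _) (P.addHom_assoc _ _ _)
  zero_add φ := mk_eq (P.zero_add _) (P.zero_add _) (P.zero_addHom _)
  add_zero φ := mk_eq (P.add_zero _) (P.add_zero _) (P.addHom_zero _)
  nsmul := nsmulRec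

theorem id_add (a b : P) : ident (P.add a b) = ident a + ident b :=
  congrArg mk (P.addHom_id a b).symm

theorem add_comp {φ φ' θ θ' : Arr P} (h : φ.tgt = θ.src) (h' : φ'.tgt = θ'.src) :
    (φ + φ') ⊚ (θ + θ') = (φ ⊚ θ) + (φ' ⊚ θ') := by
  obtain ⟨f⟩ := φ
  obtain ⟨f'⟩ := φ'
  obtain ⟨g⟩ := θ
  obtain ⟨g'⟩ := θ'
  dsimp only at h h'
  subst h
  subst h'
  simp only [← mk_comp, ← mk_addHom, P.addHom_comp]

theorem comp_add_id {φ θ : Arr P} (h : φ.tgt = θ.src) (a : P) :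
    (φ ⊚ θ) + ident a = (φ + ident a) ⊚ (θ + ident a) := by
  rw [add_comp h rfl, comp_id]

theorem id_add_comp {φ θ : Arr P} (h : φ.tgt = θ.src) (a : P) :
    ident a + (φ ⊚ θ) = (ident a + φ) ⊚ (ident a + θ) := by
  rw [add_comp rfl h, comp_id]

/-- The additive twist as an arrow. -/
def tw (a b : P) : Arr P := mk (P.twist a b)

@[simp] theorem tw_src (a b : P) : (tw a b).src = P.add a b := rfl
@[simp] theorem tw_tgt (a b : P) : (tw a b).tgt = P.add b a := rfl

theorem tw_natural (φ θ : Arr P) : (φ + θ) ⊚ tw φ.tgt θ.tgt = tw φ.src θ.src ⊚ (θ + φ) := by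
  obtain ⟨f⟩ := φ
  obtain ⟨g⟩ := θ
  simp only [tw, ← mk_addHom, ← mk_comp, P.twist_natural]

theorem tw_tw (a b : P) : tw a b ⊚ tw b a = ident a + ident b := by
  rw [tw, tw, ← mk_comp, P.twist_twist, ← id_add]; rfl

theorem tw_zero (a : P) : tw a P.zero = ident a :=
  mk_eq (P.add_zero a) (P.zero_add a) (P.twist_zero a)

theorem tw_add (a b c : P) : tw (P.add a b) c = (ident a + tw b c) ⊚ (tw a c + ident b) := by
  refine (mk_eq (P.add_assoc a b c) (P.add_assoc c a b).symm (P.twist_add a b c)).trans ?_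
  rw [mk_comp, mk_eqToHom_comp]
  rfl

theorem zero_tw (a : P) : tw P.zero a = ident a := by
  have h := tw_tw P.zero a
  rwa [tw_zero, ← id_add, P.zero_add, comp_id] at h

/-- The second hexagon of the additive twist; it follows from the first by passing to inverses. -/
theorem tw_add' (a b c : P) : tw c (P.add a b) = (tw c a + ident b) ⊚ (ident a + tw c b) := by
  have h : ((tw c a + ident b) ⊚ (ident a + tw c b)) ⊚ tw (P.add a b) c = ident c + ident a + ident b := by
    have h₁ : (ident a + tw c b) ⊚ (ident a + tw b c) = ident a + (ident c + ident b) := by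
      rw [← id_add_comp rfl, tw_tw]
    have h₂ : (tw c a + ident b) ⊚ (tw a c + ident b) = ident c + ident a + ident b := by
      rw [← comp_add_id rfl, tw_tw]
    rw [tw_add, comp_assoc (by simp [P.add_assoc]), ← comp_assoc (θ := ident a + tw b c) (by simp), h₁]
    simp only [← id_add] at h₂ ⊢
    rw [id_comp' (by simp [P.add_assoc]), h₂]
  have h' := congrArg (· ⊚ tw c (P.add a b)) h
  rw [comp_assoc (by rw [comp_tgt] <;> simp [P.add_assoc]), tw_tw, ← id_add, comp_id, ← id_add, ← id_add,
    id_comp' (by simp [P.add_assoc])] at h'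
  exact h'.symm

theorem map_add (F : StrictHom P Q) (φ θ : Arr P) :
    (φ + θ).map F.functor = φ.map F.functor + θ.map F.functor :=
  mk_eq (F.obj_add _ _) (F.obj_add _ _) (F.map_addHom _ _)

theorem map_zero (F : StrictHom P Q) : (0 : Arr P).map F.functor = 0 := by
  rw [zero_def, map_id, F.obj_zero]; rfl

theorem map_tw (F : StrictHom P Q) (a b : P) :
    (tw a b).map F.functor = tw (F.functor.obj a) (F.functor.obj b) :=
  mk_eq (F.obj_add _ _) (F.obj_add _ _) (F.map_twist _ _)

end Add

end Arr

/-! ### Sums of arrows and permutations of summands -/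

namespace PermCat

section

variable (P : PermCat.{v, u}) {ι : Type w} {κ : Type w'}

theorem sum_congr {A B : ι → P} {L : List ι} (h : ∀ i ∈ L, A i = B i) : P.sum A L = P.sum B L := by
  induction L with
  | nil => rfl
  | cons i L ih =>
    simp only [List.forall_mem_cons] at h
    simp only [sum, h.1, ih h.2]

theorem sum_singleton (A : ι → P) (i : ι) : P.sum A [i] = A i := P.add_zero _

end

end PermCat

namespace Arr

variable {P : PermCat.{v, u}} {Q : PermCat.{v, u}} {ι : Type w} {κ : Type w'}

@[simp] theorem sum_src (φ : ι → Arr P) (L : List ι) :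
    (L.map φ).sum.src = P.sum (fun i => (φ i).src) L := by
  induction L with
  | nil => rfl
  | cons i L ih => simp only [List.map_cons, List.sum_cons, add_src, ih, PermCat.sum]

@[simp] theorem sum_tgt (φ : ι → Arr P) (L : List ι) :
    (L.map φ).sum.tgt = P.sum (fun i => (φ i).tgt) L := by
  induction L with
  | nil => rfl
  | cons i L ih => simp only [List.map_cons, List.sum_cons, add_tgt, ih, PermCat.sum]

theorem mk_sumHom {A B : ι → P} (f : ∀ i, A i ⟶ B i) (L : List ι) :
    mk (P.sumHom f L) = (L.map fun i => mk (f i)).sum := by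
  induction L with
  | nil => rfl
  | cons i L ih => exact congrArg (mk (f i) + ·) ih

theorem id_sum (A : ι → P) (L : List ι) : ident (P.sum A L) = (L.map fun i => ident (A i)).sum := by
  induction L with
  | nil => rfl
  | cons i L ih => rw [PermCat.sum, id_add, ih]; rfl

theorem sum_comp {φ θ : ι → Arr P} {L : List ι} (h : ∀ i ∈ L, (φ i).tgt = (θ i).src) :
    (L.map fun i => φ i ⊚ θ i).sum = (L.map φ).sum ⊚ (L.map θ).sum := by
  induction L with
  | nil => exact (comp_id _ _).symm
  | cons i L ih =>
    simp only [List.forall_mem_cons] at h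
    simp only [List.map_cons, List.sum_cons]
    rw [ih h.2, add_comp h.1]
    simpa using P.sum_congr h.2

theorem sum_flatMap (φ : ι → Arr P) (L : List κ) (M : κ → List ι) :
    ((L.flatMap M).map φ).sum = (L.map fun k => ((M k).map φ).sum).sum := by
  induction L with
  | nil => rfl
  | cons k L ih => simp only [List.flatMap_cons, List.map_append, List.sum_append, ih,
      List.map_cons, List.sum_cons]

theorem map_sum (F : StrictHom P Q) (φ : ι → Arr P) (L : List ι) :
    (L.map φ).sum.map F.functor = (L.map fun i => (φ i).map F.functor).sum := by
  induction L with
  | nil => exact map_zero F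
  | cons i L ih => simp only [List.map_cons, List.sum_cons, map_add, ih]

end Arr

open Arr in
/-- `PermArr P A L M φ` says that `φ` is a composite of additive twists of adjacent summands that
goes from the sum of the family `A` over `L` to the sum over `M`, where the summands that change
places have different indices. -/
inductive PermArr (P : PermCat.{v, u}) {ι : Type w} (A : ι → P) :
    List ι → List ι → Arr P → Prop
  | nil : PermArr P A [] [] 0
  | cons (i : ι) {L M : List ι} {φ : Arr P} :
      PermArr P A L M φ → PermArr P A (i :: L) (i :: M) (ident (A i) + φ)
  | swap (i j : ι) (L : List ι) : i ≠ j →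
      PermArr P A (i :: j :: L) (j :: i :: L) (tw (A i) (A j) + ident (P.sum A L))
  | trans {L M N : List ι} {φ θ : Arr P} :
      PermArr P A L M φ → PermArr P A M N θ → PermArr P A L N (φ ⊚ θ)

namespace PermArr

open Arr

variable {P : PermCat.{v, u}} {Q : PermCat.{v, u}} {ι : Type w} {κ : Type w'} {A : ι → P}
  {L L' M M' N : List ι} {φ θ : Arr P}

theorem src_tgt (h : PermArr P A L M φ) : φ.src = P.sum A L ∧ φ.tgt = P.sum A M := by
  induction h with
  | nil => exact ⟨rfl, rfl⟩
  | cons i h ih => simp [ih, PermCat.sum]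
  | swap i j L h => simp [PermCat.sum, P.add_assoc]
  | trans h h' ih ih' => rw [comp_tgt (by rw [ih.2, ih'.1]), comp_src]; exact ⟨ih.1, ih'.2⟩

theorem src (h : PermArr P A L M φ) : φ.src = P.sum A L := h.src_tgt.1

theorem tgt (h : PermArr P A L M φ) : φ.tgt = P.sum A M := h.src_tgt.2

theorem perm (h : PermArr P A L M φ) : L.Perm M := by
  induction h with
  | nil => exact .nil
  | cons i h ih => exact ih.cons i
  | swap i j L h => exact .swap j i L
  | trans h h' ih ih' => exact ih.trans ih'

theorem refl : ∀ L : List ι, PermArr P A L L (ident (P.sum A L))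
  | [] => nil
  | i :: L => by rw [PermCat.sum, id_add]; exact cons i (refl L)

theorem append_left : ∀ (L : List ι), PermArr P A M N φ →
    PermArr P A (L ++ M) (L ++ N) (ident (P.sum A L) + φ)
  | [], h => by rw [PermCat.sum, ← zero_def, zero_add]; exact h
  | i :: L, h => by
    rw [PermCat.sum, id_add, add_assoc]; exact cons i (append_left L h)

theorem append_right (N : List ι) (h : PermArr P A L M φ) :
    PermArr P A (L ++ N) (M ++ N) (φ + ident (P.sum A N)) := by
  induction h with
  | nil => rw [zero_add]; exact refl N
  | cons i h ih => rw [add_assoc]; exact cons i ih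
  | swap i j L h =>
    rw [add_assoc, ← id_add, ← P.sum_append]; exact swap i j _ h
  | trans h h' ih ih' => rw [comp_add_id (by rw [h.tgt, h'.src])]; exact ih.trans ih'

theorem append (h : PermArr P A L L' φ) (h' : PermArr P A M M' θ) :
    PermArr P A (L ++ M) (L' ++ M') (φ + θ) := by
  have := (h.append_right M).trans (h'.append_left L')
  rwa [← h'.src, ← h.tgt, add_comp rfl rfl, comp_id, id_comp] at this

theorem sum (L : List κ) {M N : κ → List ι} {φ : κ → Arr P}
    (h : ∀ k ∈ L, PermArr P A (M k) (N k) (φ k)) :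
    PermArr P A (L.flatMap M) (L.flatMap N) (L.map φ).sum := by
  induction L with
  | nil => exact nil
  | cons k L ih =>
    simp only [List.forall_mem_cons] at h
    exact h.1.append (ih h.2)

theorem twist_singleton (i : ι) : ∀ L : List ι, i ∉ L →
    PermArr P A (L ++ [i]) (i :: L) (tw (P.sum A L) (A i))
  | [], _ => by rw [PermCat.sum, zero_tw, ← P.sum_singleton A i]; exact refl _
  | j :: L, h => by
    simp only [List.mem_cons, not_or] at h
    rw [PermCat.sum, tw_add]
    exact (cons j (twist_singleton i L h.2)).trans (swap j i L (Ne.symm h.1))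

/-- The additive twist of two sums is a permutation of their summands. -/
theorem twist (L : List ι) : ∀ M : List ι, L.Disjoint M →
    PermArr P A (L ++ M) (M ++ L) (tw (P.sum A L) (P.sum A M))
  | [], _ => by
    simp only [List.append_nil, List.nil_append, PermCat.sum, tw_zero]; exact refl L
  | i :: M, h => by
    rw [List.disjoint_cons_right] at h
    rw [PermCat.sum, tw_add']
    have h₁ := ((twist_singleton (P := P) (A := A) i L h.1).append_right M).trans
      (cons i (twist L M h.2))
    rwa [List.append_assoc] at h₁

theorem map_family (F : StrictHom P Q) (h : PermArr P A L M φ) :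
    PermArr Q (fun i => F.functor.obj (A i)) L M (φ.map F.functor) := by
  induction h with
  | nil => rw [map_zero]; exact nil
  | cons i h ih => rw [map_add, map_id]; exact cons i ih
  | swap i j L h =>
    rw [map_add, map_tw, map_id, F.obj_sum]; exact swap i j L h
  | trans h h' ih ih' => rw [map_comp _ (by rw [h.tgt, h'.src])]; exact ih.trans ih'

/-- Relabelling the summands along an injective map. -/
theorem map_index {f : κ → ι} (hf : f.Injective) {L M : List κ}
    (h : PermArr P (fun k => A (f k)) L M φ) : PermArr P A (L.map f) (M.map f) φ := by
  induction h with
  | nil => exact nil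
  | cons i h ih => exact cons _ ih
  | swap i j L h => rw [← P.sum_map]; exact swap _ _ _ (hf.ne h)
  | trans h h' ih ih' => exact ih.trans ih'

theorem congr_family {B : ι → P} (h : PermArr P A L M φ) (hAB : ∀ i ∈ L, A i = B i) :
    PermArr P B L M φ := by
  induction h with
  | nil => exact nil
  | cons i h ih =>
    simp only [List.forall_mem_cons] at hAB
    rw [hAB.1]; exact cons i (ih hAB.2)
  | swap i j L h =>
    simp only [List.forall_mem_cons] at hAB
    rw [hAB.1, hAB.2.1, P.sum_congr hAB.2.2]; exact swap i j L h
  | trans h h' ih ih' =>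
    exact (ih hAB).trans (ih' fun i hi => hAB i (h.perm.mem_iff.2 hi))

/-- A permutation of the summands is natural. -/
theorem natural {B : ι → P} (f : ι → Arr P) (h : PermArr P A L M φ)
    (hA : ∀ i ∈ L, (f i).src = A i) (hB : ∀ i ∈ L, (f i).tgt = B i) :
    ∃ φ', PermArr P B L M φ' ∧ (L.map f).sum ⊚ φ' = φ ⊚ (M.map f).sum := by
  induction h with
  | nil => exact ⟨0, nil, rfl⟩
  | @cons i L M φ h ih =>
    simp only [List.forall_mem_cons] at hA hB
    obtain ⟨φ', h₁, h₂⟩ := ih hA.2 hB.2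
    refine ⟨_, cons i h₁, ?_⟩
    simp only [List.map_cons, List.sum_cons]
    have hM : P.sum A M = P.sum (fun i => (f i).src) M :=
      P.sum_congr fun i hi => (hA.2 i (h.perm.mem_iff.2 hi)).symm
    rw [add_comp (by simp [hB.1]) (by simpa [h₁.src] using P.sum_congr hB.2),
      add_comp (by simp [hA.1]) (by simpa [h.tgt] using hM), h₂, id_comp' hA.1.symm, comp_id]
  | swap i j L h =>
    simp only [List.forall_mem_cons] at hA hB
    refine ⟨_, swap i j L h, ?_⟩
    simp only [List.map_cons, List.sum_cons]
    have hL : P.sum A L = P.sum (fun i => (f i).src) L := P.sum_congr fun i hi => (hA.2.2 i hi).symm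
    rw [← add_assoc, ← add_assoc, add_comp (by simp [hB.1, hB.2.1])
      (by simpa using P.sum_congr hB.2.2), add_comp (by simp [hA.1, hA.2.1]) (by simpa using hL),
      ← hB.1, ← hB.2.1, ← hA.1, ← hA.2.1, tw_natural, comp_id, id_comp' (by simpa using hL)]
  | @trans L M N φ θ h h' ih ih' =>
    have hp := h.perm
    obtain ⟨φ', h₁, h₂⟩ := ih hA hB
    obtain ⟨θ', h₁', h₂'⟩ := ih' (fun i hi => hA i (hp.mem_iff.2 hi))
      (fun i hi => hB i (hp.mem_iff.2 hi))
    refine ⟨_, h₁.trans h₁', ?_⟩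
    have hM : (M.map f).sum.src = P.sum A M := by
      simpa using P.sum_congr fun i hi => hA i (hp.mem_iff.2 hi)
    rw [← comp_assoc (by simpa [h₁.src] using P.sum_congr hB), h₂, comp_assoc (by rw [h.tgt, hM]),
      h₂', comp_assoc (by rw [h.tgt, h'.src])]

/-- A permutation of blocks is a permutation of summands. -/
theorem flatMap {B : κ → P} {L M : List κ} (N : κ → List ι) (h : PermArr P B L M φ)
    (hB : ∀ k ∈ L, B k = P.sum A (N k))
    (hN : ∀ k ∈ L, ∀ k' ∈ L, k ≠ k' → (N k).Disjoint (N k')) :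
    PermArr P A (L.flatMap N) (M.flatMap N) φ := by
  induction h with
  | nil => exact nil
  | cons k h ih =>
    simp only [List.forall_mem_cons] at hB
    rw [hB.1]
    exact (ih hB.2 fun k hk k' hk' => hN k (.tail _ hk) k' (.tail _ hk')).append_left (N k)
  | swap k k' L h =>
    simp only [List.forall_mem_cons] at hB
    rw [hB.1, hB.2.1, P.sum_congr hB.2.2, ← P.sum_flatMap]
    have := (twist (P := P) (A := A) (N k) (N k') (hN k (.head _) k' (.tail _ (.head _)) h)).append_right
      (L.flatMap N)
    simpa only [List.flatMap_cons, List.append_assoc] using this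
  | trans h h' ih ih' =>
    have hp := h.perm
    exact (ih hB hN).trans (ih' (fun k hk => hB k (hp.mem_iff.2 hk))
      fun k hk k' hk' => hN k (hp.mem_iff.2 hk) k' (hp.mem_iff.2 hk'))

theorem eq_zero {K K' : List ι} (h : PermArr P A K K' φ) (hK : K = []) : φ = 0 := by
  induction h with
  | nil => rfl
  | cons => exact absurd hK (by simp)
  | swap => exact absurd hK (by simp)
  | trans h h' ih ih' =>
    subst hK
    rw [ih rfl, ih' h.perm.symm.eq_nil]
    exact comp_id _ _

section

variable [DecidableEq ι]

/-- The arrow that moves the summand with index `i` to the front. -/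
def extractArr (A : ι → P) (i : ι) (L : List ι) (h : i ∈ L) : Arr P := mk (P.extract A i L h)

/-- The arrow that permutes the summands. -/
def permArr (A : ι → P) (L M : List ι) (h : L.Perm M) : Arr P := mk (P.permHom A M L h)

@[simp] theorem extractArr_src {i : ι} (h : i ∈ L) : (extractArr A i L h).src = P.sum A L := rfl

@[simp] theorem extractArr_tgt {i : ι} (h : i ∈ L) :
    (extractArr A i L h).tgt = P.add (A i) (P.sum A (L.erase i)) := rfl

@[simp] theorem permArr_src (h : L.Perm M) : (permArr A L M h).src = P.sum A L := rfl

@[simp] theorem permArr_tgt (h : L.Perm M) : (permArr A L M h).tgt = P.sum A M := rfl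

theorem extractArr_head (i : ι) (L : List ι) (h : i ∈ i :: L) :
    extractArr A i (i :: L) h = ident (P.sum A (i :: L)) := by
  rw [extractArr, PermCat.extract, dif_pos rfl, mk_eqToHom]

theorem extractArr_tail {i j : ι} {L : List ι} (h : i ∈ j :: L) (h' : i ∈ L) (e : j ≠ i) :
    extractArr A i (j :: L) h = (ident (A j) + extractArr A i L h') ⊚
      (tw (A j) (A i) + ident (P.sum A (L.erase i))) := by
  rw [extractArr, PermCat.extract, dif_neg e]
  exact mk_comp_eqToHom_comp_eqToHom (P.addHom (𝟙 (A j)) (P.extract A i L h')) _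
    (P.addHom (P.twist (A j) (A i)) (𝟙 _)) _

theorem extractArr_mem (i : ι) : ∀ (L : List ι) (h : i ∈ L),
    PermArr P A L (i :: L.erase i) (extractArr A i L h)
  | [], h => absurd h List.not_mem_nil
  | j :: L, h => by
    by_cases e : j = i
    · subst e
      rw [extractArr_head, List.erase_cons_head]
      exact refl (j :: L)
    · have h' := (List.mem_cons.1 h).resolve_left (Ne.symm e)
      rw [extractArr_tail h h' e, List.erase_cons_tail (by simpa using e)]
      exact (cons j (extractArr_mem i L h')).trans (swap j i _ e)

theorem permArr_nil (h : ([] : List ι).Perm []) : permArr A [] [] h = 0 := by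
  rw [permArr, PermCat.permHom, mk_eqToHom]; rfl

theorem permArr_cons (i : ι) (M L : List ι) (h : L.Perm (i :: M)) (hi : i ∈ L)
    (h' : (L.erase i).Perm M) : permArr A L (i :: M) h =
      extractArr A i L hi ⊚ (ident (A i) + permArr A (L.erase i) M h') :=
  mk_comp (P.extract A i L hi) (P.addHom (𝟙 (A i)) (P.permHom A M (L.erase i) h'))

theorem permArr_mem : ∀ (M L : List ι) (h : L.Perm M), PermArr P A L M (permArr A L M h)
  | [], L, h => by
    obtain rfl := h.eq_nil
    rw [permArr_nil]; exact nil
  | i :: M, L, h => by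
    have hi : i ∈ L := h.mem_iff.2 List.mem_cons_self
    have h' : (L.erase i).Perm M := (h.erase i).trans (by rw [List.erase_cons_head])
    rw [permArr_cons i M L h hi h']
    exact (extractArr_mem i L hi).trans (cons i (permArr_mem M _ h'))

/-- Extracting a summand after a permutation amounts to extracting it first and permuting the
remaining summands. -/
theorem comp_extractArr {i : ι} (h : PermArr P A L M φ) (hi : i ∈ L) (hi' : i ∈ M) :
    ∃ φ', PermArr P A (L.erase i) (M.erase i) φ' ∧
      φ ⊚ extractArr A i M hi' = extractArr A i L hi ⊚ (ident (A i) + φ') := by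
  induction h with
  | nil => exact absurd hi List.not_mem_nil
  | @cons j L M φ h ih =>
    by_cases e : j = i
    · subst e
      refine ⟨φ, by simpa only [List.erase_cons_head], ?_⟩
      rw [extractArr_head, extractArr_head, comp_id, id_comp' (by simp [h.src, PermCat.sum])]
    · have hL := (List.mem_cons.1 hi).resolve_left (Ne.symm e)
      have hM := (List.mem_cons.1 hi').resolve_left (Ne.symm e)
      obtain ⟨φ', h₁, h₂⟩ := ih hL hM
      refine ⟨ident (A j) + φ', ?_, ?_⟩
      · rw [List.erase_cons_tail (by simpa using e), List.erase_cons_tail (by simpa using e)]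
        exact cons j h₁
      rw [extractArr_tail hi hL e, extractArr_tail hi' hM e, ← comp_assoc (by simp [h.tgt]),
        ← id_add_comp (by simp [h.tgt]), h₂, id_add_comp (by simp [h₁.src]),
        comp_assoc (by simp [h₁.src]), comp_assoc (by simp [P.add_assoc]), ← h₁.src, ← h₁.tgt]
      congr 1
      rw [← add_assoc, ← add_assoc, add_comp (by simp) (by simp), add_comp (by simp) (by simp),
        ← id_add, ← id_add, id_comp' (by simp), comp_id, comp_id, id_comp]
  | swap a b L hab =>
    by_cases ha : a = i
    · subst ha
      refine ⟨ident (P.sum A (b :: L)), ?_, ?_⟩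
      · rw [List.erase_cons_head, List.erase_cons_tail (by simpa using hab.symm),
          List.erase_cons_head]
        exact refl _
      · rw [extractArr_head, extractArr_tail hi' (by simp) (Ne.symm hab), extractArr_head,
          List.erase_cons_head, ← id_add, ← id_add, comp_id,
          id_comp' (by simp [PermCat.sum, P.add_assoc]), add_comp rfl rfl, tw_tw, comp_id]
        simp only [PermCat.sum, id_add, add_assoc]
    · by_cases hb : b = i
      · subst hb
        refine ⟨ident (P.sum A (a :: L)), ?_, ?_⟩
        · rw [List.erase_cons_head, List.erase_cons_tail (by simpa using hab),
            List.erase_cons_head]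
          exact refl _
        · rw [extractArr_head, extractArr_tail hi (by simp) hab, extractArr_head,
            List.erase_cons_head, comp_id, ← id_add, ← id_add, comp_id,
            id_comp' (by simp [PermCat.sum, P.add_assoc])]
      · have hL : i ∈ L := by
          simpa only [List.mem_cons, Ne.symm ha, Ne.symm hb, false_or] using hi
        have hLa : i ∈ a :: L := .tail _ hL
        have hLb : i ∈ b :: L := .tail _ hL
        refine ⟨tw (A a) (A b) + ident (P.sum A (L.erase i)), ?_, ?_⟩
        · simp only [List.erase_cons_tail, beq_iff_eq, ha, hb, not_false_iff]
          exact swap a b _ hab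
        · rw [extractArr_tail hi hLb ha, extractArr_tail hLb hL hb, extractArr_tail hi' hLa hb,
            extractArr_tail hLa hL ha]
          simp only [List.erase_cons_tail, beq_iff_eq, ha, hb, not_false_iff]
          have hE : (extractArr A i L hL).tgt = P.add (A i) (P.sum A (L.erase i)) := rfl
          have hE' : (extractArr A i L hL).src = P.sum A L := rfl
          simp only [PermCat.sum]
          generalize extractArr A i L hL = E at hE hE' ⊢
          generalize P.sum A (L.erase i) = R at hE ⊢
          generalize P.sum A L = S at hE' ⊢
          subst hE'
          -- both sides begin with `E`; what remains is the hexagon for `A i`, `A a`, `A b`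
          have key : (tw (A a) (A b) + ident (A i)) ⊚ (ident (A b) + tw (A a) (A i)) ⊚
              (tw (A b) (A i) + ident (A a)) = (ident (A a) + tw (A b) (A i)) ⊚
              (tw (A a) (A i) + ident (A b)) ⊚ (ident (A i) + tw (A a) (A b)) := by
            rw [← tw_add, ← comp_assoc (by simp [P.add_assoc]), ← tw_add]
            exact tw_natural (tw (A a) (A b)) (ident (A i))
          have key' := congrArg (· + ident R) key
          rw [comp_add_id (by simp [P.add_assoc]), comp_add_id (by simp [P.add_assoc]),
            comp_add_id (by simp [P.add_assoc]), comp_add_id (by simp [P.add_assoc])]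
            at key'
          simp only [add_assoc] at key'
          have e₁ : ∀ x y : P, (ident x + ((ident y + E) ⊚ (tw y (A i) + ident R))) =
              (ident x + (ident y + E)) ⊚ (ident x + (tw y (A i) + ident R)) := fun x y =>
            id_add_comp (by simp [hE, P.add_assoc]) x
          have e₂ : (tw (A a) (A b) + ident E.src) ⊚ (ident (A b) + (ident (A a) + E)) =
              (ident (A a) + (ident (A b) + E)) ⊚
                (tw (A a) (A b) + (ident (A i) + ident R)) := by
            rw [← add_assoc, ← add_assoc, ← id_add, ← id_add, ← id_add, add_comp rfl rfl,
              add_comp rfl hE, comp_id, id_comp' rfl, comp_id,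
              id_comp' (by simp)]
          rw [e₁, e₁, comp_assoc (by simp [hE, P.add_assoc]),
            ← comp_assoc (by simp [P.add_assoc]), e₂, comp_assoc (by simp [hE, P.add_assoc]),
            id_add, id_add, key', comp_assoc (by
              rw [comp_tgt (by simp [hE, P.add_assoc])]; simp [P.add_assoc]),
            comp_assoc (by simp [hE, P.add_assoc])]
  | trans h h' ih ih' =>
    have hM := h.perm.mem_iff.1 hi
    obtain ⟨φ', h₁, h₂⟩ := ih hi hM
    obtain ⟨θ', h₁', h₂'⟩ := ih' hM hi'
    refine ⟨_, h₁.trans h₁', ?_⟩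
    rw [comp_assoc (by rw [h.tgt, h'.src]), h₂', ← comp_assoc (by simp [h.tgt]), h₂,
      comp_assoc (by simp [h₁.src]), id_add_comp (by rw [h₁.tgt, h₁'.src])]

/-- A permutation of the summands followed by the standard permutation to `N` is the standard
permutation to `N`. -/
theorem comp_permArr (h : PermArr P A L M φ) (hM : M.Perm N) (hL : L.Perm N) :
    φ ⊚ permArr A M N hM = permArr A L N hL := by
  induction N generalizing L M φ with
  | nil =>
    obtain rfl := hM.eq_nil
    obtain rfl := hL.eq_nil
    rw [permArr_nil, h.eq_zero rfl]; exact comp_id _ _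
  | cons i N ih =>
    have hiM : i ∈ M := hM.mem_iff.2 List.mem_cons_self
    have hiL : i ∈ L := hL.mem_iff.2 List.mem_cons_self
    have hM' : (M.erase i).Perm N := (hM.erase i).trans (by rw [List.erase_cons_head])
    have hL' : (L.erase i).Perm N := (hL.erase i).trans (by rw [List.erase_cons_head])
    rw [permArr_cons i N M hM hiM hM', permArr_cons i N L hL hiL hL',
      ← comp_assoc (by simp [h.tgt])]
    obtain ⟨φ', h₁, h₂⟩ := h.comp_extractArr hiL hiM
    rw [h₂, comp_assoc (by simp [h₁.src]), ← id_add_comp (by simp [h₁.tgt]), ih h₁ hM' hL']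

theorem permArr_self {L M : List ι} (e : L = M) (h : L.Perm M) :
    permArr A L M h = ident (P.sum A L) := by
  induction M generalizing L with
  | nil => subst e; rw [permArr_nil]; rfl
  | cons i M ih =>
    subst e
    have h' : ((i :: M).erase i).Perm M := by rw [List.erase_cons_head]
    rw [permArr_cons i M _ h (by simp) h', extractArr_head, ih (List.erase_cons_head _ _),
      ← id_add, comp_id]

/-- Coherence: a permutation of the summands is determined by the lists of indices. -/
theorem eq_permArr (h : PermArr P A L M φ) : φ = permArr A L M h.perm := by
  have := h.comp_permArr (List.Perm.refl M) h.perm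
  rwa [permArr_self rfl, comp_id] at this

end

/-- Two permutations of the summands with the same lists of indices agree.  Every comparison of
reorderings of sums below is an instance of this. -/
theorem unique (h : PermArr P A L M φ) (h' : PermArr P A L M θ) : φ = θ := by
  classical
  rw [h.eq_permArr, h'.eq_permArr]

theorem exists_of_perm (A : ι → P) (h : L.Perm M) : ∃ φ, PermArr P A L M φ := by
  classical
  exact ⟨_, permArr_mem M L h⟩

end PermArr

/-! ### Multimorphisms of the Grothendieck construction -/

namespace Hocolim

variable {J : PermCat.{v₁, u₁}} (C : J ⥤ PermCat.{v₂, u₂})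

/-- An object `(x, X)` of the Grothendieck construction of `C` with a morphism `x ⟶ y`. -/
structure Leg (y : J) where
  obj : Σ x : J, C.obj x
  hom : obj.1 ⟶ y

/-- A morphism of `C(y)` whose source is the sum of the images in `C(y)` of a list of objects of
the Grothendieck construction. -/
structure Block (y : J) where
  legs : List (Leg C y)
  arr : Arr (C.obj y)
  src_eq : arr.src = (C.obj y).sum (fun s => (C.map s.hom).functor.obj s.obj.2) legs

/-- A multimorphism of the Grothendieck construction: from the objects of its legs to
`(y, Y)`, where `Y` is the target of the underlying morphism of `C(y)`. -/
abbrev Multi := Σ y : J, Block C y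

variable {C} {x y z : J}

namespace Leg

/-- The image in `C(y)` of the object of a leg. -/
def image (s : Leg C y) : C.obj y := (C.map s.hom).functor.obj s.obj.2

/-- The leg obtained by composing the morphism of `J` with `k`. -/
def map (k : y ⟶ z) (s : Leg C y) : Leg C z := ⟨s.obj, s.hom ≫ k⟩

theorem image_map (k : y ⟶ z) (s : Leg C y) :
    (s.map k).image = (C.map k).functor.obj s.image := by
  rw [image, map, C.map_comp]; rfl

end Leg

namespace Block

@[ext] theorem ext {β γ : Block C y} (h : β.legs = γ.legs) (h' : β.arr = γ.arr) : β = γ := by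
  cases β; cases γ; congr

theorem src (β : Block C y) : β.arr.src = (C.obj y).sum Leg.image β.legs := β.src_eq

instance : Zero (Block C y) := ⟨⟨[], 0, rfl⟩⟩

instance : Add (Block C y) := ⟨fun β γ => ⟨β.legs ++ γ.legs, β.arr + γ.arr, by
  rw [PermCat.sum_append, Arr.add_src, β.src_eq, γ.src_eq]⟩⟩

@[simp] theorem zero_legs : (0 : Block C y).legs = [] := rfl
@[simp] theorem zero_arr : (0 : Block C y).arr = 0 := rfl
@[simp] theorem add_legs (β γ : Block C y) : (β + γ).legs = β.legs ++ γ.legs := rfl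
@[simp] theorem add_arr (β γ : Block C y) : (β + γ).arr = β.arr + γ.arr := rfl

instance : AddMonoid (Block C y) where
  add_assoc β γ δ := ext (by simp) (by simp [add_assoc])
  zero_add β := ext (by simp) (by simp)
  add_zero β := ext (by simp) (by simp)
  nsmul := nsmulRec

theorem sum_legs {ι : Type w} (β : ι → Block C y) (L : List ι) :
    (L.map β).sum.legs = L.flatMap fun i => (β i).legs := by
  induction L with
  | nil => rfl
  | cons i L ih => simp [ih]

theorem sum_arr {ι : Type w} (β : ι → Block C y) (L : List ι) :
    (L.map β).sum.arr = (L.map fun i => (β i).arr).sum := by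
  induction L with
  | nil => rfl
  | cons i L ih => simp [ih]

/-- The image of a block under the functor `C(k)`. -/
def map (k : y ⟶ z) (β : Block C y) : Block C z where
  legs := β.legs.map (Leg.map k)
  arr := β.arr.map (C.map k).functor
  src_eq := by
    rw [PermCat.sum_map, Arr.map_src, β.src_eq, StrictHom.obj_sum]
    exact PermCat.sum_congr _ fun s _ => (Leg.image_map k s).symm

@[simp] theorem map_legs (k : y ⟶ z) (β : Block C y) :
    (β.map k).legs = β.legs.map (Leg.map k) := rfl

@[simp] theorem map_arr (k : y ⟶ z) (β : Block C y) :
    (β.map k).arr = β.arr.map (C.map k).functor := rfl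

theorem map_id (β : Block C y) : β.map (𝟙 y) = β := by
  refine ext ?_ ?_
  · have : Leg.map (C := C) (𝟙 y) = _root_.id := by
      funext s; simp [Leg.map]
    simp [this]
  · rw [map_arr, C.map_id]; rfl

theorem map_map {t : J} (k : y ⟶ z) (l : z ⟶ t) (β : Block C y) :
    (β.map k).map l = β.map (k ≫ l) := by
  refine ext ?_ ?_
  · simp [Leg.map, Function.comp_def]
  · simp only [map_arr, C.map_comp]; rfl

theorem map_add (k : y ⟶ z) (β γ : Block C y) : (β + γ).map k = β.map k + γ.map k :=
  ext (by simp [map]) (Arr.map_add _ _ _)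

theorem map_zero (k : y ⟶ z) : (0 : Block C y).map k = 0 :=
  ext rfl (Arr.map_zero _)

/-- The composite of a block with a morphism of `C(y)`. -/
def post (β : Block C y) (φ : Arr (C.obj y)) : Block C y :=
  ⟨β.legs, β.arr ⊚ φ, by rw [Arr.comp_src, β.src_eq]⟩

@[simp] theorem post_legs (β : Block C y) (φ : Arr (C.obj y)) : (β.post φ).legs = β.legs := rfl

@[simp] theorem post_arr (β : Block C y) (φ : Arr (C.obj y)) :
    (β.post φ).arr = (β.arr ⊚ φ) := rfl

theorem map_post (k : y ⟶ z) (β : Block C y) {φ : Arr (C.obj y)} (h : β.arr.tgt = φ.src) :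
    (β.post φ).map k = (β.map k).post (φ.map (C.map k).functor) :=
  ext rfl (Arr.map_comp _ h)

end Block

open Classical in
/-- The image of a multimorphism with target `(x, X)` under a leg with object `(x, X)`; it is zero
if the grades do not match. -/
def Leg.act (s : Leg C y) (ν : Multi C) : Block C y :=
  if h : ν.1 = s.obj.1 then ν.2.map (eqToHom h ≫ s.hom) else 0

theorem Leg.act_mk {p : Σ x : J, C.obj x} (k : p.1 ⟶ y) (β : Block C p.1) :
    (⟨p, k⟩ : Leg C y).act ⟨p.1, β⟩ = β.map k := by
  rw [Leg.act, dif_pos rfl]; simp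

/-- The sum of the images of a list of multimorphisms under a list of legs. -/
def blockSum (ss : List (Leg C y)) (νs : List (Multi C)) : Block C y :=
  (List.zipWith Leg.act ss νs).sum

theorem blockSum_cons (s : Leg C y) (ν : Multi C) (ss : List (Leg C y)) (νs : List (Multi C)) :
    blockSum (s :: ss) (ν :: νs) = s.act ν + blockSum ss νs := by
  simp [blockSum]

theorem blockSum_map {ι : Type w} (s : ι → Leg C y) (ν : ι → Multi C) (K : List ι) :
    blockSum (K.map s) (K.map ν) = (K.map fun k => (s k).act (ν k)).sum := by
  rw [blockSum, List.zipWith_map, List.zipWith_self]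

theorem blockSum_append {ss : List (Leg C y)} {νs : List (Multi C)} (h : ss.length = νs.length)
    (ss' : List (Leg C y)) (νs' : List (Multi C)) :
    blockSum (ss ++ ss') (νs ++ νs') = blockSum ss νs + blockSum ss' νs' := by
  rw [blockSum, List.zipWith_append h, List.sum_append]; rfl

namespace Multi

/-- The target of a multimorphism. -/
def tgt (μ : Multi C) : Σ x : J, C.obj x := ⟨μ.1, μ.2.arr.tgt⟩

/-- Composition of multimorphisms. -/
def comp (μ : Multi C) (νs : List (Multi C)) : Multi C :=
  ⟨μ.1, (blockSum μ.2.legs νs).post μ.2.arr⟩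

/-- The multimorphism with a single leg. -/
def unary (p : Σ x : J, C.obj x) (k : p.1 ⟶ y) (φ : Arr (C.obj y))
    (h : φ.src = (C.map k).functor.obj p.2) : Multi C :=
  ⟨y, [⟨p, k⟩], φ, h.trans (PermCat.sum_singleton _ _ _).symm⟩

/-- The identity of an object of the Grothendieck construction. -/
def unit (p : Σ x : J, C.obj x) : Multi C :=
  unary p (𝟙 p.1) (Arr.ident p.2) (map_id_obj p.1 p.2).symm

theorem unit_eq (p : Σ x : J, C.obj x) : unit p = ⟨p.1, [⟨p, 𝟙 p.1⟩], Arr.ident p.2,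
    (map_id_obj p.1 p.2).symm.trans (PermCat.sum_singleton _ _ _).symm⟩ := rfl

/-- The targets of the multimorphisms `νs` are the objects of the legs `ss`. -/
abbrev Match (ss : List (Leg C y)) (νs : List (Multi C)) : Prop :=
  List.Forall₂ (fun s ν => tgt ν = s.obj) ss νs

theorem exists_of_tgt {ν : Multi C} {p : Σ x : J, C.obj x} (h : ν.tgt = p) :
    ∃ β : Block C p.1, ν = ⟨p.1, β⟩ ∧ β.arr.tgt = p.2 := by
  subst h; exact ⟨ν.2, rfl, rfl⟩

theorem act_tgt {s : Leg C y} {ν : Multi C} (h : tgt ν = s.obj) :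
    (s.act ν).arr.tgt = s.image := by
  obtain ⟨p, k⟩ := s
  obtain ⟨β, rfl, hβ⟩ := exists_of_tgt h
  rw [Leg.act_mk, Leg.image, ← hβ]; rfl

theorem blockSum_tgt {ss : List (Leg C y)} {νs : List (Multi C)} (h : Match ss νs) :
    (blockSum ss νs).arr.tgt = (C.obj y).sum Leg.image ss := by
  induction h with
  | nil => rfl
  | cons h h' ih => rw [blockSum_cons, Block.add_arr, Arr.add_tgt, act_tgt h, ih]; rfl

theorem act_map (k : y ⟶ z) (s : Leg C y) (ν : Multi C) :
    (s.map k).act ν = (s.act ν).map k := by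
  by_cases h : ν.1 = s.obj.1
  · rw [Leg.act, Leg.act, dif_pos h, Block.map_map, Category.assoc]
    exact dif_pos h
  · rw [Leg.act, Leg.act, dif_neg h, Block.map_zero]
    exact dif_neg h

theorem blockSum_map_legs (k : y ⟶ z) (ss : List (Leg C y)) (νs : List (Multi C)) :
    blockSum (ss.map (Leg.map k)) νs = (blockSum ss νs).map k := by
  induction ss generalizing νs with
  | nil => simp [blockSum, Block.map_zero]
  | cons s ss ih =>
    cases νs with
    | nil => simp [blockSum, Block.map_zero]
    | cons ν νs => rw [List.map_cons, blockSum_cons, blockSum_cons, Block.map_add, act_map, ih]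

theorem act_comp {s : Leg C y} {ν : Multi C} (h : tgt ν = s.obj) {ρs : List (Multi C)}
    (hρ : Match ν.2.legs ρs) :
    s.act (ν.comp ρs) = (blockSum (s.act ν).legs ρs).post (s.act ν).arr := by
  obtain ⟨p, k⟩ := s
  obtain ⟨β, rfl, hβ⟩ := exists_of_tgt h
  have hρ' : Match β.legs ρs := hρ
  rw [comp, Leg.act_mk, Leg.act_mk]
  dsimp only
  rw [Block.map_post _ _ (by rw [blockSum_tgt hρ', β.src]), Block.map_legs, blockSum_map_legs]
  rfl

/-- Composition of multimorphisms is associative. -/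
theorem comp_comp {κ : Type w} (μ : Multi C) (N : List κ) (ν : κ → Multi C)
    (ρ : κ → List (Multi C)) (hμ : Match μ.2.legs (N.map ν))
    (hν : ∀ m ∈ N, Match (ν m).2.legs (ρ m)) :
    (μ.comp (N.map ν)).comp (N.flatMap ρ) = μ.comp (N.map fun m => (ν m).comp (ρ m)) := by
  obtain ⟨y, ss, φ, hφ⟩ := μ
  have key : ∀ (ss : List (Leg C y)) (N : List κ), Match ss (N.map ν) →
      (∀ m ∈ N, Match (ν m).2.legs (ρ m)) →
      blockSum ss (N.map fun m => (ν m).comp (ρ m)) =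
        (blockSum (blockSum ss (N.map ν)).legs (N.flatMap ρ)).post (blockSum ss (N.map ν)).arr ∧
      (blockSum (blockSum ss (N.map ν)).legs (N.flatMap ρ)).arr.tgt =
        (blockSum ss (N.map ν)).arr.src := by
    intro ss N
    induction N generalizing ss with
    | nil =>
      rintro (_ | _) -
      exact ⟨Block.ext rfl (Arr.comp_id _ _).symm, rfl⟩
    | cons m N ih =>
      rintro hs hm
      cases hs with
      | @cons s _ ss' _ h₁ h₂ =>
      simp only [List.forall_mem_cons] at hm
      obtain ⟨ih₁, ih₂⟩ := ih ss' h₂ hm.2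
      have hlen : (s.act (ν m)).legs.length = (ρ m).length := by
        rw [← hm.1.length_eq]
        obtain ⟨p, k⟩ := s
        obtain ⟨β, e, hβ⟩ := exists_of_tgt h₁
        rw [e, Leg.act_mk]
        simp [Block.map]
      have htgt : (blockSum (s.act (ν m)).legs (ρ m)).arr.tgt = (s.act (ν m)).arr.src := by
        obtain ⟨p, k⟩ := s
        obtain ⟨β, e, hβ⟩ := exists_of_tgt h₁
        have h₃ := hm.1
        rw [e] at h₃ ⊢
        rw [Leg.act_mk, Block.map, blockSum_map_legs]
        dsimp only at h₃ ⊢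
        rw [Block.map, Arr.map_tgt, Arr.map_src, blockSum_tgt h₃, β.src]
      constructor
      · rw [List.map_cons, blockSum_cons, ih₁, act_comp h₁ hm.1, List.map_cons, blockSum_cons,
          Block.add_legs, List.flatMap_cons, blockSum_append hlen]
        exact Block.ext rfl (Arr.add_comp htgt ih₂).symm
      · rw [List.map_cons, blockSum_cons, Block.add_legs, List.flatMap_cons,
          blockSum_append hlen, Block.add_arr, Block.add_arr, Arr.add_tgt, Arr.add_src, htgt, ih₂]
  obtain ⟨h₁, h₂⟩ := key ss N hμ hν
  rw [comp, comp, comp]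
  dsimp only [Block.post]
  refine congrArg (Sigma.mk y) (Block.ext ?_ ?_)
  · dsimp only
    rw [h₁]; rfl
  · dsimp only
    rw [h₁, Block.post, Arr.comp_assoc h₂]

theorem unit_comp {μ : Multi C} {p : Σ x : J, C.obj x} (h : μ.tgt = p) : (unit p).comp [μ] = μ := by
  obtain ⟨β, rfl, hβ⟩ := exists_of_tgt h
  rw [comp, unit_eq]
  dsimp only
  rw [blockSum_cons, Leg.act_mk, Block.map_id]
  exact congrArg (Sigma.mk _) (Block.ext (by simp [blockSum, Block.post])
    ((Arr.comp_id _ _).trans (by simp [blockSum])))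

theorem blockSum_unit (ss : List (Leg C y)) : (blockSum ss (ss.map fun s => unit s.obj)).legs = ss ∧
    (blockSum ss (ss.map fun s => unit s.obj)).arr =
      Arr.ident ((C.obj y).sum Leg.image ss) := by
  induction ss with
  | nil => exact ⟨rfl, rfl⟩
  | cons s ss ih =>
    obtain ⟨p, k⟩ := s
    rw [List.map_cons, blockSum_cons, unit_eq, Leg.act_mk]
    constructor
    · rw [Block.add_legs, ih.1]
      simp [Block.map, Leg.map]
    · rw [Block.add_arr, ih.2]
      refine Eq.trans ?_ (Arr.id_add _ _).symm
      simp [Leg.image]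

theorem comp_unit (μ : Multi C) : μ.comp (μ.2.legs.map fun s => unit s.obj) = μ := by
  obtain ⟨y, β⟩ := μ
  obtain ⟨h₁, h₂⟩ := blockSum_unit β.legs
  refine congrArg (Sigma.mk y) (Block.ext h₁ ?_)
  rw [Block.post_arr, h₂, ← β.src]; exact Arr.id_comp _

end Multi

end Hocolim

/-! ### Morphisms of the homotopy colimit as families of multimorphisms -/

open Classical in
/-- The permutation of summands from one list of indices to another, if there is one. -/
def PermArr.ofLists {P : PermCat.{v, u}} {ι : Type w} (A : ι → P) (L M : List ι) : Arr P :=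
  if h : L.Perm M then PermArr.permArr A L M h else Arr.ident (P.sum A L)

theorem PermArr.ofLists_src {P : PermCat.{v, u}} {ι : Type w} (A : ι → P) (L M : List ι) :
    (PermArr.ofLists A L M).src = P.sum A L := by
  rw [ofLists]; split <;> rfl

theorem PermArr.ofLists_eq {P : PermCat.{v, u}} {ι : Type w} {A : ι → P} {L M : List ι}
    {φ : Arr P} (h : PermArr P A L M φ) : PermArr.ofLists A L M = φ := by
  classical
  rw [ofLists, dif_pos h.perm]
  exact (permArr_mem _ _ _).unique h

namespace Hocolim

variable {J : PermCat.{v₁, u₁}} {C : J ⥤ PermCat.{v₂, u₂}} {S T U V S' T' : Hocolim C}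

namespace Mor

open Classical in
/-- The leg of the index `i` in the fibre over `j`. For `i` outside the fibre this is a leg whose
image is zero. -/
def leg (f : Mor S T) (j : Fin T.len) (i : Fin S.len) : Leg C (T.entry j).1 :=
  if h : f.ψ i = j then ⟨S.entry i, f.ℓ i j h⟩ else ⟨⟨_, (C.obj (T.entry j).1).zero⟩, 𝟙 _⟩

theorem leg_pos (f : Mor S T) {j : Fin T.len} {i : Fin S.len} (h : f.ψ i = j) :
    f.leg j i = ⟨S.entry i, f.ℓ i j h⟩ := dif_pos h

/-- The fibre over `j` in increasing order. -/
def fibre (f : Mor S T) (j : Fin T.len) : List (Fin S.len) :=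
  (Finset.univ.sort (α := {i // f.ψ i = j})).map Subtype.val

/-- The list `L` enumerates the fibre over `j`. -/
def Enum (f : Mor S T) (j : Fin T.len) (L : List (Fin S.len)) : Prop :=
  L.Nodup ∧ ∀ i, i ∈ L ↔ f.ψ i = j

theorem enum_fibre (f : Mor S T) (j : Fin T.len) : f.Enum j (f.fibre j) := by
  refine ⟨(Finset.sort_nodup _ _).map Subtype.val_injective, fun i => ?_⟩
  simp [fibre]

theorem Enum.perm {f : Mor S T} {j : Fin T.len} {L M : List (Fin S.len)} (hL : f.Enum j L)
    (hM : f.Enum j M) : L.Perm M :=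
  (List.perm_ext_iff_of_nodup hL.1 hM.1).2 fun i => (hL.2 i).trans (hM.2 i).symm

/-- The third coordinate as an untyped arrow. -/
def arr (f : Mor S T) (j : Fin T.len) : Arr (C.obj (T.entry j).1) := Arr.mk (f.ϱ j)

@[simp] theorem arr_tgt (f : Mor S T) (j : Fin T.len) : (f.arr j).tgt = (T.entry j).2 := rfl

theorem arr_src (f : Mor S T) (j : Fin T.len) :
    (f.arr j).src = (C.obj (T.entry j).1).sum (fun i => (f.leg j i).image) (f.fibre j) := by
  rw [fibre, PermCat.sum_map]
  refine PermCat.sum_congr _ fun i _ => ?_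
  rw [f.leg_pos i.2]; rfl

/-- The multimorphism over the index `j` of the target, as a block, with its legs in the order
given by an enumeration `L` of the fibre. -/
def blk (f : Mor S T) (j : Fin T.len) (L : List (Fin S.len)) : Block C (T.entry j).1 :=
  ⟨L.map (f.leg j),
    PermArr.ofLists (fun i => (f.leg j i).image) L (f.fibre j) ⊚ f.arr j, by
      rw [Arr.comp_src, PermArr.ofLists_src, PermCat.sum_map]; rfl⟩

/-- The multimorphism over the index `j` of the target. -/
abbrev multi (f : Mor S T) (j : Fin T.len) (L : List (Fin S.len)) : Multi C :=
  ⟨(T.entry j).1, f.blk j L⟩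

@[simp] theorem blk_legs (f : Mor S T) (j : Fin T.len) (L : List (Fin S.len)) :
    (f.blk j L).legs = L.map (f.leg j) := rfl

theorem blk_arr {f : Mor S T} {j : Fin T.len} {L : List (Fin S.len)}
    {φ : Arr (C.obj (T.entry j).1)}
    (h : PermArr (C.obj (T.entry j).1) (fun i => (f.leg j i).image) L (f.fibre j) φ) :
    (f.blk j L).arr = (φ ⊚ f.arr j) := by
  rw [← h.ofLists_eq]; rfl

theorem blk_perm {f : Mor S T} {j : Fin T.len} {L M : List (Fin S.len)} (hM : f.Enum j M)
    {φ : Arr (C.obj (T.entry j).1)}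
    (h : PermArr (C.obj (T.entry j).1) (fun i => (f.leg j i).image) L M φ) :
    (f.blk j L).arr = (φ ⊚ (f.blk j M).arr) := by
  obtain ⟨θ, hθ⟩ := PermArr.exists_of_perm (P := C.obj (T.entry j).1)
    (fun i => (f.leg j i).image) (hM.perm (f.enum_fibre j))
  rw [blk_arr hθ, blk_arr (h.trans hθ), Arr.comp_assoc (by rw [h.tgt, hθ.src])]

theorem multi_tgt {f : Mor S T} {j : Fin T.len} {L : List (Fin S.len)} (hL : f.Enum j L) :
    (f.multi j L).tgt = T.entry j := by
  obtain ⟨θ, hθ⟩ := PermArr.exists_of_perm (P := C.obj (T.entry j).1)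
    (fun i => (f.leg j i).image) (hL.perm (f.enum_fibre j))
  have : (f.blk j L).arr.tgt = (T.entry j).2 := by
    rw [blk_arr hθ, Arr.comp_tgt (by rw [hθ.tgt, arr_src]), arr_tgt]
  exact congrArg (Sigma.mk (T.entry j).1) this

/-- Morphisms are equal if they have the same multimorphisms for some enumerations of the
fibres. -/
theorem hext {f : Mor S T} {f' : Mor S' T'} (hS : S = S') (hT : T = T')
    (h : ∀ j : Fin T.len, ∃ L L', f.Enum j L ∧ f'.Enum (Fin.cast (congrArg len hT) j) L' ∧
      L' = L.map (Fin.cast (congrArg len hS)) ∧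
      f.multi j L = f'.multi (Fin.cast (congrArg len hT) j) L') : HEq f f' := by
  subst hS
  subst hT
  apply heq_of_eq
  have h' : ∀ j : Fin T.len, ∃ L : List (Fin S.len), f.Enum j L ∧ f'.Enum j L ∧
      f.multi j L = f'.multi j L := by
    intro j
    obtain ⟨L, L', h₁, h₂, h₄, h₃⟩ := h j
    rw [Fin.cast_refl, List.map_id] at h₄
    subst h₄
    exact ⟨_, h₁, h₂, h₃⟩
  clear h
  have hψ : f.ψ = f'.ψ := by
    funext i
    obtain ⟨L, h₁, h₂, -⟩ := h' (f.ψ i)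
    exact ((h₂.2 i).1 ((h₁.2 i).2 rfl)).symm
  obtain ⟨ψ, hs, ℓ, ϱ⟩ := f
  obtain ⟨ψ', hs', ℓ', ϱ'⟩ := f'
  dsimp only at hψ
  subst hψ
  -- the legs over the fibres determine the second coordinate
  have hℓ : ℓ = ℓ' := by
    funext i j hij
    obtain ⟨L, h₁, h₂, h₃⟩ := h' j
    have h₄ : L.map (leg ⟨ψ, hs, ℓ, ϱ⟩ j) = L.map (leg ⟨ψ, hs, ℓ', ϱ'⟩ j) :=
      congrArg Block.legs (eq_of_heq (Sigma.mk.inj h₃).2)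
    have h₅ := List.map_inj_left.1 h₄ i ((h₁.2 i).2 hij)
    rw [leg_pos _ hij, leg_pos _ hij] at h₅
    simpa using h₅
  subst hℓ
  -- the third coordinate is recovered from the block by cancelling the permutation of the fibre
  have hϱ : ϱ = ϱ' := by
    funext j
    obtain ⟨L, h₁, h₂, h₃⟩ := h' j
    have h₄ : (blk ⟨ψ, hs, ℓ, ϱ⟩ j L).arr = (blk ⟨ψ, hs, ℓ, ϱ'⟩ j L).arr :=
      congrArg Block.arr (eq_of_heq (Sigma.mk.inj h₃).2)
    obtain ⟨φ, hφ⟩ := PermArr.exists_of_perm (P := C.obj (T.entry j).1)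
      (fun i => (leg ⟨ψ, hs, ℓ, ϱ⟩ j i).image) (h₁.perm (enum_fibre ⟨ψ, hs, ℓ, ϱ⟩ j))
    obtain ⟨θ, hθ⟩ := PermArr.exists_of_perm (P := C.obj (T.entry j).1)
      (fun i => (leg ⟨ψ, hs, ℓ, ϱ⟩ j i).image) ((enum_fibre ⟨ψ, hs, ℓ, ϱ⟩ j).perm h₁)
    have h₅ : ∀ ζ : Mor S T, θ.tgt = φ.src → (ζ.arr j).src = θ.src →
        θ ⊚ φ = Arr.ident θ.src → θ ⊚ φ ⊚ ζ.arr j = ζ.arr j := by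
      intro ζ e₁ e₂ e₃
      rw [← Arr.comp_assoc e₁, e₃, Arr.id_comp' e₂.symm]
    have e₃ : θ ⊚ φ = Arr.ident θ.src := by
      rw [hθ.src]; exact (hθ.trans hφ).unique (PermArr.refl _)
    have h₆ := congrArg (θ ⊚ ·) h₄
    beta_reduce at h₆
    rw [blk_arr (f := ⟨ψ, hs, ℓ, ϱ⟩) hφ, blk_arr (f := ⟨ψ, hs, ℓ, ϱ'⟩) hφ,
      h₅ _ (by rw [hθ.tgt, hφ.src]) (by rw [hθ.src, arr_src]) e₃,
      h₅ _ (by rw [hθ.tgt, hφ.src]) (by rw [hθ.src, arr_src]; rfl) e₃] at h₆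
    exact Arr.mk_inj.1 h₆
  subst hϱ
  rfl

theorem ext_multi {f f' : Mor S T}
    (h : ∀ j, ∃ L, f.Enum j L ∧ f'.Enum j L ∧ f.multi j L = f'.multi j L) : f = f' := by
  refine eq_of_heq (hext rfl rfl fun j => ?_)
  obtain ⟨L, h₁, h₂, h₃⟩ := h j
  exact ⟨L, L, h₁, h₂, by simp, h₃⟩

theorem leg_act {g : Mor T U} {r : Fin U.len} {k : Fin T.len} (hk : g.ψ k = r)
    {β : Block C (T.entry k).1} : (g.leg r k).act ⟨(T.entry k).1, β⟩ = β.map (g.ℓ k r hk) := by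
  rw [leg_pos _ hk, Leg.act_mk]

end Mor

/-- The fibre of a composite is enumerated by blocks. -/
theorem enum_comp {f : S ⟶ T} {g : T ⟶ U} {r : Fin U.len} {K : List (Fin T.len)}
    {L : Fin T.len → List (Fin S.len)} (hK : Mor.Enum g r K) (hL : ∀ k ∈ K, Mor.Enum f k (L k)) :
    Mor.Enum (f ≫ g) r (K.flatMap L) := by
  constructor
  · rw [List.nodup_flatMap]
    refine ⟨fun k hk => (hL k hk).1, hK.1.imp_of_mem ?_⟩
    intro k k' hk hk' h i hi hi'
    exact h ((((hL k hk).2 i).1 hi).symm.trans (((hL k' hk').2 i).1 hi'))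
  · intro i
    rw [List.mem_flatMap]
    constructor
    · rintro ⟨k, hk, hi⟩
      change Mor.ψ g (Mor.ψ f i) = r
      rw [((hL k hk).2 i).1 hi, (hK.2 k).1 hk]
    · intro h
      have hk := (hK.2 (Mor.ψ f i)).2 h
      exact ⟨_, hk, ((hL _ hk).2 i).2 rfl⟩

theorem leg_comp {f : S ⟶ T} {g : T ⟶ U} {r : Fin U.len} {k : Fin T.len} {i : Fin S.len}
    (hk : Mor.ψ g k = r) (hi : Mor.ψ f i = k) :
    Mor.leg (f ≫ g) r i = (Mor.leg f k i).map (Mor.ℓ g k r hk) := by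
  subst hi
  rw [Mor.leg_pos (f ≫ g) (show Mor.ψ (f ≫ g) i = r from hk), Mor.leg_pos f rfl]
  rfl

/-- The canonical isomorphism that sorts a sum into blocks is a permutation of the summands. -/
theorem regroup_mem {P : PermCat.{v, u}} {ι : Type w} [Fintype ι] [LinearOrder ι]
    {κ : Type w'} [Fintype κ] [LinearOrder κ] (A : ι → P) {ι' : κ → Type w'}
    [∀ k, Fintype (ι' k)] [∀ k, LinearOrder (ι' k)] (f : ∀ k, ι' k → ι)
    (hf : Function.Bijective fun s : Σ k, ι' k => f s.1 s.2) :
    PermArr P A (Finset.univ.sort) ((Finset.univ.sort (α := κ)).flatMap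
      fun k => (Finset.univ.sort (α := ι' k)).map (f k)) (Arr.mk (P.regroup A f hf)) := by
  have e : Arr.mk (P.regroup A f hf) = PermArr.permArr A _ _ (PermCat.sort_perm_flatMap f hf) :=
    Arr.mk_comp_eqToHom _ (P.permHom A _ _ (PermCat.sort_perm_flatMap f hf))
  rw [e]
  exact PermArr.permArr_mem _ _ _

/-- The canonical isomorphism along a bijection of index sets is a permutation of the summands. -/
theorem reindex_mem {P : PermCat.{v, u}} {ι : Type w} [Fintype ι] [LinearOrder ι]
    {κ : Type w'} [Fintype κ] [LinearOrder κ] (A : ι → P) (f : κ → ι) (hf : f.Bijective) :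
    PermArr P A (Finset.univ.sort) ((Finset.univ.sort (α := κ)).map f)
      (Arr.mk (P.reindex A f hf)) := by
  have hp : (Finset.univ.sort (α := ι)).Perm ((Finset.univ.sort (α := κ)).map f) := by
    rw [List.perm_ext_iff_of_nodup (Finset.sort_nodup _ _) ((Finset.sort_nodup _ _).map hf.1)]
    intro i
    simpa using hf.2 i
  have e : Arr.mk (P.reindex A f hf) = PermArr.permArr A _ _ hp :=
    Arr.mk_comp_eqToHom _ (P.permHom A _ _ hp)
  rw [e]
  exact PermArr.permArr_mem _ _ _

/-- The block given by the fibre over `j` in increasing order. -/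
def Mor.block (f : Mor S T) (j : Fin T.len) : Block C (T.entry j).1 :=
  ⟨(f.fibre j).map (f.leg j), f.arr j, by rw [arr_src, PermCat.sum_map]; rfl⟩

/-- The third coordinate of a composite, with the canonical permutation of summands described by
its lists of indices only. -/
theorem arr_comp (f : S ⟶ T) (g : T ⟶ U) (r : Fin U.len) : ∃ φ,
    PermArr (C.obj (U.entry r).1) (fun i => (Mor.leg (f ≫ g) r i).image)
      (Mor.fibre (f ≫ g) r) ((Mor.fibre g r).flatMap (Mor.fibre f)) φ ∧
    Mor.arr (f ≫ g) r = (φ ⊚ ((Mor.fibre g r).map fun k =>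
      ((Mor.leg g r k).act ⟨(T.entry k).1, Mor.block f k⟩).arr).sum ⊚ Mor.arr g r) := by
  let A := fun i : {i // Mor.ψ (f ≫ g) i = r} =>
    (C.map (Mor.ℓ (f ≫ g) i r i.2)).functor.obj (S.entry i).2
  refine ⟨Arr.mk ((C.obj (U.entry r).1).regroup A (compIncl f g r) (compIncl_bijective f g r)),
    ?_, ?_⟩
  · have h := regroup_mem (P := C.obj (U.entry r).1) A (compIncl f g r) (compIncl_bijective f g r)
    have h' := PermArr.map_index (A := fun i => (Mor.leg (f ≫ g) r i).image)
      Subtype.val_injective (h.congr_family fun i _ => by rw [Mor.leg_pos (f ≫ g) i.2]; rfl)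
    rw [List.map_flatMap] at h'
    rw [Mor.fibre, Mor.fibre, List.flatMap_map]
    convert h' using 3
    rename_i k
    exact (List.map_map (f := compIncl f g r k) (g := Subtype.val)
      (l := Finset.univ.sort)).symm
  · refine (Arr.mk_comp ((C.obj (U.entry r).1).regroup A (compIncl f g r)
      (compIncl_bijective f g r)) _).trans ?_
    congr 1
    refine (Arr.mk_eqToHom_comp _ _).trans ?_
    refine (Arr.mk_comp _ _).trans ?_
    congr 1
    refine (Arr.mk_sumHom _ _).trans ?_
    rw [Mor.fibre, List.map_map]
    congr 2
    funext k
    exact (congrArg Block.arr (Mor.leg_act (g := g) (β := Mor.block f k) k.2)).symm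

/-- The multimorphisms of a composite are the composites of the multimorphisms, where the fibre of
the composite is enumerated by blocks. -/
theorem multi_comp {f : S ⟶ T} {g : T ⟶ U} {r : Fin U.len} {K : List (Fin T.len)}
    {L : Fin T.len → List (Fin S.len)} (hK : Mor.Enum g r K) (hL : ∀ k ∈ K, Mor.Enum f k (L k)) :
    Mor.multi (f ≫ g) r (K.flatMap L) =
      (Mor.multi g r K).comp (K.map fun k => Mor.multi f k (L k)) := by
  change (⟨_, _⟩ : Multi C) = ⟨(U.entry r).1, (blockSum (K.map (Mor.leg g r))
    (K.map fun k => Mor.multi f k (L k))).post (Mor.blk g r K).arr⟩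
  rw [blockSum_map]
  refine congrArg (Sigma.mk _) (Block.ext ?_ ?_)
  · change (K.flatMap L).map _ = _
    rw [Block.post_legs, Block.sum_legs, List.map_flatMap]
    refine List.flatMap_congr fun k hk => ?_
    have hk' := (hK.2 k).1 hk
    rw [Mor.leg_act hk', Block.map_legs, Mor.blk_legs, List.map_map]
    refine List.map_congr_left fun i hi => ?_
    exact leg_comp hk' (((hL k hk).2 i).1 hi)
  · obtain ⟨φ, h₁, h₂⟩ := arr_comp f g r
    let b := fun k => (Mor.leg g r k).act ⟨(T.entry k).1, Mor.block f k⟩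
    let A := fun i => (Mor.leg (f ≫ g) r i).image
    have hA : ∀ k ∈ K, (b k).arr.src = (C.obj (U.entry r).1).sum A (Mor.fibre f k) ∧
        (b k).arr.tgt = (Mor.leg g r k).image := by
      intro k hk
      have hk' := (hK.2 k).1 hk
      refine ⟨?_, Multi.act_tgt (by rw [Mor.leg_pos _ hk']; rfl)⟩
      rw [Block.src]
      simp only [b, Mor.leg_act hk', Block.map_legs, Mor.block, PermCat.sum_map, A]
      refine PermCat.sum_congr _ fun i hi => ?_
      rw [← leg_comp hk' (((Mor.enum_fibre f k).2 i).1 hi)]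
    -- `b k` is the multimorphism over `k` with its fibre in increasing order; it differs from the
    -- given enumeration by the permutation `Θ k`
    have hΘ : ∀ k, ∃ Θ, k ∈ K → PermArr (C.obj (U.entry r).1) A (L k) (Mor.fibre f k) Θ ∧
        ((Mor.leg g r k).act (Mor.multi f k (L k))).arr = (Θ ⊚ (b k).arr) := by
      intro k
      by_cases hk : k ∈ K
      · have hk' := (hK.2 k).1 hk
        obtain ⟨θ, hθ⟩ := PermArr.exists_of_perm (P := C.obj (T.entry k).1)
          (fun i => (Mor.leg f k i).image) ((hL k hk).perm (Mor.enum_fibre f k))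
        refine ⟨θ.map (C.map (Mor.ℓ g k r hk')).functor, fun _ => ⟨?_, ?_⟩⟩
        · refine (hθ.map_family (C.map (Mor.ℓ g k r hk'))).congr_family fun i hi => ?_
          simp only [A]
          rw [leg_comp hk' (((hL k hk).2 i).1 hi), Leg.image_map]
        · simp only [b, Mor.leg_act hk']
          rw [Block.map_arr, Block.map_arr, ← Arr.map_comp _ (by rw [hθ.tgt, Block.src,
            Mor.block, PermCat.sum_map])]
          exact congrArg _ (Mor.blk_arr hθ)
      · exact ⟨0, fun h => absurd h hk⟩
    choose Θ hΘ using hΘ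
    -- `ω` permutes the summands indexed by the fibre of `g`, `π` the same summands before `b` is
    -- applied, and `κ` sorts the fibre of the composite
    obtain ⟨ω, hω⟩ := PermArr.exists_of_perm (P := C.obj (U.entry r).1)
      (fun k => (Mor.leg g r k).image) (hK.perm (Mor.enum_fibre g r))
    obtain ⟨π, hπ⟩ := PermArr.exists_of_perm (P := C.obj (U.entry r).1)
      (fun k => (b k).arr.src) (hK.perm (Mor.enum_fibre g r))
    obtain ⟨κ, hκ⟩ := PermArr.exists_of_perm (P := C.obj (U.entry r).1) A
      ((enum_comp hK hL).perm (Mor.enum_fibre (f ≫ g) r))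
    obtain ⟨ω', hω', hn⟩ := hπ.natural (B := fun k => (Mor.leg g r k).image)
      (fun k => (b k).arr) (fun k _ => rfl) (fun k hk => (hA k hk).2)
    obtain rfl := hω'.unique hω
    have hπ' : PermArr (C.obj (U.entry r).1) A (K.flatMap (Mor.fibre f))
        ((Mor.fibre g r).flatMap (Mor.fibre f)) π := by
      refine hπ.flatMap _ (fun k hk => (hA k hk).1) fun k hk k' hk' h i hi hi' => h ?_
      exact (((Mor.enum_fibre f k).2 i).1 hi).symm.trans (((Mor.enum_fibre f k').2 i).1 hi')
    have hs : PermArr (C.obj (U.entry r).1) A (K.flatMap L) (K.flatMap (Mor.fibre f))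
        (K.map Θ).sum := PermArr.sum K fun k hk => (hΘ k hk).1
    have hb : (K.map fun k => (b k).arr).sum.tgt = ω'.src := by
      rw [Arr.sum_tgt, hω'.src]
      exact PermCat.sum_congr _ fun k hk => (hA k hk).2
    have hb' : ∀ k ∈ K, (Θ k).tgt = (b k).arr.src := fun k hk => by
      rw [(hΘ k hk).1.tgt, (hA k hk).1]
    have hK' : (K.map fun k => ((Mor.leg g r k).act (Mor.multi f k (L k))).arr).sum =
        ((K.map Θ).sum ⊚ (K.map fun k => (b k).arr).sum) := by
      rw [← Arr.sum_comp hb']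
      exact congrArg List.sum (List.map_congr_left fun k hk => (hΘ k hk).2)
    have hsb : (K.map Θ).sum.tgt = (K.map fun k => (b k).arr).sum.src := by
      rw [Arr.sum_tgt, Arr.sum_src]; exact PermCat.sum_congr _ hb'
    rw [Block.post_arr, Block.sum_arr, hK', Mor.blk_arr hω', Arr.comp_assoc hsb,
      ← Arr.comp_assoc hb, hn]
    refine (Mor.blk_arr hκ).trans ?_
    have hπb : π.tgt = ((Mor.fibre g r).map fun k => (b k).arr).sum.src := by
      rw [hπ.tgt, Arr.sum_src]
    have hsπ : (K.map Θ).sum.tgt = π.src := by rw [hs.tgt, hπ'.src]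
    rw [h₂, ← Arr.comp_assoc (by rw [hκ.tgt, h₁.src]), (hκ.trans h₁).unique (hs.trans hπ'),
      Arr.comp_assoc hsπ, Arr.comp_assoc hπb]

end Hocolim

/-! ### Composites, permutations and sums of morphisms -/

namespace Hocolim

section

variable {J : Type u₁} [Category.{v₁} J] {C : J ⥤ PermCat.{v₂, u₂}}

theorem ext_entry {S T : Hocolim C} (h : S.len = T.len)
    (h' : ∀ i, S.entry i = T.entry (Fin.cast h i)) : S = T := by
  obtain ⟨n, hn, a⟩ := S
  obtain ⟨m, hm, b⟩ := T
  dsimp only at h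
  subst h
  congr
  funext i
  exact h' i

end

variable {J : PermCat.{v₁, u₁}} {C : J ⥤ PermCat.{v₂, u₂}} {S T U V S' T' : Hocolim C}

theorem Multi.match_of_map {y : J} : ∀ {ss : List (Leg C y)} {νs : List (Multi C)},
    ss.map Leg.obj = νs.map tgt → Match ss νs
  | [], [], _ => .nil
  | s :: ss, ν :: νs, h => by
    simp only [List.map_cons, List.cons.injEq] at h
    exact .cons h.1.symm (match_of_map h.2)

/-- The multimorphism of `f` over the index `j` is `μ` when its legs are listed in the order of
the enumeration `L` of the fibre. -/
def Mor.At (f : Mor S T) (j : Fin T.len) (L : List (Fin S.len)) (μ : Multi C) : Prop :=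
  f.Enum j L ∧ f.multi j L = μ

theorem Mor.at_multi {f : Mor S T} {j : Fin T.len} {L : List (Fin S.len)} (h : f.Enum j L) :
    f.At j L (f.multi j L) := ⟨h, rfl⟩

theorem Mor.exists_at (f : Mor S T) (j : Fin T.len) : ∃ L μ, f.At j L μ :=
  ⟨_, _, at_multi (f.enum_fibre j)⟩

theorem Mor.At.tgt {f : Mor S T} {j : Fin T.len} {L : List (Fin S.len)} {μ : Multi C}
    (h : f.At j L μ) : μ.tgt = T.entry j := by
  rw [← h.2]; exact multi_tgt h.1

theorem Mor.At.objs {f : Mor S T} {j : Fin T.len} {L : List (Fin S.len)} {μ : Multi C}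
    (h : f.At j L μ) : μ.2.legs.map Leg.obj = L.map S.entry := by
  rw [← h.2, blk_legs, List.map_map]
  refine List.map_congr_left fun i hi => ?_
  rw [Function.comp_apply, leg_pos _ ((h.1.2 i).1 hi)]

theorem Mor.At.units {f : Mor S T} {j : Fin T.len} {L : List (Fin S.len)} {μ : Multi C}
    (h : f.At j L μ) : L.map (fun i => Multi.unit (S.entry i)) =
      μ.2.legs.map fun s => Multi.unit s.obj := by
  have := congrArg (List.map Multi.unit) h.objs
  rw [List.map_map, List.map_map] at this
  exact this.symm

/-- To identify two morphisms it suffices to find, over each index of the target, one multimorphism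
that both of them have for corresponding lists of indices. -/
theorem Mor.At.heq {f : Mor S T} {f' : Mor S' T'} (hS : S = S') (hT : T = T')
    (h : ∀ j : Fin T.len, ∃ L μ, f.At j L μ ∧
      f'.At (Fin.cast (congrArg len hT) j) (L.map (Fin.cast (congrArg len hS))) μ) :
    HEq f f' := by
  refine hext hS hT fun j => ?_
  obtain ⟨L, μ, h₁, h₂⟩ := h j
  exact ⟨L, _, h₁.1, h₂.1, rfl, h₁.2.trans h₂.2.symm⟩

theorem Mor.At.ext {f f' : Mor S T} (h : ∀ j, ∃ L μ, f.At j L μ ∧ f'.At j L μ) : f = f' := by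
  refine ext_multi fun j => ?_
  obtain ⟨L, μ, h₁, h₂⟩ := h j
  exact ⟨L, h₁.1, h₂.1, h₁.2.trans h₂.2.symm⟩

/-- The multimorphisms of a composite are composites of multimorphisms. -/
theorem Mor.At.comp {f : S ⟶ T} {g : T ⟶ U} {r : Fin U.len} {K : List (Fin T.len)}
    {L : Fin T.len → List (Fin S.len)} {μ : Multi C} {ν : Fin T.len → Multi C}
    (hg : Mor.At g r K μ) (hf : ∀ k ∈ K, Mor.At f k (L k) (ν k)) :
    Mor.At (f ≫ g) r (K.flatMap L) (μ.comp (K.map ν)) := by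
  refine ⟨enum_comp hg.1 fun k hk => (hf k hk).1, ?_⟩
  rw [multi_comp hg.1 fun k hk => (hf k hk).1, hg.2]
  congr 1
  exact List.map_congr_left fun k hk => (hf k hk).2

theorem Mor.At.match {f : S ⟶ T} {g : T ⟶ U} {r : Fin U.len} {K : List (Fin T.len)}
    {L : Fin T.len → List (Fin S.len)} {μ : Multi C} {ν : Fin T.len → Multi C}
    (hg : Mor.At g r K μ) (hf : ∀ k ∈ K, Mor.At f k (L k) (ν k)) :
    Multi.Match μ.2.legs (K.map ν) := by
  refine Multi.match_of_map ?_
  rw [hg.objs, List.map_map]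
  exact List.map_congr_left fun k hk => (hf k hk).tgt.symm

theorem comp_assoc (f : S ⟶ T) (g : T ⟶ U) (h : U ⟶ V) : (f ≫ g) ≫ h = f ≫ g ≫ h := by
  refine Mor.At.ext fun r => ?_
  obtain ⟨M, μ, hμ⟩ := Mor.exists_at h r
  choose K ν hν using Mor.exists_at g
  choose L ρ hρ using Mor.exists_at f
  refine ⟨_, _, hμ.comp fun m _ => (hν m).comp fun k _ => hρ k, ?_⟩
  have := (hμ.comp fun m _ => hν m).comp fun k _ => hρ k
  have e := Multi.comp_comp μ M ν (fun m => (K m).map ρ) (hμ.match fun m _ => hν m)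
    fun m _ => (hν m).match fun k _ => hρ k
  rw [List.flatMap_assoc] at this
  rwa [List.map_flatMap, e] at this

/-- A morphism given by a bijection has multimorphisms with a single leg. -/
theorem Mor.at_ofEquiv (e : Fin S.len ≃ Fin T.len)
    (ℓ : ∀ i j, e i = j → ((S.entry i).1 ⟶ (T.entry j).1))
    (f : ∀ i j (h : e i = j), (C.map (ℓ i j h)).functor.obj (S.entry i).2 ⟶ (T.entry j).2)
    {i : Fin S.len} {j : Fin T.len} (h : e i = j) :
    (Mor.ofEquiv e ℓ f).At j [i]
      (Multi.unary (S.entry i) (ℓ i j h) (Arr.mk (f i j h)) rfl) := by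
  have hE : (Mor.ofEquiv e ℓ f).Enum j [i] := by
    refine ⟨List.nodup_singleton i, fun i' => ?_⟩
    rw [List.mem_singleton, ← h]
    exact e.injective.eq_iff.symm
  refine ⟨hE, congrArg (Sigma.mk _) (Block.ext ?_ ?_)⟩
  · rw [blk_legs, List.map_singleton, leg_pos _ (show (Mor.ofEquiv e ℓ f).ψ i = j from h)]; rfl
  · have hF : (Mor.ofEquiv e ℓ f).fibre j = [i] := (enum_fibre _ j).perm hE |>.eq_singleton
    have hr := PermArr.refl (P := C.obj (T.entry j).1)
      (A := fun i => (leg (Mor.ofEquiv e ℓ f) j i).image) [i]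
    rw [blk_arr (by rw [hF]; exact hr), Arr.id_comp' (by rw [arr_src, hF])]
    refine (Arr.mk_eqToHom_comp _ _).trans ?_
    have key : ∀ i' (h' : e i' = j), i' = i → Arr.mk (f i' j h') = Arr.mk (f i j h) := by
      rintro i' h' rfl; rfl
    exact key _ _ (by rw [← h, e.symm_apply_apply])

theorem unary_eq_unit {p q : Σ x : J, C.obj x} (h : p = q) :
    Multi.unary p (eqToHom (congrArg Sigma.fst h)) (Arr.mk (eqToHom (entry_cast h))) rfl =
      Multi.unit p := by
  subst h
  refine congrArg (Sigma.mk _) (Block.ext rfl ?_)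
  change Arr.mk (eqToHom _) = Arr.ident p.2
  rw [Arr.mk_eqToHom, eqToHom_refl, map_id_obj]

/-- The morphism `f` consists of a permutation and identities. -/
def Mor.IsPerm (f : Mor S T) : Prop := ∀ i, f.At (f.ψ i) [i] (Multi.unit (S.entry i))

theorem Mor.isPerm_perm (e : Fin S.len ≃ Fin T.len) (h : ∀ i, S.entry i = T.entry (e i)) :
    (Mor.perm e h).IsPerm := fun i => by
  have := at_ofEquiv e _ (fun i j hj => eqToHom (entry_cast ((h i).trans (congrArg T.entry hj))))
    (i := i) rfl
  rwa [unary_eq_unit (h i)] at this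

theorem isPerm_id (S : Hocolim C) : Mor.IsPerm (𝟙 S) := Mor.isPerm_perm (Equiv.refl _) _

theorem Mor.at_id (i : Fin S.len) : Mor.At (𝟙 S) i [i] (Multi.unit (S.entry i)) := isPerm_id S i

theorem id_comp (f : S ⟶ T) : 𝟙 S ≫ f = f := by
  refine Mor.At.ext fun j => ?_
  obtain ⟨L, μ, h⟩ := Mor.exists_at f j
  refine ⟨L, μ, ?_, h⟩
  have := h.comp (f := 𝟙 S) fun i _ => Mor.at_id i
  rw [h.units, Multi.comp_unit] at this
  simpa using this

theorem comp_id (f : S ⟶ T) : f ≫ 𝟙 T = f := by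
  refine Mor.At.ext fun j => ?_
  obtain ⟨L, μ, h⟩ := Mor.exists_at f j
  refine ⟨L, μ, ?_, h⟩
  have := (Mor.at_id j).comp (f := f) (L := fun _ => L) (ν := fun _ => μ) fun k hk => by
    rw [List.mem_singleton.1 hk]; exact h
  rw [List.map_singleton, Multi.unit_comp h.tgt] at this
  simpa using this

theorem isCat : IsCat (Hocolim C) := ⟨id_comp, comp_id, comp_assoc⟩

namespace Mor

/-- Composing with a permutation morphism renumbers the multimorphisms. -/
theorem At.comp_perm {f : S ⟶ T} {g : T ⟶ U} (hg : IsPerm g) {j : Fin T.len}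
    {L : List (Fin S.len)} {μ : Multi C} (hf : At f j L μ) : At (f ≫ g) (ψ g j) L μ := by
  have := (hg j).comp (f := f) (L := fun _ => L) (ν := fun _ => μ) fun k hk => by
    rw [List.mem_singleton.1 hk]; exact hf
  rw [List.map_singleton, Multi.unit_comp hf.tgt] at this
  simpa using this

/-- Precomposing with a permutation morphism renumbers the legs. -/
theorem At.perm_comp {f : S ⟶ T} (hf : IsPerm f) {g : T ⟶ U} {j : Fin U.len}
    {L : List (Fin S.len)} {μ : Multi C} (hg : At g j (L.map (ψ f)) μ) :
    At (f ≫ g) j L μ := by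
  have h : ∀ k, ∃ i, ψ f i = k := surj f
  choose s hs using h
  have hi : ∀ i, s (ψ f i) = i := by
    intro i
    have h₁ := hf i
    rw [← hs (ψ f i)] at h₁
    have := ((h₁.1.2 (s (ψ f i))).2 rfl)
    exact List.mem_singleton.1 this
  have hf' : ∀ k, At f k [s k] (Multi.unit (T.entry k)) := by
    intro k
    have := hf (s k)
    rw [hs] at this
    have e := this.tgt
    have e' : (Multi.unit (S.entry (s k))).tgt = S.entry (s k) := rfl
    rwa [e'.symm.trans e] at this
  have := hg.comp fun k _ => hf' k
  rw [hg.units, Multi.comp_unit] at this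
  have e' : (L.map (ψ f)).flatMap (fun k => [s k]) = L := by
    rw [List.flatMap_map]
    simp [hi]
  rwa [e'] at this

theorem IsPerm.comp {f : S ⟶ T} {g : T ⟶ U} (hf : IsPerm f) (hg : IsPerm g) : IsPerm (f ≫ g) :=
  fun i => (hf i).comp_perm hg

/-- A permutation morphism is determined by its map of indices. -/
theorem IsPerm.heq {f : Mor S T} {f' : Mor S' T'} (hf : f.IsPerm) (hf' : f'.IsPerm) (hS : S = S')
    (hT : T = T') (h : ∀ i, (f.ψ i : ℕ) = f'.ψ (Fin.cast (congrArg len hS) i)) : HEq f f' := by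
  refine At.heq hS hT fun j => ?_
  obtain ⟨i, rfl⟩ := f.surj j
  refine ⟨_, _, hf i, ?_⟩
  have e : Fin.cast (congrArg len hT) (f.ψ i) = f'.ψ (Fin.cast (congrArg len hS) i) :=
    Fin.ext (h i)
  rw [e]
  have := hf' (Fin.cast (congrArg len hS) i)
  subst hS
  exact this

theorem IsPerm.ext {f f' : Mor S T} (hf : f.IsPerm) (hf' : f'.IsPerm) (h : ∀ i, f.ψ i = f'.ψ i) :
    f = f' :=
  eq_of_heq (hf.heq hf' rfl rfl fun i => congrArg Fin.val (h i))

theorem isPerm_eqToHom (h : S = T) : IsPerm (eqToHom h) := by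
  subst h; exact isPerm_id S

theorem eqToHom_ψ (h : S = T) (i : Fin S.len) :
    ψ (eqToHom h) i = Fin.cast (congrArg len h) i := by
  subst h; rfl

end Mor

/-- The block with the legs of the indices in `L` and the arrow `φ`, the source of which is a sum
over the list `F`. -/
def mkBlk {y : J} {n : ℕ} (leg : Fin n → Leg C y) (F L : List (Fin n)) (φ : Arr (C.obj y)) :
    Block C y :=
  ⟨L.map leg, PermArr.ofLists (fun i => (leg i).image) L F ⊚ φ, by
    rw [Arr.comp_src, PermArr.ofLists_src, PermCat.sum_map]; rfl⟩

/-- Relabelling the indices of a block along `u` when the two arrows differ by the permutation of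
summands that compares the lists `F` and `F'`. -/
theorem mkBlk_eq {y : J} {n m : ℕ} {leg : Fin n → Leg C y} {F L : List (Fin n)}
    {leg' : Fin m → Leg C y} {F' L' : List (Fin m)} {u : Fin m → Fin n} (hu : u.Injective)
    (hL : L = L'.map u) (hF : L'.Perm F')
    (hleg : ∀ i ∈ L', leg (u i) = leg' i) {φ φ' π : Arr (C.obj y)}
    (hφ : φ = (π ⊚ φ')) (hπ : PermArr (C.obj y) (fun i => (leg i).image) F (F'.map u) π) : mkBlk leg F L φ = mkBlk leg' F' L' φ' := by
  subst hL
  subst hφ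
  refine Block.ext ?_ ?_
  · exact List.map_map.trans (List.map_congr_left hleg)
  · obtain ⟨θ, hθ⟩ := PermArr.exists_of_perm (P := C.obj y) (fun i => (leg' i).image) hF
    have hθ' := PermArr.map_index (A := fun i => (leg i).image) hu
      (hθ.congr_family fun i hi => by rw [hleg i hi])
    obtain ⟨ζ, hζ⟩ := PermArr.exists_of_perm (P := C.obj y) (fun i => (leg i).image)
      (hθ'.perm.trans hπ.perm.symm)
    rw [mkBlk, mkBlk]
    dsimp only
    rw [hθ.ofLists_eq, hζ.ofLists_eq, ← Arr.comp_assoc (by rw [hζ.tgt, hπ.src]),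
      (hζ.trans hπ).unique hθ']

theorem reindex_mem_of {P : PermCat.{v, u}} {ι : Type w} [Fintype ι] [LinearOrder ι]
    {κ : Type w'} [Fintype κ] [LinearOrder κ] {A : ι → P} {f : κ → ι} (hf : f.Bijective)
    {α : Type} {v : ι → α} (hv : v.Injective) {B : α → P} (hA : ∀ i, A i = B (v i)) {M : List α}
    (hM : M = (Finset.univ.sort (α := κ)).map fun k => v (f k)) :
    PermArr P B (Finset.univ.sort.map v) M (Arr.mk (P.reindex A f hf)) := by
  have h := PermArr.map_index (A := B) hv ((reindex_mem A f hf).congr_family fun i _ => hA i)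
  rw [List.map_map] at h
  rw [hM]
  exact h

theorem Mor.blk_eq_mkBlk (f : Mor S T) (j : Fin T.len) (L : List (Fin S.len)) :
    f.blk j L = mkBlk (f.leg j) (f.fibre j) L (f.arr j) := rfl

section Sum

variable (f : Mor S S') (g : Mor T T')

open Classical in
/-- The legs of `f ⊕ g` over the index `q`. -/
def sumLeg (q : Fin S'.len ⊕ Fin T'.len) (p : Fin (S.len + T.len)) :
    Leg C (Sum.elim S'.entry T'.entry q).1 :=
  if h : Sum.map f.ψ g.ψ (finSumFinEquiv.symm p) = q then
    ⟨Sum.elim S.entry T.entry (finSumFinEquiv.symm p), sumℓ f g (finSumFinEquiv.symm p) q h⟩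
  else ⟨⟨_, (C.obj _).zero⟩, 𝟙 _⟩

theorem sumLeg_pos {q : Fin S'.len ⊕ Fin T'.len} {p : Fin (S.len + T.len)}
    (h : Sum.map f.ψ g.ψ (finSumFinEquiv.symm p) = q) : sumLeg f g q p =
      ⟨Sum.elim S.entry T.entry (finSumFinEquiv.symm p), sumℓ f g (finSumFinEquiv.symm p) q h⟩ :=
  dif_pos h

theorem sumLeg_inl {i : Fin S.len} {j : Fin S'.len} (h : f.ψ i = j) :
    sumLeg f g (.inl j) (finSumFinEquiv (.inl i)) = f.leg j i := by
  rw [f.leg_pos h]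
  have key : ∀ (p : Fin S.len ⊕ Fin T.len) (hp : Sum.map f.ψ g.ψ p = .inl j), p = .inl i →
      (⟨Sum.elim S.entry T.entry p, sumℓ f g p (.inl j) hp⟩ : Leg C (S'.entry j).1) =
        ⟨S.entry i, f.ℓ i j h⟩ := by
    rintro p hp rfl; rfl
  exact (sumLeg_pos f g (by simp [h])).trans (key _ _ (by simp))

theorem sumLeg_inr {i : Fin T.len} {j : Fin T'.len} (h : g.ψ i = j) :
    sumLeg f g (.inr j) (finSumFinEquiv (.inr i)) = g.leg j i := by
  rw [g.leg_pos h]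
  have key : ∀ (p : Fin S.len ⊕ Fin T.len) (hp : Sum.map f.ψ g.ψ p = .inr j), p = .inr i →
      (⟨Sum.elim S.entry T.entry p, sumℓ f g p (.inr j) hp⟩ : Leg C (T'.entry j).1) =
        ⟨T.entry i, g.ℓ i j h⟩ := by
    rintro p hp rfl; rfl
  exact (sumLeg_pos f g (by simp [h])).trans (key _ _ (by simp))

/-- The multimorphism of `f ⊕ g` over the index `q`. -/
def sumMulti (q : Fin S'.len ⊕ Fin T'.len) (L : List (Fin (S.len + T.len))) : Multi C :=
  ⟨_, mkBlk (sumLeg f g q) ((Finset.univ.sort (α := {p : Fin (S.len + T.len) //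
    Sum.map f.ψ g.ψ (finSumFinEquiv.symm p) = q})).map Subtype.val) L (Arr.mk (sumϱ f g q))⟩

/-- The multimorphisms of a sum of morphisms, for any enumeration of the fibre. -/
theorem addHom_multi (q : Fin (S'.len + T'.len)) {L : List (Fin (S.len + T.len))}
    (hL : Mor.Enum (addHom f g) q L) :
    Mor.multi (addHom f g) q L = sumMulti f g (finSumFinEquiv.symm q) L := by
  refine congrArg (Sigma.mk _) ((Mor.blk_eq_mkBlk _ _ _).trans ?_)
  have hl : ∀ p, p ∈ L → Sum.map f.ψ g.ψ (finSumFinEquiv.symm p) = finSumFinEquiv.symm q :=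
    fun p hp => (Equiv.eq_symm_apply _).2 ((hL.2 p).1 hp)
  refine mkBlk_eq (u := id) Function.injective_id (by simp) ?_ ?_
    (Arr.mk_comp _ _)
    (reindex_mem_of (sumFibre_bijective f g q) Subtype.val_injective (fun i => ?_) ?_)
  · refine (List.perm_ext_iff_of_nodup hL.1
      ((Finset.sort_nodup _ _).map Subtype.val_injective)).2 fun p => ?_
    simp only [List.mem_map, Finset.mem_sort, Finset.mem_univ, true_and, Subtype.exists,
      exists_prop, exists_eq_right]
    exact (hL.2 p).trans (Equiv.eq_symm_apply _).symm
  · intro p hp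
    rw [sumLeg_pos f g (hl p hp)]
    exact Mor.leg_pos _ ((hL.2 p).1 hp)
  · rw [Mor.leg_pos (addHom f g) i.2]; rfl
  · rw [List.map_id]; rfl

theorem sumMulti_inl {j : Fin S'.len} {L : List (Fin S.len)} (hL : f.Enum j L) :
    sumMulti f g (.inl j) (L.map fun i => finSumFinEquiv (.inl i)) = f.multi j L := by
  refine congrArg (Sigma.mk (S'.entry j).1) ?_
  refine mkBlk_eq (u := fun i => finSumFinEquiv (.inl i))
    (finSumFinEquiv.injective.comp Sum.inl_injective) rfl (hL.perm (f.enum_fibre j)) ?_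
    ((Arr.mk_comp _ _).trans (congrArg _ (Arr.mk_eqToHom_comp _ _)))
    (reindex_mem_of (inclLeft_bijective f g j) Subtype.val_injective (fun i => ?_) ?_)
  · intro i hi
    exact sumLeg_inl f g ((hL.2 i).1 hi)
  · rw [sumLeg_pos f g i.2]; rfl
  · exact List.map_map

theorem sumMulti_inr {j : Fin T'.len} {L : List (Fin T.len)} (hL : g.Enum j L) :
    sumMulti f g (.inr j) (L.map fun i => finSumFinEquiv (.inr i)) = g.multi j L := by
  refine congrArg (Sigma.mk (T'.entry j).1) ?_
  refine mkBlk_eq (u := fun i => finSumFinEquiv (.inr i))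
    (finSumFinEquiv.injective.comp Sum.inr_injective) rfl (hL.perm (g.enum_fibre j)) ?_
    ((Arr.mk_comp _ _).trans (congrArg _ (Arr.mk_eqToHom_comp _ _)))
    (reindex_mem_of (inclRight_bijective f g j) Subtype.val_injective (fun i => ?_) ?_)
  · intro i hi
    exact sumLeg_inr f g ((hL.2 i).1 hi)
  · rw [sumLeg_pos f g i.2]; rfl
  · exact List.map_map

variable {f g}

/-- Over an index of the first summand, `f ⊕ g` has the multimorphism of `f`. -/
theorem Mor.At.inl {j : Fin S'.len} {L : List (Fin S.len)} {μ : Multi C} (h : f.At j L μ) :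
    Mor.At (addHom f g) (finSumFinEquiv (.inl j)) (L.map fun i => finSumFinEquiv (.inl i)) μ := by
  have hE : Mor.Enum (addHom f g) (finSumFinEquiv (.inl j))
      (L.map fun i => finSumFinEquiv (.inl i)) := by
    refine ⟨h.1.1.map (finSumFinEquiv.injective.comp Sum.inl_injective), fun p => ?_⟩
    obtain ⟨p, rfl⟩ := finSumFinEquiv.surjective p
    change _ ↔ finSumFinEquiv (Sum.map f.ψ g.ψ (finSumFinEquiv.symm (finSumFinEquiv p))) = _
    rw [Equiv.symm_apply_apply, finSumFinEquiv.injective.eq_iff]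
    cases p with
    | inl i => simp only [List.mem_map, finSumFinEquiv.injective.eq_iff, Sum.inl.injEq,
        exists_eq_right, Sum.map_inl, h.1.2]
    | inr i => simp only [List.mem_map, finSumFinEquiv.injective.eq_iff, reduceCtorEq, and_false,
        exists_false, Sum.map_inr]
  refine ⟨hE, (addHom_multi f g _ hE).trans ?_⟩
  rw [Equiv.symm_apply_apply, sumMulti_inl f g h.1]
  exact h.2

/-- Over an index of the second summand, `f ⊕ g` has the multimorphism of `g`. -/
theorem Mor.At.inr {j : Fin T'.len} {L : List (Fin T.len)} {μ : Multi C} (h : g.At j L μ) :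
    Mor.At (addHom f g) (finSumFinEquiv (.inr j)) (L.map fun i => finSumFinEquiv (.inr i)) μ := by
  have hE : Mor.Enum (addHom f g) (finSumFinEquiv (.inr j))
      (L.map fun i => finSumFinEquiv (.inr i)) := by
    refine ⟨h.1.1.map (finSumFinEquiv.injective.comp Sum.inr_injective), fun p => ?_⟩
    obtain ⟨p, rfl⟩ := finSumFinEquiv.surjective p
    change _ ↔ finSumFinEquiv (Sum.map f.ψ g.ψ (finSumFinEquiv.symm (finSumFinEquiv p))) = _
    rw [Equiv.symm_apply_apply, finSumFinEquiv.injective.eq_iff]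
    cases p with
    | inr i => simp only [List.mem_map, finSumFinEquiv.injective.eq_iff, Sum.inr.injEq,
        exists_eq_right, Sum.map_inr, h.1.2]
    | inl i => simp only [List.mem_map, finSumFinEquiv.injective.eq_iff, reduceCtorEq, and_false,
        exists_false, Sum.map_inl]
  refine ⟨hE, (addHom_multi f g _ hE).trans ?_⟩
  rw [Equiv.symm_apply_apply, sumMulti_inr f g h.1]
  exact h.2

end Sum

end Hocolim

/-! ### The additive structure of the homotopy colimit -/

namespace Hocolim

section Index

variable {n m k N : ℕ}

theorem cast_inl_inl (h : n + m + k = n + (m + k)) (i : Fin n) :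
    Fin.cast h (finSumFinEquiv (.inl (finSumFinEquiv (.inl i)))) = finSumFinEquiv (.inl i) :=
  Fin.ext (by simp)

theorem cast_inl_inr (h : n + m + k = n + (m + k)) (i : Fin m) :
    Fin.cast h (finSumFinEquiv (.inl (finSumFinEquiv (.inr i)))) =
      finSumFinEquiv (.inr (finSumFinEquiv (.inl i))) :=
  Fin.ext (by simp)

theorem cast_inr (h : n + m + k = n + (m + k)) (i : Fin k) :
    Fin.cast h (finSumFinEquiv (.inr i)) = finSumFinEquiv (.inr (finSumFinEquiv (.inr i))) :=
  Fin.ext (by simp [Nat.add_assoc])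

theorem cast_inl (h : n + (m + k) = n + m + k) (i : Fin n) :
    Fin.cast h (finSumFinEquiv (.inl i)) = finSumFinEquiv (.inl (finSumFinEquiv (.inl i))) :=
  Fin.ext (by simp)

theorem cast_inr_inl (h : n + (m + k) = n + m + k) (i : Fin m) :
    Fin.cast h (finSumFinEquiv (.inr (finSumFinEquiv (.inl i)))) =
      finSumFinEquiv (.inl (finSumFinEquiv (.inr i))) :=
  Fin.ext (by simp)

theorem cast_inr_inr (h : n + (m + k) = n + m + k) (i : Fin k) :
    Fin.cast h (finSumFinEquiv (.inr (finSumFinEquiv (.inr i)))) = finSumFinEquiv (.inr i) :=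
  Fin.ext (by simp [Nat.add_assoc])

theorem forall_sum {p : Fin (n + m) → Prop} (hl : ∀ i, p (finSumFinEquiv (.inl i)))
    (hr : ∀ i, p (finSumFinEquiv (.inr i))) (i : Fin (n + m)) : p i := by
  obtain ⟨i, rfl⟩ := finSumFinEquiv.surjective i
  cases i
  · exact hl _
  · exact hr _

end Index

variable {J : PermCat.{v₁, u₁}} {C : J ⥤ PermCat.{v₂, u₂}} {S T U V S' T' U' : Hocolim C}

theorem add_entry_inl (i : Fin S.len) : (add S T).entry (finSumFinEquiv (.inl i)) = S.entry i := by
  simp only [Equiv.symm_apply_apply, Sum.elim_inl]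

theorem add_entry_inr (i : Fin T.len) : (add S T).entry (finSumFinEquiv (.inr i)) = T.entry i := by
  simp only [Equiv.symm_apply_apply, Sum.elim_inr]

theorem comp_ψ (f : S ⟶ T) (g : T ⟶ U) (i : Fin S.len) : Mor.ψ (f ≫ g) i = g.ψ (f.ψ i) := rfl

theorem id_ψ (i : Fin S.len) : Mor.ψ (𝟙 S) i = i := rfl

theorem addHom_ψ_inl (f : Mor S S') (g : Mor T T') (i : Fin S.len) :
    (addHom f g).ψ (finSumFinEquiv (.inl i)) = finSumFinEquiv (.inl (f.ψ i)) := by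
  change finSumFinEquiv (Sum.map f.ψ g.ψ (finSumFinEquiv.symm (finSumFinEquiv _))) = _
  rw [Equiv.symm_apply_apply]; rfl

theorem addHom_ψ_inr (f : Mor S S') (g : Mor T T') (i : Fin T.len) :
    (addHom f g).ψ (finSumFinEquiv (.inr i)) = finSumFinEquiv (.inr (g.ψ i)) := by
  change finSumFinEquiv (Sum.map f.ψ g.ψ (finSumFinEquiv.symm (finSumFinEquiv _))) = _
  rw [Equiv.symm_apply_apply]; rfl

theorem addTwist_ψ_inl (i : Fin S.len) :
    (addTwist S T).ψ (finSumFinEquiv (.inl i)) = finSumFinEquiv (.inr i) := by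
  change finSumFinEquiv (Sum.swap (finSumFinEquiv.symm (finSumFinEquiv _))) = _
  rw [Equiv.symm_apply_apply]; rfl

theorem addTwist_ψ_inr (i : Fin T.len) :
    (addTwist S T).ψ (finSumFinEquiv (.inr i)) = finSumFinEquiv (.inl i) := by
  change finSumFinEquiv (Sum.swap (finSumFinEquiv.symm (finSumFinEquiv _))) = _
  rw [Equiv.symm_apply_apply]; rfl

namespace Mor

theorem isPerm_addTwist (S T : Hocolim C) : IsPerm (addTwist S T) := isPerm_perm _ _

theorem IsPerm.addHom {f : Mor S S'} {g : Mor T T'} (hf : f.IsPerm) (hg : g.IsPerm) :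
    IsPerm (addHom f g) := by
  refine forall_sum (fun i => ?_) fun i => ?_
  · have := (hf i).inl (g := g)
    rwa [← add_entry_inl (T := T), ← addHom_ψ_inl f g] at this
  · have := (hg i).inr (f := f)
    rwa [← add_entry_inr (S := S), ← addHom_ψ_inr f g] at this

/-- The multimorphisms of a composite, for an enumeration with repetitions allowed in the index
type. -/
theorem At.comp_map {κ : Type w} {f : S ⟶ T} {g : T ⟶ U} {r : Fin U.len} {N : List κ}
    {t : κ → Fin T.len} {L : κ → List (Fin S.len)} {μ : Multi C} {ν : κ → Multi C}
    (hg : At g r (N.map t) μ) (hf : ∀ k ∈ N, At f (t k) (L k) (ν k)) :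
    At (f ≫ g) r (N.flatMap L) (μ.comp (N.map ν)) := by
  classical
  have h : ∀ p, ∃ L' ν', ∀ k ∈ N, t k = p → L' = L k ∧ ν' = ν k := by
    intro p
    by_cases hp : ∃ k ∈ N, t k = p
    · obtain ⟨k, hk, rfl⟩ := hp
      refine ⟨L k, ν k, fun k' hk' e => ?_⟩
      rw [List.inj_on_of_nodup_map hg.1.1 hk' hk e]
      exact ⟨rfl, rfl⟩
    · exact ⟨[], Multi.unit (T.entry p), fun k hk e => absurd ⟨k, hk, e⟩ hp⟩
  choose L' ν' h using h
  have := hg.comp (f := f) (L := L') (ν := ν') (by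
    intro p hp
    obtain ⟨k, hk, rfl⟩ := List.mem_map.1 hp
    obtain ⟨e, e'⟩ := h _ k hk rfl
    rw [e, e']; exact hf k hk)
  rw [List.flatMap_map, List.map_map] at this
  have e₁ : N.flatMap (fun k => L' (t k)) = N.flatMap L :=
    List.flatMap_congr fun k hk => (h _ k hk rfl).1
  have e₂ : N.map (ν' ∘ t) = N.map ν := List.map_congr_left fun k hk => (h _ k hk rfl).2
  rwa [e₁, e₂] at this

end Mor

theorem addHom_id (S T : Hocolim C) : addHom (𝟙 S) (𝟙 T) = 𝟙 (add S T) :=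
  ((isPerm_id S).addHom (isPerm_id T)).ext (isPerm_id _)
    (forall_sum (fun i => addHom_ψ_inl _ _ i) fun i => addHom_ψ_inr _ _ i)

theorem addHom_comp (f : S ⟶ T) (f' : T ⟶ U) (g : S' ⟶ T') (g' : T' ⟶ U') :
    addHom (f ≫ f') (g ≫ g') = addHom f g ≫ addHom f' g' := by
  refine Mor.At.ext (forall_sum (fun r => ?_) fun r => ?_)
  · obtain ⟨K, μ, hμ⟩ := Mor.exists_at f' r
    choose L ν hν using Mor.exists_at f
    refine ⟨_, _, (hμ.comp fun k _ => hν k).inl, ?_⟩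
    rw [List.map_flatMap]
    exact (Mor.At.inl (g := g') hμ).comp_map fun k _ => (hν k).inl
  · obtain ⟨K, μ, hμ⟩ := Mor.exists_at g' r
    choose L ν hν using Mor.exists_at g
    refine ⟨_, _, (hμ.comp fun k _ => hν k).inr, ?_⟩
    rw [List.map_flatMap]
    exact (Mor.At.inr (f := f') hμ).comp_map fun k _ => (hν k).inr

theorem add_assoc (S T U : Hocolim C) : add (add S T) U = add S (add T U) := by
  refine ext_entry (Nat.add_assoc _ _ _) (forall_sum (forall_sum (fun i => ?_) fun i => ?_)
    fun i => ?_)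
  · rw [cast_inl_inl]; simp only [Equiv.symm_apply_apply, Sum.elim_inl]
  · rw [cast_inl_inr]; simp only [Equiv.symm_apply_apply, Sum.elim_inl, Sum.elim_inr]
  · rw [cast_inr]; simp only [Equiv.symm_apply_apply, Sum.elim_inr]

theorem addHom_assoc (f : S ⟶ S') (g : T ⟶ T') (h : U ⟶ U') :
    HEq (addHom (addHom f g) h) (addHom f (addHom g h)) := by
  refine Mor.At.heq (add_assoc _ _ _) (add_assoc _ _ _) (forall_sum (forall_sum (fun r => ?_)
    fun r => ?_) fun r => ?_)
  · obtain ⟨L, μ, hμ⟩ := Mor.exists_at f r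
    refine ⟨_, _, hμ.inl.inl, ?_⟩
    have := hμ.inl (g := addHom g h)
    rw [List.map_map, List.map_map, cast_inl_inl]
    convert this using 2
    exact funext fun i => cast_inl_inl (Nat.add_assoc _ _ _) i
  · obtain ⟨L, μ, hμ⟩ := Mor.exists_at g r
    refine ⟨_, _, hμ.inr.inl, ?_⟩
    have := (hμ.inl (g := h)).inr (f := f)
    rw [List.map_map] at this ⊢
    rw [List.map_map, cast_inl_inr]
    convert this using 2
    exact funext fun i => cast_inl_inr (Nat.add_assoc _ _ _) i
  · obtain ⟨L, μ, hμ⟩ := Mor.exists_at h r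
    refine ⟨_, _, hμ.inr, ?_⟩
    have := (hμ.inr (f := g)).inr (f := f)
    rw [List.map_map] at this ⊢
    rw [cast_inr]
    convert this using 2
    exact funext fun i => cast_inr (Nat.add_assoc _ _ _) i

theorem addTwist_natural (f : S ⟶ S') (g : T ⟶ T') :
    addHom f g ≫ addTwist S' T' = addTwist S T ≫ addHom g f := by
  refine Mor.At.ext (forall_sum (fun r => ?_) fun r => ?_)
  · obtain ⟨L, μ, hμ⟩ := Mor.exists_at g r
    have h := (hμ.inr (f := f)).comp_perm (Mor.isPerm_addTwist S' T')
    refine ⟨_, _, by rwa [addTwist_ψ_inr] at h, Mor.At.perm_comp (Mor.isPerm_addTwist S T) ?_⟩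
    rw [List.map_map]
    convert hμ.inl using 2
    exact funext fun i => addTwist_ψ_inr i
  · obtain ⟨L, μ, hμ⟩ := Mor.exists_at f r
    have h := (hμ.inl (g := g)).comp_perm (Mor.isPerm_addTwist S' T')
    refine ⟨_, _, by rwa [addTwist_ψ_inl] at h, Mor.At.perm_comp (Mor.isPerm_addTwist S T) ?_⟩
    rw [List.map_map]
    convert hμ.inr using 2
    exact funext fun i => addTwist_ψ_inl i

theorem addTwist_add (S T U : Hocolim C) : HEq (addTwist (add S T) U)
    (addHom (𝟙 S) (addTwist T U) ≫ eqToHom (add_assoc S U T).symm ≫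
      addHom (addTwist S U) (𝟙 T)) := by
  refine (Mor.isPerm_addTwist _ _).heq
    (((isPerm_id S).addHom (Mor.isPerm_addTwist T U)).comp
      ((Mor.isPerm_eqToHom _).comp ((Mor.isPerm_addTwist S U).addHom (isPerm_id T))))
    (add_assoc _ _ _) (add_assoc _ _ _).symm (forall_sum (forall_sum (fun i => ?_) fun i => ?_)
    fun i => ?_)
  · rw [cast_inl_inl, comp_ψ, comp_ψ, addHom_ψ_inl, Mor.eqToHom_ψ, addTwist_ψ_inl, id_ψ, cast_inl,
      addHom_ψ_inl, addTwist_ψ_inl]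
    simp
  · rw [cast_inl_inr, comp_ψ, comp_ψ, addHom_ψ_inr, Mor.eqToHom_ψ, addTwist_ψ_inl, addTwist_ψ_inl,
      cast_inr_inr, addHom_ψ_inr, id_ψ]
    simp [Nat.add_assoc]
  · rw [cast_inr, comp_ψ, comp_ψ, addHom_ψ_inr, Mor.eqToHom_ψ, addTwist_ψ_inr, addTwist_ψ_inr,
      cast_inr_inl, addHom_ψ_inl, addTwist_ψ_inr]
    simp

theorem isZerolessPermutative : IsZerolessPermutative (addData (C := C)) where
  isCat := isCat
  addHom_id := addHom_id
  addHom_comp := addHom_comp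
  add_assoc := add_assoc
  addHom_assoc := addHom_assoc
  twist_natural := addTwist_natural
  twist_twist S T := ((Mor.isPerm_addTwist S T).comp (Mor.isPerm_addTwist T S)).ext (isPerm_id _)
    (forall_sum (fun i => by rw [comp_ψ, addTwist_ψ_inl, addTwist_ψ_inr]; rfl)
      fun i => by rw [comp_ψ, addTwist_ψ_inr, addTwist_ψ_inl]; rfl)
  twist_add := addTwist_add

end Hocolim

/-! ### Products of arrows and left distributivity over lists -/

variable {J : PermCat.{v₁, u₁}} {C : J ⥤ PermCat.{v₂, u₂}}

namespace GradedMul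

open Arr

variable (M : GradedMul J C) {x y z t : J} {ι : Type w} {κ : Type w'}

/-- The product of arrows. -/
def tensor (φ : Arr (C.obj x)) (θ : Arr (C.obj y)) : Arr (C.obj (J.add x y)) :=
  Arr.mk (M.mulHom φ.hom θ.hom)

@[simp] theorem tensor_src (φ : Arr (C.obj x)) (θ : Arr (C.obj y)) :
    (M.tensor φ θ).src = M.mul φ.src θ.src := rfl

@[simp] theorem tensor_tgt (φ : Arr (C.obj x)) (θ : Arr (C.obj y)) :
    (M.tensor φ θ).tgt = M.mul φ.tgt θ.tgt := rfl

theorem tensor_id (a : C.obj x) (b : C.obj y) :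
    M.tensor (ident a) (ident b) = ident (M.mul a b) :=
  congrArg Arr.mk (M.mulHom_id a b)

theorem tensor_comp {φ φ' : Arr (C.obj x)} {θ θ' : Arr (C.obj y)} (h : φ.tgt = φ'.src)
    (h' : θ.tgt = θ'.src) : M.tensor (φ ⊚ φ') (θ ⊚ θ') = M.tensor φ θ ⊚ M.tensor φ' θ' := by
  obtain ⟨f⟩ := φ
  obtain ⟨f'⟩ := φ'
  obtain ⟨g⟩ := θ
  obtain ⟨g'⟩ := θ'
  dsimp only at h h'
  subst h
  subst h'
  rw [← mk_comp, ← mk_comp]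
  exact (congrArg Arr.mk (M.mulHom_comp _ _ _ _)).trans (mk_comp _ _)

theorem tensor_eq (φ : Arr (C.obj x)) (θ : Arr (C.obj y)) :
    M.tensor φ θ = M.tensor (ident φ.src) θ ⊚ M.tensor φ (ident θ.tgt) := by
  rw [← M.tensor_comp rfl rfl, Arr.id_comp, Arr.comp_id]

theorem add_tensor (φ φ' : Arr (C.obj x)) (θ : Arr (C.obj y)) :
    M.tensor (φ + φ') θ = M.tensor φ θ + M.tensor φ' θ :=
  mk_eq (M.add_mul _ _ _) (M.add_mul _ _ _) (M.add_mulHom _ _ _)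

theorem zero_tensor (θ : Arr (C.obj y)) : M.tensor (0 : Arr (C.obj x)) θ = 0 :=
  mk_eq (M.zero_mul _) (M.zero_mul _) (M.zero_mulHom _)

theorem tensor_zero (φ : Arr (C.obj x)) : M.tensor φ (0 : Arr (C.obj y)) = 0 :=
  mk_eq (M.mul_zero _) (M.mul_zero _) (M.mulHom_zero _)

theorem tensor_tw (a a' : C.obj x) (b : C.obj y) :
    M.tensor (tw a a') (ident b) = tw (M.mul a b) (M.mul a' b) :=
  mk_eq (M.add_mul _ _ _) (M.add_mul _ _ _) (M.twist_mulHom _ _ _)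

theorem sum_mul (a : ι → C.obj x) (b : C.obj y) (L : List ι) :
    M.mul ((C.obj x).sum a L) b = (C.obj (J.add x y)).sum (fun i => M.mul (a i) b) L := by
  induction L with
  | nil => exact M.zero_mul b
  | cons i L ih => simp only [PermCat.sum, M.add_mul, ih]

theorem sum_tensor (φ : ι → Arr (C.obj x)) (θ : Arr (C.obj y)) (L : List ι) :
    M.tensor (L.map φ).sum θ = (L.map fun i => M.tensor (φ i) θ).sum := by
  induction L with
  | nil => exact M.zero_tensor θ
  | cons i L ih => simp only [List.map_cons, List.sum_cons, add_tensor, ih]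

theorem map_tensor (k : x ⟶ z) (l : y ⟶ t) (φ : Arr (C.obj x)) (θ : Arr (C.obj y)) :
    (M.tensor φ θ).map (C.map (J.addHom k l)).functor =
      M.tensor (φ.map (C.map k).functor) (θ.map (C.map l).functor) :=
  mk_eq (M.map_mul k l _ _) (M.map_mul k l _ _) (M.map_mulHom k l _ _)

theorem tensor_assoc (φ : Arr (C.obj x)) (θ : Arr (C.obj y)) (ζ : Arr (C.obj z)) :
    (M.tensor (M.tensor φ θ) ζ).map (gradeCast C (J.add_assoc x y z)) =
      M.tensor φ (M.tensor θ ζ) :=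
  mk_eq (M.mul_assoc _ _ _) (M.mul_assoc _ _ _) (M.mulHom_assoc _ _ _)

theorem one_tensor (θ : Arr (C.obj y)) :
    (M.tensor (ident M.one) θ).map (gradeCast C (J.zero_add y)) = θ :=
  mk_eq (M.one_mul _) (M.one_mul _) (M.one_mulHom _)

theorem tensor_one (φ : Arr (C.obj x)) :
    (M.tensor φ (ident M.one)).map (gradeCast C (J.add_zero x)) = φ :=
  mk_eq (M.mul_one _) (M.mul_one _) (M.mulHom_one _)

/-- Multiplication by `b` from the right, as a strict symmetric monoidal functor. -/
def mulRight (x : J) (b : C.obj y) : StrictHom (C.obj x) (C.obj (J.add x y)) where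
  functor :=
    { obj := fun a => M.mul a b
      map := fun f => M.mulHom f (𝟙 b)
      map_id := fun a => M.mulHom_id a b
      map_comp := fun f g => by rw [← M.mulHom_comp, Category.comp_id] }
  obj_zero := M.zero_mul b
  obj_add := fun a a' => M.add_mul a a' b
  map_addHom := fun f g => M.add_mulHom f g (𝟙 b)
  map_twist := fun a a' => M.twist_mulHom a a' b

theorem _root_.PermArr.tensor_id {A : ι → C.obj x} {L L' : List ι} {φ : Arr (C.obj x)}
    (h : PermArr (C.obj x) A L L' φ) (b : C.obj y) :
    PermArr (C.obj (J.add x y)) (fun i => M.mul (A i) b) L L' (M.tensor φ (ident b)) :=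
  h.map_family (M.mulRight x b)

end GradedMul

namespace GradedStrictlyBimonoidal

open Arr

variable (B : GradedStrictlyBimonoidal J C) {x y z t : J} {ι : Type w} {κ : Type w'}

/-- The left distributivity isomorphism as an arrow. -/
def dl (a : C.obj x) (b b' : C.obj y) : Arr (C.obj (J.add x y)) := Arr.mk (B.leftDist a b b')

@[simp] theorem dl_src (a : C.obj x) (b b' : C.obj y) :
    (B.dl a b b').src = (C.obj (J.add x y)).add (B.mul a b) (B.mul a b') := rfl

@[simp] theorem dl_tgt (a : C.obj x) (b b' : C.obj y) :
    (B.dl a b b').tgt = B.mul a ((C.obj y).add b b') := rfl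

theorem dl_natural (φ : Arr (C.obj x)) (θ θ' : Arr (C.obj y)) :
    (B.tensor φ θ + B.tensor φ θ') ⊚ B.dl φ.tgt θ.tgt θ'.tgt =
      B.dl φ.src θ.src θ'.src ⊚ B.tensor φ (θ + θ') := by
  refine (mk_comp _ _).symm.trans (Eq.trans ?_ (mk_comp _ _))
  exact congrArg Arr.mk (B.leftDist_natural _ _ _)

theorem map_dl (k : x ⟶ z) (l : y ⟶ t) (a : C.obj x) (b b' : C.obj y) :
    (B.dl a b b').map (C.map (J.addHom k l)).functor =
      B.dl ((C.map k).functor.obj a) ((C.map l).functor.obj b) ((C.map l).functor.obj b') :=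
  mk_eq (by rw [dl_src, (C.map (J.addHom k l)).obj_add, B.map_mul, B.map_mul])
    (by rw [dl_tgt, B.map_mul, (C.map l).obj_add]) (B.map_leftDist k l a b b')

theorem dl_twist (a : C.obj x) (b b' : C.obj y) :
    B.dl a b b' ⊚ B.tensor (ident a) (tw b b') =
      tw (B.mul a b) (B.mul a b') ⊚ B.dl a b' b := by
  refine (mk_comp _ _).symm.trans (Eq.trans ?_ (mk_comp _ _))
  exact congrArg Arr.mk (B.leftDistLaws.twist a b b')

theorem dl_assoc (a : C.obj x) (b : C.obj y) (c c' : C.obj z) :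
    (B.dl (B.mul a b) c c').map (gradeCast C (J.add_assoc x y z)) =
      B.dl a (B.mul b c) (B.mul b c') ⊚ B.tensor (ident a) (B.dl b c c') := by
  refine Eq.trans ?_ (mk_comp _ _)
  exact mk_eq (by rw [dl_src, (C.map (eqToHom (J.add_assoc x y z))).obj_add, B.mul_assoc, B.mul_assoc])
    (B.mul_assoc _ _ _) (B.leftDistLaws.assoc a b c c')

theorem dl_pentagon (a a' : C.obj x) (b b' : C.obj y) :
    B.dl a b b' + B.dl a' b b' =
      (ident (B.mul a b) + tw (B.mul a b') (B.mul a' b) + ident (B.mul a' b')) ⊚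
        B.dl ((C.obj x).add a a') b b' := by
  exact (mk_eq (by simp only [(C.obj (J.add x y)).add_assoc]) (B.add_mul _ _ _).symm
    (B.leftDistLaws.pentagon a a' b b')).trans
    ((mk_comp _ _).trans (congrArg _ (mk_eqToHom_comp _ _)))

theorem dl_mul (a : C.obj x) (b b' : C.obj y) (c : C.obj z) :
    (B.tensor (B.dl a b b') (ident c)).map (gradeCast C (J.add_assoc x y z)) =
      B.dl a (B.mul b c) (B.mul b' c) :=
  mk_eq (by rw [GradedMul.tensor_src, dl_src, id_src, B.add_mul,
      (C.map (eqToHom (J.add_assoc x y z))).obj_add, B.mul_assoc, B.mul_assoc])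
    (by rw [GradedMul.tensor_tgt, dl_tgt, id_tgt, B.mul_assoc, B.add_mul]) (B.leftDist_mul a b b' c)

theorem dl_add (a : C.obj x) (b b' b'' : C.obj y) :
    (B.dl a b b' + ident (B.mul a b'')) ⊚ B.dl a ((C.obj y).add b b') b'' =
      (ident (B.mul a b) + B.dl a b' b'') ⊚ B.dl a b ((C.obj y).add b' b'') := by
  refine (mk_comp _ _).symm.trans (Eq.trans ?_ (mk_comp _ _))
  exact mk_eq ((C.obj _).add_assoc _ _ _) (by rw [(C.obj y).add_assoc]) (B.leftDist_add a b b' b'')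

/-- An idempotent isomorphism is an identity. -/
theorem _root_.Arr.eq_id_of_idem {X : Type u} [Category.{v} X] {a b : X} (f : a ⟶ b) [IsIso f]
    (h : a = b) (hf : Arr.mk f ⊚ Arr.mk f = Arr.mk f) : Arr.mk f = ident a := by
  subst h
  rw [← mk_comp, mk_inj] at hf
  have : f = 𝟙 a := by
    rw [← cancel_mono f, hf, Category.id_comp]
  rw [this]; rfl

/-- This is `dl_mul` for `c = 0`: its left side is a product with a zero object, hence an identity. -/
theorem dl_zero_zero (a : C.obj x) :
    B.dl a (C.obj y).zero (C.obj y).zero = ident (C.obj (J.add x y)).zero := by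
  have h := B.dl_mul a (C.obj y).zero (C.obj y).zero (C.obj J.zero).zero
  rw [B.zero_mul, ← zero_def, B.tensor_zero, Arr.map_zero (C.map (eqToHom _))] at h
  have key : ∀ y' : J, J.add y J.zero = y' →
      B.dl a (C.obj y').zero (C.obj y').zero = ident (C.obj (J.add x y')).zero := by
    rintro _ rfl
    exact h.symm
  exact key y (J.add_zero y)

/-- By `dl_add` and `dl_zero_zero` the distributivity for `(a, b, 0)` is idempotent. -/
theorem dl_zero_right (a : C.obj x) (b : C.obj y) :
    B.dl a b (C.obj y).zero = ident (B.mul a b) := by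
  have h := B.dl_add a b (C.obj y).zero (C.obj y).zero
  simp only [B.dl_zero_zero, B.mul_zero, (C.obj y).add_zero] at h
  rw [← zero_def, add_zero, add_zero, id_comp' (by
    rw [dl_src, B.mul_zero, (C.obj (J.add x y)).add_zero])] at h
  have := B.isIso_leftDist a b (C.obj y).zero
  refine (eq_id_of_idem (B.leftDist a b (C.obj y).zero) ?_ h).trans ?_
  · rw [B.mul_zero, (C.obj (J.add x y)).add_zero, (C.obj y).add_zero]
  · rw [B.mul_zero, (C.obj (J.add x y)).add_zero]

/-- By `dl_add` and `dl_zero_zero` the distributivity for `(a, 0, b)` is idempotent. -/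
theorem dl_zero_left (a : C.obj x) (b : C.obj y) :
    B.dl a (C.obj y).zero b = ident (B.mul a b) := by
  have h := B.dl_add a (C.obj y).zero (C.obj y).zero b
  simp only [B.dl_zero_zero, B.mul_zero, (C.obj y).zero_add] at h
  rw [← zero_def, zero_add, zero_add, id_comp' (by
    rw [dl_src, B.mul_zero, (C.obj (J.add x y)).zero_add])] at h
  have := B.isIso_leftDist a (C.obj y).zero b
  refine (eq_id_of_idem (B.leftDist a (C.obj y).zero b) ?_ h.symm).trans ?_
  · rw [B.mul_zero, (C.obj (J.add x y)).zero_add, (C.obj y).zero_add]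
  · rw [B.mul_zero, (C.obj (J.add x y)).zero_add]

/-- The pentagon for `a = a' = 0` makes the distributivity for `(0, b, b')` idempotent. -/
theorem zero_dl (b b' : C.obj y) :
    B.dl (C.obj x).zero b b' = ident (C.obj (J.add x y)).zero := by
  have h := B.dl_pentagon (C.obj x).zero (C.obj x).zero b b'
  have e : B.dl (C.obj x).zero b b' + B.dl (C.obj x).zero b b' =
      B.dl (C.obj x).zero b b' ⊚ B.dl (C.obj x).zero b b' := by
    have h₁ : (B.dl (C.obj x).zero b b').tgt = (C.obj (J.add x y)).zero := B.zero_mul _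
    have h₂ : (B.dl (C.obj x).zero b b').src = (C.obj (J.add x y)).zero := by
      rw [dl_src, B.zero_mul, B.zero_mul, (C.obj (J.add x y)).zero_add]
    generalize B.dl (C.obj x).zero b b' = ε at h₁ h₂
    -- the sum of two endomorphisms of the zero object is their composite
    have h₃ := add_comp (φ := ε) (φ' := 0) (θ := 0) (θ' := ε) h₁ h₂.symm
    rw [add_zero, zero_add] at h₃
    rw [h₃, zero_def, comp_id, id_comp' h₂.symm]
  rw [e] at h
  simp only [B.zero_mul, (C.obj x).zero_add, tw_zero] at h
  rw [← zero_def, zero_add, zero_add, zero_def, id_comp' (by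
    rw [dl_src, B.zero_mul, B.zero_mul, (C.obj (J.add x y)).zero_add])] at h
  have := B.isIso_leftDist (C.obj x).zero b b'
  refine (eq_id_of_idem (B.leftDist (C.obj x).zero b b') ?_ h).trans ?_
  · rw [B.zero_mul, B.zero_mul, B.zero_mul, (C.obj (J.add x y)).zero_add]
  · rw [B.zero_mul, B.zero_mul, (C.obj (J.add x y)).zero_add]

theorem _root_.map_gradeCast_refl (φ : Arr (C.obj x)) (h : x = x) : φ.map (gradeCast C h) = φ := by
  rw [gradeCast, eqToHom_refl, C.map_id]; rfl

theorem _root_.map_gradeCast_map (φ : Arr (C.obj x)) (h : x = y) (h' : y = z) :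
    (φ.map (gradeCast C h)).map (gradeCast C h') = φ.map (gradeCast C (h.trans h')) := by
  subst h
  rw [map_gradeCast_refl]

/-- The left distributivity is compatible with identifications of the degrees. -/
theorem dl_cast (h : x = z) (h' : y = t) (a : C.obj x) (b b' : C.obj y) :
    (B.dl a b b').map (gradeCast C (congrArg₂ J.add h h')) =
      B.dl ((gradeCast C h).obj a) ((gradeCast C h').obj b) ((gradeCast C h').obj b') := by
  subst h
  subst h'
  rw [map_gradeCast_refl]
  simp only [gradeCast, eqToHom_refl, Hocolim.map_id_obj]

/-- By `dl_assoc` for `a = b = 1`, the distributivity for `a = 1` is idempotent after the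
identification of `0 + y` with `y`. -/
theorem dl_one (b b' : C.obj y) :
    (B.dl B.one b b').map (gradeCast C (J.zero_add y)) = ident ((C.obj y).add b b') := by
  have h := congrArg (Arr.map (gradeCast C ((J.zero_add (J.add J.zero y)).trans (J.zero_add y))))
    (B.dl_assoc B.one B.one b b')
  rw [map_gradeCast_map, Arr.map_comp _ (by simp),
    ← map_gradeCast_map (B.dl B.one _ _) (congrArg₂ J.add rfl (J.zero_add y)) (J.zero_add y),
    ← map_gradeCast_map (B.tensor _ _) (J.zero_add _) (J.zero_add y), B.one_tensor] at h
  have e : ∀ {w : J.carrier} (h : w = w) (a : C.obj w), (gradeCast C h).obj a = a :=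
    fun _ a => Hocolim.map_id_obj _ a
  have h₁ := B.dl_cast (J.zero_add J.zero) (rfl : y = y) (B.mul B.one B.one) b b'
  have h₂ := B.dl_cast (rfl : J.zero = J.zero) (J.zero_add y) B.one (B.mul B.one b) (B.mul B.one b')
  rw [B.one_mul, e, e] at h₁
  rw [B.one_mul, B.one_mul, e] at h₂
  rw [h₂, ← map_gradeCast_map _ (congrArg₂ J.add (J.zero_add J.zero) rfl) (J.zero_add y), h₁] at h
  have := B.isIso_leftDist B.one b b'
  have hs : (gradeCast C (J.zero_add y)).obj (B.dl B.one b b').src = (C.obj y).add b b' := by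
    rw [dl_src, (C.map (eqToHom (J.zero_add y))).obj_add, B.one_mul, B.one_mul]
  have ht : (gradeCast C (J.zero_add y)).obj (B.dl B.one b b').tgt = (C.obj y).add b b' := by
    rw [dl_tgt, B.one_mul]
  refine (eq_id_of_idem ((gradeCast C (J.zero_add y)).map (B.leftDist B.one b b'))
    (hs.trans ht.symm) h.symm).trans ?_
  exact congrArg ident hs

/-- The iterated left distributivity isomorphism. -/
def dlSum (a : C.obj x) (b : ι → C.obj y) : List ι → Arr (C.obj (J.add x y))
  | [] => 0
  | i :: L => (ident (B.mul a (b i)) + dlSum a b L) ⊚ B.dl a (b i) ((C.obj y).sum b L)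

theorem dlSum_src_tgt (a : C.obj x) (b : ι → C.obj y) (L : List ι) :
    (B.dlSum a b L).src = (C.obj (J.add x y)).sum (fun i => B.mul a (b i)) L ∧
      (B.dlSum a b L).tgt = B.mul a ((C.obj y).sum b L) := by
  induction L with
  | nil => exact ⟨rfl, (B.mul_zero a).symm⟩
  | cons i L ih =>
    rw [dlSum, comp_tgt (by rw [add_tgt, ih.2]; rfl)]
    exact ⟨by rw [comp_src, add_src, ih.1]; rfl, rfl⟩

@[simp] theorem dlSum_src (a : C.obj x) (b : ι → C.obj y) (L : List ι) :
    (B.dlSum a b L).src = (C.obj (J.add x y)).sum (fun i => B.mul a (b i)) L :=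
  (B.dlSum_src_tgt a b L).1

@[simp] theorem dlSum_tgt (a : C.obj x) (b : ι → C.obj y) (L : List ι) :
    (B.dlSum a b L).tgt = B.mul a ((C.obj y).sum b L) :=
  (B.dlSum_src_tgt a b L).2

theorem mk_leftDistSum (a : C.obj x) {ι : Type} (b : ι → C.obj y) (L : List ι) :
    Arr.mk (Hocolim.leftDistSum B.toGradedMul B.leftDist a b L) = B.dlSum a b L := by
  induction L with
  | nil => exact (mk_eqToHom _).trans rfl
  | cons i L ih => exact (mk_comp _ _).trans (by rw [dlSum, ← ih]; rfl)

theorem dlSum_congr {a : C.obj x} {b b' : ι → C.obj y} {L : List ι} (h : ∀ i ∈ L, b i = b' i) :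
    B.dlSum a b L = B.dlSum a b' L := by
  induction L with
  | nil => rfl
  | cons i L ih =>
    simp only [List.forall_mem_cons] at h
    rw [dlSum, dlSum, ih h.2, h.1, PermCat.sum_congr _ h.2]

theorem dlSum_map_index (a : C.obj x) (b : ι → C.obj y) (f : κ → ι) (L : List κ) :
    B.dlSum a b (L.map f) = B.dlSum a (fun k => b (f k)) L := by
  induction L with
  | nil => rfl
  | cons i L ih => rw [List.map_cons, dlSum, dlSum, ih, PermCat.sum_map]

theorem dlSum_singleton (a : C.obj x) (b : ι → C.obj y) (i : ι) :
    B.dlSum a b [i] = ident (B.mul a (b i)) := by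
  rw [dlSum, dlSum, add_zero, PermCat.sum, dl_zero_right, comp_id]

theorem zero_dlSum (b : ι → C.obj y) (L : List ι) : B.dlSum (C.obj x).zero b L = 0 := by
  induction L with
  | nil => rfl
  | cons i L ih => rw [dlSum, ih, add_zero, zero_dl, comp_id, B.zero_mul]; rfl

theorem dlSum_natural (φ : Arr (C.obj x)) (θ : ι → Arr (C.obj y)) (L : List ι) :
    (L.map fun i => B.tensor φ (θ i)).sum ⊚ B.dlSum φ.tgt (fun i => (θ i).tgt) L =
      B.dlSum φ.src (fun i => (θ i).src) L ⊚ B.tensor φ (L.map θ).sum := by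
  induction L with
  | nil =>
    refine (comp_id _ _).trans ?_
    exact ((congrArg (_ ⊚ ·) (B.tensor_zero φ)).trans (comp_id _ _)).symm
  | cons i L ih =>
    have h := B.dl_natural φ (θ i) (L.map θ).sum
    rw [sum_src, sum_tgt] at h
    rw [List.map_cons, List.sum_cons, List.map_cons, List.sum_cons, dlSum, dlSum,
      comp_assoc (by simp), ← h, ← comp_assoc (by simp), ← comp_assoc (by simp),
      add_comp (by simp) (by simp), add_comp (by simp) (by simp), ih, comp_id, id_comp' (by simp)]

/-- The iterated left distributivity of a concatenation first distributes over the two parts. -/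
theorem dlSum_append (a : C.obj x) (b : ι → C.obj y) (L M : List ι) :
    B.dlSum a b (L ++ M) = (B.dlSum a b L + B.dlSum a b M) ⊚
      B.dl a ((C.obj y).sum b L) ((C.obj y).sum b M) := by
  induction L with
  | nil =>
    rw [List.nil_append, dlSum, zero_add, PermCat.sum, dl_zero_left, comp_id]
  | cons i L ih =>
    rw [List.cons_append, dlSum, ih, dlSum, PermCat.sum_append, id_add_comp (by simp),
      comp_assoc (by simp), ← B.dl_add, ← comp_assoc (by simp [PermCat.add_assoc]), PermCat.sum]
    congr 1
    have h := add_comp (φ := ident (B.mul a (b i)) + B.dlSum a b L) (φ' := B.dlSum a b M)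
      (θ := B.dl a (b i) ((C.obj y).sum b L)) (θ' := ident (B.mul a ((C.obj y).sum b M)))
      (by simp) (by simp)
    rw [comp_id, _root_.add_assoc] at h
    exact h

/-- The iterated left distributivity over a list of lists is computed in two steps. -/
theorem dlSum_flatMap (a : C.obj x) (b : ι → C.obj y) (L : List κ) (N : κ → List ι) :
    B.dlSum a b (L.flatMap N) = (L.map fun k => B.dlSum a b (N k)).sum ⊚
      B.dlSum a (fun k => (C.obj y).sum b (N k)) L := by
  induction L with
  | nil => exact (comp_id _ _).symm
  | cons k L ih =>
    rw [List.flatMap_cons, dlSum_append, ih, List.map_cons, List.sum_cons, dlSum,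
      ← comp_assoc (by simp), add_comp (by simp) (by simp), comp_id, PermCat.sum_flatMap]

theorem map_dlSum (k : x ⟶ z) (l : y ⟶ t) (a : C.obj x) (b : ι → C.obj y) (L : List ι) :
    (B.dlSum a b L).map (C.map (J.addHom k l)).functor =
      B.dlSum ((C.map k).functor.obj a) (fun i => (C.map l).functor.obj (b i)) L := by
  induction L with
  | nil => exact Arr.map_zero _
  | cons i L ih =>
    rw [dlSum, dlSum, map_comp _ (by simp), map_add, map_id, ih, B.map_mul, map_dl,
      StrictHom.obj_sum]

theorem dlSum_mul (a : C.obj x) (b : ι → C.obj y) (c : C.obj z) (L : List ι) :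
    (B.tensor (B.dlSum a b L) (ident c)).map (gradeCast C (J.add_assoc x y z)) =
      B.dlSum a (fun i => B.mul (b i) c) L := by
  induction L with
  | nil =>
    rw [dlSum, B.zero_tensor]; exact Arr.map_zero (C.map _)
  | cons i L ih =>
    have h := B.tensor_comp (φ := ident (B.mul a (b i)) + B.dlSum a b L)
      (φ' := B.dl a (b i) ((C.obj y).sum b L)) (θ := ident c) (θ' := ident c) (by simp) rfl
    rw [comp_id] at h
    rw [dlSum, dlSum, h, map_comp _ (by simp), B.add_tensor, map_add (C.map (eqToHom _)), ih,
      dl_mul, B.sum_mul, B.tensor_id, map_id, B.mul_assoc]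

theorem dlSum_assoc (a : C.obj x) (b : C.obj y) (c : ι → C.obj z) (L : List ι) :
    (B.dlSum (B.mul a b) c L).map (gradeCast C (J.add_assoc x y z)) =
      B.dlSum a (fun i => B.mul b (c i)) L ⊚ B.tensor (ident a) (B.dlSum b c L) := by
  induction L with
  | nil =>
    rw [dlSum, dlSum, dlSum, B.tensor_zero]
    exact (Arr.map_zero (C.map _)).trans (comp_id _ _).symm
  | cons i L ih =>
    have h := B.tensor_comp (φ := ident a) (φ' := ident a)
      (θ := ident (B.mul b (c i)) + B.dlSum b c L) (θ' := B.dl b (c i) ((C.obj z).sum c L)) rfl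
      (by simp)
    rw [comp_id] at h
    have h' := B.dl_natural (ident a) (ident (B.mul b (c i))) (B.dlSum b c L)
    simp only [dlSum_src, dlSum_tgt, B.tensor_id, id_src, id_tgt] at h'
    rw [dlSum, dlSum, dlSum, map_comp _ (by simp), map_add (C.map (eqToHom _)), ih, map_id,
      B.mul_assoc, dl_assoc, h, id_add_comp (by simp), comp_assoc (by simp),
      ← comp_assoc (φ := ident _ + B.tensor _ _) (by simp),
      h', comp_assoc (by simp), comp_assoc (by simp)]

/-- The iterated left distributivity commutes with permutations of the summands; for a single
transposition this is the compatibility of `dl` with the additive twist. -/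
theorem dlSum_perm (a : C.obj x) {b : ι → C.obj y} {L M : List ι} {φ : Arr (C.obj y)}
    (h : PermArr (C.obj y) b L M φ) :
    ∃ φ', PermArr (C.obj (J.add x y)) (fun i => B.mul a (b i)) L M φ' ∧
      B.dlSum a b L ⊚ B.tensor (ident a) φ = φ' ⊚ B.dlSum a b M := by
  induction h with
  | nil =>
    exact ⟨0, .nil, congrArg (_ ⊚ ·) (B.tensor_zero _)⟩
  | @cons i L M φ h ih =>
    obtain ⟨φ', h₁, h₂⟩ := ih
    refine ⟨_, h₁.cons i, ?_⟩
    have h' := B.dl_natural (ident a) (ident (b i)) φ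
    simp only [h.src, h.tgt, B.tensor_id, id_src, id_tgt] at h'
    rw [dlSum, dlSum, comp_assoc (by simp), ← h', ← comp_assoc (by simp [h.src]),
      ← id_add_comp (by simp [h.src]), h₂, id_add_comp (by simp [h₁.tgt]),
      comp_assoc (by simp [h₁.tgt])]
  | swap i j L h =>
    refine ⟨_, .swap i j L h, ?_⟩
    -- the first two summands may be distributed together first, by `dl_add`
    have key : ∀ i j, B.dlSum a b (i :: j :: L) =
        (ident (B.mul a (b i)) + ident (B.mul a (b j)) + B.dlSum a b L) ⊚
          (B.dl a (b i) (b j) + ident (B.mul a ((C.obj y).sum b L))) ⊚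
            B.dl a ((C.obj y).add (b i) (b j)) ((C.obj y).sum b L) := by
      intro i j
      rw [dlSum, dlSum, id_add_comp (by simp), comp_assoc (by simp), PermCat.sum, ← B.dl_add,
        ← _root_.add_assoc]
    have h' := B.dl_natural (ident a) (tw (b i) (b j)) (ident ((C.obj y).sum b L))
    simp only [B.tensor_id, id_src, id_tgt, tw_src, tw_tgt] at h'
    rw [key, key, comp_assoc (by simp [PermCat.add_assoc]), comp_assoc (by simp), ← h',
      ← comp_assoc (θ := B.tensor _ _ + _) (by simp), ← comp_add_id (by simp), dl_twist,
      comp_add_id (by simp),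
      ← comp_assoc (by simp [PermCat.add_assoc]),
      ← comp_assoc (by simp [PermCat.add_assoc]),
      ← comp_assoc (by simp [PermCat.add_assoc]),
      ← comp_assoc
        (by rw [comp_tgt (by simp [PermCat.add_assoc])]; simp [PermCat.add_assoc])]
    congr 2
    have e₁ := id_comp (tw (B.mul a (b i)) (B.mul a (b j)))
    rw [tw_src, id_add] at e₁
    have e₂ := comp_id (tw (B.mul a (b i)) (B.mul a (b j)))
      ((C.obj _).add (B.mul a (b j)) (B.mul a (b i)))
    rw [id_add] at e₂
    rw [add_comp (by simp) (by simp), add_comp (by simp) (by simp), e₁, e₂, comp_id,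
      id_comp' (by simp)]
  | @trans L M N φ θ h h' ih ih' =>
    obtain ⟨φ', h₁, h₂⟩ := ih
    obtain ⟨θ', h₁', h₂'⟩ := ih'
    refine ⟨_, h₁.trans h₁', ?_⟩
    have e := B.tensor_comp (φ := ident a) (φ' := ident a) (θ := φ) (θ' := θ) rfl
      (by rw [h.tgt, h'.src])
    rw [comp_id] at e
    rw [e, ← comp_assoc (by simp [h.src]), h₂, comp_assoc (by simp [h₁.tgt]), h₂',
      comp_assoc (by rw [h₁.tgt, h₁'.src])]

end GradedStrictlyBimonoidal

/-! ### The pentagon over lists, and products of permutations -/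

/-- Two arrows pass the additive twist that separates them; this is the rearrangement needed in the
inductive step of `dlSum_add`. -/
theorem Arr.add_comp_tw {P : PermCat.{v, u}} (φ θ : Arr P) (p q : P) :
    ((ident p + φ) + (ident q + θ)) ⊚ (ident p + tw φ.tgt q + ident θ.tgt) =
      (ident p + (tw φ.src q + ident θ.src)) ⊚ (ident p + (ident q + (φ + θ))) := by
  have h := tw_natural φ (ident q)
  rw [id_src, id_tgt] at h
  have h₁ : (ident p + φ) + (ident q + θ) = (ident p + (φ + ident q)) + θ := by
    simp only [add_assoc]
  have h₂ : ident p + (ident q + (φ + θ)) = (ident p + (ident q + φ)) + θ := by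
    simp only [add_assoc]
  have h₃ : ident p + (tw φ.src q + ident θ.src) = (ident p + tw φ.src q) + ident θ.src := by
    simp only [add_assoc]
  rw [h₁, h₂, h₃, add_comp (by simp) (by simp), add_comp (by simp) (by simp),
    add_comp (by simp) (by simp), add_comp (by simp) (by simp), h, comp_id, comp_id, id_comp]

namespace GradedStrictlyBimonoidal

open Arr

variable {J : PermCat.{v₁, u₁}} {C : J ⥤ PermCat.{v₂, u₂}} (B : GradedStrictlyBimonoidal J C)
  {x y z t : J} {ι : Type w} {κ : Type w'}

theorem sum_mul_map (a : ι → C.obj x) (b : κ → C.obj y) (L : List ι) (j : κ) :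
    (C.obj (J.add x y)).sum (fun p : ι × κ => B.mul (a p.1) (b p.2)) (L.map fun i => (i, j)) =
      B.mul ((C.obj x).sum a L) (b j) := by
  rw [PermCat.sum_map, B.sum_mul]

/-- The pentagon for one summand `a i` and a sum of further ones, iterated over the list `M` of the
second factor. -/
theorem dlSum_add (a : ι → C.obj x) (b : κ → C.obj y) (i : ι) (L : List ι) (hi : i ∉ L)
    (M : List κ) :
    ∃ ρ, PermArr (C.obj (J.add x y)) (fun p : ι × κ => B.mul (a p.1) (b p.2))
        ((M.map fun j => (i, j)) ++ M.flatMap fun j => L.map fun i => (i, j))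
        (M.flatMap fun j => (i :: L).map fun i => (i, j)) ρ ∧
      B.dlSum (a i) b M + B.dlSum ((C.obj x).sum a L) b M =
        ρ ⊚ B.dlSum ((C.obj x).sum a (i :: L)) b M := by
  induction M with
  | nil => exact ⟨0, .nil, (zero_add _).trans (comp_id (0 : Arr (C.obj (J.add x y))) _).symm⟩
  | cons j M ih =>
    obtain ⟨ρ, h₁, h₂⟩ := ih
    -- the block of the pairs with the index `j` moves past the rest of the row of `i`
    have ht := PermArr.twist (P := C.obj (J.add x y))
      (A := fun p : ι × κ => B.mul (a p.1) (b p.2)) (M.map fun j => (i, j))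
      (L.map fun i => (i, j)) (by
        rintro ⟨i', j'⟩ hp hp'
        obtain ⟨_, _, h⟩ := List.mem_map.1 hp
        obtain ⟨k, hk, h'⟩ := List.mem_map.1 hp'
        cases h
        cases h'
        exact hi hk)
    have hp := PermArr.cons (i, j) (ht.append_right (M.flatMap fun j => L.map fun i => (i, j)))
    have hp' := PermArr.cons (i, j) (h₁.append_left (L.map fun i => (i, j)))
    rw [List.append_assoc, List.append_assoc] at hp
    refine ⟨_, hp.trans hp', ?_⟩
    have hR : (C.obj (J.add x y)).sum (fun p : ι × κ => B.mul (a p.1) (b p.2))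
        (M.flatMap fun j => L.map fun i => (i, j)) =
        (C.obj (J.add x y)).sum (fun j => B.mul ((C.obj x).sum a L) (b j)) M := by
      rw [PermCat.sum_flatMap]
      exact PermCat.sum_congr _ fun j _ => B.sum_mul_map a b L j
    have hL := B.sum_mul_map a b L j
    have hM : (C.obj (J.add x y)).sum (fun p : ι × κ => B.mul (a p.1) (b p.2))
        (M.map fun j => (i, j)) = (C.obj (J.add x y)).sum (fun j => B.mul (a i) (b j)) M :=
      PermCat.sum_map _ _ _ _
    have hρ := h₁.src
    have hρ' := h₁.tgt
    rw [PermCat.sum_append, hM, hR] at hρ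
    have hρt : ρ.tgt = (B.dlSum ((C.obj x).sum a (i :: L)) b M).src := by
      rw [hρ', dlSum_src, PermCat.sum_flatMap]
      exact PermCat.sum_congr _ fun j _ => B.sum_mul_map a b (i :: L) j
    rw [hL, hM, hR]
    set S := (C.obj x).sum a L
    set T := (C.obj y).sum b M
    have e := add_comp_tw (B.dlSum (a i) b M) (B.dlSum S b M) (B.mul (a i) (b j)) (B.mul S (b j))
    rw [dlSum_src, dlSum_tgt, dlSum_src, dlSum_tgt, h₂] at e
    rw [dlSum, dlSum, dlSum, ← add_comp (by simp) (by simp), dl_pentagon,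
      ← comp_assoc (by simp [PermCat.add_assoc]), e]
    have hS : (C.obj x).sum a (i :: L) = (C.obj x).add (a i) S := rfl
    have hρ₂ : ρ.tgt = (C.obj (J.add x y)).sum
        (fun j => B.mul ((C.obj x).sum a (i :: L)) (b j)) M := hρt.trans (B.dlSum_src _ _ _)
    rw [← hS]
    clear_value S T
    generalize (C.obj x).sum a (i :: L) = U at *
    subst hS
    have h₃ : ident (B.mul (a i) (b j)) + (ident (B.mul S (b j)) +
        (ρ ⊚ B.dlSum ((C.obj x).add (a i) S) b M)) =
        (ident (B.mul (a i) (b j)) + (ident (B.mul S (b j)) + ρ)) ⊚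
          (ident (B.mul ((C.obj x).add (a i) S) (b j)) +
            B.dlSum ((C.obj x).add (a i) S) b M) := by
      rw [id_add_comp hρt, id_add_comp (by simp [hρ₂]), B.add_mul, id_add, _root_.add_assoc]
    rw [h₃, ← comp_assoc (by simp [hρ, PermCat.add_assoc]), comp_assoc]
    rw [comp_tgt (by simp [hρ, PermCat.add_assoc])]
    simp [hρ₂, B.add_mul, PermCat.add_assoc]

/-- The pentagon over lists: distributing first over `M` for every `i ∈ L` and then adding up, or first
adding up
and then distributing, differs by the transposition of the index pairs. -/
theorem sum_dlSum (a : ι → C.obj x) (b : κ → C.obj y) (L : List ι) (hL : L.Nodup) (M : List κ) :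
    ∃ π, PermArr (C.obj (J.add x y)) (fun p : ι × κ => B.mul (a p.1) (b p.2))
        (L.flatMap fun i => M.map fun j => (i, j)) (M.flatMap fun j => L.map fun i => (i, j)) π ∧
      (L.map fun i => B.dlSum (a i) b M).sum = π ⊚ B.dlSum ((C.obj x).sum a L) b M := by
  induction L with
  | nil =>
    refine ⟨0, ?_, ?_⟩
    · have : M.flatMap (fun j => ([] : List ι).map fun i => (i, j)) = [] := by
        simp
      rw [this]
      exact .nil
    · rw [PermCat.sum, zero_dlSum]
      exact (comp_id (0 : Arr (C.obj (J.add x y))) _).symm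
  | cons i L ih =>
    rw [List.nodup_cons] at hL
    obtain ⟨π, h₁, h₂⟩ := ih hL.2
    obtain ⟨ρ, h₁', h₂'⟩ := B.dlSum_add a b i L hL.1 M
    refine ⟨_, (h₁.append_left (M.map fun j => (i, j))).trans h₁', ?_⟩
    have hM := PermCat.sum_map (C.obj (J.add x y)) (fun j : κ => (i, j))
      (fun p : ι × κ => B.mul (a p.1) (b p.2)) M
    have hπ : π.tgt = (B.dlSum ((C.obj x).sum a L) b M).src := by
      rw [h₁.tgt, dlSum_src, PermCat.sum_flatMap]
      exact PermCat.sum_congr _ fun j _ => B.sum_mul_map a b L j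
    have hρ : ρ.src = (B.dlSum (a i) b M + B.dlSum ((C.obj x).sum a L) b M).src := by
      rw [h₂', comp_src]
    rw [List.map_cons, List.sum_cons, h₂, hM,
      comp_assoc (by rw [hρ, add_tgt, add_src, hπ, id_tgt, dlSum_src (a := a i)]) , ← h₂',
      add_comp (by simp) hπ, id_comp' (by simp)]

/-- The canonical morphism `⨁ᵢ ⨁ⱼ aᵢ ⊗ bⱼ ⟶ (⨁ᵢ aᵢ) ⊗ (⨁ⱼ bⱼ)`. -/
def prodSum (a : ι → C.obj x) (b : κ → C.obj y) (L : List ι) (M : List κ) :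
    Arr (C.obj (J.add x y)) := (L.map fun i => B.dlSum (a i) b M).sum

theorem prodSum_src (a : ι → C.obj x) (b : κ → C.obj y) (L : List ι) (M : List κ) :
    (B.prodSum a b L M).src = (C.obj (J.add x y)).sum
      (fun p : ι × κ => B.mul (a p.1) (b p.2)) (L.flatMap fun i => M.map fun j => (i, j)) := by
  rw [prodSum, sum_src, PermCat.sum_flatMap]
  exact PermCat.sum_congr _ fun i _ => by rw [dlSum_src, PermCat.sum_map]

@[simp] theorem prodSum_tgt (a : ι → C.obj x) (b : κ → C.obj y) (L : List ι) (M : List κ) :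
    (B.prodSum a b L M).tgt = B.mul ((C.obj x).sum a L) ((C.obj y).sum b M) := by
  rw [prodSum, sum_tgt, B.sum_mul]
  exact PermCat.sum_congr _ fun i _ => B.dlSum_tgt _ _ _

/-- Permutations of the summands in both factors pass through `prodSum` to a permutation of the
pairs. -/
theorem prodSum_perm {a : ι → C.obj x} {b : κ → C.obj y} {L L' : List ι} {M M' : List κ}
    {φ : Arr (C.obj x)} {θ : Arr (C.obj y)} (h : PermArr (C.obj x) a L L' φ)
    (h' : PermArr (C.obj y) b M M' θ) :
    ∃ π, PermArr (C.obj (J.add x y)) (fun p : ι × κ => B.mul (a p.1) (b p.2))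
        (L.flatMap fun i => M.map fun j => (i, j)) (L'.flatMap fun i => M'.map fun j => (i, j)) π ∧
      B.prodSum a b L M ⊚ B.tensor φ θ = π ⊚ B.prodSum a b L' M' := by
  -- first the rows are permuted by `ω` inside each row, then the rows themselves by `ζ`
  choose ω h₁ h₂ using fun i => B.dlSum_perm (a i) h'
  have hs : PermArr (C.obj (J.add x y)) (fun p : ι × κ => B.mul (a p.1) (b p.2))
      (L.flatMap fun i => M.map fun j => (i, j)) (L.flatMap fun i => M'.map fun j => (i, j))
      (L.map ω).sum :=
    PermArr.sum L fun i _ => PermArr.map_index (f := fun j => (i, j))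
      (fun _ _ e => (Prod.mk.inj e).2) (h₁ i)
  obtain ⟨ζ, hζ⟩ := PermArr.exists_of_perm (P := C.obj (J.add x y))
    (fun i => (C.obj (J.add x y)).sum (fun j => B.mul (a i) (b j)) M') h.perm
  obtain ⟨ζ', hζ', e⟩ := hζ.natural (B := fun i => B.mul (a i) ((C.obj y).sum b M'))
    (fun i => B.dlSum (a i) b M') (fun i _ => B.dlSum_src _ _ _) (fun i _ => B.dlSum_tgt _ _ _)
  have hζ'' : ζ' = B.tensor φ (ident ((C.obj y).sum b M')) := hζ'.unique (h.tensor_id _ _)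
  refine ⟨_, hs.trans (hζ.flatMap (fun i => M'.map fun j => (i, j))
    (fun i _ => by rw [PermCat.sum_map]) ?_), ?_⟩
  · rintro i - i' - hne ⟨k, j⟩ hk hk'
    obtain ⟨_, _, e₁⟩ := List.mem_map.1 hk
    obtain ⟨_, _, e₂⟩ := List.mem_map.1 hk'
    cases e₁
    cases e₂
    exact hne rfl
  · rw [GradedMul.tensor_eq, h.src, h'.tgt, id_sum, GradedMul.sum_tensor, prodSum, prodSum,
      ← comp_assoc (by
        rw [sum_tgt, sum_src]
        exact PermCat.sum_congr _ fun i _ => by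
          rw [dlSum_tgt, B.tensor_src, id_src, h'.src]),
      ← sum_comp (fun i _ => by rw [dlSum_tgt, B.tensor_src, id_src, h'.src])]
    simp only [h₂]
    rw [sum_comp (fun i _ => by rw [(h₁ i).tgt, dlSum_src]), ← hζ'',
      comp_assoc (by
        rw [sum_tgt, sum_src]
        exact PermCat.sum_congr _ fun i _ => by rw [(h₁ i).tgt, dlSum_src]), e,
      comp_assoc (by
        rw [sum_tgt, hζ.src]
        exact PermCat.sum_congr _ fun i _ => by rw [(h₁ i).tgt])]

/-- The interchange of products with sums of arrows in the second factor. -/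
theorem prodSum_tensor_sum {ν : Type w} {a : ι → C.obj x} {b : κ → C.obj y} {L : List ι}
    (hL : L.Nodup) {N : List ν} {O : ν → List κ}
    (hO : ∀ n ∈ N, ∀ n' ∈ N, n ≠ n' → (O n).Disjoint (O n')) {φ : Arr (C.obj x)}
    {θ : ν → Arr (C.obj y)} (hφ : φ.src = (C.obj x).sum a L)
    (hθ : ∀ n ∈ N, (θ n).src = (C.obj y).sum b (O n)) :
    ∃ π, PermArr (C.obj (J.add x y)) (fun p : ι × κ => B.mul (a p.1) (b p.2))
        (L.flatMap fun i => (N.flatMap O).map fun j => (i, j))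
        (N.flatMap fun n => L.flatMap fun i => (O n).map fun j => (i, j)) π ∧
      B.prodSum a b L (N.flatMap O) ⊚ B.tensor φ (N.map θ).sum =
        π ⊚ (N.map fun n => B.prodSum a b L (O n) ⊚ B.tensor φ (θ n)).sum ⊚
          B.dlSum φ.tgt (fun n => (θ n).tgt) N := by
  obtain ⟨π, h₁, h₂⟩ := B.sum_dlSum a (fun n => (C.obj y).sum b (O n)) L hL N
  -- `ζ` is the transposition `ζ'` of the pairs `(i, n)`, carried out on the finer summands
  obtain ⟨ζ, hζ⟩ := PermArr.exists_of_perm (P := C.obj (J.add x y))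
    (fun p : ι × ν => (C.obj (J.add x y)).sum (fun j => B.mul (a p.1) (b j)) (O p.2)) h₁.perm
  obtain ⟨ζ', hζ', e⟩ := hζ.natural
    (B := fun p : ι × ν => B.mul (a p.1) ((C.obj y).sum b (O p.2)))
    (fun p => B.dlSum (a p.1) b (O p.2)) (fun p _ => B.dlSum_src _ _ _)
    (fun p _ => B.dlSum_tgt _ _ _)
  obtain rfl := hζ'.unique h₁
  have hp := hζ.flatMap (A := fun p : ι × κ => B.mul (a p.1) (b p.2))
    (fun p : ι × ν => (O p.2).map fun j => (p.1, j))
    (fun p _ => by rw [PermCat.sum_map]) (by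
      rintro ⟨i, n⟩ hn ⟨i', n'⟩ hn' hne ⟨k, j⟩ hk hk'
      obtain ⟨j₁, hj₁, e₁⟩ := List.mem_map.1 hk
      obtain ⟨j₂, hj₂, e₂⟩ := List.mem_map.1 hk'
      cases e₁
      cases e₂
      simp only [List.mem_flatMap, List.mem_map] at hn hn'
      obtain ⟨_, _, _, hn, e₁⟩ := hn
      obtain ⟨_, _, _, hn', e₂⟩ := hn'
      cases e₁
      cases e₂
      exact hO n hn n' hn' (fun h => hne (by rw [h])) hj₁ hj₂)
  simp only [List.flatMap_assoc, List.flatMap_map] at hp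
  simp only [List.map_flatMap]
  refine ⟨ζ, hp, ?_⟩
  have hLN : ((L.flatMap fun i => N.map fun n => (i, n)).map
      fun p => B.dlSum (a p.1) b (O p.2)).sum =
        (L.map fun i => (N.map fun n => B.dlSum (a i) b (O n)).sum).sum := by
    rw [Arr.sum_flatMap]
    simp only [List.map_map]; rfl
  have hNL : ((N.flatMap fun n => L.map fun i => (i, n)).map
      fun p => B.dlSum (a p.1) b (O p.2)).sum = (N.map fun n => B.prodSum a b L (O n)).sum := by
    rw [Arr.sum_flatMap]
    simp only [List.map_map]; rfl
  rw [hLN, hNL] at e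
  have h₃ : B.prodSum a b L (N.flatMap O) =
      (L.map fun i => (N.map fun n => B.dlSum (a i) b (O n)).sum).sum ⊚
        ζ' ⊚ B.dlSum φ.src (fun n => (θ n).src) N := by
    rw [hφ, B.dlSum_congr hθ, ← h₂, ← sum_comp (fun i _ => by
      rw [sum_tgt, dlSum_src]
      exact PermCat.sum_congr _ fun n _ => B.dlSum_tgt _ _ _)]
    exact congrArg List.sum (List.map_congr_left fun i _ => B.dlSum_flatMap _ _ _ _)
  have hs : ∀ n ∈ N, (B.prodSum a b L (O n)).tgt = (B.tensor φ (θ n)).src := fun n hn => by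
    rw [prodSum_tgt, B.tensor_src, hφ, hθ n hn]
  have hζt : ζ.tgt = (N.map fun n => B.prodSum a b L (O n)).sum.src := by
    rw [hζ.tgt, sum_src, PermCat.sum_flatMap]
    exact PermCat.sum_congr _ fun n _ => by
      rw [PermCat.sum_map, prodSum, sum_src]
      exact PermCat.sum_congr _ fun i _ => by rw [dlSum_src]
  have hts : ((L.map fun i => (N.map fun n => B.dlSum (a i) b (O n)).sum).sum).tgt = ζ'.src := by
    rw [hζ'.src, sum_tgt, PermCat.sum_flatMap]
    exact PermCat.sum_congr _ fun i _ => by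
      rw [sum_tgt, PermCat.sum_map]
      exact PermCat.sum_congr _ fun n _ => by rw [dlSum_tgt]
  have hP : (N.map fun n => B.prodSum a b L (O n)).sum.tgt =
      (B.dlSum φ.src (fun n => (θ n).src) N).src := by
    rw [sum_tgt, dlSum_src]; exact PermCat.sum_congr _ fun n hn => hs n hn
  rw [← comp_assoc hts, e, comp_assoc hζt] at h₃
  rw [h₃, sum_comp hs, comp_assoc (φ := (N.map _).sum) (by
      rw [sum_tgt, sum_src]; exact PermCat.sum_congr _ hs), B.dlSum_natural φ θ N,
    comp_assoc (by rw [hζt, comp_src]), comp_assoc hP]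

end GradedStrictlyBimonoidal

namespace GradedStrictlyBimonoidal

open Arr

variable {J : PermCat.{v₁, u₁}} {C : J ⥤ PermCat.{v₂, u₂}} (B : GradedStrictlyBimonoidal J C)
  {x y z t : J} {ι : Type w} {κ : Type w'}

/-- The interchange of products with sums of arrows in both factors. -/
theorem prodSum_sum_tensor_sum {ι' κ' : Type w} {a : ι → C.obj x} {b : κ → C.obj y}
    {K : List ι'} {L : ι' → List ι} {N : List κ'} {O : κ' → List κ}
    (hL : ∀ k ∈ K, (L k).Nodup)
    (hO : ∀ n ∈ N, ∀ n' ∈ N, n ≠ n' → (O n).Disjoint (O n')) {φ : ι' → Arr (C.obj x)}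
    {θ : κ' → Arr (C.obj y)} (hφ : ∀ k ∈ K, (φ k).src = (C.obj x).sum a (L k))
    (hθ : ∀ n ∈ N, (θ n).src = (C.obj y).sum b (O n)) :
    ∃ π, PermArr (C.obj (J.add x y)) (fun p : ι × κ => B.mul (a p.1) (b p.2))
        ((K.flatMap L).flatMap fun i => (N.flatMap O).map fun j => (i, j))
        (K.flatMap fun k => N.flatMap fun n => (L k).flatMap fun i => (O n).map fun j => (i, j)) π ∧
      B.prodSum a b (K.flatMap L) (N.flatMap O) ⊚ B.tensor (K.map φ).sum (N.map θ).sum =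
        π ⊚ (K.map fun k => (N.map fun n =>
          B.prodSum a b (L k) (O n) ⊚ B.tensor (φ k) (θ n)).sum).sum ⊚
          B.prodSum (fun k => (φ k).tgt) (fun n => (θ n).tgt) K N := by
  have h : ∀ k, ∃ π, k ∈ K → PermArr (C.obj (J.add x y)) (fun p : ι × κ => B.mul (a p.1) (b p.2))
        ((L k).flatMap fun i => (N.flatMap O).map fun j => (i, j))
        (N.flatMap fun n => (L k).flatMap fun i => (O n).map fun j => (i, j)) π ∧
      B.prodSum a b (L k) (N.flatMap O) ⊚ B.tensor (φ k) (N.map θ).sum =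
        π ⊚ (N.map fun n => B.prodSum a b (L k) (O n) ⊚ B.tensor (φ k) (θ n)).sum ⊚
          B.dlSum (φ k).tgt (fun n => (θ n).tgt) N := by
    intro k
    by_cases hk : k ∈ K
    · obtain ⟨π, hπ⟩ := B.prodSum_tensor_sum (hL k hk) hO (hφ k hk) hθ
      exact ⟨π, fun _ => hπ⟩
    · exact ⟨0, fun h => absurd h hk⟩
  choose π hπ using h
  have hp := PermArr.sum K fun k hk => (hπ k hk).1
  refine ⟨_, by rwa [List.flatMap_assoc], ?_⟩
  have hb : (C.obj y).sum b (N.flatMap O) = (N.map θ).sum.src := by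
    rw [PermCat.sum_flatMap, sum_src]
    exact PermCat.sum_congr _ fun n hn => (hθ n hn).symm
  have h₁ : B.prodSum a b (K.flatMap L) (N.flatMap O) =
      (K.map fun k => B.prodSum a b (L k) (N.flatMap O)).sum := Arr.sum_flatMap _ _ _
  have h₂ : ∀ k ∈ K, ∀ n ∈ N, (B.prodSum a b (L k) (O n) ⊚ B.tensor (φ k) (θ n)).tgt =
      B.mul (φ k).tgt (θ n).tgt := fun k hk n hn => by
    rw [comp_tgt (by rw [prodSum_tgt, B.tensor_src, hφ k hk, hθ n hn]), B.tensor_tgt]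
  have h₃ : ∀ k ∈ K, (N.map fun n => B.prodSum a b (L k) (O n) ⊚ B.tensor (φ k) (θ n)).sum.tgt =
      (B.dlSum (φ k).tgt (fun n => (θ n).tgt) N).src := fun k hk => by
    rw [sum_tgt, dlSum_src]
    exact PermCat.sum_congr _ fun n hn => h₂ k hk n hn
  have h₄ : ∀ k ∈ K, (π k).tgt =
      (N.map fun n => B.prodSum a b (L k) (O n) ⊚ B.tensor (φ k) (θ n)).sum.src := fun k hk => by
    rw [(hπ k hk).1.tgt, sum_src, PermCat.sum_flatMap]
    exact PermCat.sum_congr _ fun n _ => by rw [comp_src, prodSum_src]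
  rw [h₁, GradedMul.sum_tensor, ← sum_comp (fun k hk => by
      rw [prodSum_tgt, B.tensor_src, hφ k hk, hb]),
    List.map_congr_left fun k hk => (hπ k hk).2, sum_comp (fun k hk => by rw [h₄ k hk, comp_src]),
    sum_comp h₃]
  rfl

theorem prodSum_map_index {ι' : Type u} {κ' : Type v} (a : ι → C.obj x) (b : κ → C.obj y)
    (f : ι' → ι) (g : κ' → κ) (L : List ι') (M : List κ') :
    B.prodSum a b (L.map f) (M.map g) = B.prodSum (fun i => a (f i)) (fun j => b (g j)) L M := by
  rw [prodSum, prodSum, List.map_map]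
  exact congrArg List.sum (List.map_congr_left fun i _ => B.dlSum_map_index _ _ _ _)

theorem prodSum_congr {a a' : ι → C.obj x} {b b' : κ → C.obj y} {L : List ι} {M : List κ}
    (h : ∀ i ∈ L, a i = a' i) (h' : ∀ j ∈ M, b j = b' j) :
    B.prodSum a b L M = B.prodSum a' b' L M := by
  rw [prodSum, prodSum]
  exact congrArg List.sum (List.map_congr_left fun i hi => by rw [h i hi, B.dlSum_congr h'])

theorem map_prodSum (k : x ⟶ z) (l : y ⟶ t) (a : ι → C.obj x) (b : κ → C.obj y) (L : List ι)
    (M : List κ) : (B.prodSum a b L M).map (C.map (J.addHom k l)).functor =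
      B.prodSum (fun i => (C.map k).functor.obj (a i)) (fun j => (C.map l).functor.obj (b j)) L M := by
  rw [prodSum, Arr.map_sum]
  exact congrArg List.sum (List.map_congr_left fun i _ => B.map_dlSum _ _ _ _ _)

theorem prodSum_singleton_left (a : ι → C.obj x) (b : κ → C.obj y) (i : ι) (M : List κ) :
    B.prodSum a b [i] M = B.dlSum (a i) b M := by
  simp [prodSum]

theorem prodSum_singleton_right (a : ι → C.obj x) (b : κ → C.obj y) (L : List ι) (j : κ) :
    B.prodSum a b L [j] = ident (B.mul ((C.obj x).sum a L) (b j)) := by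
  simp only [prodSum, dlSum_singleton]
  rw [B.sum_mul, id_sum]

/-- The two ways to expand a product of three sums agree.  There is no permutation here: both sides
list the triples of indices in lexicographic order. -/
theorem prodSum_assoc {ι' : Type u} (a : ι → C.obj x) (b : κ → C.obj y) (c : ι' → C.obj z)
    (L : List ι) (M : List κ) (N : List ι') :
    (B.prodSum (fun p : ι × κ => B.mul (a p.1) (b p.2)) c
          (L.flatMap fun i => M.map fun j => (i, j)) N ⊚
        B.tensor (B.prodSum a b L M) (ident ((C.obj z).sum c N))).map
          (gradeCast C (J.add_assoc x y z)) =
      B.prodSum a (fun p : κ × ι' => B.mul (b p.1) (c p.2)) L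
          (M.flatMap fun j => N.map fun k => (j, k)) ⊚
        B.tensor (ident ((C.obj x).sum a L)) (B.prodSum b c M N) := by
  have h₁ : B.prodSum (fun p : ι × κ => B.mul (a p.1) (b p.2)) c
      (L.flatMap fun i => M.map fun j => (i, j)) N =
        (L.map fun i => (M.map fun j => B.dlSum (B.mul (a i) (b j)) c N).sum).sum := by
    rw [prodSum, Arr.sum_flatMap]
    simp only [List.map_map]; rfl
  have h₂ : ∀ i, B.dlSum (a i) (fun p : κ × ι' => B.mul (b p.1) (c p.2))
      (M.flatMap fun j => N.map fun k => (j, k)) =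
        (M.map fun j => B.dlSum (a i) (fun k => B.mul (b j) (c k)) N).sum ⊚
          B.dlSum (a i) (fun j => (C.obj (J.add y z)).sum (fun k => B.mul (b j) (c k)) N) M := by
    intro i
    rw [dlSum_flatMap]
    congr 2
    · exact List.map_congr_left fun j _ => B.dlSum_map_index _ _ _ _
    · funext j; rw [PermCat.sum_map]
  have h₃ : ∀ i, (M.map fun j => B.dlSum (a i) (fun k => B.mul (b j) (c k)) N ⊚
        B.tensor (ident (a i)) (B.dlSum (b j) c N)).sum ⊚
          B.dlSum (a i) (fun j => B.mul (b j) ((C.obj z).sum c N)) M =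
      B.dlSum (a i) (fun p : κ × ι' => B.mul (b p.1) (c p.2))
        (M.flatMap fun j => N.map fun k => (j, k)) ⊚
          B.tensor (ident (a i)) (B.prodSum b c M N) := by
    intro i
    have hn := B.dlSum_natural (ident (a i)) (fun j => B.dlSum (b j) c N) M
    simp only [dlSum_src, dlSum_tgt, id_src, id_tgt] at hn
    rw [h₂, sum_comp (fun j _ => by simp), comp_assoc (by simp), hn, comp_assoc (by simp)]
    rfl
  have h₄ : ∀ i, ((M.map fun j => B.dlSum (B.mul (a i) (b j)) c N).sum).map
        (gradeCast C (J.add_assoc x y z)) =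
      (M.map fun j => B.dlSum (a i) (fun k => B.mul (b j) (c k)) N ⊚
        B.tensor (ident (a i)) (B.dlSum (b j) c N)).sum := fun i =>
    (Arr.map_sum (C.map _) _ _).trans
      (congrArg List.sum (List.map_congr_left fun j _ => B.dlSum_assoc _ _ _ _))
  have h₅ : ∀ i, ((M.map fun j => B.dlSum (a i) (fun k => B.mul (b j) (c k)) N ⊚
        B.tensor (ident (a i)) (B.dlSum (b j) c N)).sum).tgt =
      (B.dlSum (a i) (fun j => B.mul (b j) ((C.obj z).sum c N)) M).src := fun i => by
    rw [sum_tgt, dlSum_src]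
    exact PermCat.sum_congr _ fun j _ => by rw [comp_tgt (by simp)]; simp
  rw [h₁, prodSum, GradedMul.sum_tensor, map_comp _ (by simp [B.sum_mul])]
  refine (congrArg₂ (· ⊚ ·) (Arr.map_sum (C.map _) _ _) (Arr.map_sum (C.map _) _ _)).trans ?_
  simp only [h₄, dlSum_mul]
  rw [← sum_comp fun i _ => h₅ i, prodSum, id_sum, GradedMul.sum_tensor, ← sum_comp fun i _ => by
    rw [dlSum_tgt, B.tensor_src, prodSum_src]; rfl]
  exact congrArg List.sum (List.map_congr_left fun i _ => h₃ i)

end GradedStrictlyBimonoidal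

/-! ### Products of multimorphisms -/

namespace Hocolim

variable {J : PermCat.{v₁, u₁}} {C : J ⥤ PermCat.{v₂, u₂}} (B : GradedStrictlyBimonoidal J C)
  {x y z t : J}

/-- The product of two legs. -/
def mulLeg (s : Leg C x) (t : Leg C y) : Leg C (J.add x y) :=
  ⟨mulEntry B.toGradedMul s.obj t.obj, J.addHom s.hom t.hom⟩

theorem image_mulLeg (s : Leg C x) (t : Leg C y) :
    (mulLeg B s t).image = B.mul s.image t.image := B.map_mul _ _ _ _

/-- The product of two blocks, with the legs in the lexicographic order. -/
def Block.mul (β : Block C x) (γ : Block C y) : Block C (J.add x y) where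
  legs := β.legs.flatMap fun s => γ.legs.map fun t => mulLeg B s t
  arr := B.prodSum Leg.image Leg.image β.legs γ.legs ⊚ B.tensor β.arr γ.arr
  src_eq := by
    rw [Arr.comp_src, B.prodSum_src, PermCat.sum_flatMap, PermCat.sum_flatMap]
    refine PermCat.sum_congr _ fun s _ => ?_
    rw [PermCat.sum_map, PermCat.sum_map]
    exact PermCat.sum_congr _ fun t _ => (image_mulLeg B s t).symm

theorem Block.mul_legs (β : Block C x) (γ : Block C y) :
    (β.mul B γ).legs = β.legs.flatMap fun s => γ.legs.map fun t => mulLeg B s t := rfl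

theorem Block.mul_arr (β : Block C x) (γ : Block C y) :
    (β.mul B γ).arr = (B.prodSum Leg.image Leg.image β.legs γ.legs ⊚ B.tensor β.arr γ.arr) := rfl

/-- The product of two multimorphisms. -/
def Multi.mul (μ ν : Multi C) : Multi C := ⟨J.add μ.1 ν.1, Block.mul B μ.2 ν.2⟩

theorem Block.mul_arr_tgt (β : Block C x) (γ : Block C y) :
    (β.mul B γ).arr.tgt = B.mul β.arr.tgt γ.arr.tgt := by
  rw [Block.mul, Arr.comp_tgt (by rw [B.prodSum_tgt, B.tensor_src, β.src, γ.src]), B.tensor_tgt]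

section MulHom

variable {S T S' T' : Hocolim C} {f : Mor S S'} {g : Mor T T'}

theorem mulHom_leg {q : Fin (S'.len * T'.len)} {i : Fin S.len} {j : Fin T.len}
    (hi : f.ψ i = (finProdFinEquiv.symm q).1) (hj : g.ψ j = (finProdFinEquiv.symm q).2) :
    Mor.leg (mulHom B.toGradedMul B.leftDist f g) q (finProdFinEquiv (i, j)) =
      mulLeg B (f.leg _ i) (g.leg _ j) := by
  rw [f.leg_pos hi, g.leg_pos hj]
  refine (Mor.leg_pos (mulHom B.toGradedMul B.leftDist f g)
    (mulIncl f g q ⟨i, hi⟩ ⟨j, hj⟩).2).trans ?_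
  have key : ∀ (p : Fin S.len × Fin T.len) (h : Prod.map f.ψ g.ψ p = finProdFinEquiv.symm q),
      p = (i, j) →
      (⟨mulEntry B.toGradedMul (S.entry p.1) (T.entry p.2),
        mulℓ f g p (finProdFinEquiv.symm q) h⟩ : Leg C _) =
      mulLeg B ⟨S.entry i, f.ℓ i _ hi⟩ ⟨T.entry j, g.ℓ j _ hj⟩ := by
    rintro p h rfl; rfl
  exact key _ ((Equiv.eq_symm_apply _).2 (mulIncl f g q ⟨i, hi⟩ ⟨j, hj⟩).2)
    (finProdFinEquiv.symm_apply_apply _)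

theorem mulHom_ψ (i : Fin S.len) (j : Fin T.len) :
    (mulHom B.toGradedMul B.leftDist f g).ψ (finProdFinEquiv (i, j)) =
      finProdFinEquiv (f.ψ i, g.ψ j) := by
  change finProdFinEquiv (Prod.map f.ψ g.ψ (finProdFinEquiv.symm (finProdFinEquiv _))) = _
  rw [Equiv.symm_apply_apply]; rfl

/-- The product of two lists of indices in the lexicographic order. -/
def prodList {n m : ℕ} (L : List (Fin n)) (M : List (Fin m)) : List (Fin (n * m)) :=
  L.flatMap fun i => M.map fun j => finProdFinEquiv (i, j)

theorem prodList_eq_map {n m : ℕ} (L : List (Fin n)) (M : List (Fin m)) :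
    prodList L M = (L.flatMap fun i => M.map fun j => (i, j)).map finProdFinEquiv := by
  simp only [prodList, List.map_flatMap, List.map_map]; rfl

theorem enum_mulHom {r : Fin S'.len} {s : Fin T'.len} {L : List (Fin S.len)}
    {M : List (Fin T.len)} (hL : f.Enum r L) (hM : g.Enum s M) :
    Mor.Enum (mulHom B.toGradedMul B.leftDist f g) (finProdFinEquiv (r, s)) (prodList L M) := by
  constructor
  · rw [prodList_eq_map]
    refine List.Nodup.map finProdFinEquiv.injective ?_
    exact hL.1.product hM.1
  · intro p
    obtain ⟨⟨i, j⟩, rfl⟩ := finProdFinEquiv.surjective p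
    rw [prodList_eq_map, List.mem_map_of_injective finProdFinEquiv.injective, mulHom_ψ,
      finProdFinEquiv.injective.eq_iff, Prod.mk.injEq, ← hL.2, ← hM.2]
    exact List.pair_mem_product

/-- The third coordinate of a product of morphisms, with its identifications of sums described as a
permutation of the summands. -/
theorem mulHom_arr (q : Fin (S'.len * T'.len)) :
    ∃ π, PermArr _ (fun p => (Mor.leg (mulHom B.toGradedMul B.leftDist f g) q p).image)
        (Mor.fibre (mulHom B.toGradedMul B.leftDist f g) q)
        (prodList (f.fibre (finProdFinEquiv.symm q).1) (g.fibre (finProdFinEquiv.symm q).2)) π ∧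
      Mor.arr (mulHom B.toGradedMul B.leftDist f g) q =
        (π ⊚ B.prodSum (fun i => (f.leg (finProdFinEquiv.symm q).1 i).image)
            (fun j => (g.leg (finProdFinEquiv.symm q).2 j).image)
            (f.fibre (finProdFinEquiv.symm q).1) (g.fibre (finProdFinEquiv.symm q).2) ⊚
          B.tensor (f.arr (finProdFinEquiv.symm q).1) (g.arr (finProdFinEquiv.symm q).2)) := by
  let F := mulHom B.toGradedMul B.leftDist f g
  let P := C.obj ((mul B.toGradedMul S' T').entry q).1
  let A := fun p : {p // Mor.ψ F p = q} =>
    (C.map (Mor.ℓ F p q p.2)).functor.obj ((mul B.toGradedMul S T).entry p).2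
  refine ⟨Arr.mk (P.regroup A (mulIncl f g q) (mulIncl_bijective f g q)), ?_, ?_⟩
  · have h := regroup_mem (P := P) A (mulIncl f g q) (mulIncl_bijective f g q)
    have h' := PermArr.map_index (A := fun p => (Mor.leg F q p).image)
      Subtype.val_injective (h.congr_family fun i _ => by rw [Mor.leg_pos F i.2]; rfl)
    rw [List.map_flatMap] at h'
    have e : prodList (f.fibre (finProdFinEquiv.symm q).1) (g.fibre (finProdFinEquiv.symm q).2) =
        (Finset.univ.sort).flatMap fun i =>
          (Finset.univ.sort.map (mulIncl f g q i)).map Subtype.val := by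
      rw [prodList, Mor.fibre, Mor.fibre, List.flatMap_map]
      refine List.flatMap_congr fun i _ => ?_
      rw [List.map_map, List.map_map]; rfl
    rw [e]
    exact h'
  · refine (Arr.mk_comp (P.regroup A (mulIncl f g q) (mulIncl_bijective f g q)) _).trans ?_
    congr 1
    refine (Arr.mk_eqToHom_comp _ _).trans ?_
    refine (Arr.mk_comp _ _).trans ?_
    rw [GradedMul.tensor_eq]
    have e₁ : B.tensor (Arr.ident (f.arr (finProdFinEquiv.symm q).1).src)
        (g.arr (finProdFinEquiv.symm q).2) = ((f.fibre (finProdFinEquiv.symm q).1).map fun i =>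
          B.tensor (Arr.ident (f.leg (finProdFinEquiv.symm q).1 i).image)
            (g.arr (finProdFinEquiv.symm q).2)).sum := by
      rw [Mor.arr_src, Arr.id_sum, GradedMul.sum_tensor]
    rw [e₁, ← Arr.comp_assoc (by
        rw [B.prodSum_tgt, Arr.sum_src, B.sum_mul]
        exact PermCat.sum_congr _ fun i _ => by rw [B.tensor_src, Mor.arr_src]; rfl),
      GradedStrictlyBimonoidal.prodSum, ← Arr.sum_comp fun i _ => by
        rw [B.dlSum_tgt, B.tensor_src, Mor.arr_src]; rfl]
    refine congrArg₂ (· ⊚ ·) ?_ ?_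
    · refine (Arr.mk_sumHom _ _).trans ?_
      refine Eq.trans ?_ (congrArg List.sum (List.map_map (f := Subtype.val)).symm)
      refine congrArg List.sum (List.map_congr_left fun i _ => ?_)
      refine (Arr.mk_comp _ _).trans ?_
      rw [Function.comp_apply, f.leg_pos i.2]
      refine congrArg (· ⊚ _) ((B.mk_leftDistSum _ _ _).trans ?_)
      rw [Mor.fibre, B.dlSum_map_index]
      refine B.dlSum_congr fun j _ => ?_
      rw [g.leg_pos j.2]; rfl
    · refine (Arr.mk_eqToHom_comp _ _).trans ?_
      rfl

/-- The multimorphisms of a product of morphisms are the products of their multimorphisms. -/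
theorem Mor.At.mulHom {r : Fin S'.len} {s : Fin T'.len} {L : List (Fin S.len)}
    {M : List (Fin T.len)} {μ ν : Multi C} (hf : f.At r L μ) (hg : g.At s M ν) :
    Mor.At (mulHom B.toGradedMul B.leftDist f g) (finProdFinEquiv (r, s)) (prodList L M)
      (μ.mul B ν) := by
  refine ⟨enum_mulHom B hf.1 hg.1, ?_⟩
  rw [← hf.2, ← hg.2]
  have key : ∀ (q : Fin (S'.len * T'.len)) (r : Fin S'.len) (s : Fin T'.len),
      (finProdFinEquiv.symm q).1 = r → (finProdFinEquiv.symm q).2 = s →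
      f.Enum r L → g.Enum s M → Mor.Enum (Hocolim.mulHom B.toGradedMul B.leftDist f g) q (prodList L M) →
      Mor.multi (Hocolim.mulHom B.toGradedMul B.leftDist f g) q (prodList L M) =
        Multi.mul B (f.multi r L) (g.multi s M) := by
    rintro q r s rfl rfl hL hM hE
    refine congrArg (Sigma.mk _) (Block.ext ?_ ?_)
    · rw [blk_legs, Block.mul_legs, blk_legs, blk_legs, prodList, List.map_flatMap, List.flatMap_map]
      refine List.flatMap_congr fun i hi => ?_
      rw [List.map_map, List.map_map]
      refine List.map_congr_left fun j hj => ?_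
      exact mulHom_leg B ((hL.2 i).1 hi) ((hM.2 j).1 hj)
    · obtain ⟨θ, hθ⟩ := PermArr.exists_of_perm
        (fun i => (f.leg (finProdFinEquiv.symm q).1 i).image) (hL.perm (f.enum_fibre _))
      obtain ⟨η, hη⟩ := PermArr.exists_of_perm
        (fun j => (g.leg (finProdFinEquiv.symm q).2 j).image) (hM.perm (g.enum_fibre _))
      obtain ⟨π, hπ, e⟩ := mulHom_arr B (f := f) (g := g) q
      obtain ⟨ζ, hζ⟩ := PermArr.exists_of_perm
        (fun p => (Mor.leg (Hocolim.mulHom B.toGradedMul B.leftDist f g) q p).image)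
        (hE.perm (enum_fibre _ _))
      obtain ⟨κ, hκ, e'⟩ := B.prodSum_perm hθ hη
      have hκ' := PermArr.map_index
        (A := fun p => (Mor.leg (Hocolim.mulHom B.toGradedMul B.leftDist f g) q p).image)
        finProdFinEquiv.injective (hκ.congr_family fun p hp => by
          obtain ⟨i, j⟩ := p
          obtain ⟨hi, hj⟩ := List.pair_mem_product.1 hp
          rw [mulHom_leg B ((hL.2 i).1 hi) ((hM.2 j).1 hj), image_mulLeg])
      rw [← prodList_eq_map, ← prodList_eq_map] at hκ'
      -- the permutations on the two sides have the same lists of indices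
      have hl : ∀ X, (ζ ⊚ π ⊚ X) = (κ ⊚ X) := fun X => by
        rw [← Arr.comp_assoc (by rw [hζ.tgt, hπ.src]), (hζ.trans hπ).unique hκ']
      rw [blk_arr hζ, e, hl]
      refine Eq.symm ?_
      refine (Block.mul_arr B (f.blk (finProdFinEquiv.symm q).1 L)
        (g.blk (finProdFinEquiv.symm q).2 M)).trans ?_
      rw [blk_legs, blk_legs, blk_arr hθ, blk_arr hη,
        B.tensor_comp (by rw [hθ.tgt, arr_src]) (by rw [hη.tgt, arr_src]), B.prodSum_map_index,
        ← Arr.comp_assoc (by rw [B.prodSum_tgt, B.tensor_src, hθ.src, hη.src]), e',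
        Arr.comp_assoc]
      rw [B.prodSum_src, hκ.tgt]
  exact key _ r s (by simp) (by simp) hf.1 hg.1 (enum_mulHom B hf.1 hg.1)

end MulHom

end Hocolim

/-! ### Functoriality of the product -/

namespace Hocolim

theorem forall_prod {n m : ℕ} {p : Fin (n * m) → Prop}
    (h : ∀ i j, p (finProdFinEquiv (i, j))) (q : Fin (n * m)) : p q := by
  obtain ⟨⟨i, j⟩, rfl⟩ := finProdFinEquiv.surjective q
  exact h i j

variable {J : PermCat.{v₁, u₁}} {C : J ⥤ PermCat.{v₂, u₂}} (B : GradedStrictlyBimonoidal J C)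
  {x y z t : J} {S T U S' T' U' : Hocolim C}

theorem mul_entry (M : GradedMul J C) (i : Fin S.len) (j : Fin T.len) :
    (mul M S T).entry (finProdFinEquiv (i, j)) = mulEntry M (S.entry i) (T.entry j) := by
  simp only [Equiv.symm_apply_apply]

theorem Multi.unit_mul_unit (p q : Σ x : J, C.obj x) :
    (Multi.unit p).mul B (Multi.unit q) = Multi.unit (mulEntry B.toGradedMul p q) := by
  refine congrArg (Sigma.mk (J.add p.1 q.1)) (Block.ext ?_ ?_)
  · rw [Block.mul_legs]
    change [mulLeg B ⟨p, 𝟙 p.1⟩ ⟨q, 𝟙 q.1⟩] = [⟨mulEntry B.toGradedMul p q, 𝟙 (J.add p.1 q.1)⟩]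
    rw [mulLeg, J.addHom_id]
  · have h := B.prodSum_singleton_right Leg.image Leg.image [(⟨p, 𝟙 p.1⟩ : Leg C p.1)]
      (⟨q, 𝟙 q.1⟩ : Leg C q.1)
    rw [PermCat.sum_singleton] at h
    simp only [Leg.image, map_id_obj] at h
    refine (congrArg₂ (· ⊚ ·) h (B.tensor_id p.2 q.2)).trans ?_
    exact Arr.comp_id _ _

theorem Mor.IsPerm.mulHom {f : Mor S S'} {g : Mor T T'} (hf : f.IsPerm) (hg : g.IsPerm) :
    IsPerm (mulHom B.toGradedMul B.leftDist f g) := forall_prod fun i j => by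
  have h := Mor.At.mulHom B (hf i) (hg j)
  rw [Multi.unit_mul_unit, ← mul_entry, ← mulHom_ψ] at h
  exact h

theorem mulHom_id (S T : Hocolim C) : mulHom B.toGradedMul B.leftDist (𝟙 S) (𝟙 T) = 𝟙 _ :=
  (Mor.IsPerm.mulHom B (isPerm_id S) (isPerm_id T)).ext (isPerm_id _)
    (forall_prod fun i j => mulHom_ψ B i j)

theorem Block.map_mul (k : x ⟶ z) (l : y ⟶ t) (β : Block C x) (γ : Block C y) :
    (β.mul B γ).map (J.addHom k l) = (β.map k).mul B (γ.map l) := by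
  refine Block.ext ?_ ?_
  · rw [Block.map_legs, Block.mul_legs, Block.mul_legs, Block.map_legs, Block.map_legs,
      List.map_flatMap, List.flatMap_map]
    refine List.flatMap_congr fun s _ => ?_
    rw [List.map_map, List.map_map]
    refine List.map_congr_left fun t _ => ?_
    simp only [Function.comp_apply, Leg.map, mulLeg, J.addHom_comp]
  · rw [Block.map_arr, Block.mul_arr, Block.mul_arr, Block.map_legs, Block.map_legs,
      Arr.map_comp _ (by rw [B.prodSum_tgt, B.tensor_src, β.src, γ.src]), B.map_prodSum,
      B.map_tensor, B.prodSum_map_index]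
    simp only [Leg.image_map, Block.map_arr]

/-- The action of a product of legs on a product of multimorphisms. -/
theorem Multi.act_mul {s : Leg C x} {t : Leg C y} {ν σ : Multi C} (h : ν.tgt = s.obj)
    (h' : σ.tgt = t.obj) :
    (mulLeg B s t).act (ν.mul B σ) = (s.act ν).mul B (t.act σ) := by
  obtain ⟨p, k⟩ := s
  obtain ⟨q, l⟩ := t
  obtain ⟨β, rfl, hβ⟩ := exists_of_tgt h
  obtain ⟨γ, rfl, hγ⟩ := exists_of_tgt h'
  rw [Leg.act_mk, Leg.act_mk, ← Block.map_mul]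
  exact Leg.act_mk (p := mulEntry B.toGradedMul p q) _ _

theorem Block.post_mul_post {β : Block C x} {γ : Block C y} {φ : Arr (C.obj x)}
    {θ : Arr (C.obj y)} (h : β.arr.tgt = φ.src) (h' : γ.arr.tgt = θ.src) :
    (β.post φ).mul B (γ.post θ) = (β.mul B γ).post (B.tensor φ θ) :=
  Block.ext rfl (by
    rw [Block.mul_arr, Block.post_arr, Block.post_arr, Block.post_arr, Block.mul_arr,
      B.tensor_comp h h', ← Arr.comp_assoc (by
        rw [B.prodSum_tgt, B.tensor_src, Block.post_legs, Block.post_legs, β.src, γ.src])]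
    rfl)

/-- A product of sums of blocks is, up to a permutation of the legs, the sum of the products. -/
theorem Block.sum_mul_sum {ι κ ι' κ' : Type w} {b : κ → Block C x} {c : κ' → Block C y}
    {s : ι → Leg C x} {t : ι' → Leg C y} {K : List κ} {N : List κ'} {L : κ → List ι}
    {O : κ' → List ι'} (hb : ∀ k ∈ K, (b k).legs = (L k).map s)
    (hc : ∀ n ∈ N, (c n).legs = (O n).map t) (hL : ∀ k ∈ K, (L k).Nodup)
    (hO : ∀ n ∈ N, ∀ n' ∈ N, n ≠ n' → (O n).Disjoint (O n')) :
    ∃ π, PermArr (C.obj (J.add x y)) (fun p : ι × ι' => (mulLeg B (s p.1) (t p.2)).image)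
        ((K.flatMap L).flatMap fun i => (N.flatMap O).map fun j => (i, j))
        (K.flatMap fun k => N.flatMap fun n => (L k).flatMap fun i => (O n).map fun j => (i, j)) π ∧
      ((K.map b).sum.mul B (N.map c).sum).arr =
        (π ⊚ (K.map fun k => (N.map fun n => ((b k).mul B (c n)).arr).sum).sum ⊚
          B.prodSum (fun k => (b k).arr.tgt) (fun n => (c n).arr.tgt) K N) := by
  have hb' : ∀ k ∈ K, (b k).arr.src = (C.obj x).sum (fun i => (s i).image) (L k) := fun k hk => by
    rw [Block.src, hb k hk, PermCat.sum_map]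
  have hc' : ∀ n ∈ N, (c n).arr.src = (C.obj y).sum (fun i => (t i).image) (O n) := fun n hn => by
    rw [Block.src, hc n hn, PermCat.sum_map]
  obtain ⟨π, h₁, h₂⟩ := B.prodSum_sum_tensor_sum hL hO hb' hc'
  refine ⟨π, ?_, ?_⟩
  · simp only [image_mulLeg]; exact h₁
  · have e₁ : (K.map b).sum.legs = (K.flatMap L).map s := by
      rw [Block.sum_legs, List.map_flatMap]; exact List.flatMap_congr hb
    have e₂ : (N.map c).sum.legs = (N.flatMap O).map t := by
      rw [Block.sum_legs, List.map_flatMap]; exact List.flatMap_congr hc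
    rw [Block.mul_arr, e₁, e₂, B.prodSum_map_index, Block.sum_arr, Block.sum_arr, h₂]
    congr 3
    refine List.map_congr_left fun k hk => congrArg List.sum (List.map_congr_left fun n hn => ?_)
    rw [Block.mul_arr, hb k hk, hc n hn, B.prodSum_map_index]

/-- The legs of a multimorphism of `f` may be listed in any other order, provided the arrow is
changed by the corresponding permutation. -/
theorem Mor.At.reorder {f : Mor S T} {j : Fin T.len} {L L' : List (Fin S.len)} {β β' : Block C y}
    (h : f.At j L ⟨y, β⟩) {s : Fin S.len → Leg C y} (hs : β.legs = L.map s)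
    (hs' : β'.legs = L'.map s) {π : Arr (C.obj y)}
    (hπ : PermArr (C.obj y) (fun i => (s i).image) L' L π) (e : β'.arr = (π ⊚ β.arr)) :
    f.At j L' ⟨y, β'⟩ := by
  obtain ⟨hE, h⟩ := h
  obtain ⟨rfl, h⟩ := Sigma.mk.inj h
  obtain rfl := eq_of_heq h
  have hE' : f.Enum j L' := ⟨hπ.perm.nodup_iff.2 hE.1, fun i => (hπ.perm.mem_iff).trans (hE.2 i)⟩
  refine ⟨hE', congrArg (Sigma.mk _) (Block.ext ?_ ?_)⟩
  · rw [blk_legs, hs']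
    rw [blk_legs] at hs
    exact List.map_congr_left fun i hi => List.map_inj_left.1 hs i (hπ.perm.mem_iff.1 hi)
  · rw [e]
    refine blk_perm hE (hπ.congr_family fun i hi => ?_)
    rw [blk_legs] at hs
    rw [List.map_inj_left.1 hs i (hπ.perm.mem_iff.1 hi)]

/-- The product of two composites is, up to a permutation of the legs, the composite of the
products. -/
theorem Block.comp_mul_comp {ι κ ι' κ' : Type w} {β : Block C x} {γ : Block C y}
    {ν : κ → Multi C} {σ : κ' → Multi C} {s : ι → Leg C x} {t : ι' → Leg C y} {s' : κ → Leg C x}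
    {t' : κ' → Leg C y} {K : List κ} {N : List κ'} {L : κ → List ι} {O : κ' → List ι'}
    (hβ : β.legs = K.map s') (hγ : γ.legs = N.map t') (hν : ∀ k ∈ K, (ν k).tgt = (s' k).obj)
    (hσ : ∀ n ∈ N, (σ n).tgt = (t' n).obj)
    (hs : ∀ k ∈ K, ((s' k).act (ν k)).legs = (L k).map s)
    (ht : ∀ n ∈ N, ((t' n).act (σ n)).legs = (O n).map t) (hL : ∀ k ∈ K, (L k).Nodup)
    (hO : ∀ n ∈ N, ∀ n' ∈ N, n ≠ n' → (O n).Disjoint (O n')) :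
    ((((blockSum β.legs (K.map ν)).post β.arr).mul B
        ((blockSum γ.legs (N.map σ)).post γ.arr)).legs =
      ((K.flatMap L).flatMap fun i => (N.flatMap O).map fun j => (i, j)).map
        fun p => mulLeg B (s p.1) (t p.2)) ∧
    (((blockSum (β.mul B γ).legs ((K.flatMap fun k => N.map fun n => (k, n)).map
        fun p => (ν p.1).mul B (σ p.2))).post (β.mul B γ).arr).legs =
      (K.flatMap fun k => N.flatMap fun n => (L k).flatMap fun i => (O n).map fun j => (i, j)).map
        fun p => mulLeg B (s p.1) (t p.2)) ∧
    ∃ π, PermArr (C.obj (J.add x y)) (fun p : ι × ι' => (mulLeg B (s p.1) (t p.2)).image)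
        ((K.flatMap L).flatMap fun i => (N.flatMap O).map fun j => (i, j))
        (K.flatMap fun k => N.flatMap fun n => (L k).flatMap fun i => (O n).map fun j => (i, j)) π ∧
      (((blockSum β.legs (K.map ν)).post β.arr).mul B
          ((blockSum γ.legs (N.map σ)).post γ.arr)).arr =
        (π ⊚ ((blockSum (β.mul B γ).legs ((K.flatMap fun k => N.map fun n => (k, n)).map
          fun p => (ν p.1).mul B (σ p.2))).post (β.mul B γ).arr).arr) := by
  have hl : (β.mul B γ).legs = (K.flatMap fun k => N.map fun n => (k, n)).map
      fun p => mulLeg B (s' p.1) (t' p.2) := by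
    rw [Block.mul_legs, hβ, hγ, List.flatMap_map, List.map_flatMap]
    simp only [List.map_map]; rfl
  have ha : ∀ k ∈ K, ∀ n ∈ N, (mulLeg B (s' k) (t' n)).act ((ν k).mul B (σ n)) =
      ((s' k).act (ν k)).mul B ((t' n).act (σ n)) := fun k hk n hn =>
    Multi.act_mul B (hν k hk) (hσ n hn)
  have hb : ∀ k ∈ K, ((s' k).act (ν k)).arr.tgt = (s' k).image := fun k hk =>
    Multi.act_tgt (hν k hk)
  have hc : ∀ n ∈ N, ((t' n).act (σ n)).arr.tgt = (t' n).image := fun n hn =>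
    Multi.act_tgt (hσ n hn)
  have hβt : (K.map fun k => (s' k).act (ν k)).sum.arr.tgt = β.arr.src := by
    rw [Block.sum_arr, Arr.sum_tgt, β.src, hβ, PermCat.sum_map]
    exact PermCat.sum_congr _ hb
  have hγt : (N.map fun n => (t' n).act (σ n)).sum.arr.tgt = γ.arr.src := by
    rw [Block.sum_arr, Arr.sum_tgt, γ.src, hγ, PermCat.sum_map]
    exact PermCat.sum_congr _ hc
  have hR : (blockSum (β.mul B γ).legs ((K.flatMap fun k => N.map fun n => (k, n)).map
        fun p => (ν p.1).mul B (σ p.2))) = ((K.flatMap fun k => N.map fun n => (k, n)).map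
          fun p => ((s' p.1).act (ν p.1)).mul B ((t' p.2).act (σ p.2))).sum := by
    rw [hl, blockSum_map]
    refine congrArg List.sum (List.map_congr_left fun p hp => ?_)
    obtain ⟨k, n⟩ := p
    obtain ⟨hk, hn⟩ := List.pair_mem_product.1 hp
    exact ha k hk n hn
  obtain ⟨π, h₁, h₂⟩ := Block.sum_mul_sum B hs ht hL hO
  have e₁ : (blockSum β.legs (K.map ν)) = (K.map fun k => (s' k).act (ν k)).sum := by
    rw [hβ, blockSum_map]
  have e₂ : (blockSum γ.legs (N.map σ)) = (N.map fun n => (t' n).act (σ n)).sum := by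
    rw [hγ, blockSum_map]
  refine ⟨?_, ?_, π, h₁, ?_⟩
  · rw [e₁, e₂, Block.mul_legs, Block.post_legs, Block.post_legs, Block.sum_legs, Block.sum_legs,
      List.flatMap_congr hs, List.flatMap_congr ht, ← List.map_flatMap (f := t),
      ← List.map_flatMap (f := s), List.flatMap_map]
    refine Eq.trans ?_ List.map_flatMap.symm
    refine List.flatMap_congr fun i _ => ?_
    rw [List.map_map, List.map_map]; rfl
  · rw [hR, Block.post_legs, Block.sum_legs, List.flatMap_assoc, List.map_flatMap]
    refine List.flatMap_congr fun k hk => ?_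
    rw [List.flatMap_map, List.map_flatMap]
    refine List.flatMap_congr fun n hn => ?_
    rw [Block.mul_legs, hs k hk, ht n hn, List.flatMap_map, List.map_flatMap]
    simp only [List.map_map]; rfl
  · rw [e₁, e₂, Block.post_mul_post B hβt hγt, Block.post_arr, h₂, hR, Block.post_arr,
      Block.mul_arr B β γ, Block.sum_arr, Arr.sum_flatMap]
    have hp : B.prodSum Leg.image Leg.image β.legs γ.legs =
        B.prodSum (fun k => ((s' k).act (ν k)).arr.tgt) (fun n => ((t' n).act (σ n)).arr.tgt)
          K N := by
      rw [hβ, hγ, B.prodSum_map_index]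
      exact B.prodSum_congr (fun k hk => (hb k hk).symm) fun n hn => (hc n hn).symm
    simp only [List.map_map]
    rw [hp]
    have e₃ : ((K.map fun k => (N.map fun n =>
        (((s' k).act (ν k)).mul B ((t' n).act (σ n))).arr).sum).sum).tgt =
          (B.prodSum (fun k => ((s' k).act (ν k)).arr.tgt)
            (fun n => ((t' n).act (σ n)).arr.tgt) K N).src := by
      rw [Arr.sum_tgt, B.prodSum_src, PermCat.sum_flatMap]
      refine PermCat.sum_congr _ fun k _ => ?_
      rw [Arr.sum_tgt, PermCat.sum_map]
      exact PermCat.sum_congr _ fun n _ => Block.mul_arr_tgt B _ _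
    have e₄ : π.tgt = ((K.map fun k => (N.map fun n =>
        (((s' k).act (ν k)).mul B ((t' n).act (σ n))).arr).sum).sum).src := by
      rw [h₁.tgt, Arr.sum_src, PermCat.sum_flatMap]
      refine PermCat.sum_congr _ fun k hk => ?_
      rw [Arr.sum_src, PermCat.sum_flatMap]
      refine PermCat.sum_congr _ fun n hn => ?_
      rw [Block.src, Block.mul_legs, hs k hk, ht n hn, List.flatMap_map, PermCat.sum_flatMap,
        PermCat.sum_flatMap]
      refine PermCat.sum_congr _ fun i _ => ?_
      rw [List.map_map, PermCat.sum_map, PermCat.sum_map]; rfl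
    rw [Arr.comp_assoc (by rw [e₄, Arr.comp_src]), Arr.comp_assoc e₃]
    rfl

theorem Mor.At.act_legs {f : S ⟶ T} {g : T ⟶ U} {r : Fin U.len} {k : Fin T.len}
    (hk : Mor.ψ g k = r) {L : List (Fin S.len)} {ν : Multi C} (h : Mor.At f k L ν) :
    ((Mor.leg g r k).act ν).legs = L.map (Mor.leg (f ≫ g) r) := by
  rw [← h.2, multi, Mor.leg_act hk, Block.map_legs, blk_legs, List.map_map]
  exact List.map_congr_left fun i hi => (leg_comp hk ((h.1.2 i).1 hi)).symm

/-- Functoriality of the product.  Both sides have the multimorphisms of `Block.comp_mul_comp`,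
which differ only in the order of the legs. -/
theorem mulHom_comp (f : S ⟶ T) (f' : T ⟶ U) (g : S' ⟶ T') (g' : T' ⟶ U') :
    mulHom B.toGradedMul B.leftDist (f ≫ f') (g ≫ g') =
      (show mul B.toGradedMul S S' ⟶ mul B.toGradedMul T T' from
        mulHom B.toGradedMul B.leftDist f g) ≫ mulHom B.toGradedMul B.leftDist f' g' := by
  refine Mor.At.ext (forall_prod fun r s => ?_)
  obtain ⟨K, μ, hμ⟩ := Mor.exists_at f' r
  obtain ⟨N, ρ, hρ⟩ := Mor.exists_at g' s
  choose L ν hν using Mor.exists_at f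
  choose O σ hσ using Mor.exists_at g
  have h₁ := Mor.At.mulHom B (hμ.comp fun k _ => hν k) (hρ.comp fun n _ => hσ n)
  have h₂ := Mor.At.mulHom B hμ hρ
  rw [prodList_eq_map] at h₂
  have h₃ := h₂.comp_map (f := mulHom B.toGradedMul B.leftDist f g)
    (L := fun p => prodList (L p.1) (O p.2)) (ν := fun p => (ν p.1).mul B (σ p.2))
    fun p _ => Mor.At.mulHom B (hν p.1) (hσ p.2)
  refine ⟨_, _, h₁, ?_⟩
  have eμ := hμ.2.symm
  have eρ := hρ.2.symm
  have hK := hμ.1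
  have hN := hρ.1
  subst eμ eρ
  have hk : ∀ k ∈ K, Mor.ψ f' k = r := fun k hk => (hK.2 k).1 hk
  have hn : ∀ n ∈ N, Mor.ψ g' n = s := fun n hn => (hN.2 n).1 hn
  obtain ⟨e₁, e₂, π, hπ, e₃⟩ := Block.comp_mul_comp B (β := Mor.blk f' r K) (γ := Mor.blk g' s N)
    (ν := ν) (σ := σ) (s := Mor.leg (f ≫ f') r) (t := Mor.leg (g ≫ g') s) (s' := Mor.leg f' r)
    (t' := Mor.leg g' s) (K := K) (N := N) (L := L) (O := O) rfl rfl
    (fun k hk' => by rw [(hν k).tgt, Mor.leg_pos _ (hk k hk')])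
    (fun n hn' => by rw [(hσ n).tgt, Mor.leg_pos _ (hn n hn')])
    (fun k hk' => (hν k).act_legs (hk k hk')) (fun n hn' => (hσ n).act_legs (hn n hn'))
    (fun k _ => (hν k).1.1) fun n _ n' _ hne j hj hj' =>
      hne ((((hσ n).1.2 j).1 hj).symm.trans (((hσ n').1.2 j).1 hj'))
  have hQ : ∀ Q : List (Fin S.len × Fin S'.len),
      Q.map (fun p => mulLeg B (Mor.leg (f ≫ f') r p.1) (Mor.leg (g ≫ g') s p.2)) =
        (Q.map finProdFinEquiv).map fun p => mulLeg B
          (Mor.leg (f ≫ f') r (finProdFinEquiv.symm p).1)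
          (Mor.leg (g ≫ g') s (finProdFinEquiv.symm p).2) := fun Q => by
    rw [List.map_map]
    refine List.map_congr_left fun p _ => ?_
    rw [Function.comp_apply, Equiv.symm_apply_apply]
  have hl : (K.flatMap fun k => N.map fun n => (k, n)).flatMap
      (fun p => prodList (L p.1) (O p.2)) = (K.flatMap fun k => N.flatMap fun n =>
        (L k).flatMap fun i => (O n).map fun j => (i, j)).map finProdFinEquiv := by
    simp only [List.flatMap_assoc, List.map_flatMap, List.flatMap_map, prodList_eq_map]
  have hπ' := PermArr.map_index (A := fun p => (mulLeg B
    (Mor.leg (f ≫ f') r (finProdFinEquiv.symm p).1)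
    (Mor.leg (g ≫ g') s (finProdFinEquiv.symm p).2)).image) finProdFinEquiv.injective
    (hπ.congr_family fun p _ => by rw [Equiv.symm_apply_apply])
  rw [← hl, ← prodList_eq_map] at hπ'
  rw [hQ, ← hl] at e₂
  rw [hQ, ← prodList_eq_map] at e₁
  exact Mor.At.reorder h₃ e₂ e₁ hπ' e₃

end Hocolim

/-! ### Associativity and units of the product -/

theorem GradedStrictlyBimonoidal.dlSum_one {J : PermCat.{v₁, u₁}} {C : J ⥤ PermCat.{v₂, u₂}}
    (B : GradedStrictlyBimonoidal J C) {y : J} {ι : Type w} (b : ι → C.obj y) (L : List ι) :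
    (B.dlSum B.one b L).map (gradeCast C (J.zero_add y)) = Arr.ident ((C.obj y).sum b L) := by
  induction L with
  | nil => exact Arr.map_zero (C.map _)
  | cons i L ih =>
    have h := Arr.map_add (C.map (eqToHom (J.zero_add y))) (Arr.ident (B.mul B.one (b i)))
      (B.dlSum B.one b L)
    rw [Arr.map_id, B.one_mul] at h
    rw [dlSum, Arr.map_comp _ (by simp), B.dl_one]
    refine (Arr.comp_id _ _).trans (h.trans ?_)
    refine (congrArg (Arr.ident (b i) + ·) ih).trans ?_
    exact (Arr.id_add _ _).symm

namespace Hocolim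

section Index

variable {n m k l : ℕ}

theorem cast_prod_assoc (h : n * m * k = n * (m * k)) (i : Fin n) (j : Fin m) (l : Fin k) :
    Fin.cast h (finProdFinEquiv (finProdFinEquiv (i, j), l)) =
      finProdFinEquiv (i, finProdFinEquiv (j, l)) :=
  Fin.ext (by simp only [Fin.val_cast, finProdFinEquiv_apply_val]; ring)

theorem cast_one_prod (h : 1 * n = n) (i : Fin n) :
    Fin.cast h (finProdFinEquiv ((0 : Fin 1), i)) = i :=
  Fin.ext (by simp [finProdFinEquiv_apply_val])

theorem cast_prod_one (h : n * 1 = n) (i : Fin n) :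
    Fin.cast h (finProdFinEquiv (i, (0 : Fin 1))) = i :=
  Fin.ext (by simp [finProdFinEquiv_apply_val])

theorem cast_inl_prod (h : (n + m) * k = n * k + m * k) (i : Fin n) (j : Fin k) :
    Fin.cast h (finProdFinEquiv (finSumFinEquiv (.inl i), j)) =
      finSumFinEquiv (.inl (finProdFinEquiv (i, j))) :=
  Fin.ext (by simp [finProdFinEquiv_apply_val])

theorem cast_inr_prod (h : (n + m) * k = n * k + m * k) (i : Fin m) (j : Fin k) :
    Fin.cast h (finProdFinEquiv (finSumFinEquiv (.inr i), j)) =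
      finSumFinEquiv (.inr (finProdFinEquiv (i, j))) :=
  Fin.ext (by simp [finProdFinEquiv_apply_val]; ring)

end Index

variable {J : PermCat.{v₁, u₁}} {C : J ⥤ PermCat.{v₂, u₂}} (B : GradedStrictlyBimonoidal J C)
  {x y z t : J} {S T U V S' T' U' : Hocolim C}

theorem mulEntry_assoc (p q r : Σ x : J, C.obj x) :
    mulEntry B.toGradedMul (mulEntry B.toGradedMul p q) r =
      mulEntry B.toGradedMul p (mulEntry B.toGradedMul q r) := by
  refine (sigma_gradeCast (J.add_assoc _ _ _) _).trans ?_
  exact congrArg (Sigma.mk _) (B.mul_assoc _ _ _)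

theorem one_mulEntry (p : Σ x : J, C.obj x) : mulEntry B.toGradedMul ⟨J.zero, B.one⟩ p = p := by
  refine (sigma_gradeCast (J.zero_add _) _).trans ?_
  exact congrArg (Sigma.mk _) (B.one_mul _)

theorem mulEntry_one (p : Σ x : J, C.obj x) : mulEntry B.toGradedMul p ⟨J.zero, B.one⟩ = p := by
  refine (sigma_gradeCast (J.add_zero _) _).trans ?_
  exact congrArg (Sigma.mk _) (B.mul_one _)

theorem Leg.ext' {s t : Leg C y} (h : s.obj = t.obj)
    (h' : s.hom = eqToHom (congrArg Sigma.fst h) ≫ t.hom) : s = t := by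
  obtain ⟨p, k⟩ := s
  obtain ⟨q, l⟩ := t
  dsimp only at h
  subst h
  rw [Leg.mk.injEq]
  exact ⟨rfl, heq_of_eq (h'.trans (Category.id_comp _))⟩

theorem Multi.mk_eq {β : Block C x} {γ : Block C y} (h : x = y) (h' : β.map (eqToHom h) = γ) :
    (⟨x, β⟩ : Multi C) = ⟨y, γ⟩ := by
  subst h
  rw [← h', eqToHom_refl, Block.map_id]

/-- A morphism of `J` between equal objects is an identification if it agrees with an identity up
to heterogeneous equality. -/
theorem hom_eq_of_heq {a b a' b' : J} {f : a ⟶ b} {g : a' ⟶ b'} (ha : a = a') (hb : b = b')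
    (h : HEq f g) : f ≫ eqToHom hb = eqToHom ha ≫ g := by
  subst ha; subst hb; subst h; simp

theorem mulLeg_assoc (r : Leg C x) (s : Leg C y) (t : Leg C z) :
    (mulLeg B (mulLeg B r s) t).map (eqToHom (J.add_assoc x y z)) =
      mulLeg B r (mulLeg B s t) :=
  Leg.ext' (mulEntry_assoc B _ _ _) (hom_eq_of_heq _ _ (J.addHom_assoc _ _ _))

theorem one_mulLeg (s : Leg C y) :
    (mulLeg B ⟨⟨J.zero, B.one⟩, 𝟙 J.zero⟩ s).map (eqToHom (J.zero_add y)) = s :=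
  Leg.ext' (one_mulEntry B _) (hom_eq_of_heq _ _ (J.zero_addHom _))

theorem mulLeg_one (s : Leg C y) :
    (mulLeg B s ⟨⟨J.zero, B.one⟩, 𝟙 J.zero⟩).map (eqToHom (J.add_zero y)) = s :=
  Leg.ext' (mulEntry_one B _) (hom_eq_of_heq _ _ (J.addHom_zero _))

theorem Block.mul_legs_eq_map (β : Block C x) (γ : Block C y) : (β.mul B γ).legs =
    (β.legs.flatMap fun s => γ.legs.map fun t => (s, t)).map fun p => mulLeg B p.1 p.2 := by
  rw [Block.mul_legs, List.map_flatMap]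
  simp only [List.map_map]; rfl

/-- The product of blocks is associative up to the identification of `x + y + z` with `x + (y + z)`. -/
theorem Block.mul_assoc (β : Block C x) (γ : Block C y) (δ : Block C z) :
    ((β.mul B γ).mul B δ).map (eqToHom (J.add_assoc x y z)) = β.mul B (γ.mul B δ) := by
  refine Block.ext ?_ ?_
  · rw [Block.map_legs, Block.mul_legs, Block.mul_legs, Block.mul_legs, Block.mul_legs,
      List.flatMap_assoc, List.map_flatMap]
    refine List.flatMap_congr fun r _ => ?_
    rw [List.flatMap_map, List.map_flatMap, List.map_flatMap]
    refine List.flatMap_congr fun s _ => ?_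
    rw [List.map_map, List.map_map]
    exact List.map_congr_left fun t _ => mulLeg_assoc B r s t
  · have h := B.prodSum_assoc Leg.image Leg.image Leg.image β.legs γ.legs δ.legs
    have e₁ : B.prodSum Leg.image Leg.image (β.mul B γ).legs δ.legs =
        B.prodSum (fun p : Leg C x × Leg C y => B.mul p.1.image p.2.image) Leg.image
          (β.legs.flatMap fun r => γ.legs.map fun s => (r, s)) δ.legs := by
      have := B.prodSum_map_index Leg.image Leg.image (fun p => mulLeg B p.1 p.2) id
        (β.legs.flatMap fun r => γ.legs.map fun s => (r, s)) δ.legs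
      rw [List.map_id, ← Block.mul_legs_eq_map] at this
      rw [this]
      exact B.prodSum_congr (fun p _ => image_mulLeg B _ _) fun _ _ => rfl
    have e₂ : B.prodSum Leg.image Leg.image β.legs (γ.mul B δ).legs =
        B.prodSum Leg.image (fun p : Leg C y × Leg C z => B.mul p.1.image p.2.image)
          β.legs (γ.legs.flatMap fun r => δ.legs.map fun s => (r, s)) := by
      have := B.prodSum_map_index Leg.image Leg.image id (fun p => mulLeg B p.1 p.2) β.legs
        (γ.legs.flatMap fun r => δ.legs.map fun s => (r, s))
      rw [List.map_id, ← Block.mul_legs_eq_map] at this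
      rw [this]
      exact B.prodSum_congr (fun _ _ => rfl) fun p _ => image_mulLeg B _ _
    rw [← e₁, ← e₂, ← δ.src, ← β.src] at h
    have h₁ := B.tensor_comp (φ := B.prodSum Leg.image Leg.image β.legs γ.legs)
      (φ' := B.tensor β.arr γ.arr) (θ := Arr.ident δ.arr.src) (θ' := δ.arr)
      (by rw [B.prodSum_tgt, B.tensor_src, β.src, γ.src]) rfl
    have h₂ := B.tensor_comp (φ := Arr.ident β.arr.src) (φ' := β.arr)
      (θ := B.prodSum Leg.image Leg.image γ.legs δ.legs) (θ' := B.tensor γ.arr δ.arr)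
      rfl (by rw [B.prodSum_tgt, B.tensor_src, γ.src, δ.src])
    rw [Arr.id_comp] at h₁ h₂
    have hs : (B.prodSum Leg.image Leg.image (β.mul B γ).legs δ.legs).tgt =
        (B.tensor (B.prodSum Leg.image Leg.image β.legs γ.legs) (Arr.ident δ.arr.src)).src := by
      rw [B.prodSum_tgt, B.tensor_src, Arr.id_src, δ.src, ← Block.src, Block.mul_arr, Arr.comp_src]
    have hs' : (B.prodSum Leg.image Leg.image β.legs (γ.mul B δ).legs).tgt =
        (B.tensor (Arr.ident β.arr.src) (B.prodSum Leg.image Leg.image γ.legs δ.legs)).src := by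
      rw [B.prodSum_tgt, B.tensor_src, Arr.id_src, β.src, ← Block.src (γ.mul B δ), Block.mul_arr,
        Arr.comp_src]
    have ht : (B.tensor (B.prodSum Leg.image Leg.image β.legs γ.legs) (Arr.ident δ.arr.src)).tgt =
        (B.tensor (B.tensor β.arr γ.arr) δ.arr).src := by
      rw [B.tensor_tgt, B.tensor_src, B.tensor_src, B.prodSum_tgt, β.src, γ.src, Arr.id_tgt]
    have h₃ := congrArg (Arr.map (gradeCast C (J.add_assoc x y z)))
      (Arr.comp_assoc (ζ := B.tensor (B.tensor β.arr γ.arr) δ.arr) hs)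
    rw [Arr.map_comp _ (by rw [Arr.comp_tgt hs, ht]), h, B.tensor_assoc, Arr.comp_assoc hs',
      ← h₂, ← h₁] at h₃
    exact h₃.symm

/-- The identity block of the unit `(0, 1)`. -/
def Block.one : Block C J.zero := (Multi.unit ⟨J.zero, B.one⟩).2

theorem Block.one_mul (β : Block C y) :
    ((Block.one B).mul B β).map (eqToHom (J.zero_add y)) = β := by
  refine Block.ext ?_ ?_
  · rw [Block.map_legs, Block.mul_legs]
    change List.map _ ((β.legs.map fun t => mulLeg B ⟨⟨J.zero, B.one⟩, 𝟙 J.zero⟩ t) ++ []) = _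
    rw [List.append_nil, List.map_map]
    refine (List.map_congr_left fun s _ => ?_).trans (List.map_id _)
    exact one_mulLeg B s
  · have h := B.prodSum_singleton_left Leg.image Leg.image
      (⟨⟨J.zero, B.one⟩, 𝟙 J.zero⟩ : Leg C J.zero) β.legs
    rw [show Leg.image (⟨⟨J.zero, B.one⟩, 𝟙 J.zero⟩ : Leg C J.zero) = B.one from
      map_id_obj _ _] at h
    have h₁ := congrArg (Arr.map (gradeCast C (J.zero_add y)))
      (congrArg (· ⊚ B.tensor (Arr.ident B.one) β.arr) h)
    refine h₁.trans ?_
    rw [Arr.map_comp _ (by rw [B.dlSum_tgt, B.tensor_src, β.src]; rfl), B.dlSum_one,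
      B.one_tensor, ← β.src, Arr.id_comp]

theorem Block.mul_one (β : Block C y) :
    (β.mul B (Block.one B)).map (eqToHom (J.add_zero y)) = β := by
  refine Block.ext ?_ ?_
  · rw [Block.map_legs, Block.mul_legs]
    change List.map _ (β.legs.flatMap fun s => [mulLeg B s ⟨⟨J.zero, B.one⟩, 𝟙 J.zero⟩]) = _
    rw [List.map_flatMap]
    simp only [List.map_singleton, mulLeg_one, List.flatMap_singleton']
  · have h := B.prodSum_singleton_right Leg.image Leg.image β.legs
      (⟨⟨J.zero, B.one⟩, 𝟙 J.zero⟩ : Leg C J.zero)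
    rw [show Leg.image (⟨⟨J.zero, B.one⟩, 𝟙 J.zero⟩ : Leg C J.zero) = B.one from
      map_id_obj _ _, ← β.src] at h
    have h₁ := congrArg (Arr.map (gradeCast C (J.add_zero y)))
      (congrArg (· ⊚ B.tensor β.arr (Arr.ident B.one)) h)
    refine h₁.trans ?_
    rw [Arr.id_comp' (by rw [B.tensor_src, Arr.id_src]), B.tensor_one]

theorem Multi.mul_assoc (μ ν ρ : Multi C) : (μ.mul B ν).mul B ρ = μ.mul B (ν.mul B ρ) :=
  Multi.mk_eq (J.add_assoc _ _ _) (Block.mul_assoc B _ _ _)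

theorem Multi.one_mul (μ : Multi C) : (Multi.unit ⟨J.zero, B.one⟩).mul B μ = μ :=
  Multi.mk_eq (J.zero_add _) (Block.one_mul B _)

theorem Multi.mul_one (μ : Multi C) : μ.mul B (Multi.unit ⟨J.zero, B.one⟩) = μ :=
  Multi.mk_eq (J.add_zero _) (Block.mul_one B _)

theorem Mor.At.congr {f : Mor S T} {j j' : Fin T.len} {L L' : List (Fin S.len)} {μ : Multi C}
    (h : f.At j L μ) (hj : j = j') (hL : L = L') : f.At j' L' μ := by
  subst hj; subst hL; exact h

theorem mul_assoc (S T U : Hocolim C) : mul B.toGradedMul (mul B.toGradedMul S T) U =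
    mul B.toGradedMul S (mul B.toGradedMul T U) := by
  refine ext_entry (Nat.mul_assoc _ _ _) (forall_prod (m := U.len) fun i l => ?_)
  revert i
  refine forall_prod fun i j => ?_
  rw [cast_prod_assoc, mul_entry, mul_entry, mul_entry, mul_entry, mulEntry_assoc]

theorem one_mul (S : Hocolim C) : mul B.toGradedMul (one B.toGradedMul) S = S := by
  refine ext_entry (Nat.one_mul _) (forall_prod (n := 1) fun i j => ?_)
  obtain rfl := Subsingleton.elim i 0
  rw [cast_one_prod, mul_entry, one_mulEntry]

theorem mul_one (S : Hocolim C) : mul B.toGradedMul S (one B.toGradedMul) = S := by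
  refine ext_entry (Nat.mul_one _) (forall_prod (m := 1) fun i j => ?_)
  obtain rfl := Subsingleton.elim j 0
  rw [cast_prod_one, mul_entry, mulEntry_one]

theorem add_mul (S S' T : Hocolim C) : mul B.toGradedMul (add S S') T =
    add (mul B.toGradedMul S T) (mul B.toGradedMul S' T) := by
  refine ext_entry (Nat.add_mul _ _ _) (forall_prod (m := T.len) fun i j => ?_)
  revert i
  refine forall_sum (fun i => ?_) fun i => ?_
  · rw [cast_inl_prod, mul_entry, add_entry_inl, add_entry_inl, mul_entry]
  · rw [cast_inr_prod, mul_entry, add_entry_inr, add_entry_inr, mul_entry]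

theorem mulHom_assoc (f : S ⟶ S') (g : T ⟶ T') (h : U ⟶ U') :
    HEq (mulHom B.toGradedMul B.leftDist (mulHom B.toGradedMul B.leftDist f g) h)
      (mulHom B.toGradedMul B.leftDist f (mulHom B.toGradedMul B.leftDist g h)) := by
  refine Mor.At.heq (mul_assoc B _ _ _) (mul_assoc B _ _ _)
    (forall_prod (m := U'.len) fun i l => ?_)
  revert i
  refine forall_prod fun i j => ?_
  obtain ⟨L, μ, hμ⟩ := Mor.exists_at f i
  obtain ⟨M, ν, hν⟩ := Mor.exists_at g j
  obtain ⟨N, ρ, hρ⟩ := Mor.exists_at h l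
  refine ⟨_, _, Mor.At.mulHom B (Mor.At.mulHom B hμ hν) hρ, ?_⟩
  have := Mor.At.mulHom B hμ (Mor.At.mulHom B hν hρ)
  rw [cast_prod_assoc, Multi.mul_assoc]
  convert this using 2
  simp only [prodList, List.flatMap_assoc, List.flatMap_map, List.map_flatMap, List.map_map]
  refine List.flatMap_congr fun i _ => List.flatMap_congr fun j _ => List.map_congr_left fun l _ => ?_
  exact cast_prod_assoc _ i j l

theorem one_mulHom (f : S ⟶ S') :
    HEq (mulHom B.toGradedMul B.leftDist (𝟙 (one B.toGradedMul)) f) f := by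
  refine Mor.At.heq (one_mul B _) (one_mul B _) (forall_prod (n := 1) fun i j => ?_)
  obtain rfl := Subsingleton.elim i 0
  obtain ⟨L, μ, hμ⟩ := Mor.exists_at f j
  refine ⟨_, _, Mor.At.mulHom B (Mor.at_id (S := one B.toGradedMul) 0) hμ, ?_⟩
  rw [cast_one_prod, Multi.one_mul]
  convert hμ
  simp only [prodList, List.flatMap_singleton, List.map_map]
  exact (List.map_congr_left fun j _ => cast_one_prod _ j).trans (List.map_id _)

theorem mulHom_one (f : S ⟶ S') :
    HEq (mulHom B.toGradedMul B.leftDist f (𝟙 (one B.toGradedMul))) f := by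
  refine Mor.At.heq (mul_one B _) (mul_one B _) (forall_prod (m := 1) fun i j => ?_)
  obtain rfl := Subsingleton.elim j 0
  obtain ⟨L, μ, hμ⟩ := Mor.exists_at f i
  refine ⟨_, _, Mor.At.mulHom B hμ (Mor.at_id (S := one B.toGradedMul) 0), ?_⟩
  rw [cast_prod_one, Multi.mul_one]
  convert hμ
  simp only [prodList, List.map_singleton, List.map_flatMap]
  exact (List.flatMap_congr fun j _ => by rw [cast_prod_one]).trans (List.flatMap_singleton' L)

/-- Strict right distributivity on morphisms: in lexicographic order the products with the first
summand come before those with the second. -/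
theorem add_mulHom (f : S ⟶ S') (f' : T ⟶ T') (g : U ⟶ U') :
    HEq (mulHom B.toGradedMul B.leftDist (addHom f f') g)
      (addHom (mulHom B.toGradedMul B.leftDist f g) (mulHom B.toGradedMul B.leftDist f' g)) := by
  refine Mor.At.heq (add_mul B _ _ _) (add_mul B _ _ _) (forall_prod (m := U'.len) fun i l => ?_)
  obtain ⟨N, ρ, hρ⟩ := Mor.exists_at g l
  revert i
  refine forall_sum (fun i => ?_) fun i => ?_
  · obtain ⟨L, μ, hμ⟩ := Mor.exists_at f i
    refine ⟨_, _, Mor.At.mulHom B hμ.inl hρ, ?_⟩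
    have := Mor.At.inl (g := mulHom B.toGradedMul B.leftDist f' g) (Mor.At.mulHom B hμ hρ)
    refine this.congr (cast_inl_prod _ _ _).symm (Eq.symm ?_)
    simp only [prodList, List.flatMap_map, List.map_flatMap, List.map_map]
    exact List.flatMap_congr fun i _ => List.map_congr_left fun l _ => cast_inl_prod _ i l
  · obtain ⟨L, μ, hμ⟩ := Mor.exists_at f' i
    refine ⟨_, _, Mor.At.mulHom B hμ.inr hρ, ?_⟩
    have := Mor.At.inr (f := mulHom B.toGradedMul B.leftDist f g) (Mor.At.mulHom B hμ hρ)
    refine this.congr (cast_inr_prod _ _ _).symm (Eq.symm ?_)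
    simp only [prodList, List.flatMap_map, List.map_flatMap, List.map_map]
    exact List.flatMap_congr fun i _ => List.map_congr_left fun l _ => cast_inr_prod _ i l

end Hocolim

/-! ### Distributivity in the homotopy colimit -/

namespace Hocolim

section Perm

variable {J : PermCat.{v₁, u₁}} {C : J ⥤ PermCat.{v₂, u₂}} (M : GradedMul J C)
  {S T U S' T' U' : Hocolim C}

theorem leftDist_ψ_inl (i : Fin S.len) (j : Fin T.len) :
    (leftDist M S T U).ψ (finSumFinEquiv (.inl (finProdFinEquiv (i, j)))) =
      finProdFinEquiv (i, finSumFinEquiv (.inl j)) := by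
  change leftDistPerm _ _ _ _ = _
  simp only [leftDistPerm, Equiv.trans_apply, Equiv.symm_apply_apply, Equiv.sumCongr_apply,
    Sum.map_inl]
  rfl

theorem leftDist_ψ_inr (i : Fin S.len) (j : Fin U.len) :
    (leftDist M S T U).ψ (finSumFinEquiv (.inr (finProdFinEquiv (i, j)))) =
      finProdFinEquiv (i, finSumFinEquiv (.inr j)) := by
  change leftDistPerm _ _ _ _ = _
  simp only [leftDistPerm, Equiv.trans_apply, Equiv.symm_apply_apply, Equiv.sumCongr_apply,
    Sum.map_inr]
  rfl

theorem isPerm_leftDist (S T U : Hocolim C) : Mor.IsPerm (leftDist M S T U) := Mor.isPerm_perm _ _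

theorem inl_val {n m : ℕ} (i : Fin n) :
    (finSumFinEquiv (.inl i : Fin n ⊕ Fin m) : ℕ) = i := by simp

theorem inr_val {n m : ℕ} (i : Fin m) :
    (finSumFinEquiv (.inr i : Fin n ⊕ Fin m) : ℕ) = n + i := by simp

theorem prod_val {n m : ℕ} (i : Fin n) (j : Fin m) :
    (finProdFinEquiv (i, j) : ℕ) = j + m * i := rfl

end Perm

variable {J : PermCat.{v₁, u₁}} {C : J ⥤ PermCat.{v₂, u₂}} (B : GradedStrictlyBimonoidal J C)
  {x y z t : J} {S T U V S' T' U' : Hocolim C}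

theorem twist_mulHom (S T U : Hocolim C) :
    HEq (mulHom B.toGradedMul B.leftDist (addTwist S T) (𝟙 U))
      (addTwist (mul B.toGradedMul S U) (mul B.toGradedMul T U)) := by
  refine (Mor.IsPerm.mulHom B (Mor.isPerm_addTwist S T) (isPerm_id U)).heq
    (Mor.isPerm_addTwist _ _) (add_mul B _ _ _) (add_mul B _ _ _)
    (forall_prod (m := U.len) fun i k => ?_)
  revert i
  refine forall_sum (fun i => ?_) fun i => ?_
  · rw [cast_inl_prod, mulHom_ψ, addTwist_ψ_inl, addTwist_ψ_inl, id_ψ]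
    simp only [inr_val, prod_val]; ring
  · rw [cast_inr_prod, mulHom_ψ, addTwist_ψ_inr, addTwist_ψ_inr, id_ψ]
    simp only [inl_val, prod_val]

theorem leftDist_twist (S T U : Hocolim C) :
    leftDist B.toGradedMul S T U ≫
        (show mul B.toGradedMul S (add T U) ⟶ mul B.toGradedMul S (add U T) from
          mulHom B.toGradedMul B.leftDist (𝟙 S) (addTwist T U)) =
      addTwist (mul B.toGradedMul S T) (mul B.toGradedMul S U) ≫ leftDist B.toGradedMul S U T := by
  refine ((isPerm_leftDist _ _ _ _).comp (Mor.IsPerm.mulHom B (isPerm_id S)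
    (Mor.isPerm_addTwist T U))).ext ((Mor.isPerm_addTwist _ _).comp (isPerm_leftDist _ _ _ _))
    (forall_sum (forall_prod fun i j => ?_) (forall_prod fun i j => ?_))
  · rw [comp_ψ, comp_ψ, leftDist_ψ_inl, mulHom_ψ, addTwist_ψ_inl, addTwist_ψ_inl, leftDist_ψ_inr,
      id_ψ]
  · rw [comp_ψ, comp_ψ, leftDist_ψ_inr, mulHom_ψ, addTwist_ψ_inr, addTwist_ψ_inr, leftDist_ψ_inl,
      id_ψ]

theorem leftDist_assoc (S T U V : Hocolim C) :
    HEq (leftDist B.toGradedMul (mul B.toGradedMul S T) U V)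
      (leftDist B.toGradedMul S (mul B.toGradedMul T U) (mul B.toGradedMul T V) ≫
        (show mul B.toGradedMul S (add (mul B.toGradedMul T U) (mul B.toGradedMul T V)) ⟶
            mul B.toGradedMul S (mul B.toGradedMul T (add U V)) from
          mulHom B.toGradedMul B.leftDist (𝟙 S) (leftDist B.toGradedMul T U V))) := by
  refine (isPerm_leftDist _ _ _ _).heq ((isPerm_leftDist _ _ _ _).comp (Mor.IsPerm.mulHom B
    (isPerm_id S) (isPerm_leftDist _ _ _ _)))
    (congrArg₂ add (mul_assoc B _ _ _) (mul_assoc B _ _ _)) (mul_assoc B _ _ _) ?_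
  have e₁ : ∀ (i : Fin S.len) (j : Fin T.len) (k : Fin U.len) h, Fin.cast h
      (finSumFinEquiv (.inl (finProdFinEquiv (finProdFinEquiv (i, j), k)) :
        _ ⊕ Fin (S.len * T.len * V.len))) =
      finSumFinEquiv (.inl (finProdFinEquiv (i, finProdFinEquiv (j, k))) :
        _ ⊕ Fin (S.len * (T.len * V.len))) := fun i j k h =>
    Fin.ext (by simp only [Fin.val_cast, inl_val, prod_val]; ring)
  have e₂ : ∀ (i : Fin S.len) (j : Fin T.len) (k : Fin V.len) h, Fin.cast h
      (finSumFinEquiv (.inr (finProdFinEquiv (finProdFinEquiv (i, j), k)) :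
        Fin (S.len * T.len * U.len) ⊕ _)) =
      finSumFinEquiv (.inr (finProdFinEquiv (i, finProdFinEquiv (j, k))) :
        Fin (S.len * (T.len * U.len)) ⊕ _) := fun i j k h =>
    Fin.ext (by simp only [Fin.val_cast, inr_val, prod_val]; ring)
  refine forall_sum (forall_prod fun i k => ?_) (forall_prod fun i k => ?_)
  · revert i
    refine forall_prod fun i j => ?_
    rw [e₁, comp_ψ, leftDist_ψ_inl, leftDist_ψ_inl, mulHom_ψ, leftDist_ψ_inl, id_ψ]
    simp only [inl_val, prod_val]; ring
  · revert i
    refine forall_prod fun i j => ?_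
    rw [e₂, comp_ψ, leftDist_ψ_inr, leftDist_ψ_inr, mulHom_ψ, leftDist_ψ_inr, id_ψ]
    simp only [inr_val, prod_val]; ring

/-- All arrows of the pentagon are permutation morphisms, hence it suffices to compare indices. -/
theorem pentagon (S S' T T' : Hocolim C) (h) :
    HEq (addHom (leftDist B.toGradedMul S T T') (leftDist B.toGradedMul S' T T'))
      (addHom (addHom (𝟙 (mul B.toGradedMul S T))
          (addTwist (mul B.toGradedMul S T') (mul B.toGradedMul S' T)))
          (𝟙 (mul B.toGradedMul S' T')) ≫ eqToHom h ≫
        leftDist B.toGradedMul (add S S') T T') := by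
  have hS : add (add (mul B.toGradedMul S T) (mul B.toGradedMul S T'))
      (add (mul B.toGradedMul S' T) (mul B.toGradedMul S' T')) =
      add (add (mul B.toGradedMul S T) (add (mul B.toGradedMul S T') (mul B.toGradedMul S' T)))
        (mul B.toGradedMul S' T') := by simp only [add_assoc]
  refine ((isPerm_leftDist _ _ _ _).addHom (isPerm_leftDist _ _ _ _)).heq
    ((((isPerm_id _).addHom (Mor.isPerm_addTwist _ _)).addHom (isPerm_id _)).comp
      ((Mor.isPerm_eqToHom h).comp (isPerm_leftDist _ _ _ _))) hS (add_mul B _ _ _).symm ?_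
  have c : ∀ {n m : ℕ} (h : n = m) (i : Fin n) (j : Fin m), (i : ℕ) = j → Fin.cast h i = j :=
    fun h i j e => Fin.ext e
  refine forall_sum (forall_sum (forall_prod fun i j => ?_) (forall_prod fun i j => ?_))
    (forall_sum (forall_prod fun i j => ?_) (forall_prod fun i j => ?_))
  · rw [c _ _ (finSumFinEquiv (.inl (finSumFinEquiv (.inl (finProdFinEquiv (i, j))))))
      (by simp only [inl_val]), comp_ψ, comp_ψ, addHom_ψ_inl, addHom_ψ_inl, addHom_ψ_inl, id_ψ,
      Mor.eqToHom_ψ,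
      c _ _ (finSumFinEquiv (.inl (finProdFinEquiv (finSumFinEquiv (.inl i), j))))
        (by simp only [inl_val, prod_val]), leftDist_ψ_inl, leftDist_ψ_inl]
    simp only [inl_val, prod_val]
  · rw [c _ _ (finSumFinEquiv (.inl (finSumFinEquiv (.inr (finSumFinEquiv
        (.inl (finProdFinEquiv (i, j))))))))
      (by simp only [inl_val, inr_val]), comp_ψ, comp_ψ, addHom_ψ_inl, addHom_ψ_inl,
      addHom_ψ_inr, addTwist_ψ_inl,
      Mor.eqToHom_ψ,
      c _ _ (finSumFinEquiv (.inr (finProdFinEquiv (finSumFinEquiv (.inl i), j))))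
        (by simp only [inl_val, inr_val, prod_val]; ring), leftDist_ψ_inr, leftDist_ψ_inr]
    simp only [inl_val, inr_val, prod_val]
  · rw [c _ _ (finSumFinEquiv (.inl (finSumFinEquiv (.inr (finSumFinEquiv
        (.inr (finProdFinEquiv (i, j))))))))
      (by simp only [inl_val, inr_val]; ring), comp_ψ, comp_ψ, addHom_ψ_inr, addHom_ψ_inl,
      addHom_ψ_inr, addTwist_ψ_inr, Mor.eqToHom_ψ,
      c _ _ (finSumFinEquiv (.inl (finProdFinEquiv (finSumFinEquiv (.inr i), j))))
        (by simp only [inl_val, inr_val, prod_val]; ring), leftDist_ψ_inl, leftDist_ψ_inl]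
    simp only [inl_val, inr_val, prod_val]; ring
  · rw [c _ _ (finSumFinEquiv (.inr (finProdFinEquiv (i, j))))
      (by simp only [inr_val]; ring), comp_ψ, comp_ψ, addHom_ψ_inr, addHom_ψ_inr, id_ψ,
      Mor.eqToHom_ψ,
      c _ _ (finSumFinEquiv (.inr (finProdFinEquiv (finSumFinEquiv (.inr i), j))))
        (by simp only [inr_val, prod_val]; ring), leftDist_ψ_inr, leftDist_ψ_inr]
    simp only [inr_val, prod_val]; ring

theorem leftDist_mul (S T T' U : Hocolim C) :
    HEq (mulHom B.toGradedMul B.leftDist (leftDist B.toGradedMul S T T') (𝟙 U))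
      (leftDist B.toGradedMul S (mul B.toGradedMul T U) (mul B.toGradedMul T' U)) := by
  have hS : mul B.toGradedMul (add (mul B.toGradedMul S T) (mul B.toGradedMul S T')) U =
      add (mul B.toGradedMul S (mul B.toGradedMul T U))
        (mul B.toGradedMul S (mul B.toGradedMul T' U)) := by
    rw [add_mul, mul_assoc, mul_assoc]
  have hT : mul B.toGradedMul (mul B.toGradedMul S (add T T')) U =
      mul B.toGradedMul S (add (mul B.toGradedMul T U) (mul B.toGradedMul T' U)) := by
    rw [mul_assoc, add_mul]
  refine (Mor.IsPerm.mulHom B (isPerm_leftDist _ _ _ _) (isPerm_id U)).heq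
    (isPerm_leftDist _ _ _ _) hS hT (forall_prod (m := U.len) fun i k => ?_)
  have c : ∀ {n m : ℕ} (h : n = m) (i : Fin n) (j : Fin m), (i : ℕ) = j → Fin.cast h i = j :=
    fun h i j e => Fin.ext e
  revert i
  refine forall_sum (forall_prod fun i j => ?_) (forall_prod fun i j => ?_)
  · rw [c _ _ (finSumFinEquiv (.inl (finProdFinEquiv (i, finProdFinEquiv (j, k)))))
      (by simp only [inl_val, prod_val]; ring), leftDist_ψ_inl, mulHom_ψ, leftDist_ψ_inl, id_ψ]
    simp only [inl_val, prod_val]; ring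
  · rw [c _ _ (finSumFinEquiv (.inr (finProdFinEquiv (i, finProdFinEquiv (j, k)))))
      (by simp only [inr_val, prod_val]; ring), leftDist_ψ_inr, mulHom_ψ, leftDist_ψ_inr, id_ψ]
    simp only [inr_val, prod_val]; ring

theorem leftDist_add (S T T' T'' : Hocolim C) :
    HEq (addHom (leftDist B.toGradedMul S T T') (𝟙 (mul B.toGradedMul S T'')) ≫
        leftDist B.toGradedMul S (add T T') T'')
      (addHom (𝟙 (mul B.toGradedMul S T)) (leftDist B.toGradedMul S T' T'') ≫
        leftDist B.toGradedMul S T (add T' T'')) := by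
  refine (((isPerm_leftDist _ _ _ _).addHom (isPerm_id _)).comp (isPerm_leftDist _ _ _ _)).heq
    (((isPerm_id _).addHom (isPerm_leftDist _ _ _ _)).comp (isPerm_leftDist _ _ _ _))
    (add_assoc _ _ _) (congrArg _ (add_assoc _ _ _)) (forall_sum (forall_sum
      (forall_prod fun i j => ?_) (forall_prod fun i j => ?_)) (forall_prod fun i j => ?_))
  · rw [cast_inl_inl, comp_ψ, comp_ψ, addHom_ψ_inl, addHom_ψ_inl, leftDist_ψ_inl, leftDist_ψ_inl,
      id_ψ, leftDist_ψ_inl]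
    simp only [inl_val, prod_val]; ring
  · rw [cast_inl_inr, comp_ψ, comp_ψ, addHom_ψ_inl, addHom_ψ_inr, leftDist_ψ_inl, leftDist_ψ_inr,
      leftDist_ψ_inl, leftDist_ψ_inr]
    simp only [inl_val, inr_val, prod_val]; ring
  · rw [cast_inr, comp_ψ, comp_ψ, addHom_ψ_inr, addHom_ψ_inr, id_ψ, leftDist_ψ_inr,
      leftDist_ψ_inr, leftDist_ψ_inr]
    simp only [inr_val, prod_val]; ring

/-- Over the index `(i, j)` both composites have the product of the multimorphism of `f` over `i`
with that of `g` or `g'` over `j`. -/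
theorem leftDist_natural (f : S ⟶ S') (g : T ⟶ T') (g' : U ⟶ U') :
    (show add (mul B.toGradedMul S T) (mul B.toGradedMul S U) ⟶
        add (mul B.toGradedMul S' T') (mul B.toGradedMul S' U') from
      addHom (mulHom B.toGradedMul B.leftDist f g) (mulHom B.toGradedMul B.leftDist f g')) ≫
        leftDist B.toGradedMul S' T' U' =
      leftDist B.toGradedMul S T U ≫
        (show mul B.toGradedMul S (add T U) ⟶ mul B.toGradedMul S' (add T' U') from
          mulHom B.toGradedMul B.leftDist f (addHom g g')) := by
  refine Mor.At.ext (forall_prod fun r s => ?_)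
  obtain ⟨L, μ, hμ⟩ := Mor.exists_at f r
  revert s
  refine forall_sum (fun s => ?_) fun s => ?_
  · obtain ⟨N, ν, hν⟩ := Mor.exists_at g s
    have h := ((Mor.At.mulHom B hμ hν).inl (g := mulHom B.toGradedMul B.leftDist f g')).comp_perm
      (isPerm_leftDist _ _ _ _)
    rw [leftDist_ψ_inl] at h
    refine ⟨_, _, h, Mor.At.perm_comp (isPerm_leftDist _ _ _ _)
      ((Mor.At.mulHom B hμ (hν.inl (g := g'))).congr rfl ?_)⟩
    simp only [prodList, List.map_flatMap, List.map_map]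
    refine List.flatMap_congr fun i _ => List.map_congr_left fun j _ => ?_
    exact (leftDist_ψ_inl _ i j).symm
  · obtain ⟨N, ν, hν⟩ := Mor.exists_at g' s
    have h := ((Mor.At.mulHom B hμ hν).inr (f := mulHom B.toGradedMul B.leftDist f g)).comp_perm
      (isPerm_leftDist _ _ _ _)
    rw [leftDist_ψ_inr] at h
    refine ⟨_, _, h, Mor.At.perm_comp (isPerm_leftDist _ _ _ _)
      ((Mor.At.mulHom B hμ (hν.inr (f := g))).congr rfl ?_)⟩
    simp only [prodList, List.map_flatMap, List.map_map]
    refine List.flatMap_congr fun i _ => List.map_congr_left fun j _ => ?_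
    exact (leftDist_ψ_inr _ i j).symm

/-- The inverse of a permutation morphism. -/
theorem Mor.perm_inverse (e : Fin S.len ≃ Fin T.len) (h : ∀ i, S.entry i = T.entry (e i)) :
    ∃ g : T ⟶ S, (show S ⟶ T from Mor.perm e h) ≫ g = 𝟙 S ∧
      g ≫ (show S ⟶ T from Mor.perm e h) = 𝟙 T := by
  have h' : ∀ i, T.entry i = S.entry (e.symm i) := fun i => by rw [h, e.apply_symm_apply]
  refine ⟨Mor.perm e.symm h', ?_, ?_⟩
  · exact ((Mor.isPerm_perm e h).comp (Mor.isPerm_perm e.symm h')).ext (isPerm_id S)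
      fun i => e.symm_apply_apply i
  · exact ((Mor.isPerm_perm e.symm h').comp (Mor.isPerm_perm e h)).ext (isPerm_id T)
      fun i => e.apply_symm_apply i

theorem leftDist_iso (S T U : Hocolim C) :
    ∃ e : mul B.toGradedMul S (add T U) ⟶ add (mul B.toGradedMul S T) (mul B.toGradedMul S U),
      leftDist B.toGradedMul S T U ≫ e = 𝟙 _ ∧ e ≫ leftDist B.toGradedMul S T U = 𝟙 _ :=
  Mor.perm_inverse _ _

theorem isZerolessBimonoidalCore :
    IsZerolessBimonoidalCore (bimonData B.toGradedMul B.leftDist) where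
  permutative := isZerolessPermutative
  mulHom_id := mulHom_id B
  mulHom_comp := mulHom_comp B
  mul_assoc := mul_assoc B
  mulHom_assoc := mulHom_assoc B
  one_mul := one_mul B
  one_mulHom := one_mulHom B
  mul_one := mul_one B
  mulHom_one := mulHom_one B
  add_mul := add_mul B
  add_mulHom := add_mulHom B
  twist_mulHom := twist_mulHom B
  leftDist_twist := leftDist_twist B
  leftDist_assoc := leftDist_assoc B
  pentagon S S' T T' := by
    dsimp only [bimonData, addData]
    exact pentagon B S S' T T' _

theorem isZerolessStrictlyBimonoidal :
    IsZerolessStrictlyBimonoidal (bimonData B.toGradedMul B.leftDist) where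
  toIsZerolessBimonoidalCore := isZerolessBimonoidalCore B
  leftDist_iso := leftDist_iso B
  leftDist_natural := leftDist_natural B
  leftDist_mul := leftDist_mul B
  leftDist_add := leftDist_add B

end Hocolim

/-! ### Graded bipermutative categories are strictly bimonoidal -/

namespace Arr

variable {X : Type u} [Category.{v} X] {Y : Type u₁} [Category.{v₁} Y]

/-- The arrow `θ` is inverse to `φ`. -/
structure Inverse (φ θ : Arr X) : Prop where
  src : θ.src = φ.tgt
  tgt : θ.tgt = φ.src
  hom_inv : φ ⊚ θ = ident φ.src
  inv_hom : θ ⊚ φ = ident φ.tgt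

theorem Inverse.symm {φ θ : Arr X} (h : Inverse φ θ) : Inverse θ φ :=
  ⟨h.tgt.symm, h.src.symm, by rw [h.inv_hom, h.src], by rw [h.hom_inv, h.tgt]⟩

theorem Inverse.isIso {a b : X} {f : a ⟶ b} {θ : Arr X} (h : Inverse (Arr.mk f) θ) : IsIso f := by
  obtain ⟨g⟩ := θ
  obtain ⟨h₁, h₂, h₃, h₄⟩ := h
  dsimp only at h₁ h₂
  subst h₁
  subst h₂
  rw [← mk_comp] at h₃ h₄
  exact ⟨g, mk_inj.1 h₃, mk_inj.1 h₄⟩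

theorem Inverse.map {φ θ : Arr X} (h : Inverse φ θ) (F : X ⥤ Y) :
    Inverse (φ.map F) (θ.map F) := by
  refine ⟨by simp [h.src], by simp [h.tgt], ?_, ?_⟩
  · rw [← map_comp F h.src.symm, h.hom_inv, map_id]; rfl
  · rw [← map_comp F h.tgt, h.inv_hom, map_id]; rfl

theorem Inverse.add {P : PermCat.{v, u}} {φ θ φ' θ' : Arr P} (h : Inverse φ θ)
    (h' : Inverse φ' θ') : Inverse (φ + φ') (θ + θ') := by
  refine ⟨by simp [h.src, h'.src], by simp [h.tgt, h'.tgt], ?_, ?_⟩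
  · rw [add_comp h.src.symm h'.src.symm, h.hom_inv, h'.hom_inv, add_src, id_add]
  · rw [add_comp h.tgt h'.tgt, h.inv_hom, h'.inv_hom, add_tgt, id_add]

theorem Inverse.comp {φ θ φ' θ' : Arr X} (h : Inverse φ θ) (h' : Inverse φ' θ')
    (e : φ.tgt = φ'.src) : Inverse (φ ⊚ φ') (θ' ⊚ θ) := by
  have e' : θ'.tgt = θ.src := by rw [h'.tgt, h.src, e]
  refine ⟨by rw [comp_src, comp_tgt e, h'.src], by rw [comp_src, comp_tgt e', h.tgt], ?_, ?_⟩
  · rw [comp_assoc e, ← comp_assoc h'.src.symm, h'.hom_inv, ← e, ← h.src, id_comp, h.hom_inv,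
      comp_src]
  · rw [comp_assoc e', ← comp_assoc h.tgt, h.inv_hom, e, id_comp, h'.inv_hom, comp_tgt e]

theorem Inverse.cancel_right {φ θ ζ ζ' : Arr X} (h : Inverse φ θ) (h₁ : ζ.tgt = φ.src)
    (h₂ : ζ'.tgt = φ.src) (e : ζ ⊚ φ = ζ' ⊚ φ) : ζ = ζ' := by
  have : (ζ ⊚ φ) ⊚ θ = (ζ' ⊚ φ) ⊚ θ := congrArg (· ⊚ θ) e
  rwa [comp_assoc h₁, comp_assoc h₂, h.hom_inv, comp_id, comp_id] at this

theorem Inverse.cancel_left {φ θ ζ ζ' : Arr X} (h : Inverse φ θ) (h₁ : φ.tgt = ζ.src)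
    (h₂ : φ.tgt = ζ'.src) (e : φ ⊚ ζ = φ ⊚ ζ') : ζ = ζ' := by
  have : θ ⊚ φ ⊚ ζ = θ ⊚ φ ⊚ ζ' := congrArg (θ ⊚ ·) e
  rwa [← comp_assoc h.tgt, ← comp_assoc h.tgt, h.inv_hom, h₁, id_comp, ← h₁, h₂, id_comp] at this

end Arr

theorem Arr.eq_eqToHom {X : Type u} [Category.{v} X] {a b : X} {f : a ⟶ b} (h : a = b)
    (hf : Arr.mk f = ident a) : f = eqToHom h := by
  subst h; exact Arr.mk_inj.1 hf

theorem PermCat.twist_zero_right (P : PermCat.{v, u}) (a : P) :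
    P.twist a P.zero = eqToHom ((P.add_zero a).trans (P.zero_add a).symm) :=
  Arr.eq_eqToHom _ ((Arr.tw_zero a).trans (by rw [P.add_zero]))

theorem PermCat.twist_zero_left (P : PermCat.{v, u}) (a : P) :
    P.twist P.zero a = eqToHom ((P.zero_add a).trans (P.add_zero a).symm) :=
  Arr.eq_eqToHom _ ((Arr.zero_tw a).trans (by rw [P.zero_add]))

section Functor

variable {J : PermCat.{v₁, u₁}} {C : J ⥤ PermCat.{v₂, u₂}} {x y z t : J}

theorem Arr.map_functor_comp (k : x ⟶ y) (l : y ⟶ z) (φ : Arr (C.obj x)) :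
    (φ.map (C.map k).functor).map (C.map l).functor = φ.map (C.map (k ≫ l)).functor := by
  rw [C.map_comp]; rfl

theorem Arr.map_functor_id (φ : Arr (C.obj x)) : φ.map (C.map (𝟙 x)).functor = φ := by
  rw [C.map_id]; rfl

theorem Arr.map_twist_twist (φ : Arr (C.obj (J.add x y))) :
    (φ.map (C.map (J.twist x y)).functor).map (C.map (J.twist y x)).functor = φ := by
  rw [map_functor_comp, J.twist_twist, map_functor_id]

/-- The isomorphism `C(x) ⟶ C(y)` induced by an isomorphism of `J` is injective on arrows. -/
theorem Arr.map_injective (k : x ⟶ y) (l : y ⟶ x) (h : k ≫ l = 𝟙 x) {φ θ : Arr (C.obj x)}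
    (e : φ.map (C.map k).functor = θ.map (C.map k).functor) : φ = θ := by
  have := congrArg (Arr.map (C.map l).functor) e
  rwa [map_functor_comp, map_functor_comp, h, map_functor_id, map_functor_id] at this

theorem gradeCast_eq (h : x = y) {a : C.obj x} {b : C.obj y}
    (e : (⟨x, a⟩ : Σ x : J, C.obj x) = ⟨y, b⟩) : (gradeCast C h).obj a = b := by
  rw [Hocolim.sigma_gradeCast h] at e
  exact eq_of_heq (Sigma.mk.inj e).2

theorem Arr.map_gradeCast_injective (h : x = y) {φ θ : Arr (C.obj x)}
    (e : φ.map (gradeCast C h) = θ.map (gradeCast C h)) : φ = θ :=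
  map_injective (eqToHom h) (eqToHom h.symm) (by simp) e

end Functor

namespace GradedBipermutative

open Arr

variable {J : PermCat.{v₁, u₁}} {C : J ⥤ PermCat.{v₂, u₂}} (B : GradedBipermutative J C)
  {x y z t : J}

/-- The multiplicative twist `a ⊗ b ⟶ C(χ)(b ⊗ a)` as an arrow. -/
def tm (a : C.obj x) (b : C.obj y) : Arr (C.obj (J.add x y)) := Arr.mk (B.mulTwist a b)

@[simp] theorem tm_src (a : C.obj x) (b : C.obj y) : (B.tm a b).src = B.mul a b := rfl

@[simp] theorem tm_tgt (a : C.obj x) (b : C.obj y) :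
    (B.tm a b).tgt = (C.map (J.twist y x)).functor.obj (B.mul b a) := rfl

theorem tm_natural (φ : Arr (C.obj x)) (θ : Arr (C.obj y)) :
    B.tensor φ θ ⊚ B.tm φ.tgt θ.tgt =
      B.tm φ.src θ.src ⊚ (B.tensor θ φ).map (C.map (J.twist y x)).functor := by
  refine (mk_comp _ _).symm.trans (Eq.trans ?_ (mk_comp _ _))
  exact congrArg Arr.mk (B.mulTwist_natural _ _)

theorem map_tm (k : x ⟶ z) (l : y ⟶ t) (a : C.obj x) (b : C.obj y) :
    (B.tm a b).map (C.map (J.addHom k l)).functor =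
      B.tm ((C.map k).functor.obj a) ((C.map l).functor.obj b) := by
  refine mk_eq (B.map_mul _ _ _ _) ?_ (B.map_mulTwist k l a b)
  rw [← B.map_mul]
  have e : ∀ {p q r : J} (k : p ⟶ q) (l : q ⟶ r) (a : C.obj p),
      (C.map l).functor.obj ((C.map k).functor.obj a) = (C.map (k ≫ l)).functor.obj a := by
    intro p q r k l a
    rw [C.map_comp]; rfl
  refine (e _ _ _).trans (Eq.trans ?_ (e _ _ _).symm)
  rw [J.twist_natural]

theorem tm_tm (a : C.obj x) (b : C.obj y) :
    B.tm a b ⊚ (B.tm b a).map (C.map (J.twist y x)).functor = ident (B.mul a b) := by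
  refine (mk_comp _ _).symm.trans (mk_eq rfl ?_ (B.mulTwist_mulTwist a b))
  exact GradedMul.map_twist_twist _ _ _

theorem tm_inverse (a : C.obj x) (b : C.obj y) :
    Inverse (B.tm a b) ((B.tm b a).map (C.map (J.twist y x)).functor) := by
  refine ⟨rfl, GradedMul.map_twist_twist _ _ _, B.tm_tm a b, ?_⟩
  have h := congrArg (Arr.map (C.map (J.twist y x)).functor) (B.tm_tm b a)
  rw [Arr.map_comp _ rfl, map_twist_twist] at h
  exact h.trans (map_id _ _)

theorem tm_one (a : C.obj x) : B.tm a B.one = ident (B.mul a B.one) := by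
  refine mk_eq rfl ?_ (B.mulTwist_one a)
  rw [J.twist_zero_left]
  refine gradeCast_eq _ ?_
  rw [Hocolim.sigma_gradeCast (J.zero_add x), Hocolim.sigma_gradeCast (J.add_zero x), B.one_mul,
    B.mul_one]

theorem one_tm (a : C.obj x) : B.tm B.one a = ident (B.mul B.one a) := by
  refine mk_eq rfl ?_ (B.one_mulTwist a)
  rw [J.twist_zero_right]
  refine gradeCast_eq _ ?_
  rw [Hocolim.sigma_gradeCast (J.zero_add x), Hocolim.sigma_gradeCast (J.add_zero x), B.one_mul,
    B.mul_one]

/-- The left distributivity as an arrow. -/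
def dl (a : C.obj x) (b b' : C.obj y) : Arr (C.obj (J.add x y)) := Arr.mk (B.leftDist a b b')

@[simp] theorem dl_src (a : C.obj x) (b b' : C.obj y) :
    (B.dl a b b').src = (C.obj (J.add x y)).add (B.mul a b) (B.mul a b') := rfl

@[simp] theorem dl_tgt (a : C.obj x) (b b' : C.obj y) :
    (B.dl a b b').tgt = B.mul a ((C.obj y).add b b') := rfl

theorem dl_eq (a : C.obj x) (b b' : C.obj y) : B.dl a b b' =
    (B.tm a b + B.tm a b') ⊚
      (B.tm ((C.obj y).add b b') a).map (C.map (J.twist y x)).functor := by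
  refine (mk_comp _ _).trans (congrArg₂ (· ⊚ ·) rfl ?_)
  refine (mk_eqToHom_comp _ _).trans ?_
  exact mk_comp_eqToHom _ _

theorem add_tm_tgt (a : C.obj x) (b b' : C.obj y) : (B.tm a b + B.tm a b').tgt =
    ((B.tm ((C.obj y).add b b') a).map (C.map (J.twist y x)).functor).src := by
  rw [add_tgt, tm_tgt, tm_tgt, map_src, tm_src, B.add_mul, (C.map (J.twist y x)).obj_add]

/-- Under the multiplicative twist, the left distributivity becomes the identity. -/
theorem dl_tm (a : C.obj x) (b b' : C.obj y) :
    B.dl a b b' ⊚ B.tm a ((C.obj y).add b b') = B.tm a b + B.tm a b' := by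
  rw [dl_eq, comp_assoc (B.add_tm_tgt a b b'), (B.tm_inverse a _).inv_hom]
  exact comp_id _ _

theorem add_tm_dl (a : C.obj x) (b b' : C.obj y) :
    (B.tm b a + B.tm b' a) ⊚ (B.dl a b b').map (C.map (J.twist x y)).functor =
      B.tm ((C.obj y).add b b') a := by
  rw [dl_eq, Arr.map_comp _ (B.add_tm_tgt a b b'), map_twist_twist, Arr.map_add,
    ← comp_assoc rfl, add_comp rfl rfl, B.tm_tm, B.tm_tm]
  rw [← id_add, id_comp' (by rw [tm_src, B.add_mul])]

/-- Naturality is that of the multiplicative twist, since the distributivity is conjugate to an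
identity. -/
theorem dl_natural (φ : Arr (C.obj x)) (θ θ' : Arr (C.obj y)) :
    (B.tensor φ θ + B.tensor φ θ') ⊚ B.dl φ.tgt θ.tgt θ'.tgt =
      B.dl φ.src θ.src θ'.src ⊚ B.tensor φ (θ + θ') := by
  refine (B.tm_inverse φ.tgt ((C.obj y).add θ.tgt θ'.tgt)).cancel_right
    (by rw [comp_tgt (by simp)]; simp) (by rw [comp_tgt (by simp)]; simp) ?_
  have h := B.tm_natural φ (θ + θ')
  have h₁ := B.tm_natural φ θ
  have h₂ := B.tm_natural φ θ'
  rw [add_tgt] at h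
  rw [comp_assoc (by simp), comp_assoc (by simp), h, dl_tm, ← comp_assoc (by simp), add_src, dl_tm,
    add_comp (by simp) (by simp), h₁, h₂, B.add_tensor, Arr.map_add, add_comp rfl rfl]

theorem isIso_leftDist (a : C.obj x) (b b' : C.obj y) : IsIso (B.leftDist a b b') := by
  have h := ((B.tm_inverse a b).add (B.tm_inverse a b')).comp
    (B.tm_inverse a ((C.obj y).add b b')).symm (B.add_tm_tgt a b b')
  rw [← dl_eq] at h
  exact Inverse.isIso h

theorem map_dl (k : x ⟶ z) (l : y ⟶ t) (a : C.obj x) (b b' : C.obj y) :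
    (B.dl a b b').map (C.map (J.addHom k l)).functor =
      B.dl ((C.map k).functor.obj a) ((C.map l).functor.obj b) ((C.map l).functor.obj b') := by
  rw [dl_eq, dl_eq, Arr.map_comp _ (B.add_tm_tgt a b b'), Arr.map_add, map_tm, map_tm,
    map_functor_comp, ← J.twist_natural, ← map_functor_comp, map_tm, (C.map l).obj_add]

theorem dl_add (a : C.obj x) (b b' b'' : C.obj y) :
    (B.dl a b b' + ident (B.mul a b'')) ⊚ B.dl a ((C.obj y).add b b') b'' =
      (ident (B.mul a b) + B.dl a b' b'') ⊚ B.dl a b ((C.obj y).add b' b'') := by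
  refine (B.tm_inverse a ((C.obj y).add ((C.obj y).add b b') b'')).cancel_right
    (by rw [comp_tgt (by simp)]; simp)
    (by rw [comp_tgt (by simp)]; simp [(C.obj y).add_assoc]) ?_
  have h := B.dl_tm a b ((C.obj y).add b' b'')
  rw [← (C.obj y).add_assoc] at h
  have e : ∀ b : C.obj y, (ident (B.mul a b) ⊚ B.tm a b) = B.tm a b := fun b =>
    id_comp (B.tm a b)
  rw [comp_assoc (by simp), dl_tm, comp_assoc (by simp), h, add_comp (by simp) (by simp),
    add_comp (by simp) (by simp), dl_tm, dl_tm, e, e, _root_.add_assoc]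

/-- The coherence of the twist of `J` that matches the two sides of the hexagon. -/
theorem twist_add_assoc (x y z : J) :
    J.addHom (J.twist x z) (𝟙 y) ≫ eqToHom (J.add_assoc z x y) ≫ J.twist z (J.add x y) ≫
        eqToHom (J.add_assoc x y z) =
      eqToHom (J.add_assoc x z y) ≫ J.addHom (𝟙 x) (J.twist z y) := by
  have h := tw_add' x y z
  have e : (tw x z + ident y) ⊚ tw z (J.add x y) = ident x + tw z y := by
    rw [h, ← comp_assoc (by simp), ← comp_add_id (by simp), tw_tw, ← id_add, ← id_add,
      id_comp' (by simp [J.add_assoc])]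
  refine mk_inj.1 ((mk_comp _ _).trans ?_)
  refine (congrArg (Arr.mk _ ⊚ ·) ((mk_eqToHom_comp _ _).trans (mk_comp_eqToHom _ _))).trans ?_
  exact e.trans (mk_eqToHom_comp _ _).symm

theorem _root_.Arr.Inverse.tensor_id (M : GradedMul J C) {φ θ : Arr (C.obj x)} (h : Inverse φ θ)
    (b : C.obj y) : Inverse (M.tensor φ (ident b)) (M.tensor θ (ident b)) := by
  have e : ident b ⊚ ident b = ident b := comp_id _ _
  refine ⟨by simp [h.src], by simp [h.tgt], ?_, ?_⟩
  · rw [← M.tensor_comp h.src.symm rfl, h.hom_inv, e, M.tensor_id]; rfl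
  · rw [← M.tensor_comp h.tgt rfl, h.inv_hom, e, M.tensor_id]; rfl

/-- The hexagon as an equation of arrows, solved for `a ⊗ γ`. -/
theorem hexagon (a : C.obj x) (b : C.obj y) (c : C.obj z) :
    (B.tm (B.mul a b) c ⊚ (B.tensor (B.tm c a) (ident b)).map
        (C.map (eqToHom (J.add_assoc z x y) ≫ J.twist z (J.add x y))).functor).map
          (gradeCast C (J.add_assoc x y z)) =
      B.tensor (ident a) (B.tm b c) := by
  refine Eq.trans ?_ (mk_eq (B.mul_assoc a b c) ?_ (B.mulTwist_mul a b c))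
  · have e : B.tm (B.mul a b) c ⊚ (B.tensor (B.tm c a) (ident b)).map
        (C.map (eqToHom (J.add_assoc z x y) ≫ J.twist z (J.add x y))).functor =
        Arr.mk (B.mulTwist (B.mul a b) c ≫ eqToHom (GradedMul.map_assoc_twist _ _ _ _) ≫
          (C.map (eqToHom (J.add_assoc z x y) ≫ J.twist z (J.add x y))).functor.map
            (B.mulHom (B.mulTwist c a) (𝟙 b))) :=
      ((mk_comp _ _).trans (congrArg (Arr.mk _ ⊚ ·) (mk_eqToHom_comp _ _))).symm
    exact congrArg (Arr.map (gradeCast C (J.add_assoc x y z))) e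
  · have e : ∀ {p q r : J} (k : p ⟶ q) (l : q ⟶ r) (a : C.obj p),
        (C.map l).functor.obj ((C.map k).functor.obj a) = (C.map (k ≫ l)).functor.obj a := by
      intro p q r k l a
      rw [C.map_comp]; rfl
    have h₁ := B.map_mul (J.twist x z) (𝟙 y) (B.mul a c) b
    have h₂ := B.map_mul (𝟙 x) (J.twist z y) a (B.mul c b)
    rw [Hocolim.map_id_obj] at h₁ h₂
    change _ = B.mul a ((C.map (J.twist z y)).functor.obj (B.mul c b))
    rw [← h₁, ← h₂, ← B.mul_assoc a c b]
    refine (congrArg _ (e _ _ _)).trans ((e _ _ _).trans (Eq.trans ?_ (e _ _ _).symm))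
    rw [← twist_add_assoc, Category.assoc, Category.assoc]

/-- The two arrows on the left of the hexagon are composable. -/
theorem hexagon_comp (a : C.obj x) (b : C.obj y) (c : C.obj z) : (B.tm (B.mul a b) c).tgt =
    ((B.tensor (B.tm c a) (ident b)).map
      (C.map (eqToHom (J.add_assoc z x y) ≫ J.twist z (J.add x y))).functor).src :=
  GradedMul.map_assoc_twist _ _ _ _

/-- The sum of the hexagons for `b` and `b'` is the hexagon for `b ⊕ b'` by strict right
distributivity.  Writing sums of twists as distributivities (`dl_tm`, `add_tm_dl`) and
cancelling the invertible twists on both sides leaves the asserted equation. -/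
theorem dl_mul (a : C.obj x) (b b' : C.obj y) (c : C.obj z) :
    (B.tensor (B.dl a b b') (ident c)).map (gradeCast C (J.add_assoc x y z)) =
      B.dl a (B.mul b c) (B.mul b' c) := by
  have h₁ := B.hexagon b c a
  have h₂ := B.hexagon b' c a
  have h₃ := B.hexagon ((C.obj y).add b b') c a
  rw [id_add, B.add_tensor, ← h₁, ← h₂] at h₃
  have h₄ := map_gradeCast_injective _
    (h₃.trans (Arr.map_add (C.map (eqToHom (J.add_assoc y z x))) _ _).symm)
  rw [← add_comp (B.hexagon_comp b c a) (B.hexagon_comp b' c a), ← Arr.map_add, ← B.add_tensor,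
    ← dl_tm] at h₄
  have h₅ := B.tensor_comp (φ := B.dl a b b') (φ' := B.tm a ((C.obj y).add b b'))
    (θ := ident c) (θ' := ident c) rfl rfl
  rw [comp_id] at h₅
  have hc : (B.tm (B.mul b c) a + B.tm (B.mul b' c) a).tgt =
      ((B.tensor (B.dl a b b') (ident c)).map
        (C.map (eqToHom (J.add_assoc x y z) ≫ J.twist x (J.add y z))).functor).src := by
    rw [add_tgt, B.hexagon_comp, B.hexagon_comp, map_src, map_src, map_src, B.tensor_src,
      B.tensor_src, B.tensor_src, dl_src]
    refine (StrictHom.obj_add _ _ _).symm.trans (congrArg _ (B.add_mul _ _ _).symm)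
  rw [h₅, Arr.map_comp _ rfl, ← comp_assoc hc] at h₄
  -- cancel the twist of `a` with `b ⊕ b'` on the right and those with `b ⊗ c`, `b' ⊗ c` on the left
  have hi := ((B.tm_inverse a ((C.obj y).add b b')).tensor_id B.toGradedMul c).map
    (C.map (eqToHom (J.add_assoc x y z) ≫ J.twist x (J.add y z))).functor
  have h₆ := hi.cancel_right (B.hexagon_comp _ _ _) ((comp_tgt hc).trans rfl) h₄
  have h₇ := B.add_tm_dl a (B.mul b c) (B.mul b' c)
  rw [← B.add_mul, h₆] at h₇
  have h₈ := ((B.tm_inverse (B.mul b c) a).add (B.tm_inverse (B.mul b' c) a)).cancel_left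
    (by rw [add_tgt, tm_tgt, tm_tgt, map_src, dl_src, StrictHom.obj_add]) hc h₇
  rw [← map_functor_comp] at h₈
  exact (map_injective _ _ (J.twist_twist _ _) h₈).symm

/-- A graded bipermutative category as a graded strictly bimonoidal category. -/
def toGradedStrictlyBimonoidal : GradedStrictlyBimonoidal J C where
  toGradedMul := B.toGradedMul
  leftDist := B.leftDist
  isIso_leftDist := B.isIso_leftDist
  leftDist_natural f g g' := by
    have h := B.dl_natural (Arr.mk f) (Arr.mk g) (Arr.mk g')
    exact mk_inj.1 ((mk_comp _ _).trans (h.trans (mk_comp _ _).symm))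
  map_leftDist k l a b b' := Arr.heq (B.map_dl k l a b b')
  leftDistLaws := B.leftDistLaws
  leftDist_mul a b b' c := Arr.heq (B.dl_mul a b b' c)
  leftDist_add a b b' b'' := Arr.heq ((mk_comp _ _).trans
    ((B.dl_add a b b' b'').trans (mk_comp _ _).symm))

end GradedBipermutative

/-! ### The multiplicative twist of the homotopy colimit -/

namespace GradedBipermutative

open Arr

variable {J : PermCat.{v₁, u₁}} {C : J ⥤ PermCat.{v₂, u₂}} (B : GradedBipermutative J C)
  {x y z t : J} {ι : Type w} {κ : Type w'}

/-- The distributivity for `(a, 0, 0)` is an identity, so `dl_tm` makes the twist `γ` of `a` and `0`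
equal to `γ ⊕ γ = γ ∘ γ`; being invertible it is an identity. -/
theorem tm_zero (a : C.obj x) : B.tm a (C.obj y).zero = 0 := by
  have h₁ : (B.tm a (C.obj y).zero).src = (0 : Arr (C.obj (J.add x y))).tgt := B.mul_zero a
  have h₂ : (B.tm a (C.obj y).zero).tgt = (0 : Arr (C.obj (J.add x y))).src := by
    rw [tm_tgt, B.zero_mul, StrictHom.obj_zero]; rfl
  have h := B.dl_tm a (C.obj y).zero (C.obj y).zero
  have h₃ : B.dl a (C.obj y).zero (C.obj y).zero = 0 :=
    B.toGradedStrictlyBimonoidal.dl_zero_zero a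
  rw [h₃, PermCat.zero_add] at h
  -- the sum of two endomorphisms of the zero object is their composite
  have h₄ := add_comp (φ := B.tm a (C.obj y).zero) (φ' := 0) (θ := 0)
    (θ' := B.tm a (C.obj y).zero) h₂ h₁.symm
  rw [add_zero, zero_add] at h₄
  have e₁ : (B.tm a (C.obj y).zero ⊚ (0 : Arr (C.obj (J.add x y)))) = B.tm a (C.obj y).zero := by
    rw [zero_def]; exact comp_id _ _
  have e₂ : ((0 : Arr (C.obj (J.add x y))) ⊚ B.tm a (C.obj y).zero) = B.tm a (C.obj y).zero := by
    rw [zero_def]; exact id_comp' h₁.symm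
  rw [e₁, e₂] at h₄
  refine (B.tm_inverse a (C.obj y).zero).cancel_right (h₂.trans h₁.symm) h₁.symm ?_
  exact h₄.trans h.symm

theorem zero_tm (c : C.obj y) : B.tm (C.obj x).zero c = 0 := by
  have h := B.tm_tm (C.obj x).zero c
  rw [tm_zero, Arr.map_zero, zero_def] at h
  exact (comp_id _ _).symm.trans (h.trans (congrArg ident (B.zero_mul c)))

/-- The iterated left distributivity followed by the twist of the sum is the sum of the twists. -/
theorem dlSum_tm (a : C.obj x) (b : κ → C.obj y) (M : List κ) :
    B.toGradedStrictlyBimonoidal.dlSum a b M ⊚ B.tm a ((C.obj y).sum b M) =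
      (M.map fun j => B.tm a (b j)).sum := by
  induction M with
  | nil =>
    rw [PermCat.sum, tm_zero]
    exact comp_id (0 : Arr (C.obj (J.add x y))) _
  | cons j M ih =>
    have e : B.toGradedStrictlyBimonoidal.dlSum a b (j :: M) =
        (ident (B.mul a (b j)) + B.toGradedStrictlyBimonoidal.dlSum a b M) ⊚
          B.dl a (b j) ((C.obj y).sum b M) := rfl
    have ht := B.toGradedStrictlyBimonoidal.dlSum_tgt a b M
    rw [e, PermCat.sum, comp_assoc (by rw [add_tgt, ht]; rfl), dl_tm, add_comp rfl (by rw [ht]; rfl),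
      ih, List.map_cons, List.sum_cons]
    exact congrArg (· + _) (id_comp (B.tm a (b j)))

/-- A sum of twists followed by the image of the iterated left distributivity under the twist of `J`
is the twist of the sum. -/
theorem sum_tm_dlSum (a : ι → C.obj x) (c : C.obj y) (L : List ι) :
    (L.map fun i => B.tm (a i) c).sum ⊚
        (B.toGradedStrictlyBimonoidal.dlSum c a L).map (C.map (J.twist y x)).functor =
      B.tm ((C.obj x).sum a L) c := by
  induction L with
  | nil =>
    rw [PermCat.sum, zero_tm]
    exact (congrArg (_ ⊚ ·) (Arr.map_zero (C.map (J.twist y x)))).trans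
      (comp_id (0 : Arr (C.obj (J.add x y))) _)
  | cons i L ih =>
    have e : B.toGradedStrictlyBimonoidal.dlSum c a (i :: L) =
        (ident (B.mul c (a i)) + B.toGradedStrictlyBimonoidal.dlSum c a L) ⊚
          B.dl c (a i) ((C.obj x).sum a L) := rfl
    have ht := B.toGradedStrictlyBimonoidal.dlSum_tgt c a L
    have hs : (L.map fun i => B.tm (a i) c).sum.tgt =
        ((B.toGradedStrictlyBimonoidal.dlSum c a L).map (C.map (J.twist y x)).functor).src := by
      rw [sum_tgt, map_src, B.toGradedStrictlyBimonoidal.dlSum_src, StrictHom.obj_sum]; rfl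
    rw [e, PermCat.sum, Arr.map_comp _ (by rw [add_tgt, ht]; rfl), Arr.map_add, ← comp_assoc (by
      rw [List.map_cons, List.sum_cons, add_tgt, add_src, hs]; rfl), List.map_cons, List.sum_cons,
      add_comp rfl hs, ih, ← add_tm_dl]
    have hid : (B.tm (a i) c ⊚ (ident (B.mul c (a i))).map (C.map (J.twist y x)).functor) =
        B.tm (a i) c := (congrArg (_ ⊚ ·) (map_id _ _)).trans (comp_id _ _)
    rw [hid]

/-- Under the multiplicative twist, the canonical morphism `⨁ᵢⱼ aᵢ ⊗ bⱼ ⟶ (⨁ᵢ aᵢ) ⊗ (⨁ⱼ bⱼ)`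
becomes, up to a permutation, the canonical morphism `⨁ⱼᵢ bⱼ ⊗ aᵢ ⟶ (⨁ⱼ bⱼ) ⊗ (⨁ᵢ aᵢ)`. -/
theorem prodSum_tm (a : ι → C.obj x) (b : κ → C.obj y) (L : List ι) (hL : L.Nodup) (M : List κ) :
    ∃ π, PermArr (C.obj (J.add x y)) (fun p : ι × κ => B.mul (a p.1) (b p.2))
        (L.flatMap fun i => M.map fun j => (i, j)) (M.flatMap fun j => L.map fun i => (i, j)) π ∧
      B.toGradedStrictlyBimonoidal.prodSum a b L M ⊚
          B.tm ((C.obj x).sum a L) ((C.obj y).sum b M) =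
        π ⊚ (M.map fun j => (L.map fun i => B.tm (a i) (b j)).sum).sum ⊚
          (B.toGradedStrictlyBimonoidal.prodSum b a M L).map (C.map (J.twist y x)).functor := by
  obtain ⟨π, h₁, h₂⟩ := B.toGradedStrictlyBimonoidal.sum_dlSum a b L hL M
  refine ⟨π, h₁, ?_⟩
  have ht := h₁.tgt
  rw [GradedStrictlyBimonoidal.prodSum, h₂, comp_assoc, dlSum_tm,
    GradedStrictlyBimonoidal.prodSum, Arr.map_sum, ← sum_comp]
  · simp only [sum_tm_dlSum]
  · intro j _
    rw [sum_tgt, map_src, B.toGradedStrictlyBimonoidal.dlSum_src, StrictHom.obj_sum]; rfl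
  · rw [ht, B.toGradedStrictlyBimonoidal.dlSum_src, PermCat.sum_flatMap]
    exact PermCat.sum_congr _ fun j _ => B.toGradedStrictlyBimonoidal.sum_mul_map a b L j

end GradedBipermutative

namespace Hocolim

section Unary

variable {J : PermCat.{v₁, u₁}} {C : J ⥤ PermCat.{v₂, u₂}} {x y z t : J}

theorem Leg.act_unary {p q : Σ x : J, C.obj x} (k : p.1 ⟶ y) (l : q.1 ⟶ p.1) (φ : Arr (C.obj p.1))
    (h : φ.src = (C.map l).functor.obj q.2) : (⟨p, k⟩ : Leg C y).act (Multi.unary q l φ h) =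
      ⟨[⟨q, l ≫ k⟩], φ.map (C.map k).functor, by
        rw [Arr.map_src, h, PermCat.sum_singleton, C.map_comp]; rfl⟩ :=
  Leg.act_mk k _

theorem Multi.unary_comp {p : Σ x : J, C.obj x} (k : p.1 ⟶ y) (φ : Arr (C.obj y))
    (h : φ.src = (C.map k).functor.obj p.2) {Y : C.obj y} (l : y ⟶ z) (θ : Arr (C.obj z))
    (h' : θ.src = (C.map l).functor.obj Y) :
    (unary ⟨y, Y⟩ l θ h').comp [unary p k φ h] =
      unary p (k ≫ l) (φ.map (C.map l).functor ⊚ θ) (by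
        rw [Arr.comp_src, Arr.map_src, h, C.map_comp]; rfl) := by
  refine congrArg (Sigma.mk z) ?_
  refine (congrArg (Block.post · θ) ((blockSum_cons _ _ [] []).trans ((add_zero _).trans
    (Leg.act_unary (p := ⟨y, Y⟩) l k φ h)))).trans ?_
  rfl

theorem Multi.unary_eq {p q : Σ x : J, C.obj x} {k : p.1 ⟶ y} {φ : Arr (C.obj y)}
    {h : φ.src = (C.map k).functor.obj p.2} {l : q.1 ⟶ z} {θ : Arr (C.obj z)}
    {h' : θ.src = (C.map l).functor.obj q.2} (hp : p = q) (hy : y = z)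
    (hk : k ≫ eqToHom hy = eqToHom (congrArg Sigma.fst hp) ≫ l)
    (hφ : φ.map (gradeCast C hy) = θ) : unary p k φ h = unary q l θ h' := by
  subst hp hy
  rw [eqToHom_refl, eqToHom_refl, Category.comp_id, Category.id_comp] at hk
  subst hk
  refine congrArg (Sigma.mk y) (Block.ext rfl ?_)
  exact (map_gradeCast_refl φ rfl).symm.trans hφ

theorem Multi.unary_mul (B : GradedStrictlyBimonoidal J C) {p q : Σ x : J, C.obj x} (k : p.1 ⟶ y)
    (φ : Arr (C.obj y)) (h : φ.src = (C.map k).functor.obj p.2) (l : q.1 ⟶ z) (θ : Arr (C.obj z))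
    (h' : θ.src = (C.map l).functor.obj q.2) :
    (unary p k φ h).mul B (unary q l θ h') =
      unary (mulEntry B.toGradedMul p q) (J.addHom k l) (B.tensor φ θ) (by
        rw [B.tensor_src, h, h', B.map_mul]) := by
  refine congrArg (Sigma.mk (J.add y z)) (Block.ext rfl ?_)
  have e := B.prodSum_singleton_right Leg.image Leg.image [(⟨p, k⟩ : Leg C y)]
    (⟨q, l⟩ : Leg C z)
  rw [PermCat.sum_singleton] at e
  refine (congrArg (· ⊚ B.tensor φ θ) e).trans (Arr.id_comp' ?_)
  rw [B.tensor_src, h, h']; rfl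

theorem Mor.At.comp_single {S T U : Hocolim C} {f : S ⟶ T} {g : T ⟶ U} {r : Fin U.len}
    {k : Fin T.len} {L : List (Fin S.len)} {μ ν : Multi C} (hg : Mor.At g r [k] μ)
    (hf : Mor.At f k L ν) : Mor.At (f ≫ g) r L (μ.comp [ν]) := by
  have := hg.comp (f := f) (L := fun _ => L) (ν := fun _ => ν) fun k' hk => by
    rw [List.mem_singleton.1 hk]; exact hf
  simpa using this

theorem Mor.At.comp_eqToHom_comp {S T T' U : Hocolim C} {f : S ⟶ T} {k : Fin T.len}
    {L : List (Fin S.len)} {μ ν : Multi C} (hf : Mor.At f k L ν) (h : T = T') {k' : Fin T'.len}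
    (hk : k' = Fin.cast (congrArg len h) k) {g : T' ⟶ U} {r : Fin U.len}
    (hg : Mor.At g r [k'] μ) : Mor.At (f ≫ eqToHom h ≫ g) r L (μ.comp [ν]) := by
  subst hk
  have := hf.comp_perm (Mor.isPerm_eqToHom h)
  rw [Mor.eqToHom_ψ] at this
  rw [← comp_assoc]
  exact hg.comp_single this

end Unary

variable {J : PermCat.{v₁, u₁}} {C : J ⥤ PermCat.{v₂, u₂}} (B : GradedBipermutative J C)
  {x y z t : J} {S T U S' T' U' : Hocolim C}

/-- The multimorphism `(x + y, X ⊗ Y) ⟶ (y + x, Y ⊗ X)` given by the twist of `J` and the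
multiplicative twist of `C`. -/
def twistMulti (p q : Σ x : J, C.obj x) : Multi C :=
  Multi.unary (mulEntry B.toGradedMul p q) (J.twist p.1 q.1)
    ((B.tm p.2 q.2).map (C.map (J.twist p.1 q.1)).functor) rfl

theorem mulTwist_ψ (i : Fin S.len) (j : Fin T.len) :
    (mulTwist B.toGradedMul B.mulTwist S T).ψ (finProdFinEquiv (i, j)) =
      finProdFinEquiv (j, i) := by
  change transpose _ _ _ = _
  simp only [transpose, Equiv.trans_apply, Equiv.symm_apply_apply]; rfl

theorem at_mulTwist (i : Fin S.len) (j : Fin T.len) :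
    Mor.At (mulTwist B.toGradedMul B.mulTwist S T) (finProdFinEquiv (j, i))
      [finProdFinEquiv (i, j)] (twistMulti B (S.entry i) (T.entry j)) := by
  refine ⟨(Mor.at_ofEquiv _ _ _ (mulTwist_ψ B i j)).1,
    (Mor.at_ofEquiv _ _ _ (mulTwist_ψ B i j)).2.trans ?_⟩
  have key : ∀ (p : Fin S.len × Fin T.len) (q : Fin T.len × Fin S.len) (h : p.swap = q),
      p = (i, j) → Multi.unary (mulEntry B.toGradedMul (S.entry p.1) (T.entry p.2))
        (twistℓ B.toGradedMul S T p q h) (Arr.mk (twistϱ B.toGradedMul B.mulTwist S T p q h)) rfl =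
        twistMulti B (S.entry i) (T.entry j) := by
    rintro p q rfl rfl
    refine congrArg (Sigma.mk _) (Block.ext rfl ?_)
    exact Arr.mk_comp_eqToHom _ _
  exact key _ _ _ (by simp)

/-- The block of the twist of a product of two legs. -/
def swapBlock (s : Leg C x) (t : Leg C y) : Block C (J.add y x) :=
  ⟨[(mulLeg B.toGradedStrictlyBimonoidal s t).map (J.twist x y)],
    (B.tm s.image t.image).map (C.map (J.twist x y)).functor, by
      rw [PermCat.sum_singleton, Arr.map_src, B.tm_src]
      refine Eq.trans ?_ (Leg.image_map _ _).symm
      rw [image_mulLeg]; rfl⟩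

theorem act_twistMulti (s : Leg C x) (t : Leg C y) :
    (mulLeg B.toGradedStrictlyBimonoidal t s).act (twistMulti B s.obj t.obj) =
      swapBlock B s t := by
  refine (Leg.act_unary (p := mulEntry B.toGradedMul t.obj s.obj)
    (q := mulEntry B.toGradedMul s.obj t.obj) (J.addHom t.hom s.hom)
    (J.twist s.obj.1 t.obj.1) _ _).trans (Block.ext ?_ ?_)
  · exact congrArg (fun h => [(⟨mulEntry B.toGradedMul s.obj t.obj, h⟩ : Leg C (J.add y x))])
      (J.twist_natural _ _).symm
  · dsimp only [swapBlock]
    rw [Arr.map_functor_comp, ← J.twist_natural, ← Arr.map_functor_comp, B.map_tm]; rfl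

/-- The product of two blocks in the opposite order is obtained by twisting. -/
theorem Block.mul_twist {ι κ : Type w} {β : Block C x} {γ : Block C y} {s : ι → Leg C x}
    {t : κ → Leg C y} {K : List ι} {N : List κ} (hβ : β.legs = K.map s) (hγ : γ.legs = N.map t)
    (hK : K.Nodup) :
    (((β.mul B.toGradedStrictlyBimonoidal γ).post (B.tm β.arr.tgt γ.arr.tgt)).map
        (J.twist x y)).legs = (K.flatMap fun k => N.map fun n => (k, n)).map
          (fun p => (mulLeg B.toGradedStrictlyBimonoidal (s p.1) (t p.2)).map (J.twist x y)) ∧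
    ((blockSum (γ.mul B.toGradedStrictlyBimonoidal β).legs
        ((N.flatMap fun n => K.map fun k => (k, n)).map fun p =>
          twistMulti B (s p.1).obj (t p.2).obj)).post
            (γ.mul B.toGradedStrictlyBimonoidal β).arr).legs =
      (N.flatMap fun n => K.map fun k => (k, n)).map
        (fun p => (mulLeg B.toGradedStrictlyBimonoidal (s p.1) (t p.2)).map (J.twist x y)) ∧
    ∃ π, PermArr (C.obj (J.add y x)) (fun p : ι × κ =>
          ((mulLeg B.toGradedStrictlyBimonoidal (s p.1) (t p.2)).map (J.twist x y)).image)
        (K.flatMap fun k => N.map fun n => (k, n)) (N.flatMap fun n => K.map fun k => (k, n)) π ∧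
      (((β.mul B.toGradedStrictlyBimonoidal γ).post (B.tm β.arr.tgt γ.arr.tgt)).map
        (J.twist x y)).arr = (π ⊚ ((blockSum (γ.mul B.toGradedStrictlyBimonoidal β).legs
          ((N.flatMap fun n => K.map fun k => (k, n)).map fun p =>
            twistMulti B (s p.1).obj (t p.2).obj)).post
              (γ.mul B.toGradedStrictlyBimonoidal β).arr).arr) := by
  have hl : (γ.mul B.toGradedStrictlyBimonoidal β).legs =
      (N.flatMap fun n => K.map fun k => (k, n)).map
        fun p => mulLeg B.toGradedStrictlyBimonoidal (t p.2) (s p.1) := by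
    rw [Block.mul_legs, hβ, hγ, List.flatMap_map, List.map_flatMap]
    simp only [List.map_map]; rfl
  have hR : blockSum (γ.mul B.toGradedStrictlyBimonoidal β).legs
        ((N.flatMap fun n => K.map fun k => (k, n)).map fun p =>
          twistMulti B (s p.1).obj (t p.2).obj) =
      ((N.flatMap fun n => K.map fun k => (k, n)).map
        fun p => swapBlock B (s p.1) (t p.2)).sum := by
    rw [hl, blockSum_map]
    simp only [act_twistMulti]
  obtain ⟨π, h₁, h₂⟩ := B.prodSum_tm (fun k => (s k).image) (fun n => (t n).image) K hK N
  refine ⟨?_, ?_, _, (h₁.map_family (C.map (J.twist x y))).congr_family fun p _ => ?_, ?_⟩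
  · rw [Block.map_legs, Block.post_legs, Block.mul_legs, hβ, hγ, List.flatMap_map,
      List.map_flatMap, List.map_flatMap]
    simp only [List.map_map]; rfl
  · rw [hR, Block.post_legs, Block.sum_legs, List.map_eq_flatMap]
    rfl
  · rw [Leg.image_map, image_mulLeg]; rfl
  · have hs : β.arr.src = (C.obj x).sum (fun k => (s k).image) K := by
      rw [β.src, hβ, PermCat.sum_map]
    have ht : γ.arr.src = (C.obj y).sum (fun n => (t n).image) N := by
      rw [γ.src, hγ, PermCat.sum_map]
    rw [← hs, ← ht] at h₂
    have e₁ : B.toGradedStrictlyBimonoidal.prodSum (fun k => (s k).image) (fun n => (t n).image)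
        K N = B.toGradedStrictlyBimonoidal.prodSum Leg.image Leg.image β.legs γ.legs := by
      rw [hβ, hγ, B.toGradedStrictlyBimonoidal.prodSum_map_index]
    have e₂ : B.toGradedStrictlyBimonoidal.prodSum (fun n => (t n).image) (fun k => (s k).image)
        N K = B.toGradedStrictlyBimonoidal.prodSum Leg.image Leg.image γ.legs β.legs := by
      rw [hβ, hγ, B.toGradedStrictlyBimonoidal.prodSum_map_index]
    rw [e₁, e₂] at h₂
    have c₁ : (B.toGradedStrictlyBimonoidal.prodSum Leg.image Leg.image β.legs γ.legs).tgt =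
        B.mul β.arr.src γ.arr.src := by
      rw [B.toGradedStrictlyBimonoidal.prodSum_tgt, β.src, γ.src]; rfl
    have c₂ : (B.toGradedStrictlyBimonoidal.prodSum Leg.image Leg.image γ.legs β.legs).tgt =
        B.mul γ.arr.src β.arr.src := by
      rw [B.toGradedStrictlyBimonoidal.prodSum_tgt, β.src, γ.src]; rfl
    have c₃ : (N.map fun n => (K.map fun k => B.tm (s k).image (t n).image).sum).sum.tgt =
        ((B.toGradedStrictlyBimonoidal.prodSum Leg.image Leg.image γ.legs β.legs).map
          (C.map (J.twist y x)).functor).src := by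
      rw [← e₂, Arr.sum_tgt, Arr.map_src, B.toGradedStrictlyBimonoidal.prodSum_src,
        StrictHom.obj_sum, PermCat.sum_flatMap]
      refine PermCat.sum_congr _ fun n _ => ?_
      rw [Arr.sum_tgt, PermCat.sum_map]; rfl
    have c₄ : π.tgt =
        (N.map fun n => (K.map fun k => B.tm (s k).image (t n).image).sum).sum.src := by
      rw [h₁.tgt, Arr.sum_src, PermCat.sum_flatMap]
      refine PermCat.sum_congr _ fun n _ => ?_
      rw [Arr.sum_src, PermCat.sum_map]; rfl
    have c₅ : (B.toGradedStrictlyBimonoidal.prodSum Leg.image Leg.image β.legs γ.legs).tgt =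
        (B.tm β.arr.src γ.arr.src).src := c₁
    have h₃ : ((B.toGradedStrictlyBimonoidal.prodSum Leg.image Leg.image β.legs γ.legs ⊚
          B.tensor β.arr γ.arr) ⊚ B.tm β.arr.tgt γ.arr.tgt) =
        π ⊚ (N.map fun n => (K.map fun k => B.tm (s k).image (t n).image).sum).sum ⊚
          (B.toGradedStrictlyBimonoidal.prodSum Leg.image Leg.image γ.legs β.legs ⊚
            B.tensor γ.arr β.arr).map (C.map (J.twist y x)).functor := by
      rw [Arr.comp_assoc c₁, B.tm_natural, ← Arr.comp_assoc c₅, h₂, Arr.map_comp _ c₂,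
        Arr.comp_assoc (by rw [c₄, Arr.comp_src]), Arr.comp_assoc c₃]
    refine (congrArg (Arr.map (C.map (J.twist x y)).functor) h₃).trans ?_
    rw [Arr.map_comp _ (by rw [c₄, Arr.comp_src]), Arr.map_comp _ (by
      rw [c₃, Arr.map_src, Arr.map_src, Arr.comp_src]), Arr.map_twist_twist]
    refine (congrArg (_ ⊚ ·) (congrArg (· ⊚ _) ?_))
    rw [hR, Block.sum_arr, Arr.sum_flatMap, Arr.map_sum]
    refine congrArg List.sum (List.map_congr_left fun n _ => ?_)
    rw [Arr.map_sum, List.map_map]; rfl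

theorem twistMulti_comp {μ ν : Multi C} {p q : Σ x : J, C.obj x} (h : μ.tgt = p)
    (h' : ν.tgt = q) :
    (twistMulti B p q).comp [μ.mul B.toGradedStrictlyBimonoidal ν] = ⟨J.add ν.1 μ.1,
      ((μ.2.mul B.toGradedStrictlyBimonoidal ν.2).post (B.tm μ.2.arr.tgt ν.2.arr.tgt)).map
        (J.twist μ.1 ν.1)⟩ := by
  subst h h'
  refine congrArg (Sigma.mk (J.add ν.1 μ.1)) ?_
  rw [Block.map_post _ _ (Block.mul_arr_tgt _ _ _)]
  refine congrArg (Block.post · _) ?_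
  refine (blockSum_cons _ _ [] []).trans ((add_zero _).trans ?_)
  exact Leg.act_mk (p := mulEntry B.toGradedMul μ.tgt ν.tgt) _ _

/-- Over each index the two composites have the multimorphisms of `Block.mul_twist`, which differ
only in the order of the legs. -/
theorem mulTwist_natural (f : S ⟶ S') (g : T ⟶ T') :
    (show mul B.toGradedMul S T ⟶ mul B.toGradedMul S' T' from
        mulHom B.toGradedMul B.leftDist f g) ≫ mulTwist B.toGradedMul B.mulTwist S' T' =
      mulTwist B.toGradedMul B.mulTwist S T ≫
        (show mul B.toGradedMul T S ⟶ mul B.toGradedMul T' S' from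
          mulHom B.toGradedMul B.leftDist g f) := by
  refine Mor.At.ext (forall_prod fun s r => ?_)
  obtain ⟨K, μ, hμ⟩ := Mor.exists_at f r
  obtain ⟨N, ν, hν⟩ := Mor.exists_at g s
  have h₁ := (at_mulTwist B r s).comp_single (f := mulHom B.toGradedMul B.leftDist f g)
    (Mor.At.mulHom B.toGradedStrictlyBimonoidal hμ hν)
  rw [twistMulti_comp B hμ.tgt hν.tgt] at h₁
  have h₂ := Mor.At.mulHom B.toGradedStrictlyBimonoidal hν hμ
  have e₂ : prodList N K = (N.flatMap fun n => K.map fun k => (k, n)).map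
      fun p => finProdFinEquiv (p.2, p.1) := by
    simp only [prodList, List.map_flatMap, List.map_map]; rfl
  rw [e₂] at h₂
  have h₃ := h₂.comp_map (f := mulTwist B.toGradedMul B.mulTwist S T)
    (L := fun p => [finProdFinEquiv p]) fun p _ => at_mulTwist B p.1 p.2
  refine ⟨_, _, h₁, ?_⟩
  have eμ := hμ.2.symm
  have eν := hν.2.symm
  have hK := hμ.1
  have hN := hν.1
  subst eμ eν
  have hk : ∀ k ∈ K, (Mor.leg f r k).obj = S.entry k := fun k hk => by
    rw [Mor.leg_pos _ ((hK.2 k).1 hk)]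
  have hn : ∀ n ∈ N, (Mor.leg g s n).obj = T.entry n := fun n hn => by
    rw [Mor.leg_pos _ ((hN.2 n).1 hn)]
  obtain ⟨e₁, e₂, π, hπ, e₃⟩ := Block.mul_twist B (β := Mor.blk f r K) (γ := Mor.blk g s N)
    (s := Mor.leg f r) (t := Mor.leg g s) (K := K) (N := N) rfl rfl hK.1
  have hQ : ∀ Q : List (Fin S.len × Fin T.len),
      Q.map (fun p => (mulLeg B.toGradedStrictlyBimonoidal (Mor.leg f r p.1)
          (Mor.leg g s p.2)).map (J.twist (S'.entry r).1 (T'.entry s).1)) =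
        (Q.map finProdFinEquiv).map fun p => (mulLeg B.toGradedStrictlyBimonoidal
          (Mor.leg f r (finProdFinEquiv.symm p).1) (Mor.leg g s (finProdFinEquiv.symm p).2)).map
            (J.twist (S'.entry r).1 (T'.entry s).1) := fun Q => by
    rw [List.map_map]
    refine List.map_congr_left fun p _ => ?_
    rw [Function.comp_apply, Equiv.symm_apply_apply]
  have hT : (N.flatMap fun n => K.map fun k => (k, n)).map
      (fun p => twistMulti B (Mor.leg f r p.1).obj (Mor.leg g s p.2).obj) =
      (N.flatMap fun n => K.map fun k => (k, n)).map
        fun p => twistMulti B (S.entry p.1) (T.entry p.2) := by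
    refine List.map_congr_left fun p hp => ?_
    obtain ⟨n, hn', hp⟩ := List.mem_flatMap.1 hp
    obtain ⟨k, hk', rfl⟩ := List.mem_map.1 hp
    rw [hk k hk', hn n hn']
  rw [← List.map_eq_flatMap] at h₃
  have hπ' := PermArr.map_index (A := fun p => ((mulLeg B.toGradedStrictlyBimonoidal
    (Mor.leg f r (finProdFinEquiv.symm p).1) (Mor.leg g s (finProdFinEquiv.symm p).2)).map
      (J.twist (S'.entry r).1 (T'.entry s).1)).image) finProdFinEquiv.injective
    (hπ.congr_family fun p _ => by rw [Equiv.symm_apply_apply])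
  rw [← prodList_eq_map] at hπ'
  rw [hT, hQ] at e₂
  rw [hT] at e₃
  rw [hQ, ← prodList_eq_map] at e₁
  exact Mor.At.reorder h₃ e₂ e₁ hπ' e₃

theorem twistMulti_twistMulti (p q : Σ x : J, C.obj x) :
    (twistMulti B q p).comp [twistMulti B p q] = Multi.unit (mulEntry B.toGradedMul p q) := by
  refine (Multi.unary_comp (p := mulEntry B.toGradedMul p q) _ _ _ _ _ _).trans
    (Multi.unary_eq rfl rfl ?_ ?_)
  · simp only [eqToHom_refl, Category.comp_id]
    exact J.twist_twist _ _
  · rw [map_gradeCast_refl, Arr.map_twist_twist, B.tm_tm]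

theorem mulTwist_mulTwist (S T : Hocolim C) :
    mulTwist B.toGradedMul B.mulTwist S T ≫ mulTwist B.toGradedMul B.mulTwist T S = 𝟙 _ := by
  refine Mor.At.ext (forall_prod fun i j => ?_)
  have h := (at_mulTwist B j i).comp_single (at_mulTwist B i j)
  rw [twistMulti_twistMulti, ← mul_entry B.toGradedMul] at h
  exact ⟨_, _, h, Mor.at_id _⟩

theorem twistMulti_one (p : Σ x : J, C.obj x) :
    twistMulti B p ⟨J.zero, B.one⟩ = Multi.unit (mulEntry B.toGradedMul p ⟨J.zero, B.one⟩) := by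
  refine Multi.unary_eq rfl ((J.zero_add _).trans (J.add_zero _).symm) ?_ ?_
  · rw [J.twist_zero_right]; simp
  · rw [J.twist_zero_right, Arr.map_functor_comp, eqToHom_trans]
    exact (map_gradeCast_refl _ _).trans (B.tm_one p.2)

theorem twistMulti_one_left (p : Σ x : J, C.obj x) :
    twistMulti B ⟨J.zero, B.one⟩ p = Multi.unit (mulEntry B.toGradedMul ⟨J.zero, B.one⟩ p) := by
  refine Multi.unary_eq rfl ((J.add_zero _).trans (J.zero_add _).symm) ?_ ?_
  · rw [J.twist_zero_left]; simp
  · rw [J.twist_zero_left, Arr.map_functor_comp, eqToHom_trans]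
    exact (map_gradeCast_refl _ _).trans (B.one_tm p.2)

theorem mulTwist_one (S : Hocolim C) :
    HEq (mulTwist B.toGradedMul B.mulTwist S (one B.toGradedMul)) (𝟙 S) := by
  have h : Mor.IsPerm (mulTwist B.toGradedMul B.mulTwist S (one B.toGradedMul)) :=
    forall_prod (m := 1) fun i j => by
      have := at_mulTwist B (T := one B.toGradedMul) i j
      rw [twistMulti_one, ← mulTwist_ψ B] at this
      rw [mul_entry B.toGradedMul]
      exact this
  refine h.heq (isPerm_id S) (mul_one B.toGradedStrictlyBimonoidal S)
    (one_mul B.toGradedStrictlyBimonoidal S) (forall_prod (m := 1) fun i j => ?_)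
  obtain rfl := Subsingleton.elim j 0
  rw [cast_prod_one, mulTwist_ψ, id_ψ]
  simp

theorem one_mulTwist (S : Hocolim C) :
    HEq (mulTwist B.toGradedMul B.mulTwist (one B.toGradedMul) S) (𝟙 S) := by
  have h : Mor.IsPerm (mulTwist B.toGradedMul B.mulTwist (one B.toGradedMul) S) :=
    forall_prod (n := 1) fun i j => by
      have := at_mulTwist B (S := one B.toGradedMul) i j
      rw [twistMulti_one_left, ← mulTwist_ψ B] at this
      rw [mul_entry B.toGradedMul]
      exact this
  refine h.heq (isPerm_id S) (one_mul B.toGradedStrictlyBimonoidal S)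
    (mul_one B.toGradedStrictlyBimonoidal S) (forall_prod (n := 1) fun i j => ?_)
  obtain rfl := Subsingleton.elim i 0
  rw [cast_one_prod, mulTwist_ψ, id_ψ]
  simp

/-- The hexagon for multimorphisms. -/
theorem twistMulti_mul (p q r : Σ x : J, C.obj x) :
    ((twistMulti B p r).mul B.toGradedStrictlyBimonoidal (Multi.unit q)).comp
        [(Multi.unit p).mul B.toGradedStrictlyBimonoidal (twistMulti B q r)] =
      twistMulti B (mulEntry B.toGradedMul p q) r := by
  obtain ⟨x, a⟩ := p
  obtain ⟨y, b⟩ := q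
  obtain ⟨z, c⟩ := r
  have hK : (J.twist (J.add x y) z ≫ eqToHom (J.add_assoc z x y).symm) =
      eqToHom (J.add_assoc x y z) ≫ J.addHom (𝟙 x) (J.twist y z) ≫
        eqToHom (J.add_assoc x z y).symm ≫ J.addHom (J.twist x z) (𝟙 y) :=
    hom_eq_of_heq _ _ (J.twist_add x y z)
  have h₁ : (twistMulti B ⟨x, a⟩ ⟨z, c⟩).mul B.toGradedStrictlyBimonoidal (Multi.unit ⟨y, b⟩) =
      Multi.unary (mulEntry B.toGradedMul ⟨x, a⟩ (mulEntry B.toGradedMul ⟨z, c⟩ ⟨y, b⟩))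
        (eqToHom (J.add_assoc x z y).symm ≫ J.addHom (J.twist x z) (𝟙 y))
        (B.tensor ((B.tm a c).map (C.map (J.twist x z)).functor) (Arr.ident b)) (by
          rw [C.map_comp]
          have e := gradeCast_eq (C := C) (J.add_assoc x z y).symm
            (mulEntry_assoc B.toGradedStrictlyBimonoidal ⟨x, a⟩ ⟨z, c⟩ ⟨y, b⟩).symm
          have e' := B.map_mul (J.twist x z) (𝟙 y) (B.mul a c) b
          rw [map_id_obj] at e'
          exact e'.symm.trans (congrArg _ e.symm)) := by
    refine (Multi.unary_mul B.toGradedStrictlyBimonoidal _ _ _ _ _ _).trans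
      (Multi.unary_eq (mulEntry_assoc B.toGradedStrictlyBimonoidal _ _ _) rfl ?_ ?_)
    · simp only [eqToHom_refl, Category.comp_id, eqToHom_trans_assoc, Category.id_comp]
    · exact map_gradeCast_refl _ rfl
  have h₂ : (Multi.unit ⟨x, a⟩).mul B.toGradedStrictlyBimonoidal (twistMulti B ⟨y, b⟩ ⟨z, c⟩) =
      Multi.unary (mulEntry B.toGradedMul ⟨x, a⟩ (mulEntry B.toGradedMul ⟨y, b⟩ ⟨z, c⟩))
        (J.addHom (𝟙 x) (J.twist y z))
        (B.tensor (Arr.ident a) ((B.tm b c).map (C.map (J.twist y z)).functor)) (by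
          have e' := B.map_mul (𝟙 x) (J.twist y z) a (B.mul b c)
          rw [map_id_obj] at e'
          exact e'.symm) :=
    Multi.unary_mul B.toGradedStrictlyBimonoidal _ _ _ _ _ _
  rw [h₁, h₂]
  refine (Multi.unary_comp _ _ _ _ _ _).trans
    (Multi.unary_eq (mulEntry_assoc B.toGradedStrictlyBimonoidal _ _ _).symm
      (J.add_assoc z x y) ?_ ?_)
  · have h := congrArg (eqToHom (J.add_assoc x y z).symm ≫ · ≫ eqToHom (J.add_assoc z x y)) hK
    simp only [eqToHom_trans_assoc, eqToHom_refl, Category.id_comp, Category.assoc, eqToHom_trans,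
      Category.comp_id] at h
    simp only [Category.assoc]
    exact h.symm
  · have e₁ : B.tensor (Arr.ident a) ((B.tm b c).map (C.map (J.twist y z)).functor) =
        (B.tensor (Arr.ident a) (B.tm b c)).map
          (C.map (J.addHom (𝟙 x) (J.twist y z))).functor := by
      rw [B.map_tensor, Arr.map_functor_id]
    -- the two twists of `a` and `c` that remain after the hexagon cancel
    have e₃ : B.tensor (B.tm c a) (Arr.ident b) ⊚
        B.tensor ((B.tm a c).map (C.map (J.twist x z)).functor) (Arr.ident b) =
          Arr.ident (B.mul (B.mul c a) b) := by
      rw [← B.tensor_comp rfl rfl, B.tm_tm]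
      exact (congrArg (B.tensor _) (Arr.comp_id (Arr.ident b) b)).trans (B.tensor_id _ _)
    have e₄ : ((B.tensor (B.tm c a) (Arr.ident b)).map
        (C.map (eqToHom (J.add_assoc z x y) ≫ J.twist z (J.add x y))).functor).map
          (C.map (J.twist (J.add x y) z ≫ eqToHom (J.add_assoc z x y).symm)).functor =
        B.tensor (B.tm c a) (Arr.ident b) := by
      rw [Arr.map_functor_comp, Category.assoc, reassoc_of% (J.twist_twist z (J.add x y)),
        eqToHom_trans]
      exact map_gradeCast_refl _ rfl
    have c₁ := (congrArg (C.map (J.twist (J.add x y) z ≫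
      eqToHom (J.add_assoc z x y).symm)).functor.obj (B.hexagon_comp a b c)).trans
        (congrArg Arr.src e₄)
    rw [e₁, ← B.hexagon, Arr.map_functor_comp, Arr.map_functor_comp, ← hK,
      Arr.map_comp _ (B.hexagon_comp a b c), e₄, Arr.comp_assoc c₁, e₃]
    refine (congrArg (Arr.map _) (Arr.comp_id _ _)).trans ?_
    rw [Arr.map_functor_comp, Category.assoc, eqToHom_trans, eqToHom_refl, Category.comp_id]

theorem mulTwist_mul (S T U : Hocolim C) :
    HEq (mulTwist B.toGradedMul B.mulTwist (mul B.toGradedMul S T) U)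
      ((show mul B.toGradedMul S (mul B.toGradedMul T U) ⟶
            mul B.toGradedMul S (mul B.toGradedMul U T) from mulHom B.toGradedMul B.leftDist (𝟙 S)
          (mulTwist B.toGradedMul B.mulTwist T U)) ≫
        eqToHom (mul_assoc B.toGradedStrictlyBimonoidal S U T).symm ≫
        (show mul B.toGradedMul (mul B.toGradedMul S U) T ⟶
            mul B.toGradedMul (mul B.toGradedMul U S) T from mulHom B.toGradedMul B.leftDist
          (mulTwist B.toGradedMul B.mulTwist S U) (𝟙 T))) := by
  refine Mor.At.heq (mul_assoc B.toGradedStrictlyBimonoidal S T U)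
    (mul_assoc B.toGradedStrictlyBimonoidal U S T).symm (forall_prod (n := U.len) fun l => ?_)
  refine forall_prod (n := S.len) (m := T.len) fun i j => ?_
  have h₁ := at_mulTwist B (S := mul B.toGradedMul S T) (T := U) (finProdFinEquiv (i, j)) l
  rw [mul_entry B.toGradedMul] at h₁
  refine ⟨_, _, h₁, ?_⟩
  have h₂ := Mor.At.mulHom B.toGradedStrictlyBimonoidal (Mor.at_id i) (at_mulTwist B j l)
  have h₃ := Mor.At.mulHom B.toGradedStrictlyBimonoidal (at_mulTwist B i l) (Mor.at_id j)
  have h₅ := h₂.comp_eqToHom_comp (mul_assoc B.toGradedStrictlyBimonoidal S U T).symm (by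
    rw [← cast_prod_assoc (Nat.mul_assoc _ _ _), Fin.cast_cast, Fin.cast_eq_self]) h₃
  rw [twistMulti_mul] at h₅
  refine h₅.congr ?_ ?_
  · rw [← cast_prod_assoc (Nat.mul_assoc _ _ _), Fin.cast_cast, Fin.cast_eq_self]
  · exact congrArg (· :: []) (cast_prod_assoc _ _ _ _).symm

/-- On indices the two sides are the same permutation; the multimorphisms on the right are
composites of two inverse twists. -/
theorem leftDist_eq (S T U : Hocolim C) : leftDist B.toGradedMul S T U =
    addHom (mulTwist B.toGradedMul B.mulTwist S T) (mulTwist B.toGradedMul B.mulTwist S U) ≫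
      eqToHom (add_mul B.toGradedStrictlyBimonoidal T U S).symm ≫
        mulTwist B.toGradedMul B.mulTwist (add T U) S := by
  refine Mor.At.ext (forall_prod fun i => forall_sum (fun j => ?_) fun j => ?_)
  · have h := isPerm_leftDist B.toGradedMul S T U
      (finSumFinEquiv (.inl (finProdFinEquiv (i, j))))
    rw [leftDist_ψ_inl, add_entry_inl, mul_entry B.toGradedMul] at h
    refine ⟨_, _, h, ?_⟩
    have h₁ := (at_mulTwist B i j).inl (g := mulTwist B.toGradedMul B.mulTwist S U)
    have h₂ := at_mulTwist B (S := add T U) (finSumFinEquiv (.inl j)) i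
    rw [add_entry_inl] at h₂
    have h₃ := h₁.comp_eqToHom_comp (add_mul B.toGradedStrictlyBimonoidal T U S).symm (by
      rw [← cast_inl_prod (Nat.add_mul _ _ _), Fin.cast_cast, Fin.cast_eq_self]) h₂
    rw [twistMulti_twistMulti] at h₃
    exact h₃
  · have h := isPerm_leftDist B.toGradedMul S T U
      (finSumFinEquiv (.inr (finProdFinEquiv (i, j))))
    rw [leftDist_ψ_inr, add_entry_inr, mul_entry B.toGradedMul] at h
    refine ⟨_, _, h, ?_⟩
    have h₁ := (at_mulTwist B i j).inr (f := mulTwist B.toGradedMul B.mulTwist S T)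
    have h₂ := at_mulTwist B (S := add T U) (finSumFinEquiv (.inr j)) i
    rw [add_entry_inr] at h₂
    have h₃ := h₁.comp_eqToHom_comp (add_mul B.toGradedStrictlyBimonoidal T U S).symm (by
      rw [← cast_inr_prod (Nat.add_mul _ _ _), Fin.cast_cast, Fin.cast_eq_self]) h₂
    rw [twistMulti_twistMulti] at h₃
    exact h₃

theorem isZerolessBipermutative : IsZerolessBipermutative
    (bimonData B.toGradedMul B.leftDist) (mulTwist B.toGradedMul B.mulTwist) where
  toIsZerolessBimonoidalCore := isZerolessBimonoidalCore B.toGradedStrictlyBimonoidal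
  mulTwist_natural := mulTwist_natural B
  mulTwist_mulTwist := mulTwist_mulTwist B
  mulTwist_one := mulTwist_one B
  one_mulTwist := one_mulTwist B
  mulTwist_mul := mulTwist_mul B
  leftDist_eq := leftDist_eq B

end Hocolim

/-! ### The degree zero part and its modules -/

theorem PermCat.isZerolessPermutative (P : PermCat.{v, u}) : IsZerolessPermutative P.addData where
  isCat := ⟨Category.id_comp, Category.comp_id, Category.assoc⟩
  addHom_id := P.addHom_id
  addHom_comp := P.addHom_comp
  add_assoc := P.add_assoc
  addHom_assoc := P.addHom_assoc
  twist_natural := P.twist_natural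
  twist_twist := P.twist_twist
  twist_add := P.twist_add

theorem gradeCast_refl_obj {J : PermCat.{v₁, u₁}} {C : J ⥤ PermCat.{v₂, u₂}} {x : J} (h : x = x)
    (a : C.obj x) : (gradeCast C h).obj a = a := Hocolim.map_id_obj x a

namespace GradedMul

open Arr

variable {J : PermCat.{v₁, u₁}} {C : J ⥤ PermCat.{v₂, u₂}} (M : GradedMul J C) {x y z t : J}

theorem tensor_cast (h : x = z) (h' : y = t) (φ : Arr (C.obj x)) (θ : Arr (C.obj y)) :
    M.tensor (φ.map (gradeCast C h)) (θ.map (gradeCast C h')) =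
      (M.tensor φ θ).map (gradeCast C (congrArg₂ J.add h h')) := by
  subst h h'
  rw [map_gradeCast_refl, map_gradeCast_refl, map_gradeCast_refl]

/-- The action of arrows of `C(0)` on arrows of `C(x)`. -/
def actArr (φ : Arr (C.obj J.zero)) (θ : Arr (C.obj x)) : Arr (C.obj x) :=
  (M.tensor φ θ).map (gradeCast C (J.zero_add x))

@[simp] theorem actArr_src (φ : Arr (C.obj J.zero)) (θ : Arr (C.obj x)) :
    (M.actArr φ θ).src = M.act φ.src θ.src := rfl

@[simp] theorem actArr_tgt (φ : Arr (C.obj J.zero)) (θ : Arr (C.obj x)) :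
    (M.actArr φ θ).tgt = M.act φ.tgt θ.tgt := rfl

theorem actArr_id (r : C.obj J.zero) (m : C.obj x) :
    M.actArr (ident r) (ident m) = ident (M.act r m) := by
  rw [actArr, tensor_id, Arr.map_id]; rfl

theorem actArr_comp {φ φ' : Arr (C.obj J.zero)} {θ θ' : Arr (C.obj x)} (h : φ.tgt = φ'.src)
    (h' : θ.tgt = θ'.src) : M.actArr (φ ⊚ φ') (θ ⊚ θ') = M.actArr φ θ ⊚ M.actArr φ' θ' := by
  rw [actArr, M.tensor_comp h h', Arr.map_comp _ (by simp [h, h'])]; rfl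

theorem actArr_assoc (φ θ : Arr (C.obj J.zero)) (ζ : Arr (C.obj x)) :
    M.actArr (M.actArr φ θ) ζ = M.actArr φ (M.actArr θ ζ) := by
  have h₁ := M.tensor_cast (J.zero_add J.zero) (rfl : x = x) (M.tensor φ θ) ζ
  have h₂ := M.tensor_cast (rfl : J.zero = J.zero) (J.zero_add x) φ (M.tensor θ ζ)
  rw [map_gradeCast_refl] at h₁ h₂
  rw [actArr, actArr, actArr, actArr, h₁, h₂, ← M.tensor_assoc, map_gradeCast_map,
    map_gradeCast_map, map_gradeCast_map]

theorem one_actArr (θ : Arr (C.obj x)) : M.actArr (ident M.one) θ = θ := M.one_tensor θ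

theorem actArr_one (φ : Arr (C.obj J.zero)) : M.actArr φ (ident M.one) = φ := M.tensor_one φ

theorem add_actArr (φ φ' : Arr (C.obj J.zero)) (θ : Arr (C.obj x)) :
    M.actArr (φ + φ') θ = M.actArr φ θ + M.actArr φ' θ := by
  rw [actArr, M.add_tensor]
  exact Arr.map_add (C.map _) _ _

theorem actArr_tw (r r' : C.obj J.zero) (m : C.obj x) :
    M.actArr (tw r r') (ident m) = tw (M.act r m) (M.act r' m) := by
  rw [actArr, M.tensor_tw]
  exact Arr.map_tw (C.map _) _ _

theorem act_assoc (r s : C.obj J.zero) (m : C.obj x) :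
    M.act (M.act r s) m = M.act r (M.act s m) :=
  congrArg Arr.src (M.actArr_assoc (ident r) (ident s) (ident m))

theorem one_act (m : C.obj x) : M.act M.one m = m :=
  congrArg Arr.src (M.one_actArr (ident m))

theorem act_one (r : C.obj J.zero) : M.act r M.one = r :=
  congrArg Arr.src (M.actArr_one (ident r))

end GradedMul

namespace GradedStrictlyBimonoidal

open Arr

variable {J : PermCat.{v₁, u₁}} {C : J ⥤ PermCat.{v₂, u₂}} (B : GradedStrictlyBimonoidal J C)
  {x y z t : J}

/-- The left distributivity of the action of `C(0)` on `C(x)` as an arrow. -/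
def adl (r : C.obj J.zero) (m m' : C.obj x) : Arr (C.obj x) :=
  (B.dl r m m').map (gradeCast C (J.zero_add x))

theorem mk_actLeftDist (r : C.obj J.zero) (m m' : C.obj x) :
    Arr.mk (B.actLeftDist B.leftDist r m m') = B.adl r m m' := mk_eqToHom_comp _ _

@[simp] theorem adl_src (r : C.obj J.zero) (m m' : C.obj x) :
    (B.adl r m m').src = (C.obj x).add (B.act r m) (B.act r m') :=
  (C.map (eqToHom (J.zero_add x))).obj_add _ _

@[simp] theorem adl_tgt (r : C.obj J.zero) (m m' : C.obj x) :
    (B.adl r m m').tgt = B.act r ((C.obj x).add m m') := rfl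

theorem adl_natural (φ : Arr (C.obj J.zero)) (θ θ' : Arr (C.obj x)) :
    (B.actArr φ θ + B.actArr φ θ') ⊚ B.adl φ.tgt θ.tgt θ'.tgt =
      B.adl φ.src θ.src θ'.src ⊚ B.actArr φ (θ + θ') := by
  have h := congrArg (Arr.map (gradeCast C (J.zero_add x))) (B.dl_natural φ θ θ')
  rw [Arr.map_comp _ (by simp), Arr.map_comp _ (by simp), Arr.map_add (C.map _)] at h
  exact h

theorem adl_twist (r : C.obj J.zero) (m m' : C.obj x) :
    B.adl r m m' ⊚ B.actArr (ident r) (tw m m') = tw (B.act r m) (B.act r m') ⊚ B.adl r m' m := by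
  have h := congrArg (Arr.map (gradeCast C (J.zero_add x))) (B.dl_twist r m m')
  rw [Arr.map_comp _ (by simp), Arr.map_comp _ (by simp), Arr.map_tw (C.map _)] at h
  exact h

theorem adl_add (r : C.obj J.zero) (m m' m'' : C.obj x) :
    (B.adl r m m' + ident (B.act r m'')) ⊚ B.adl r ((C.obj x).add m m') m'' =
      (ident (B.act r m) + B.adl r m' m'') ⊚ B.adl r m ((C.obj x).add m' m'') := by
  have h := congrArg (Arr.map (gradeCast C (J.zero_add x))) (B.dl_add r m m' m'')
  rw [Arr.map_comp _ (by simp), Arr.map_comp _ (by simp), Arr.map_add (C.map _),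
    Arr.map_add (C.map _), Arr.map_id, Arr.map_id] at h
  exact h

/-- Obtained from `dl_assoc` in the degrees `0`, `0`, `x` by identifying all degrees with `x`. -/
theorem adl_assoc (r s : C.obj J.zero) (m m' : C.obj x) : B.adl (B.act r s) m m' =
    B.adl r (B.act s m) (B.act s m') ⊚ B.actArr (ident r) (B.adl s m m') := by
  have h₁ := B.dl_cast (J.zero_add J.zero) (rfl : x = x) (B.mul r s) m m'
  have h₂ := B.dl_cast (rfl : J.zero = J.zero) (J.zero_add x) r (B.mul s m) (B.mul s m')
  have h₃ := B.tensor_cast (rfl : J.zero = J.zero) (J.zero_add x) (ident r) (B.dl s m m')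
  rw [gradeCast_refl_obj, gradeCast_refl_obj] at h₁
  rw [gradeCast_refl_obj] at h₂
  rw [map_gradeCast_refl] at h₃
  have h₄ := congrArg (Arr.map (gradeCast C (J.zero_add x))) h₁
  have h₅ := congrArg (Arr.map (gradeCast C (J.zero_add x))) h₂
  have h₆ := congrArg (Arr.map (gradeCast C (J.zero_add x))) h₃
  have h := congrArg (Arr.map (gradeCast C ((J.zero_add _).trans (J.zero_add x))))
    (B.dl_assoc r s m m')
  rw [map_gradeCast_map] at h₄ h₅ h₆ h
  rw [Arr.map_comp _ (by simp)] at h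
  exact h₄.symm.trans (h.trans (congrArg₂ (· ⊚ ·) h₅ h₆.symm))

theorem adl_pentagon (r r' : C.obj J.zero) (m m' : C.obj x) :
    B.adl r m m' + B.adl r' m m' =
      (ident (B.act r m) + tw (B.act r m') (B.act r' m) + ident (B.act r' m')) ⊚
        B.adl ((C.obj J.zero).add r r') m m' := by
  have h := congrArg (Arr.map (gradeCast C (J.zero_add x))) (B.dl_pentagon r r' m m')
  rw [Arr.map_comp _ (by simp [B.add_mul, PermCat.add_assoc]), Arr.map_add (C.map _),
    Arr.map_add (C.map _), Arr.map_add (C.map _), Arr.map_tw (C.map _), Arr.map_id,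
    Arr.map_id] at h
  exact h

/-- Obtained from `dl_mul` in the degrees `0`, `0`, `x` by identifying all degrees with `x`. -/
theorem adl_mul (r s s' : C.obj J.zero) (m : C.obj x) :
    B.actArr (B.adl r s s') (ident m) = B.adl r (B.act s m) (B.act s' m) := by
  have h₁ := B.tensor_cast (J.zero_add J.zero) (rfl : x = x) (B.dl r s s') (ident m)
  have h₂ := B.dl_cast (rfl : J.zero = J.zero) (J.zero_add x) r (B.mul s m) (B.mul s' m)
  rw [gradeCast_refl_obj] at h₂
  rw [map_gradeCast_refl] at h₁
  have h₅ := congrArg (Arr.map (gradeCast C (J.zero_add x))) h₂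
  have h₆ := congrArg (Arr.map (gradeCast C (J.zero_add x))) h₁
  have h := congrArg (Arr.map (gradeCast C ((J.zero_add _).trans (J.zero_add x))))
    (B.dl_mul r s s' m)
  rw [map_gradeCast_map] at h₅ h₆ h
  exact h₆.trans (h.trans h₅)

theorem actLeftDist_iso (r : C.obj J.zero) (m m' : C.obj x) :
    ∃ e : B.act r ((C.obj x).add m m') ⟶ (C.obj x).add (B.act r m) (B.act r m'),
      B.actLeftDist B.leftDist r m m' ≫ e = 𝟙 _ ∧ e ≫ B.actLeftDist B.leftDist r m m' = 𝟙 _ := by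
  obtain ⟨e, h₁, h₂⟩ := (B.isIso_leftDist r m m').out
  refine ⟨(gradeCast C (J.zero_add x)).map e ≫ eqToHom (B.adl_src r m m'), mk_inj.1 ?_,
    mk_inj.1 ?_⟩
  · refine (mk_comp _ _).trans ((congrArg₂ (· ⊚ ·) (B.mk_actLeftDist _ _ _)
      (mk_comp_eqToHom _ _)).trans ?_)
    refine (Arr.map_comp (gradeCast C (J.zero_add x)) (φ := B.dl r m m') (θ := Arr.mk e)
      rfl).symm.trans ?_
    refine (congrArg (Arr.map _) ((mk_comp _ _).symm.trans (congrArg Arr.mk h₁))).trans ?_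
    exact (Arr.map_id _ _).trans (congrArg ident (B.adl_src r m m'))
  · refine (mk_comp _ _).trans ((congrArg₂ (· ⊚ ·) (mk_comp_eqToHom _ _)
      (B.mk_actLeftDist _ _ _)).trans ?_)
    refine (Arr.map_comp (gradeCast C (J.zero_add x)) (φ := Arr.mk e) (θ := B.dl r m m')
      rfl).symm.trans ?_
    refine (congrArg (Arr.map _) ((mk_comp _ _).symm.trans (congrArg Arr.mk h₂))).trans ?_
    exact Arr.map_id _ _

theorem actLeftDist_twist (r : C.obj J.zero) (m m' : C.obj x) :
    B.actLeftDist B.leftDist r m m' ≫ B.actHom (𝟙 r) ((C.obj x).twist m m') =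
      (C.obj x).twist (B.act r m) (B.act r m') ≫ B.actLeftDist B.leftDist r m' m :=
  mk_inj.1 ((mk_comp _ _).trans
    ((congrArg (· ⊚ B.actArr (ident r) (tw m m')) (B.mk_actLeftDist r m m')).trans
      ((B.adl_twist r m m').trans ((mk_comp _ _).trans
        (congrArg (tw (B.act r m) (B.act r m') ⊚ ·) (B.mk_actLeftDist r m' m))).symm)))

theorem actLeftDist_assoc (r s : C.obj J.zero) (m m' : C.obj x) :
    HEq (B.actLeftDist B.leftDist (B.act r s) m m')
      (B.actLeftDist B.leftDist r (B.act s m) (B.act s m') ≫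
        B.actHom (𝟙 r) (B.actLeftDist B.leftDist s m m')) :=
  Arr.heq ((B.mk_actLeftDist _ _ _).trans ((B.adl_assoc r s m m').trans
    ((mk_comp _ _).trans (congrArg₂ (· ⊚ ·) (B.mk_actLeftDist _ _ _)
      (congrArg (B.actArr (ident r)) (B.mk_actLeftDist _ _ _)))).symm))

theorem degreeZero_isZerolessBimonoidalCore :
    IsZerolessBimonoidalCore (B.degreeZero B.leftDist) where
  permutative := (C.obj J.zero).isZerolessPermutative
  mulHom_id a b := mk_inj.1 (B.actArr_id a b)
  mulHom_comp f f' g g' := mk_inj.1 (Eq.trans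
    ((congrArg₂ B.actArr (mk_comp f f') (mk_comp g g')).trans (B.actArr_comp rfl rfl))
    (mk_comp _ _).symm)
  mul_assoc := B.act_assoc
  mulHom_assoc f g h := Arr.heq (B.actArr_assoc (Arr.mk f) (Arr.mk g) (Arr.mk h))
  one_mul := B.one_act
  one_mulHom f := Arr.heq (B.one_actArr (Arr.mk f))
  mul_one := B.act_one
  mulHom_one f := Arr.heq (B.actArr_one (Arr.mk f))
  add_mul a a' b := (B.add_act a a' b).symm
  add_mulHom f f' g := Arr.heq (B.add_actArr (Arr.mk f) (Arr.mk f') (Arr.mk g))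
  twist_mulHom a a' b := Arr.heq (B.actArr_tw a a' b)
  leftDist_twist := B.actLeftDist_twist
  leftDist_assoc := B.actLeftDist_assoc
  pentagon a a' b b' := Arr.heq ((congrArg₂ (· + ·) (B.mk_actLeftDist _ _ _)
    (B.mk_actLeftDist _ _ _)).trans ((B.adl_pentagon a a' b b').trans
      ((mk_comp _ _).trans (congrArg₂ (· ⊚ ·) rfl
        ((mk_eqToHom_comp _ _).trans (B.mk_actLeftDist _ _ _)))).symm))

theorem actLeftDist_natural {r r' : C.obj J.zero} {m m₁ m' m₁' : C.obj x} (f : r ⟶ r')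
    (g : m ⟶ m₁) (g' : m' ⟶ m₁') :
    (C.obj x).addHom (B.actHom f g) (B.actHom f g') ≫ B.actLeftDist B.leftDist r' m₁ m₁' =
      B.actLeftDist B.leftDist r m m' ≫ B.actHom f ((C.obj x).addHom g g') :=
  mk_inj.1 ((mk_comp _ _).trans ((congrArg _ (B.mk_actLeftDist _ _ _)).trans
    ((B.adl_natural (Arr.mk f) (Arr.mk g) (Arr.mk g')).trans ((mk_comp _ _).trans
      (congrArg (· ⊚ _) (B.mk_actLeftDist _ _ _))).symm)))

theorem actLeftDist_add (r : C.obj J.zero) (m m' m'' : C.obj x) :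
    HEq ((C.obj x).addHom (B.actLeftDist B.leftDist r m m') (𝟙 (B.act r m'')) ≫
        B.actLeftDist B.leftDist r ((C.obj x).add m m') m'')
      ((C.obj x).addHom (𝟙 (B.act r m)) (B.actLeftDist B.leftDist r m' m'') ≫
        B.actLeftDist B.leftDist r m ((C.obj x).add m' m'')) :=
  Arr.heq ((mk_comp _ _).trans ((congrArg₂ (· ⊚ ·)
    (congrArg (· + ident (B.act r m'')) (B.mk_actLeftDist _ _ _)) (B.mk_actLeftDist _ _ _)).trans
      ((B.adl_add r m m' m'').trans ((mk_comp _ _).trans (congrArg₂ (· ⊚ ·)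
        (congrArg (ident (B.act r m) + ·) (B.mk_actLeftDist _ _ _))
          (B.mk_actLeftDist _ _ _))).symm)))

theorem degreeZero_isZerolessStrictlyBimonoidal :
    IsZerolessStrictlyBimonoidal (B.degreeZero B.leftDist) where
  toIsZerolessBimonoidalCore := B.degreeZero_isZerolessBimonoidalCore
  leftDist_iso := B.actLeftDist_iso
  leftDist_natural := B.actLeftDist_natural
  leftDist_mul a b b' c := Arr.heq ((congrArg (B.actArr · (ident c)) (B.mk_actLeftDist _ _ _)).trans
    ((B.adl_mul a b b' c).trans (B.mk_actLeftDist _ _ _).symm))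
  leftDist_add := B.actLeftDist_add

theorem degreeModule_pentagon (r r' : C.obj J.zero) (m m' : C.obj x) (h) :
    HEq ((C.obj x).addHom (B.actLeftDist B.leftDist r m m') (B.actLeftDist B.leftDist r' m m') ≫
        eqToHom (B.add_act r r' ((C.obj x).add m m')))
      ((C.obj x).addHom ((C.obj x).addHom (𝟙 (B.act r m))
          ((C.obj x).twist (B.act r m') (B.act r' m))) (𝟙 (B.act r' m')) ≫
        eqToHom h ≫ (C.obj x).addHom (eqToHom (B.add_act r r' m)) (eqToHom (B.add_act r r' m')) ≫
          B.actLeftDist B.leftDist ((C.obj J.zero).add r r') m m') := by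
  refine Arr.heq ((mk_comp_eqToHom _ _).trans ((congrArg₂ (· + ·) (B.mk_actLeftDist _ _ _)
    (B.mk_actLeftDist _ _ _)).trans ((B.adl_pentagon r r' m m').trans ?_)))
  refine Eq.symm ((mk_comp _ _).trans (congrArg₂ (· ⊚ ·) rfl
    ((mk_eqToHom_comp _ _).trans ((mk_comp _ _).trans ?_))))
  refine (congrArg₂ (· ⊚ ·) ((congrArg₂ (· + ·) (mk_eqToHom (B.add_act r r' m))
    (mk_eqToHom (B.add_act r r' m'))).trans (id_add _ _).symm) (B.mk_actLeftDist _ _ _)).trans ?_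
  exact id_comp' (by rw [adl_src, B.add_act, B.add_act])

theorem isZerolessModule_degreeModule (x : J) :
    IsZerolessModule (B.degreeModule B.leftDist x) where
  permutative := (C.obj x).isZerolessPermutative
  actHom_id r m := mk_inj.1 (B.actArr_id r m)
  actHom_comp f f' g g' := mk_inj.1 (Eq.trans
    ((congrArg₂ B.actArr (mk_comp f f') (mk_comp g g')).trans (B.actArr_comp rfl rfl))
    (mk_comp _ _).symm)
  mul_act := B.act_assoc
  mul_actHom f g h := Arr.heq (B.actArr_assoc (Arr.mk f) (Arr.mk g) (Arr.mk h))
  one_act := B.one_act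
  one_actHom f := Arr.heq (B.one_actArr (Arr.mk f))
  leftDist_natural := B.actLeftDist_natural
  rightDist_natural f f' g := mk_inj.1 ((mk_comp_eqToHom (B.add_act _ _ _) _).trans
    ((B.add_actArr (Arr.mk f) (Arr.mk f') (Arr.mk g)).symm.trans
      (mk_eqToHom_comp (B.add_act _ _ _) _).symm))
  leftDist_add := B.actLeftDist_add
  rightDist_add r r' r'' m := Arr.heq ((mk_comp_eqToHom (B.add_act _ r'' m) _).trans
    ((congrArg (· + ident (B.act r'' m)) (mk_eqToHom (B.add_act r r' m))).trans
      (((id_add _ _).symm.trans ((congrArg ident ((C.obj x).add_assoc _ _ _)).trans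
        (id_add _ _))).trans ((mk_comp_eqToHom (B.add_act r _ m) _).trans
          (congrArg (ident (B.act r m) + ·) (mk_eqToHom (B.add_act r' r'' m)))).symm)))
  leftDist_twist := B.actLeftDist_twist
  rightDist_twist r r' m := mk_inj.1 ((mk_eqToHom_comp (B.add_act r r' m) _).trans
    ((B.actArr_tw r r' m).trans (mk_comp_eqToHom (B.add_act r' r m) _).symm))
  leftDist_assoc := B.actLeftDist_assoc
  rightDist_assoc r r' s m := Arr.heq ((mk_eqToHom (B.add_act (B.act r s) (B.act r' s) m)).trans
    (Eq.trans (congrArg ident (congrArg₂ (C.obj x).add (B.act_assoc r s m) (B.act_assoc r' s m)))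
      (mk_eqToHom (B.add_act r r' (B.act s m))).symm))
  leftDist_rightDist r s s' m := Arr.heq ((mk_comp _ _).trans ((congrArg₂ (· ⊚ ·)
    (B.mk_actLeftDist r (B.act s m) (B.act s' m)) ((congrArg (B.actArr (ident r))
      (mk_eqToHom (B.add_act s s' m))).trans (B.actArr_id _ _))).trans ((comp_id _ _).trans
        ((B.adl_mul r s s' m).symm.trans ((mk_eqToHom_comp
          (B.add_act (B.act r s) (B.act r s') m) _).trans
          (congrArg (B.actArr · (ident m)) (B.mk_actLeftDist _ _ _))).symm))))
  pentagon r r' m m' := B.degreeModule_pentagon r r' m m' _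

end GradedStrictlyBimonoidal

namespace GradedBipermutative

open Arr

variable {J : PermCat.{v₁, u₁}} {C : J ⥤ PermCat.{v₂, u₂}} (B : GradedBipermutative J C)

/-- The multiplicative twist of the degree zero part as an arrow. -/
def atm (a b : C.obj J.zero) : Arr (C.obj J.zero) := (B.tm a b).map (gradeCast C (J.zero_add J.zero))

theorem mk_degreeZeroTwist (a b : C.obj J.zero) :
    Arr.mk (B.degreeZeroTwist B.mulTwist a b) = B.atm a b :=
  congrArg (Arr.map (gradeCast C (J.zero_add J.zero))) (mk_comp_eqToHom _ (B.mulTwist a b))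

theorem map_twist_zero_arr (φ : Arr (C.obj (J.add J.zero J.zero))) :
    φ.map (C.map (J.twist J.zero J.zero)).functor = φ := by
  rw [J.twist_zero_right]
  exact map_gradeCast_refl _ _

@[simp] theorem atm_src (a b : C.obj J.zero) : (B.atm a b).src = B.act a b := rfl

@[simp] theorem atm_tgt (a b : C.obj J.zero) : (B.atm a b).tgt = B.act b a :=
  congrArg (gradeCast C (J.zero_add J.zero)).obj (GradedMul.map_twist_zero _)

theorem atm_natural (φ θ : Arr (C.obj J.zero)) :
    B.actArr φ θ ⊚ B.atm φ.tgt θ.tgt = B.atm φ.src θ.src ⊚ B.actArr θ φ := by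
  have h := congrArg (Arr.map (gradeCast C (J.zero_add J.zero))) (B.tm_natural φ θ)
  rw [Arr.map_comp _ rfl, Arr.map_comp _ rfl, map_twist_zero_arr] at h
  exact h

theorem atm_atm (a b : C.obj J.zero) : B.atm a b ⊚ B.atm b a = ident (B.act a b) := by
  have h := congrArg (Arr.map (gradeCast C (J.zero_add J.zero))) (B.tm_tm a b)
  rw [Arr.map_comp _ rfl, map_twist_zero_arr, Arr.map_id] at h
  exact h

theorem atm_one (a : C.obj J.zero) : B.atm a B.one = ident a := by
  rw [atm, tm_one, Arr.map_id]
  exact congrArg ident (B.act_one a)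

theorem one_atm (a : C.obj J.zero) : B.atm B.one a = ident a := by
  rw [atm, one_tm, Arr.map_id]
  exact congrArg ident (B.one_mul a)

theorem tm_cast {x y z t : J} (h : x = z) (h' : y = t) (a : C.obj x) (b : C.obj y) :
    B.tm ((gradeCast C h).obj a) ((gradeCast C h').obj b) =
      (B.tm a b).map (gradeCast C (congrArg₂ J.add h h')) := by
  subst h h'
  rw [gradeCast_refl_obj, gradeCast_refl_obj, map_gradeCast_refl]

theorem atm_mul (a b c : C.obj J.zero) : B.atm (B.act a b) c =
    B.actArr (ident a) (B.atm b c) ⊚ B.actArr (B.atm a c) (ident b) := by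
  have h₁ := B.tm_cast (J.zero_add J.zero) (rfl : J.zero = J.zero) (B.mul a b) c
  have h₂ := B.tensor_cast (J.zero_add J.zero) (rfl : J.zero = J.zero) (B.tm c a) (ident b)
  have h₃ := B.tensor_cast (rfl : J.zero = J.zero) (J.zero_add J.zero) (ident a) (B.tm b c)
  rw [gradeCast_refl_obj] at h₁
  rw [map_gradeCast_refl] at h₂ h₃
  have h₁' : B.atm (B.act a b) c = (B.tm (B.mul a b) c).map (gradeCast C
      ((congrArg₂ J.add (J.zero_add J.zero) rfl).trans (J.zero_add J.zero))) :=
    (congrArg (Arr.map (gradeCast C (J.zero_add J.zero))) h₁).trans (map_gradeCast_map _ _ _)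
  have h₂' : B.actArr (B.atm c a) (ident b) = (B.tensor (B.tm c a) (ident b)).map (gradeCast C
      ((congrArg₂ J.add (J.zero_add J.zero) rfl).trans (J.zero_add J.zero))) :=
    (congrArg (Arr.map (gradeCast C (J.zero_add J.zero))) h₂).trans (map_gradeCast_map _ _ _)
  have h₃' : B.actArr (ident a) (B.atm b c) = (B.tensor (ident a) (B.tm b c)).map (gradeCast C
      ((congrArg₂ J.add rfl (J.zero_add J.zero)).trans (J.zero_add J.zero))) :=
    (congrArg (Arr.map (gradeCast C (J.zero_add J.zero))) h₃).trans (map_gradeCast_map _ _ _)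
  -- in degree zero all twists of `J` in the hexagon are identities
  have h := congrArg (Arr.map (gradeCast C
    ((congrArg₂ J.add rfl (J.zero_add J.zero)).trans (J.zero_add J.zero)))) (B.hexagon a b c)
  rw [map_gradeCast_map, Arr.map_comp _ (B.hexagon_comp a b c), map_functor_comp,
    J.twist_zero_left, eqToHom_trans, eqToHom_trans, ← h₃'] at h
  have h₄ : B.atm (B.act a b) c ⊚ B.actArr (B.atm c a) (ident b) =
      B.actArr (ident a) (B.atm b c) := (congrArg₂ (· ⊚ ·) h₁' h₂').trans h
  have h₅ : B.actArr (B.atm c a) (ident b) ⊚ B.actArr (B.atm a c) (ident b) =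
      ident (B.act (B.act c a) b) := by
    rw [← B.actArr_comp (by simp) rfl, atm_atm, comp_id, B.actArr_id]
  rw [← h₄, comp_assoc, h₅, comp_id]
  rw [atm_tgt, B.actArr_src, atm_src, id_src, B.act_assoc]

/-- In degree zero the left distributivity is still the conjugate of an identity under the twist. -/
theorem adl_eq (a b b' : C.obj J.zero) : B.toGradedStrictlyBimonoidal.adl a b b' =
    (B.atm a b + B.atm a b') ⊚ B.atm ((C.obj J.zero).add b b') a := by
  have h := congrArg (Arr.map (gradeCast C (J.zero_add J.zero))) (B.dl_eq a b b')
  rw [Arr.map_comp _ (B.add_tm_tgt a b b'), map_twist_zero_arr, Arr.map_add (C.map _)] at h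
  exact h

theorem degreeZero_isZerolessBipermutative :
    IsZerolessBipermutative (B.degreeZero B.leftDist) (B.degreeZeroTwist B.mulTwist) where
  toIsZerolessBimonoidalCore :=
    B.toGradedStrictlyBimonoidal.degreeZero_isZerolessBimonoidalCore
  mulTwist_natural f g := mk_inj.1 ((mk_comp _ _).trans ((congrArg _ (B.mk_degreeZeroTwist _ _)).trans
    ((B.atm_natural (Arr.mk f) (Arr.mk g)).trans ((mk_comp _ _).trans
      (congrArg (· ⊚ _) (B.mk_degreeZeroTwist _ _))).symm)))
  mulTwist_mulTwist a b := mk_inj.1 ((mk_comp _ _).trans ((congrArg₂ (· ⊚ ·)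
    (B.mk_degreeZeroTwist _ _) (B.mk_degreeZeroTwist _ _)).trans (B.atm_atm a b)))
  mulTwist_one a := Arr.heq ((B.mk_degreeZeroTwist _ _).trans (B.atm_one a))
  one_mulTwist a := Arr.heq ((B.mk_degreeZeroTwist _ _).trans (B.one_atm a))
  mulTwist_mul a b c := Arr.heq ((B.mk_degreeZeroTwist _ _).trans ((B.atm_mul a b c).trans
    ((mk_comp _ _).trans (congrArg₂ (· ⊚ ·)
      (congrArg (B.actArr (ident a)) (B.mk_degreeZeroTwist _ _))
      ((mk_eqToHom_comp _ _).trans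
        (congrArg (B.actArr · (ident b)) (B.mk_degreeZeroTwist _ _))))).symm))
  leftDist_eq a b b' := mk_inj.1 ((B.toGradedStrictlyBimonoidal.mk_actLeftDist a b b').trans
    ((B.adl_eq a b b').trans ((mk_comp _ _).trans (congrArg₂ (· ⊚ ·)
      (congrArg₂ (· + ·) (B.mk_degreeZeroTwist _ _) (B.mk_degreeZeroTwist _ _))
      ((mk_eqToHom_comp _ _).trans (B.mk_degreeZeroTwist _ _)))).symm))

end GradedBipermutative

/-! ### The canonical functors to the homotopy colimit -/

namespace Hocolim

variable {J : PermCat.{v₁, u₁}} {C : J ⥤ PermCat.{v₂, u₂}} {x y z : J} {S T U : Hocolim C}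

/-- A morphism of `C(x)` whose source is a sum, as a multimorphism of degree `x` all of whose legs
are identities. -/
def Multi.fold (L : List (C.obj x)) (φ : Arr (C.obj x)) (h : φ.src = (C.obj x).sum id L) :
    Multi C :=
  ⟨x, L.map fun X => ⟨⟨x, X⟩, 𝟙 x⟩, φ, by
    rw [h, PermCat.sum_map]
    exact PermCat.sum_congr _ fun X _ => (map_id_obj x X).symm⟩

theorem Multi.fold_congr {L L' : List (C.obj x)} {φ φ' : Arr (C.obj x)}
    {h : φ.src = (C.obj x).sum id L} {h' : φ'.src = (C.obj x).sum id L'} (e : L = L')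
    (e' : φ = φ') : Multi.fold L φ h = Multi.fold L' φ' h' := by
  subst e e'; rfl

theorem Leg.act_fold {L : List (C.obj x)} {φ : Arr (C.obj x)}
    {h : φ.src = (C.obj x).sum id L} (X : C.obj x) :
    (⟨⟨x, X⟩, 𝟙 x⟩ : Leg C x).act (Multi.fold L φ h) = (Multi.fold L φ h).2 :=
  (Leg.act_mk (p := ⟨x, X⟩) _ _).trans (Block.map_id _)

theorem Multi.fold_comp_fold {L : List (C.obj x)} {φ θ : Arr (C.obj x)}
    {h : φ.src = (C.obj x).sum id L} {X : C.obj x} (h' : θ.src = (C.obj x).sum id [X]) :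
    (Multi.fold [X] θ h').comp [Multi.fold L φ h] =
      Multi.fold L (φ ⊚ θ) (by rw [Arr.comp_src, h]) := by
  refine congrArg (Sigma.mk x) ?_
  refine (congrArg (Block.post · θ) ((blockSum_cons _ _ [] []).trans ((add_zero _).trans
    (Leg.act_fold X)))).trans ?_
  rfl

theorem Multi.fold_comp_pair {L L' : List (C.obj x)} {φ φ' θ : Arr (C.obj x)}
    {h : φ.src = (C.obj x).sum id L} {h' : φ'.src = (C.obj x).sum id L'} {X X' : C.obj x}
    (h'' : θ.src = (C.obj x).sum id [X, X']) :
    (Multi.fold [X, X'] θ h'').comp [Multi.fold L φ h, Multi.fold L' φ' h'] =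
      Multi.fold (L ++ L') ((φ + φ') ⊚ θ) (by
        rw [Arr.comp_src, Arr.add_src, h, h', PermCat.sum_append]) := by
  refine congrArg (Sigma.mk x) ?_
  refine (congrArg (Block.post · θ) ((blockSum_cons _ _ _ _).trans (congrArg₂ (· + ·)
    (Leg.act_fold X) ((blockSum_cons _ _ [] []).trans ((add_zero _).trans
      (Leg.act_fold X')))))).trans ?_
  refine Block.ext ?_ rfl
  exact List.map_append.symm

/-- Identified degrees give the same folded multimorphism. -/
theorem Multi.fold_cast (e : x = y) {L : List (C.obj x)} {L' : List (C.obj y)}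
    {φ : Arr (C.obj x)} {φ' : Arr (C.obj y)} {h : φ.src = (C.obj x).sum id L}
    {h' : φ'.src = (C.obj y).sum id L'} (e' : L.map (gradeCast C e).obj = L')
    (e'' : φ.map (gradeCast C e) = φ') : Multi.fold L φ h = Multi.fold L' φ' h' := by
  subst e
  refine Multi.fold_congr ?_ ((map_gradeCast_refl _ rfl).symm.trans e'')
  rw [← e', List.map_congr_left fun X _ => gradeCast_refl_obj rfl X, List.map_id']

theorem at_incl {X Y : C.obj x} (f : X ⟶ Y) : Mor.At ((incl x).map f) (0 : Fin 1) [(0 : Fin 1)]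
    (Multi.fold [X] (Arr.mk f) (PermCat.sum_singleton _ id X).symm) := by
  have h := Mor.at_ofEquiv (S := single x X) (T := single x Y) (Equiv.refl _)
    (fun _ _ _ => 𝟙 x) (fun _ _ _ => eqToHom (map_id_obj x X) ≫ f) (i := (0 : Fin 1)) rfl
  have e : Multi.unary ⟨x, X⟩ (𝟙 x) (Arr.mk (eqToHom (map_id_obj x X) ≫ f)) rfl =
      Multi.fold [X] (Arr.mk f) (PermCat.sum_singleton _ id X).symm :=
    congrArg (Sigma.mk x) (Block.ext rfl (Arr.mk_eqToHom_comp _ _))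
  rw [← e]
  exact h

theorem Mor.Enum.fibre_eq {f : Mor S T} {j : Fin T.len} {L : List (Fin S.len)}
    (h : f.Enum j L) (hL : L.Pairwise (· < ·)) : f.fibre j = L := by
  refine List.SortedLT.eq_of_mem_iff ?_ (List.sortedLT_iff_pairwise.2 hL) fun i =>
    ((Mor.enum_fibre f j).2 i).trans (h.2 i).symm
  rw [Mor.fibre, List.sortedLT_iff_pairwise, List.pairwise_map]
  exact List.sortedLT_iff_pairwise.1 (Finset.sortedLT_sort _)

theorem Mor.Enum.at_sorted {f : Mor S T} {j : Fin T.len} {L : List (Fin S.len)}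
    (h : f.Enum j L) (hL : L.Pairwise (· < ·)) : f.At j L ⟨(T.entry j).1, L.map (f.leg j), f.arr j,
      by rw [Mor.arr_src, h.fibre_eq hL, PermCat.sum_map]; rfl⟩ := by
  refine ⟨h, congrArg (Sigma.mk _) (Block.ext rfl ?_)⟩
  have hr := PermArr.refl (P := C.obj (T.entry j).1) (A := fun i => (f.leg j i).image) L
  rw [Mor.blk_arr (by rw [h.fibre_eq hL]; exact hr), Arr.id_comp' (by
    rw [Mor.arr_src, h.fibre_eq hL])]

theorem Mor.At.congr_multi {f : Mor S T} {j : Fin T.len} {L : List (Fin S.len)} {μ ν : Multi C}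
    (h : f.At j L μ) (e : μ = ν) : f.At j L ν := e ▸ h

/-- The structure morphism of `inclAdd` is the identity of `X ⊕ Y`, folded. -/
theorem at_inclAdd (X Y : C.obj x) : Mor.At (inclAdd x X Y) (0 : Fin 1)
    [finSumFinEquiv (.inl (0 : Fin 1)), finSumFinEquiv (.inr (0 : Fin 1))]
    (Multi.fold [X, Y] (Arr.ident ((C.obj x).add X Y))
      (congrArg _ ((C.obj x).add_zero Y)).symm) := by
  have hE : Mor.Enum (inclAdd x X Y) (0 : Fin 1)
      [finSumFinEquiv (.inl (0 : Fin 1)), finSumFinEquiv (.inr (0 : Fin 1))] := by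
    refine ⟨by simp, forall_sum (n := 1) (m := 1) (fun i => ?_) fun i => ?_⟩ <;>
      obtain rfl := Subsingleton.elim i 0
    · exact iff_of_true List.mem_cons_self (Subsingleton.elim (α := Fin 1) _ _)
    · exact iff_of_true (List.mem_cons_of_mem _ List.mem_cons_self)
        (Subsingleton.elim (α := Fin 1) _ _)
  refine (hE.at_sorted (List.pairwise_pair.2 (by decide :
    (finSumFinEquiv (.inl (0 : Fin 1)) : Fin (1 + 1)) < finSumFinEquiv (.inr (0 : Fin 1))))).congr_multi
    (congrArg (Sigma.mk x) (Block.ext ?_ ?_))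
  · exact congrArg₂ (fun s t => [s, t])
      (Mor.leg_pos (inclAdd x X Y) ((hE.2 _).1 List.mem_cons_self))
      (Mor.leg_pos (inclAdd x X Y) ((hE.2 _).1 (List.mem_cons_of_mem _ List.mem_cons_self)))
  · exact (Arr.mk_eqToHom (osum_add_single X Y 0)).trans (congrArg Arr.ident (osum_add_single X Y 0))

theorem incl_map_id (X : C.obj x) : (incl x).map (𝟙 X) = 𝟙 ((incl x).obj X) :=
  Mor.At.ext (S := single x X) (T := single x X) fun j => by
    obtain rfl := Subsingleton.elim (α := Fin 1) j 0
    exact ⟨_, _, at_incl (𝟙 X), Mor.at_id (S := single x X) (0 : Fin 1)⟩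

theorem incl_map_comp {X Y Z : C.obj x} (f : X ⟶ Y) (g : Y ⟶ Z) :
    (incl x).map (f ≫ g) = (incl x).map f ≫ (incl x).map g :=
  Mor.At.ext (S := single x X) (T := single x Z) fun j => by
    obtain rfl := Subsingleton.elim (α := Fin 1) j 0
    have h := (at_incl g).comp_single (at_incl f)
    rw [Multi.fold_comp_fold] at h
    refine ⟨_, _, at_incl (f ≫ g), ?_⟩
    rw [Multi.fold_congr rfl (Arr.mk_comp f g)]
    exact h

/-- The multimorphism of a composite with a morphism `1[(x, X)] ⊕ 1[(x, Y)] ⟶ 1[(x, X ⊕ Y)]`. -/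
theorem at_comp_inclAdd {X Y : C.obj x} {f : S ⟶ (incl x).obj X} {g : T ⟶ (incl x).obj Y}
    {L : List (Fin S.len)} {M : List (Fin T.len)} {K K' : List (C.obj x)} {φ θ : Arr (C.obj x)}
    {h : φ.src = (C.obj x).sum id K} {h' : θ.src = (C.obj x).sum id K'}
    (hf : Mor.At f (0 : Fin 1) L (Multi.fold K φ h))
    (hg : Mor.At g (0 : Fin 1) M (Multi.fold K' θ h')) :
    Mor.At (addHom f g ≫ inclAdd x X Y) (0 : Fin 1)
      (L.map (fun i => finSumFinEquiv (.inl i)) ++ M.map fun i => finSumFinEquiv (.inr i))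
      (Multi.fold (K ++ K') (φ + θ) (by rw [Arr.add_src, h, h', PermCat.sum_append])) := by
  have h₁ := Mor.At.comp_map (N := [true, false])
    (t := fun b => cond b (finSumFinEquiv (.inl (0 : Fin 1))) (finSumFinEquiv (.inr (0 : Fin 1))))
    (L := fun b => cond b (L.map (fun i => finSumFinEquiv (.inl i)))
      (M.map fun i => finSumFinEquiv (.inr i)))
    (ν := fun b => cond b (Multi.fold K φ h) (Multi.fold K' θ h')) (f := addHom f g)
    (at_inclAdd X Y) (by
      intro b _
      cases b
      · exact hg.inr
      · exact hf.inl)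
  exact (h₁.congr_multi ((Multi.fold_comp_pair (h := h) (h' := h') _).trans
    (Multi.fold_congr rfl (Arr.comp_id _ _)))).congr rfl (by simp)

theorem inclAdd_natural {X X' Y Y' : C.obj x} (f : X ⟶ X') (g : Y ⟶ Y') :
    addHom ((incl x).map f) ((incl x).map g) ≫ inclAdd x X' Y' =
      inclAdd x X Y ≫ (incl x).map ((C.obj x).addHom f g) :=
  Mor.At.ext (T := single x _) fun j => by
    obtain rfl := Subsingleton.elim (α := Fin 1) j 0
    refine ⟨_, _, at_comp_inclAdd (at_incl f) (at_incl g), ?_⟩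
    exact ((at_incl ((C.obj x).addHom f g)).comp_single (at_inclAdd X Y)).congr_multi
      ((Multi.fold_comp_fold _).trans (Multi.fold_congr rfl (Arr.id_comp (Arr.mk f + Arr.mk g))))

theorem at_id_single (X : C.obj x) : Mor.At (𝟙 (single x X)) (0 : Fin 1) [(0 : Fin 1)]
    (Multi.fold [X] (Arr.ident X) (PermCat.sum_singleton _ id X).symm) :=
  Mor.at_id (S := single x X) (0 : Fin 1)

/-- Both composites are the identity of `X ⊕ Y ⊕ Z`, folded. -/
theorem inclAdd_assoc (X Y Z : C.obj x) :
    HEq (addHom (inclAdd x X Y) (𝟙 ((incl x).obj Z)) ≫ inclAdd x ((C.obj x).add X Y) Z)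
      (addHom (𝟙 ((incl x).obj X)) (inclAdd x Y Z) ≫ inclAdd x X ((C.obj x).add Y Z)) := by
  refine Mor.At.heq (T := single x _) (T' := single x _) (add_assoc _ _ _)
    (congrArg (single x) ((C.obj x).add_assoc X Y Z)) fun j => ?_
  obtain rfl := Subsingleton.elim (α := Fin 1) j 0
  have h₁ := at_comp_inclAdd (at_inclAdd X Y) (at_id_single Z)
  have h₂ := at_comp_inclAdd (at_id_single X) (at_inclAdd Y Z)
  refine ⟨_, _, h₁, (h₂.congr_multi (Multi.fold_congr rfl ?_)).congr (Subsingleton.elim (α := Fin 1) _ _) ?_⟩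
  · rw [← Arr.id_add, ← Arr.id_add, (C.obj x).add_assoc]
  · rfl

/-- Both composites are the additive twist of `X` and `Y`, folded. -/
theorem inclAdd_twist (X Y : C.obj x) : inclAdd x X Y ≫ (incl x).map ((C.obj x).twist X Y) =
    addTwist ((incl x).obj X) ((incl x).obj Y) ≫ inclAdd x Y X :=
  Mor.At.ext (T := single x _) fun j => by
    obtain rfl := Subsingleton.elim (α := Fin 1) j 0
    have h₁ := ((at_incl ((C.obj x).twist X Y)).comp_single (at_inclAdd X Y)).congr_multi
      ((Multi.fold_comp_fold _).trans (Multi.fold_congr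
        (h' := (congrArg ((C.obj x).add X) ((C.obj x).add_zero Y)).symm) rfl
          (Arr.id_comp (Arr.tw X Y))))
    have h₂ : Mor.At (addTwist ((incl x).obj X) ((incl x).obj Y) ≫ inclAdd x Y X) (0 : Fin 1)
      [finSumFinEquiv (.inr (0 : Fin 1)), finSumFinEquiv (.inl (0 : Fin 1))] _ :=
      Mor.At.perm_comp (Mor.isPerm_addTwist _ _) (at_inclAdd Y X)
    refine ⟨_, _, h₁, ?_⟩
    let s : Fin (1 + 1) → Leg C x := fun p => Sum.elim (fun _ : Fin 1 => ⟨⟨x, X⟩, 𝟙 x⟩)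
      (fun _ : Fin 1 => ⟨⟨x, Y⟩, 𝟙 x⟩) (finSumFinEquiv.symm p)
    have hX : (C.obj x).sum (fun i => (s i).image) [finSumFinEquiv (.inl (0 : Fin 1))] = X :=
      (PermCat.sum_singleton _ _ _).trans (map_id_obj x X)
    have hY : (C.obj x).sum (fun i => (s i).image) [finSumFinEquiv (.inr (0 : Fin 1))] = Y :=
      (PermCat.sum_singleton _ _ _).trans (map_id_obj x Y)
    have hπ := PermArr.twist (P := C.obj x) (A := fun i => (s i).image)
      [finSumFinEquiv (.inl (0 : Fin 1))] [finSumFinEquiv (.inr (0 : Fin 1))] (by simp)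
    rw [hX, hY] at hπ
    exact Mor.At.reorder h₂ (s := s) rfl rfl hπ (Arr.comp_id _ _).symm

theorem isLaxAdditive (x : J) :
    IsLaxAdditive (C.obj x).addData addData (incl x) (inclAdd x) where
  map_id := incl_map_id
  map_comp := incl_map_comp
  natural := inclAdd_natural
  assoc := inclAdd_assoc
  twist := inclAdd_twist

end Hocolim

/-! ### Multiplicative properties of the canonical functors -/

namespace Hocolim

variable {J : PermCat.{v₁, u₁}} {C : J ⥤ PermCat.{v₂, u₂}} (B : GradedStrictlyBimonoidal J C)
  {x y z : J} {S T U : Hocolim C}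

/-- By strict right distributivity, a product with a one-legged multimorphism on the right is again
folded. -/
theorem Multi.fold_mul_single {L : List (C.obj x)} {φ : Arr (C.obj x)} {θ : Arr (C.obj y)}
    {h : φ.src = (C.obj x).sum id L} {b : C.obj y} {h' : θ.src = (C.obj y).sum id [b]} :
    (Multi.fold L φ h).mul B (Multi.fold [b] θ h') =
      Multi.fold (L.map fun a => B.mul a b) (B.tensor φ θ) (by
        rw [B.tensor_src, h, h', PermCat.sum_singleton, PermCat.sum_map]; exact B.sum_mul id b L) := by
  refine congrArg (Sigma.mk (J.add x y)) (Block.ext ?_ ?_)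
  · refine Eq.trans (b := (L.map fun X => (⟨⟨x, X⟩, 𝟙 x⟩ : Leg C x)).flatMap
      fun s => [mulLeg B s (⟨⟨y, b⟩, 𝟙 y⟩ : Leg C y)]) rfl ?_
    rw [List.flatMap_map, ← List.map_eq_flatMap]
    refine Eq.trans (List.map_congr_left fun a _ => ?_) List.map_map.symm
    rw [mulLeg, J.addHom_id]; rfl
  · have e := B.prodSum_singleton_right Leg.image Leg.image
      (L.map fun X => (⟨⟨x, X⟩, 𝟙 x⟩ : Leg C x)) (⟨⟨y, b⟩, 𝟙 y⟩ : Leg C y)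
    refine (congrArg (· ⊚ B.tensor φ θ) e).trans (Arr.id_comp' ?_)
    rw [B.tensor_src, h, h', PermCat.sum_singleton, PermCat.sum_map]
    exact congrArg₂ B.mul (PermCat.sum_congr _ fun X _ => map_id_obj x X) (map_id_obj y b)

theorem _root_.GradedStrictlyBimonoidal.dlSum_pair (a : C.obj x) (b b' : C.obj y) :
    B.dlSum a id [b, b'] = B.dl a b b' := by
  rw [GradedStrictlyBimonoidal.dlSum, B.dlSum_singleton, ← Arr.id_add, PermCat.sum_singleton]
  exact Arr.id_comp (B.dl a b b')

/-- A product with a one-legged multimorphism on the left is folded along the left distributivity. -/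
theorem Multi.single_mul_fold {φ : Arr (C.obj x)} {θ : Arr (C.obj y)} {a : C.obj x}
    {h : φ.src = (C.obj x).sum id [a]} {b b' : C.obj y} {h' : θ.src = (C.obj y).sum id [b, b']} :
    (Multi.fold [a] φ h).mul B (Multi.fold [b, b'] θ h') =
      Multi.fold [B.mul a b, B.mul a b'] (B.dl a b b' ⊚ B.tensor φ θ) (by
        rw [Arr.comp_src]; exact (congrArg _ ((C.obj _).add_zero _)).symm) := by
  refine congrArg (Sigma.mk (J.add x y)) (Block.ext ?_ ?_)
  · change [mulLeg B ⟨⟨x, a⟩, 𝟙 x⟩ ⟨⟨y, b⟩, 𝟙 y⟩, mulLeg B ⟨⟨x, a⟩, 𝟙 x⟩ ⟨⟨y, b'⟩, 𝟙 y⟩] = _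
    rw [mulLeg, mulLeg, J.addHom_id]; rfl
  · refine congrArg (· ⊚ B.tensor φ θ) ?_
    refine (B.prodSum_singleton_left Leg.image Leg.image (⟨⟨x, a⟩, 𝟙 x⟩ : Leg C x) _).trans ?_
    refine (B.dlSum_map_index _ _ (fun X => (⟨⟨y, X⟩, 𝟙 y⟩ : Leg C y)) [b, b']).trans ?_
    refine Eq.trans ?_ (B.dlSum_pair a b b')
    have e : Leg.image (⟨⟨x, a⟩, 𝟙 x⟩ : Leg C x) = a := map_id_obj x a
    rw [e]
    exact B.dlSum_congr fun X _ => map_id_obj y X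

/-- The canonical functors commute strictly with the action: `0 + x` is `x`. -/
theorem incl_act (M : GradedMul J C) (r : C.obj J.zero) (m : C.obj x) : (incl x).obj (M.act r m) =
    mul M ((incl J.zero).obj r) ((incl x).obj m) :=
  ext_entry (S := single x (M.act r m)) (T := mul M (single J.zero r) (single x m)) rfl
    fun _ => (sigma_gradeCast (J.zero_add x) (M.mul r m)).symm

theorem Multi.fold_act_cast {L : List (C.obj (J.add J.zero x))} {φ : Arr (C.obj (J.add J.zero x))}
    {h : φ.src = (C.obj (J.add J.zero x)).sum id L} :
    Multi.fold L φ h = Multi.fold (L.map (gradeCast C (J.zero_add x)).obj)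
      (φ.map (gradeCast C (J.zero_add x))) (by
        rw [Arr.map_src, h, PermCat.sum_map]; exact (C.map _).obj_sum _ _) :=
  Multi.fold_cast (J.zero_add x) rfl rfl

theorem incl_actHom {r r' : C.obj J.zero} {m m' : C.obj x} (f : r ⟶ r') (g : m ⟶ m') :
    HEq ((incl x).map (B.actHom f g))
      (mulHom B.toGradedMul B.leftDist ((incl J.zero).map f) ((incl x).map g)) := by
  refine Mor.At.heq (S := single x _) (T := single x _) (incl_act _ r m) (incl_act _ r' m') fun j => ?_
  obtain rfl := Subsingleton.elim (α := Fin 1) j 0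
  have h := (Mor.At.mulHom B (at_incl f) (at_incl g)).congr_multi
    ((Multi.fold_mul_single B).trans Multi.fold_act_cast)
  exact ⟨_, _, at_incl (B.actHom f g), h.congr rfl rfl⟩

/-- Compatibility of the canonical functors with the right distributivity. -/
theorem inclAdd_act (r r' : C.obj J.zero) (m : C.obj x) :
    HEq (inclAdd x (B.act r m) (B.act r' m))
      (mulHom B.toGradedMul B.leftDist (inclAdd J.zero r r') (𝟙 ((incl x).obj m))) := by
  refine Mor.At.heq (T := single x _) ?_ ?_ fun j => ?_
  · rw [add_mul, incl_act, incl_act]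
  · rw [← incl_act, B.add_act]; rfl
  obtain rfl := Subsingleton.elim (α := Fin 1) j 0
  have h := (Mor.At.mulHom B (at_inclAdd r r') (at_id_single m)).congr_multi
    ((Multi.fold_mul_single B).trans Multi.fold_act_cast)
  refine ⟨_, _, at_inclAdd _ _, (h.congr_multi (Multi.fold_congr rfl ?_)).congr rfl rfl⟩
  rw [B.tensor_id, Arr.map_id]
  exact congrArg Arr.ident (B.add_act r r' m).symm

/-- Compatibility of the canonical functors with the left distributivity. -/
theorem inclAdd_actLeftDist (r : C.obj J.zero) (m m' : C.obj x) :
    HEq (inclAdd x (B.act r m) (B.act r m') ≫ (incl x).map (B.actLeftDist B.leftDist r m m'))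
      (leftDist B.toGradedMul ((incl J.zero).obj r) ((incl x).obj m) ((incl x).obj m') ≫
        (show mul B.toGradedMul ((incl J.zero).obj r) (add ((incl x).obj m) ((incl x).obj m')) ⟶
          mul B.toGradedMul ((incl J.zero).obj r) ((incl x).obj ((C.obj x).add m m')) from
          mulHom B.toGradedMul B.leftDist (𝟙 ((incl J.zero).obj r)) (inclAdd x m m'))) := by
  refine Mor.At.heq (T := single x _) ?_ ?_ fun j => ?_
  · rw [incl_act, incl_act]
  · rw [← incl_act]; rfl
  obtain rfl := Subsingleton.elim (α := Fin 1) j 0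
  have h := (Mor.At.mulHom B (at_id_single r) (at_inclAdd m m')).congr_multi
    ((Multi.single_mul_fold B).trans Multi.fold_act_cast)
  have h₁ := ((at_incl (B.actLeftDist B.leftDist r m m')).comp_single (at_inclAdd _ _)).congr_multi
    (Multi.fold_comp_fold _)
  refine ⟨_, _, h₁, ?_⟩
  refine (Mor.At.perm_comp (isPerm_leftDist B.toGradedMul _ _ _) (L :=
    [finSumFinEquiv (.inl (finProdFinEquiv ((0 : Fin 1), (0 : Fin 1)))),
      finSumFinEquiv (.inr (finProdFinEquiv ((0 : Fin 1), (0 : Fin 1))))])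
    ((h.congr_multi (Multi.fold_congr rfl ?_)).congr rfl ?_)).congr rfl rfl
  · refine Eq.trans ?_ ((Arr.id_comp _).trans (B.mk_actLeftDist r m m')).symm
    exact congrArg (Arr.map _) ((congrArg (B.dl r m m' ⊚ ·) (B.tensor_id _ _)).trans
      (Arr.comp_id _ _))
  · exact congrArg₂ (fun p q => [p, q])
      (leftDist_ψ_inl B.toGradedMul (S := single J.zero r) (T := single x m) (U := single x m')
        (0 : Fin 1) (0 : Fin 1)).symm
      (leftDist_ψ_inr B.toGradedMul (S := single J.zero r) (T := single x m) (U := single x m')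
        (0 : Fin 1) (0 : Fin 1)).symm

end Hocolim

/-! ### Morphisms of bimonoidal categories and modules -/

namespace Hocolim

open Arr

variable {J : PermCat.{v₁, u₁}} {C : J ⥤ PermCat.{v₂, u₂}} {x y z : J}

/-- The homotopy colimit as a category. -/
@[reducible] def category : Category (Hocolim C) where
  id_comp := id_comp
  comp_id := comp_id
  assoc := comp_assoc

attribute [local instance] category

/-- The sum of arrows of the homotopy colimit. -/
def addArr (φ θ : Arr (Hocolim C)) : Arr (Hocolim C) := Arr.mk (addHom φ.hom θ.hom)

@[simp] theorem addArr_src (φ θ : Arr (Hocolim C)) : (addArr φ θ).src = add φ.src θ.src := rfl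
@[simp] theorem addArr_tgt (φ θ : Arr (Hocolim C)) : (addArr φ θ).tgt = add φ.tgt θ.tgt := rfl

theorem addArr_id (S T : Hocolim C) : addArr (ident S) (ident T) = ident (add S T) :=
  congrArg Arr.mk (addHom_id S T)

/-- The image of an arrow under the canonical functor. -/
def inclArr (φ : Arr (C.obj x)) : Arr (Hocolim C) := Arr.mk ((incl x).map φ.hom)

@[simp] theorem inclArr_src (φ : Arr (C.obj x)) : (inclArr φ).src = (incl x).obj φ.src := rfl

theorem inclArr_id (a : C.obj x) : inclArr (ident a) = ident ((incl x).obj a) :=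
  congrArg Arr.mk (incl_map_id a)

/-- The morphism `1[(x, X)] ⊕ 1[(x, Y)] ⟶ 1[(x, X ⊕ Y)]` as an arrow. -/
def inclAddArr (a b : C.obj x) : Arr (Hocolim C) := Arr.mk (inclAdd x a b)

theorem inclAddArr_natural (φ θ : Arr (C.obj x)) :
    addArr (inclArr φ) (inclArr θ) ⊚ inclAddArr φ.tgt θ.tgt =
      inclAddArr φ.src θ.src ⊚ inclArr (φ + θ) :=
  (mk_comp _ _).symm.trans ((congrArg Arr.mk (inclAdd_natural φ.hom θ.hom)).trans (mk_comp _ _))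

theorem inclAddArr_assoc (a b c : C.obj x) :
    addArr (inclAddArr a b) (ident ((incl x).obj c)) ⊚ inclAddArr ((C.obj x).add a b) c =
      addArr (ident ((incl x).obj a)) (inclAddArr b c) ⊚ inclAddArr a ((C.obj x).add b c) :=
  (mk_comp _ _).symm.trans ((mk_eq (add_assoc _ _ _)
    (congrArg (incl x).obj ((C.obj x).add_assoc _ _ _)) (inclAdd_assoc a b c)).trans (mk_comp _ _))

theorem inclAddArr_twist (a b : C.obj x) : inclAddArr a b ⊚ inclArr (tw a b) =
    Arr.mk (addTwist ((incl x).obj a) ((incl x).obj b)) ⊚ inclAddArr b a :=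
  (mk_comp _ _).symm.trans ((congrArg Arr.mk (inclAdd_twist a b)).trans (mk_comp _ _))

variable (B : GradedStrictlyBimonoidal J C) {S T U : Hocolim C}

/-- The product of arrows of the homotopy colimit. -/
def mulArr (φ θ : Arr (Hocolim C)) : Arr (Hocolim C) :=
  Arr.mk (mulHom B.toGradedMul B.leftDist φ.hom θ.hom)

theorem mulArr_id (S T : Hocolim C) :
    mulArr B (ident S) (ident T) = ident (mul B.toGradedMul S T) :=
  congrArg Arr.mk (mulHom_id B S T)

theorem mulArr_comp {φ φ' θ θ' : Arr (Hocolim C)} (h : φ.tgt = φ'.src) (h' : θ.tgt = θ'.src) :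
    mulArr B (φ ⊚ φ') (θ ⊚ θ') = mulArr B φ θ ⊚ mulArr B φ' θ' := by
  obtain ⟨f⟩ := φ
  obtain ⟨f'⟩ := φ'
  obtain ⟨g⟩ := θ
  obtain ⟨g'⟩ := θ'
  dsimp only at h h'
  subst h h'
  rw [← mk_comp, ← mk_comp]
  exact (congrArg Arr.mk (mulHom_comp B f f' g g')).trans (mk_comp _ _)

theorem mulArr_assoc (φ θ ζ : Arr (Hocolim C)) :
    mulArr B (mulArr B φ θ) ζ = mulArr B φ (mulArr B θ ζ) :=
  mk_eq (mul_assoc B _ _ _) (mul_assoc B _ _ _) (mulHom_assoc B _ _ _)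

theorem one_mulArr (φ : Arr (Hocolim C)) : mulArr B (ident (one B.toGradedMul)) φ = φ :=
  mk_eq (one_mul B _) (one_mul B _) (one_mulHom B _)

theorem add_mulArr (φ φ' θ : Arr (Hocolim C)) :
    mulArr B (addArr φ φ') θ = addArr (mulArr B φ θ) (mulArr B φ' θ) :=
  mk_eq (add_mul B _ _ _) (add_mul B _ _ _) (add_mulHom B _ _ _)

theorem twist_mulArr (S T U : Hocolim C) : mulArr B (Arr.mk (addTwist S T)) (ident U) =
    Arr.mk (addTwist (mul B.toGradedMul S U) (mul B.toGradedMul T U)) :=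
  mk_eq (add_mul B _ _ _) (add_mul B _ _ _) (twist_mulHom B S T U)

theorem inclArr_act (φ : Arr (C.obj J.zero)) (θ : Arr (C.obj x)) :
    inclArr (B.actArr φ θ) = mulArr B (inclArr φ) (inclArr θ) :=
  mk_eq (incl_act _ _ _) (incl_act _ _ _) (incl_actHom B φ.hom θ.hom)

theorem inclAddArr_act (r r' : C.obj J.zero) (m : C.obj x) :
    inclAddArr (B.act r m) (B.act r' m) = mulArr B (inclAddArr r r') (ident ((incl x).obj m)) :=
  mk_eq ((congrArg₂ add (incl_act _ r m) (incl_act _ r' m)).trans (add_mul B _ _ _).symm)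
    ((congrArg (incl x).obj (B.add_act r r' m)).trans (incl_act _ _ m)) (inclAdd_act B r r' m)

/-- The left distributivity of the homotopy colimit as an arrow. -/
def dlArr (S T U : Hocolim C) : Arr (Hocolim C) := Arr.mk (leftDist B.toGradedMul S T U)

@[simp] theorem dlArr_src (S T U : Hocolim C) : (dlArr B S T U).src =
    add (mul B.toGradedMul S T) (mul B.toGradedMul S U) := rfl

theorem inclAddArr_adl (r : C.obj J.zero) (m m' : C.obj x) :
    inclAddArr (B.act r m) (B.act r m') ⊚ inclArr (B.adl r m m') =
      dlArr B ((incl J.zero).obj r) ((incl x).obj m) ((incl x).obj m') ⊚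
        mulArr B (ident ((incl J.zero).obj r)) (inclAddArr m m') := by
  rw [← B.mk_actLeftDist]
  exact (mk_comp _ _).symm.trans ((mk_eq (by rw [incl_act, incl_act]) (by rw [← incl_act])
    (inclAdd_actLeftDist B r m m')).trans (mk_comp _ _))

theorem dlArr_natural (φ θ ζ : Arr (Hocolim C)) :
    addArr (mulArr B φ θ) (mulArr B φ ζ) ⊚ dlArr B φ.tgt θ.tgt ζ.tgt =
      dlArr B φ.src θ.src ζ.src ⊚ mulArr B φ (addArr θ ζ) :=
  (mk_comp _ _).symm.trans ((congrArg Arr.mk (leftDist_natural B φ.hom θ.hom ζ.hom)).trans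
    (mk_comp _ _))

theorem dlArr_assoc (S T U V : Hocolim C) : dlArr B (mul B.toGradedMul S T) U V =
    dlArr B S (mul B.toGradedMul T U) (mul B.toGradedMul T V) ⊚
      mulArr B (ident S) (dlArr B T U V) :=
  (mk_eq (by rw [mul_assoc, mul_assoc]) (mul_assoc B _ _ _) (leftDist_assoc B S T U V)).trans
    (mk_comp _ _)

theorem dlArr_mul (S T T' U : Hocolim C) : mulArr B (dlArr B S T T') (ident U) =
    dlArr B S (mul B.toGradedMul T U) (mul B.toGradedMul T' U) :=
  mk_eq ((add_mul B _ _ _).trans (congrArg₂ add (mul_assoc B S T U) (mul_assoc B S T' U)))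
    ((mul_assoc B _ _ _).trans (congrArg (mul _ S) (add_mul B T T' U))) (leftDist_mul B S T T' U)

theorem dlArr_pentagon (S S' T T' : Hocolim C) :
    addArr (dlArr B S T T') (dlArr B S' T T') =
      addArr (addArr (ident (mul B.toGradedMul S T))
        (Arr.mk (addTwist (mul B.toGradedMul S T') (mul B.toGradedMul S' T))))
          (ident (mul B.toGradedMul S' T')) ⊚ dlArr B (add S S') T T' := by
  have h : add (add (mul B.toGradedMul S T) (add (mul B.toGradedMul S' T)
      (mul B.toGradedMul S T'))) (mul B.toGradedMul S' T') =
      add (mul B.toGradedMul (add S S') T) (mul B.toGradedMul (add S S') T') := by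
    simp only [add_mul, add_assoc]
  exact (mk_eq (by simp only [add_assoc]) (by rw [add_mul]) (pentagon B S S' T T' h)).trans
    ((mk_comp _ _).trans (congrArg _ (mk_eqToHom_comp h _)))

theorem rightDist_ψ_inl (M : GradedMul J C) (i : Fin S.len) (j : Fin U.len) :
    (rightDist M S T U).ψ (finSumFinEquiv (.inl (finProdFinEquiv (i, j)))) =
      finProdFinEquiv (finSumFinEquiv (.inl i), j) := by
  change rightDistPerm _ _ _ _ = _
  simp only [rightDistPerm, Equiv.trans_apply, Equiv.symm_apply_apply, Equiv.sumCongr_apply,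
    Sum.map_inl]
  rfl

theorem rightDist_ψ_inr (M : GradedMul J C) (i : Fin T.len) (j : Fin U.len) :
    (rightDist M S T U).ψ (finSumFinEquiv (.inr (finProdFinEquiv (i, j)))) =
      finProdFinEquiv (finSumFinEquiv (.inr i), j) := by
  change rightDistPerm _ _ _ _ = _
  simp only [rightDistPerm, Equiv.trans_apply, Equiv.symm_apply_apply, Equiv.sumCongr_apply,
    Sum.map_inr]
  rfl

/-- In lexicographic order the bijection of `(n × m) + (n' × m)` with `(n + n') × m` is the
identity. -/
theorem mk_rightDist (S S' T : Hocolim C) : Arr.mk (rightDist B.toGradedMul S S' T) =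
    ident (add (mul B.toGradedMul S T) (mul B.toGradedMul S' T)) := by
  refine mk_eq rfl (add_mul B S S' T) (Mor.IsPerm.heq (Mor.isPerm_perm _ _) (isPerm_id _) rfl
    (add_mul B S S' T) (forall_sum (forall_prod fun i j => ?_) (forall_prod fun i j => ?_)))
  · refine (congrArg Fin.val (rightDist_ψ_inl B.toGradedMul i j)).trans ?_
    rw [id_ψ, Fin.val_cast, inl_val, prod_val, prod_val, inl_val]
  · refine (congrArg Fin.val (rightDist_ψ_inr B.toGradedMul i j)).trans ?_
    rw [id_ψ, Fin.val_cast, inr_val, prod_val, prod_val, inr_val]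
    ring

/-- The right distributivity of the homotopy colimit as a module over `C(0)`, as an arrow. -/
def rdArr (r r' : C.obj J.zero) (S : Hocolim C) : Arr (Hocolim C) :=
  mulArr B (inclAddArr r r') (ident S)

theorem mk_moduleRightDist (r r' : C.obj J.zero) (S : Hocolim C) :
    Arr.mk ((moduleData B.toGradedMul B.leftDist).rightDist r r' S) = rdArr B r r' S := by
  refine (mk_comp _ _).trans ((congrArg (· ⊚ rdArr B r r' S) (mk_rightDist B _ _ _)).trans ?_)
  exact id_comp' (add_mul B _ _ _).symm

theorem rdArr_natural (φ φ' : Arr (C.obj J.zero)) (θ : Arr (Hocolim C)) :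
    addArr (mulArr B (inclArr φ) θ) (mulArr B (inclArr φ') θ) ⊚ rdArr B φ.tgt φ'.tgt θ.tgt =
      rdArr B φ.src φ'.src θ.src ⊚ mulArr B (inclArr (φ + φ')) θ := by
  rw [rdArr, rdArr, ← add_mulArr, ← mulArr_comp B rfl rfl, ← mulArr_comp B rfl rfl,
    inclAddArr_natural, Arr.comp_id, Arr.id_comp]

theorem rdArr_add (r r' r'' : C.obj J.zero) (S : Hocolim C) :
    addArr (rdArr B r r' S) (ident (mul B.toGradedMul ((incl J.zero).obj r'') S)) ⊚
        rdArr B ((C.obj J.zero).add r r') r'' S =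
      addArr (ident (mul B.toGradedMul ((incl J.zero).obj r) S)) (rdArr B r' r'' S) ⊚
        rdArr B r ((C.obj J.zero).add r' r'') S := by
  rw [rdArr, rdArr, rdArr, rdArr, ← mulArr_id, ← mulArr_id, ← add_mulArr, ← add_mulArr,
    ← mulArr_comp B rfl rfl, ← mulArr_comp B rfl rfl, inclAddArr_assoc]

theorem rdArr_twist (r r' : C.obj J.zero) (S : Hocolim C) :
    rdArr B r r' S ⊚ mulArr B (inclArr (tw r r')) (ident S) =
      Arr.mk (addTwist (mul B.toGradedMul ((incl J.zero).obj r) S)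
        (mul B.toGradedMul ((incl J.zero).obj r') S)) ⊚ rdArr B r' r S := by
  rw [rdArr, rdArr, ← mulArr_comp B rfl rfl, inclAddArr_twist, mulArr_comp B rfl rfl, twist_mulArr]

theorem rdArr_assoc (r r' s : C.obj J.zero) (S : Hocolim C) :
    rdArr B (B.act r s) (B.act r' s) S =
      rdArr B r r' (mul B.toGradedMul ((incl J.zero).obj s) S) := by
  rw [rdArr, rdArr, inclAddArr_act, mulArr_assoc, mulArr_id]

theorem dlArr_rdArr (r s s' : C.obj J.zero) (S : Hocolim C) :
    dlArr B ((incl J.zero).obj r) (mul B.toGradedMul ((incl J.zero).obj s) S)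
        (mul B.toGradedMul ((incl J.zero).obj s') S) ⊚
          mulArr B (ident ((incl J.zero).obj r)) (rdArr B s s' S) =
      rdArr B (B.act r s) (B.act r s') S ⊚ mulArr B (inclArr (B.adl r s s')) (ident S) := by
  rw [rdArr, rdArr, ← mulArr_assoc, ← dlArr_mul, ← mulArr_comp B rfl rfl,
    ← mulArr_comp B (by rw [inclArr_src, B.adl_src]; rfl) rfl, inclAddArr_adl]

theorem dlArr_rdArr_pentagon (r r' : C.obj J.zero) (S T : Hocolim C) :
    addArr (dlArr B ((incl J.zero).obj r) S T) (dlArr B ((incl J.zero).obj r') S T) ⊚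
        rdArr B r r' (add S T) =
      addArr (addArr (ident (mul B.toGradedMul ((incl J.zero).obj r) S))
        (Arr.mk (addTwist (mul B.toGradedMul ((incl J.zero).obj r) T)
          (mul B.toGradedMul ((incl J.zero).obj r') S))))
          (ident (mul B.toGradedMul ((incl J.zero).obj r') T)) ⊚
        addArr (rdArr B r r' S) (rdArr B r r' T) ⊚
          dlArr B ((incl J.zero).obj ((C.obj J.zero).add r r')) S T := by
  have h := dlArr_natural B (inclAddArr r r') (ident S) (ident T)
  rw [addArr_id] at h
  rw [dlArr_pentagon, Arr.comp_assoc]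
  · exact congrArg _ h.symm
  · simp only [addArr_tgt, dlArr_src, add_mul, add_assoc]
    rfl

theorem leftDist_incl_assoc (r s : C.obj J.zero) (S T : Hocolim C) :
    dlArr B ((incl J.zero).obj (B.act r s)) S T =
      dlArr B ((incl J.zero).obj r) (mul B.toGradedMul ((incl J.zero).obj s) S)
        (mul B.toGradedMul ((incl J.zero).obj s) T) ⊚
          mulArr B (ident ((incl J.zero).obj r)) (dlArr B ((incl J.zero).obj s) S T) := by
  rw [incl_act, dlArr_assoc]

/-- Every law is a law of the homotopy colimit or of the canonical functor of degree zero, combined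
with the naturality of the structure morphisms. -/
theorem isZerolessModule : IsZerolessModule (moduleData B.toGradedMul B.leftDist) where
  permutative := isZerolessPermutative
  actHom_id r S := mk_inj.1 ((congrArg (mulArr B · (ident S)) (inclArr_id r)).trans
    (mulArr_id B _ _))
  actHom_comp f f' _ _ := (congrArg (mulHom B.toGradedMul B.leftDist · _)
    (incl_map_comp f f')).trans (mulHom_comp B _ _ _ _)
  mul_act r s S := (congrArg (mul B.toGradedMul · S) (incl_act B.toGradedMul r s)).trans
    (mul_assoc B _ _ _)
  mul_actHom f g h := Arr.heq ((congrArg (mulArr B · (Arr.mk h))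
    (inclArr_act B (Arr.mk f) (Arr.mk g))).trans (mulArr_assoc B _ _ _))
  one_act := one_mul B
  one_actHom f := Arr.heq ((congrArg (mulArr B · (Arr.mk f)) (inclArr_id B.one)).trans
    (one_mulArr B _))
  leftDist_natural f g g' := leftDist_natural B ((incl J.zero).map f) g g'
  rightDist_natural f f' g := mk_inj.1 ((mk_comp _ _).trans
    ((congrArg _ (mk_moduleRightDist B _ _ _)).trans
      ((rdArr_natural B (Arr.mk f) (Arr.mk f') (Arr.mk g)).trans ((mk_comp _ _).trans
        (congrArg (· ⊚ _) (mk_moduleRightDist B _ _ _))).symm)))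
  leftDist_add r := leftDist_add B ((incl J.zero).obj r)
  rightDist_add r r' r'' S := Arr.heq ((mk_comp _ _).trans ((congrArg₂ (· ⊚ ·)
    (congrArg (addArr · (ident (mul B.toGradedMul ((incl J.zero).obj r'') S)))
      (mk_moduleRightDist B r r' S)) (mk_moduleRightDist B _ r'' S)).trans
        ((rdArr_add B r r' r'' S).trans ((mk_comp _ _).trans (congrArg₂ (· ⊚ ·)
          (congrArg (addArr (ident (mul B.toGradedMul ((incl J.zero).obj r) S)))
            (mk_moduleRightDist B r' r'' S)) (mk_moduleRightDist B r _ S))).symm)))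
  leftDist_twist r S T := mk_inj.1 ((mk_comp _ _).trans ((congrArg (dlArr B _ S T ⊚ ·)
    (congrArg (mulArr B · (Arr.mk (addTwist S T))) (inclArr_id r))).trans
      ((mk_comp _ _).symm.trans (congrArg Arr.mk (leftDist_twist B ((incl J.zero).obj r) S T)))))
  rightDist_twist r r' S := mk_inj.1 ((mk_comp _ _).trans
    ((congrArg (· ⊚ mulArr B (inclArr (tw r r')) (ident S)) (mk_moduleRightDist B r r' S)).trans
      ((rdArr_twist B r r' S).trans ((mk_comp _ _).trans
        (congrArg _ (mk_moduleRightDist B r' r S))).symm)))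
  leftDist_assoc r s S T := Arr.heq ((leftDist_incl_assoc B r s S T).trans ((mk_comp _ _).trans
    (congrArg (dlArr B _ _ _ ⊚ ·) (congrArg (mulArr B · (dlArr B _ S T)) (inclArr_id r)))).symm)
  rightDist_assoc r r' s S := Arr.heq ((mk_moduleRightDist B _ _ S).trans
    ((rdArr_assoc B r r' s S).trans (mk_moduleRightDist B r r' _).symm))
  leftDist_rightDist r s s' S := Arr.heq ((mk_comp _ _).trans ((congrArg (dlArr B _ _ _ ⊚ ·)
    (congrArg₂ (mulArr B) (inclArr_id r) (mk_moduleRightDist B s s' S))).trans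
      ((dlArr_rdArr B r s s' S).trans ((mk_comp _ _).trans (congrArg₂ (· ⊚ ·)
        (mk_moduleRightDist B _ _ S) (congrArg (fun φ => mulArr B (inclArr φ) (ident S))
          (B.mk_actLeftDist r s s')))).symm)))
  pentagon r r' S T := Arr.heq ((mk_comp _ _).trans ((congrArg (_ ⊚ ·)
    (mk_moduleRightDist B r r' (add S T))).trans ((dlArr_rdArr_pentagon B r r' S T).trans
      ((mk_comp _ _).trans (congrArg (_ ⊚ ·) ((mk_eqToHom_comp _ _).trans ((mk_comp _ _).trans
        (congrArg (· ⊚ dlArr B _ S T) (congrArg₂ addArr (mk_moduleRightDist B r r' S)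
          (mk_moduleRightDist B r r' T))))))).symm)))

end Hocolim

/-! ### The canonical functors as lax morphisms and module maps -/

namespace Hocolim

open Arr

variable {J : PermCat.{v₁, u₁}} {C : J ⥤ PermCat.{v₂, u₂}}

attribute [local instance] category

section StrictlyBimonoidal

variable (B : GradedStrictlyBimonoidal J C)

/-- The multiplicative structure morphism is an identification of equal objects. -/
theorem mk_inclMul (a b : C.obj J.zero) : Arr.mk (inclMul B.toGradedMul a b) =
    ident (mul B.toGradedMul ((incl J.zero).obj a) ((incl J.zero).obj b)) :=
  mk_eq rfl (incl_act _ a b) (Mor.IsPerm.heq (Mor.isPerm_perm _ _) (isPerm_id _) rfl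
    (incl_act _ a b) fun _ => rfl)

theorem isLaxMorphism : IsLaxMorphism (B.degreeZero B.leftDist)
    (bimonData B.toGradedMul B.leftDist) (incl J.zero) (inclAdd J.zero) (inclMul B.toGradedMul)
    (𝟙 (one B.toGradedMul)) where
  additive := isLaxAdditive J.zero
  mul_natural {a a' b b'} f g := mk_inj.1 ((mk_comp _ _).trans ((congrArg (_ ⊚ ·)
    (mk_inclMul B a' b')).trans ((Arr.comp_id _ _).trans ((inclArr_act B (Arr.mk f) (Arr.mk g)).symm.trans
      ((mk_comp _ _).trans ((congrArg (· ⊚ inclArr (B.actArr (Arr.mk f) (Arr.mk g)))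
        (mk_inclMul B a b)).trans (id_comp' (incl_act _ a b).symm))).symm))))
  mul_assoc a b c := Arr.heq (((mk_comp _ _).trans ((congrArg₂ (· ⊚ ·)
    ((congrArg (mulArr B · (ident ((incl J.zero).obj c))) (mk_inclMul B a b)).trans
      (mulArr_id B _ _)) (mk_inclMul B _ c)).trans (Arr.comp_id _ _))).trans
    ((congrArg ident (mul_assoc B _ _ _)).trans ((mk_comp _ _).trans ((congrArg₂ (· ⊚ ·)
      ((congrArg (mulArr B (ident ((incl J.zero).obj a))) (mk_inclMul B b c)).trans
        (mulArr_id B _ _)) (mk_inclMul B a _)).trans (Arr.comp_id _ _))).symm))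
  one_mul a := Arr.heq ((mk_comp _ _).trans ((congrArg₂ (· ⊚ ·) (mulArr_id B _ _)
    (mk_inclMul B _ a)).trans ((Arr.comp_id _ _).trans (congrArg ident (one_mul B _)))))
  mul_one a := Arr.heq ((mk_comp _ _).trans ((congrArg₂ (· ⊚ ·) (mulArr_id B _ _)
    (mk_inclMul B a _)).trans ((Arr.comp_id _ _).trans (congrArg ident (mul_one B _)))))
  rightDist a a' b := Arr.heq ((mk_comp _ _).trans ((congrArg (· ⊚ inclAddArr _ _)
    ((congrArg₂ addArr (mk_inclMul B a b) (mk_inclMul B a' b)).trans (addArr_id _ _))).trans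
      ((id_comp' (congrArg₂ add (incl_act _ a b) (incl_act _ a' b)).symm).trans
        ((inclAddArr_act B a a' b).trans ((mk_comp _ _).trans ((congrArg (_ ⊚ ·)
          (mk_inclMul B _ b)).trans (Arr.comp_id _ _))).symm))))
  leftDist a b b' := mk_inj.1 ((mk_comp _ _).trans ((congrArg₂ (· ⊚ ·)
    ((mk_comp _ _).trans ((congrArg (· ⊚ inclAddArr _ _)
      ((congrArg₂ addArr (mk_inclMul B a b) (mk_inclMul B a b')).trans (addArr_id _ _))).trans
        (id_comp' (congrArg₂ add (incl_act _ a b) (incl_act _ a b')).symm)))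
    (congrArg inclArr (B.mk_actLeftDist a b b'))).trans ((inclAddArr_adl B a b b').trans
      ((mk_comp _ _).trans (congrArg (dlArr B _ _ _ ⊚ ·) ((mk_comp _ _).trans
        ((congrArg (_ ⊚ ·) (mk_inclMul B a _)).trans (Arr.comp_id _ _))))).symm)))

theorem isModuleMap (x : J) : IsModuleMap (B.degreeModule B.leftDist x)
    (moduleData B.toGradedMul B.leftDist) (incl x) (inclAdd x) where
  additive := isLaxAdditive x
  obj_act := incl_act B.toGradedMul
  map_actHom := incl_actHom B
  leftDist r m m' := Arr.heq ((mk_comp _ _).trans ((congrArg (_ ⊚ inclArr ·)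
    (B.mk_actLeftDist r m m')).trans ((inclAddArr_adl B r m m').trans ((mk_comp _ _).trans
      (congrArg (dlArr B _ _ _ ⊚ ·) (congrArg (mulArr B · (inclAddArr m m'))
        (inclArr_id r)))).symm)))
  rightDist r r' m := Arr.heq ((mk_comp _ _).trans ((congrArg (_ ⊚ ·)
    ((congrArg inclArr (mk_eqToHom (B.add_act r r' m))).trans (inclArr_id _))).trans
      ((Arr.comp_id _ _).trans ((inclAddArr_act B r r' m).trans
        (mk_moduleRightDist B r r' _).symm))))

end StrictlyBimonoidal

section Bipermutative

variable (B : GradedBipermutative J C)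

/-- In degree zero the twist of `J` is an identity, so the twist of the homotopy colimit has the
multimorphism given by the twist of `C(0)` alone. -/
theorem incl_degreeZeroTwist (a b : C.obj J.zero) :
    HEq ((incl J.zero).map (B.degreeZeroTwist B.mulTwist a b))
      (mulTwist B.toGradedMul B.mulTwist ((incl J.zero).obj a) ((incl J.zero).obj b)) := by
  refine Mor.At.heq (S := single J.zero _) (T := single J.zero _) (incl_act _ a b)
    (incl_act _ b a) fun j => ?_
  obtain rfl := Subsingleton.elim (α := Fin 1) j 0
  have e : twistMulti B ⟨J.zero, a⟩ ⟨J.zero, b⟩ = Multi.fold [B.act a b]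
      (Arr.mk (B.degreeZeroTwist B.mulTwist a b)) (PermCat.sum_singleton _ id _).symm := by
    refine (Multi.unary_eq (q := ⟨J.zero, B.act a b⟩) (l := 𝟙 J.zero)
      (h' := (map_id_obj J.zero (B.act a b)).symm) (sigma_gradeCast (J.zero_add J.zero) _)
      (J.zero_add J.zero) ?_ ?_).trans rfl
    · rw [J.twist_zero_right]; simp
    · rw [GradedBipermutative.map_twist_zero_arr, B.mk_degreeZeroTwist]; rfl
  exact ⟨_, _, at_incl _, ((at_mulTwist B (S := single J.zero a) (T := single J.zero b)
    (0 : Fin 1) (0 : Fin 1)).congr_multi e).congr rfl rfl⟩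

theorem isLaxBipermutativeMorphism : IsLaxBipermutativeMorphism (B.degreeZero B.leftDist)
    (B.degreeZeroTwist B.mulTwist) (bimonData B.toGradedMul B.leftDist)
    (Hocolim.mulTwist B.toGradedMul B.mulTwist) (incl J.zero) (inclAdd J.zero)
    (inclMul B.toGradedMul) (𝟙 (one B.toGradedMul)) where
  toIsLaxMorphism := isLaxMorphism B.toGradedStrictlyBimonoidal
  mulTwist a b := mk_inj.1 ((mk_comp _ _).trans ((congrArg (· ⊚ Arr.mk ((incl J.zero).map (B.degreeZeroTwist B.mulTwist a b)))
    (mk_inclMul B.toGradedStrictlyBimonoidal a b)).trans ((id_comp' (incl_act _ a b).symm).trans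
      ((mk_eq (incl_act _ a b) (incl_act _ b a) (incl_degreeZeroTwist B a b)).trans
        ((mk_comp _ _).trans ((congrArg (_ ⊚ ·)
          (mk_inclMul B.toGradedStrictlyBimonoidal b a)).trans (Arr.comp_id _ _))).symm))))

end Bipermutative

end Hocolim
theorem mainTheorem4 (J : PermCat.{v₁, u₁}) (C : J ⥤ PermCat.{v₂, u₂}) :
    (∀ B : GradedBipermutative J C,
      IsZerolessBipermutative (Hocolim.bimonData B.toGradedMul B.leftDist)
        (Hocolim.mulTwist B.toGradedMul B.mulTwist) ∧
      IsZerolessBipermutative (B.degreeZero B.leftDist) (B.degreeZeroTwist B.mulTwist) ∧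
      IsLaxBipermutativeMorphism (B.degreeZero B.leftDist) (B.degreeZeroTwist B.mulTwist)
        (Hocolim.bimonData B.toGradedMul B.leftDist)
        (Hocolim.mulTwist B.toGradedMul B.mulTwist) (Hocolim.incl J.zero)
        (Hocolim.inclAdd J.zero) (Hocolim.inclMul B.toGradedMul)
        (𝟙 (Hocolim.one B.toGradedMul)) ∧
      IsZerolessModule (Hocolim.moduleData B.toGradedMul B.leftDist) ∧
      ∀ x : J, IsZerolessModule (B.degreeModule B.leftDist x) ∧
        IsModuleMap (B.degreeModule B.leftDist x)
          (Hocolim.moduleData B.toGradedMul B.leftDist) (Hocolim.incl x) (Hocolim.inclAdd x)) ∧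
    (∀ B : GradedStrictlyBimonoidal J C,
      IsZerolessStrictlyBimonoidal (Hocolim.bimonData B.toGradedMul B.leftDist) ∧
      IsZerolessStrictlyBimonoidal (B.degreeZero B.leftDist) ∧
      IsLaxMorphism (B.degreeZero B.leftDist) (Hocolim.bimonData B.toGradedMul B.leftDist)
        (Hocolim.incl J.zero) (Hocolim.inclAdd J.zero) (Hocolim.inclMul B.toGradedMul)
        (𝟙 (Hocolim.one B.toGradedMul)) ∧
      IsZerolessModule (Hocolim.moduleData B.toGradedMul B.leftDist) ∧
      ∀ x : J, IsZerolessModule (B.degreeModule B.leftDist x) ∧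
        IsModuleMap (B.degreeModule B.leftDist x)
          (Hocolim.moduleData B.toGradedMul B.leftDist) (Hocolim.incl x)
          (Hocolim.inclAdd x)) := by
  exact ⟨fun B => ⟨Hocolim.isZerolessBipermutative B, B.degreeZero_isZerolessBipermutative,
      Hocolim.isLaxBipermutativeMorphism B, Hocolim.isZerolessModule B.toGradedStrictlyBimonoidal,
      fun x => ⟨B.toGradedStrictlyBimonoidal.isZerolessModule_degreeModule x,
        Hocolim.isModuleMap B.toGradedStrictlyBimonoidal x⟩⟩,
    fun B => ⟨Hocolim.isZerolessStrictlyBimonoidal B, B.degreeZero_isZerolessStrictlyBimonoidal,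
      Hocolim.isLaxMorphism B, Hocolim.isZerolessModule B,
      fun x => ⟨B.isZerolessModule_degreeModule x, Hocolim.isModuleMap B x⟩⟩⟩

end
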